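/- **Setting.** Let $n\ge 3$ and let $\xi_1,\dots,\xi_n\in\mathbb R\times\mathbb R_{\ge0}$ be unit vectors that follow in this order clockwise around the origin and are linearly independent over $\mathbb Z$. For $m\in\{n-1,n\}$ let $Z_m=\{\sum_{i\le m}\lambda_i\xi_i: 0\le\lambda_i\le1\}$ be the zonogon generated by $\xi_1,\dots,\xi_m$. A set $X\subseteq[m]$ is identified with the point $\sum_{i\in X}\xi_i$; we write $Xi$ for $X\cup\{i\}$ ($i\notin X$) and $X-i$ for $X\setminus\{i\}$. The left boundary $lbd(Z_m)$ is the polygonal path through $\emptyset,\{1\},\{1,2\},\dots,[m]$, and the right boundary $rbd(Z_m)$ is the one through $\emptyset,\{m\},\{m-1,m\},\dots,[m]$. A V-edge of type $i$ is a directed segment $(X,Xi)$; an H-edge of type $ij$, $i<j$, is a directed segment $(Xi,Xj)$. **c-tilings.** Tiles are convex polygons of three sorts, with vertices in $2^{[m]}$. A triangle $\Delta(A|BC)$ of type $ij$, $i<j$, has vertices $B=Xi$, $C=Xj$, $A=Xij$. A triangle $\nabla(A|BC)$ of type $ij$ has vertices $A=X$, $B=Xi$, $C=Xj$. A lens $\lambda$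 of type $i_0i_q$ has an upper boundary path $U_\lambda=(Xi_0,Xi_1,\dots,Xi_q)$ with $i_0<\dots<i_q$, $q\ge2$, and a lower boundary path $L_\lambda=(Y-j_0,\dots,Y-j_{q'})$ with $j_0>\dots>j_{q'}$, $q'\ge2$, having the same first vertex $\ell_\lambda$ and the same last vertex $r_\lambda$. A c-tiling on $Z_m$ is a set $K$ of such tiles whose union is $Z_m$, such that any two distinct tiles are disjoint or intersect in a common vertex or a common side, and each boundary edge of $Z_m$ is a side of exactly one tile. Its graph $G_K$ consists of the vertices and sides of its tiles. **Legal paths.** A legal path for a c-tiling $K'$ on $Z_{n-1}$ is a path $P=(A_0,A_1,\dots,A_M)$ in $G_{K'}$ from $A_0=\emptyset$ to $A_M=[n-1]$, all of whose edges are V-edges (traversed forward or backward), such that $|A_{d-1}|>|A_d|$ implies $|A_d|<|A_{d+1}|$, and whenever $|A_{d-1}|=|A_{d+1}|\ne|A_d|$, either $A_{d-1}=A_di$, $A_{d+1}=A_dj$ for some $i<j$, or $A_{d-1}=A_d-i'$, $A_{d+1}=A_d-j'$ for some $i'>j'$. An inner vertex $A_d$ is a slope if $|A_{d-1}|<|A_d|<|A_{d+1}|$,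 a peak if $|A_{d-1}|=|A_{d+1}|<|A_d|$, and a pit if $|A_{d-1}|=|A_{d+1}|>|A_d|$. The filling at a peak $A_d$ is the sequence of tiles $\Delta(A_d|Y_{r-1}Y_r)$ of $K'$, $1\le r\le q$, with $Y_0=A_{d-1}$, $Y_q=A_{d+1}$; the filling at a pit $A_d$ is the sequence of tiles $\nabla(A_d|X_{r-1}X_r)$ of $K'$, $1\le r\le p$, with $X_0=A_{d-1}$, $X_p=A_{d+1}$. The path $P$ splits $Z_{n-1}$ into a closed left region $R_1$ and a closed right region $R_2$, consisting of $P$ and the points that can be connected in $Z_{n-1}\setminus P$ with $lbd(Z_{n-1})$, respectively $rbd(Z_{n-1})$. **Expansion.** The $n$-expansion of $K'$ with respect to $P$ is the set $K$ of the following tiles: (1) the tiles of $K'$ lying in $R_1$ that are not in the filling of a pit; (2) the tiles $\tau+\xi_n$ (each vertex $X$ replaced by $Xn$) for the tiles $\tau$ of $K'$ lying in $R_2$ that are not in the filling of a peak; (3) for each slope $A_d$, the tiles $\nabla(A_d|A_{d+1},A_dn)$ and $\Delta(A_dn|A_d,A_{d-1}n)$, and also $\nabla(A_0|A_1,A_0n)$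 and $\Delta(A_Mn|A_M,A_{M-1}n)$; (4) for each peak $A_{d-1}$ followed by a pit $A_d$, with fillings given by $Y_0,\dots,Y_q$ at $A_{d-1}$ and by $X_0,\dots,X_p$ at $A_d$, the lens with upper path $X_0,\dots,X_p,A_dn$ and lower path $A_{d-1},Y_0n,\dots,Y_qn$. **Contraction.** Let $K$ be a c-tiling on $Z_n$, let $\mathcal T^n$ be the set of its tiles of types $in$ ($i<n$), and let $E^n$ be the set of its edges of type $n$ or of types $in$ ($i<n$). In $G_K$ with the edges of $E^n$ deleted, consider the component of $\emptyset$ and the component of $[n]$; let $K^{\rm left}$ and $K^{\rm right}$ consist of the tiles of $K\setminus\mathcal T^n$ with all vertices in the first, respectively the second, component. The $n$-contraction $K/n$ consists of the tiles of $K^{\rm left}$, the tiles of $K^{\rm right}$ shifted by $-\xi_n$ (each vertex $X$ replaced by $X-n$) and, for each lens in $\mathcal T^n$ with upper path $X_0X_1\dots X_p$ and lower path $Y_0Y_1\dots Y_q$, with $Y'_r:=Y_r-n$, the tiles $\Delta(X_0|Y'_{r-1}Y'_r)$ for $2\le r\le q$ and $\nabla(Y'_q|X_{r-1}X_r)$ for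 $1\le r\le p-1$. **Theorem.** The correspondence $(K',P)\mapsto K$, where $K'$ is a c-tiling on $Z_{n-1}$, $P$ is a legal path for $K'$, and $K$ is the $n$-expansion of $K'$ with respect to $P$, is a bijection from the set of such pairs $(K',P)$ onto the set of c-tilings on $Z_n$. Under this correspondence, $K'$ is the $n$-contraction $K/n$ of $K$. -/

import Mathlib

namespace Combi

/-- The plane with its Euclidean norm. -/
abbrev Plane := EuclideanSpace ℝ (Fin 2)

/-- The generators: vectors of the closed upper half-plane, of Euclidean norm one, in clockwise
order around the origin, and independent over the integers. -/
structure IsGenerators {n : ℕ} (ξ : Fin n → Plane) : Prop where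
  upper : ∀ i, 0 ≤ ξ i 1
  norm_eq : ∀ i, ‖ξ i‖ = 1
  clockwise : ∀ i j, i < j → ξ i 0 * ξ j 1 - ξ i 1 * ξ j 0 < 0
  indep : LinearIndependent ℤ ξ

/-- The point of the plane that a set of indices is identified with. -/
noncomputable def point {n : ℕ} (ξ : Fin n → Plane) (X : Finset (Fin n)) : Plane :=
  ∑ i ∈ X, ξ i

/-- The zonogon generated by `ξ`. -/
def zonogon {n : ℕ} (ξ : Fin n → Plane) : Set Plane :=
  {z | ∃ c : Fin n → ℝ, (∀ i, 0 ≤ c i ∧ c i ≤ 1) ∧ z = ∑ i, c i • ξ i}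

/-- The segment between the points of two sets. -/
noncomputable def seg {n : ℕ} (ξ : Fin n → Plane) (e : Finset (Fin n) × Finset (Fin n)) :
    Set Plane :=
  segment ℝ (point ξ e.1) (point ξ e.2)

/-- The edge of type `i` on the left boundary of the zonogon: from `{1, …, i - 1}` to
`{1, …, i}`. -/
def leftBoundaryEdge {n : ℕ} (i : Fin n) : Finset (Fin n) × Finset (Fin n) :=
  (Finset.univ.filter (· < i), Finset.univ.filter (· ≤ i))

/-- The edge of type `i` on the right boundary of the zonogon: from `{i + 1, …, n}` to
`{i, …, n}`. -/
def rightBoundaryEdge {n : ℕ} (i : Fin n) : Finset (Fin n) × Finset (Fin n) :=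
  (Finset.univ.filter (i < ·), Finset.univ.filter (i ≤ ·))

/-- The left boundary of the zonogon. -/
def lbd {n : ℕ} (ξ : Fin n → Plane) : Set Plane := ⋃ i, seg ξ (leftBoundaryEdge i)

/-- The right boundary of the zonogon. -/
def rbd {n : ℕ} (ξ : Fin n → Plane) : Set Plane := ⋃ i, seg ξ (rightBoundaryEdge i)

/-- `(A, B)` is congruent to the generator `i`, that is, it is a V-edge of type `i`. -/
def IsVEdge {n : ℕ} (i : Fin n) (A B : Finset (Fin n)) : Prop :=
  i ∉ A ∧ B = insert i A

/-- `(A, B)` is congruent to `ξ j - ξ i` with `i < j`, that is, it is an H-edge of type `ij`. -/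
def IsHEdge {n : ℕ} (i j : Fin n) (A B : Finset (Fin n)) : Prop :=
  i < j ∧ ∃ X : Finset (Fin n), i ∉ X ∧ j ∉ X ∧ A = insert i X ∧ B = insert j X

/-- The (combinatorial description of) tiles, given by their vertices, which are subsets of the
index set:
* `delta A B C` is the triangle `Δ(A|BC)` with top vertex `A` and base from `B` to `C`,
* `nabla A B C` is the triangle `∇(A|BC)` with bottom vertex `A` and base from `B` to `C`,
* `lens U L` has upper boundary path `U` and lower boundary path `L`, both listed from left to
  right and both including the two common end vertices. -/
inductive Tile (n : ℕ) where
  | delta (A B C : Finset (Fin n))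
  | nabla (A B C : Finset (Fin n))
  | lens (U L : List (Finset (Fin n)))

namespace Tile

/-- The vertices of a tile. -/
def verts {n : ℕ} : Tile n → Set (Finset (Fin n))
  | delta A B C => {A, B, C}
  | nabla A B C => {A, B, C}
  | lens U L => {v | v ∈ U ∨ v ∈ L}

/-- The directed edges (sides) of a tile: V-edges go upward, H-edges go to the right. -/
def edges {n : ℕ} : Tile n → Set (Finset (Fin n) × Finset (Fin n))
  | delta A B C => {(B, A), (C, A), (B, C)}
  | nabla A B C => {(A, B), (A, C), (B, C)}
  | lens U L => {e | [e.1, e.2] <:+: U ∨ [e.1, e.2] <:+: L}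

/-- The tile as a convex polygon in the plane. -/
noncomputable def polygon {n : ℕ} (ξ : Fin n → Plane) (τ : Tile n) : Set Plane :=
  convexHull ℝ (point ξ '' τ.verts)

/-- The data really describe a `Δ`-tile, a `∇`-tile or a lens. For a lens, the vertices of the
upper path are `X ∪ {i}` for `i` running increasingly through `I`, those of the lower path are
`Y \ {j}` for `j` running decreasingly through `J`, each path has at least two edges, and the two
paths have the same first vertex and the same last vertex. -/
def IsValid {n : ℕ} : Tile n → Prop
  | delta A B C => ∃ i j, IsHEdge i j B C ∧ IsVEdge j B A ∧ IsVEdge i C A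
  | nabla A B C => ∃ i j, IsHEdge i j B C ∧ IsVEdge i A B ∧ IsVEdge j A C
  | lens U L => ∃ (X Y : Finset (Fin n)) (I J : List (Fin n)),
      I.Pairwise (· < ·) ∧ 3 ≤ I.length ∧ (∀ i ∈ I, i ∉ X) ∧ U = I.map (fun i => insert i X) ∧
      J.Pairwise (· > ·) ∧ 3 ≤ J.length ∧ (∀ j ∈ J, j ∈ Y) ∧ L = J.map (fun j => Y.erase j) ∧
      U.head? = L.head? ∧ U.getLast? = L.getLast?

/-- The tile has type `ij`: for a triangle, its base has type `ij`; for a lens, its left and right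
vertices are `X ∪ {i}` and `X ∪ {j}` where `X` is the center of the upper path. -/
def HasType {n : ℕ} (i j : Fin n) : Tile n → Prop
  | delta _ B C => IsHEdge i j B C
  | nabla _ B C => IsHEdge i j B C
  | lens U _ => ∃ l r, U.head? = some l ∧ U.getLast? = some r ∧ IsHEdge i j l r

/-- Apply a map to all vertices of a tile. -/
def map {m n : ℕ} (f : Finset (Fin m) → Finset (Fin n)) : Tile m → Tile n
  | delta A B C => delta (f A) (f B) (f C)
  | nabla A B C => nabla (f A) (f B) (f C)
  | lens U L => lens (U.map f) (L.map f)

end Tile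

/-- The vertices of the graph of a set of tiles. -/
def vertices {n : ℕ} (K : Set (Tile n)) : Set (Finset (Fin n)) := {v | ∃ τ ∈ K, v ∈ τ.verts}

/-- The directed edges of the graph of a set of tiles. -/
def edges {n : ℕ} (K : Set (Tile n)) : Set (Finset (Fin n) × Finset (Fin n)) :=
  {e | ∃ τ ∈ K, e ∈ τ.edges}

/-- `K` is a combined tiling (c-tiling, combi) on the zonogon generated by `ξ`: a planar tiling
formed by `Δ`-tiles, `∇`-tiles and lenses. -/
structure IsCTiling {n : ℕ} (ξ : Fin n → Plane) (K : Set (Tile n)) : Prop where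
  valid : ∀ τ ∈ K, τ.IsValid
  cover : (⋃ τ ∈ K, τ.polygon ξ) = zonogon ξ
  inter : ∀ τ ∈ K, ∀ τ' ∈ K, τ ≠ τ' →
    τ.polygon ξ ∩ τ'.polygon ξ = ∅ ∨
    (∃ v ∈ τ.verts ∩ τ'.verts, τ.polygon ξ ∩ τ'.polygon ξ = {point ξ v}) ∨
    (∃ e ∈ τ.edges ∩ τ'.edges, τ.polygon ξ ∩ τ'.polygon ξ = seg ξ e)
  left_boundary : ∀ i : Fin n, ∃! τ, τ ∈ K ∧ leftBoundaryEdge i ∈ τ.edges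
  right_boundary : ∀ i : Fin n, ∃! τ, τ ∈ K ∧ rightBoundaryEdge i ∈ τ.edges

/-! ### Contraction -/

/-- The removal of the last index from a set, as a subset of the smaller index set. -/
def drop {n : ℕ} (A : Finset (Fin (n + 1))) : Finset (Fin n) :=
  Finset.univ.filter (fun i => i.castSucc ∈ A)

/-- The tiles of `K` of type `∗n`, where `n` is the last index. They are the tiles of the
`n`-strip. -/
def stripTiles {n : ℕ} (K : Set (Tile (n + 1))) : Set (Tile (n + 1)) :=
  {τ | τ ∈ K ∧ ∃ i, τ.HasType i (Fin.last n)}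

/-- The edges of `K` of type `n` or `∗n`, where `n` is the last index. -/
def stripEdges {n : ℕ} (K : Set (Tile (n + 1))) :
    Set (Finset (Fin (n + 1)) × Finset (Fin (n + 1))) :=
  {e | e ∈ edges K ∧ (IsVEdge (Fin.last n) e.1 e.2 ∨ ∃ i, IsHEdge i (Fin.last n) e.1 e.2)}

/-- The vertices of the connected component of `v` in the graph of `K` with the edges of type `n`
and `∗n` deleted. -/
def component {n : ℕ} (K : Set (Tile (n + 1))) (v : Finset (Fin (n + 1))) :
    Set (Finset (Fin (n + 1))) :=
  {w | w ∈ vertices K ∧ Relation.EqvGen (fun A B => (A, B) ∈ edges K \ stripEdges K) v w}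

/-- The tiles outside the strip that are carried by the left subgraph, which is the component of
the bottom vertex of the zonogon. -/
def leftTiles {n : ℕ} (K : Set (Tile (n + 1))) : Set (Tile (n + 1)) :=
  {τ | τ ∈ K \ stripTiles K ∧ τ.verts ⊆ component K ∅}

/-- The tiles outside the strip that are carried by the right subgraph, which is the component of
the top vertex of the zonogon. -/
def rightTiles {n : ℕ} (K : Set (Tile (n + 1))) : Set (Tile (n + 1)) :=
  {τ | τ ∈ K \ stripTiles K ∧ τ.verts ⊆ component K Finset.univ}

/-- The `n`-contraction `K/n`, where `n` is the last index: the left subtiling is preserved (its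
vertices do not contain `n`), the right subtiling is shifted (each vertex `X` becomes `X - n`), the
triangles of type `∗n` vanish, and every lens of type `∗n`, with `U = X₀ … X_p` and
`L = Y₀ … Y_q`, is replaced by the triangles `Δ(X₀|Y'_{r-1}Y'_r)`, `2 ≤ r ≤ q`, with
`Y'_r = Y_r - n`, and `∇(Y'_q|X_{r-1}X_r)`, `1 ≤ r ≤ p - 1`. -/
def contraction {n : ℕ} (K : Set (Tile (n + 1))) : Set (Tile n) :=
  (Tile.map drop '' leftTiles K) ∪ (Tile.map drop '' rightTiles K) ∪
  {τ | ∃ U L l u v, Tile.lens U L ∈ stripTiles K ∧ U.head? = some l ∧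
      [u, v] <:+: L.tail ∧ τ = Tile.delta (drop l) (drop u) (drop v)} ∪
  {τ | ∃ U L r u v, Tile.lens U L ∈ stripTiles K ∧ L.getLast? = some r ∧
      [u, v] <:+: U.dropLast ∧ τ = Tile.nabla (drop r) (drop u) (drop v)}

/-! ### Legal paths and expansion -/

/-- `(A, B)` is a V-edge of the graph of `K`. -/
def IsVEdgeOf {n : ℕ} (K : Set (Tile n)) (A B : Finset (Fin n)) : Prop :=
  (A, B) ∈ edges K ∧ ∃ i, IsVEdge i A B

/-- `P`, given by its sequence of vertices, is a legal path for `K`. -/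
structure IsLegalPath {n : ℕ} (K : Set (Tile n)) (P : List (Finset (Fin n))) : Prop where
  /-- `P` starts at the bottom of the zonogon. -/
  head : P.head? = some ∅
  /-- `P` ends at the top of the zonogon. -/
  last : P.getLast? = some Finset.univ
  /-- All edges of `P` are V-edges, traversed forward or backward. -/
  chain : P.IsChain (fun A B => IsVEdgeOf K A B ∨ IsVEdgeOf K B A)
  /-- Of two consecutive edges at least one is forward. -/
  forward : ∀ a b c, [a, b, c] <:+: P → b.card < a.card → b.card < c.card
  /-- Zigzags go to the right. -/
  zigzag : ∀ a b c, [a, b, c] <:+: P → a.card = c.card → a.card ≠ b.card →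
    (∃ i j, i < j ∧ IsVEdge i b a ∧ IsVEdge j b c) ∨
    (∃ i j, j < i ∧ IsVEdge i a b ∧ IsVEdge j c b)

/-- The curve in the plane formed by a path. -/
def curve {n : ℕ} (ξ : Fin n → Plane) (P : List (Finset (Fin n))) : Set Plane :=
  {z | ∃ A B, [A, B] <:+: P ∧ z ∈ seg ξ (A, B)}

/-- The part of the zonogon on the side of the boundary part `b` with respect to the path `P`: the
curve of `P` together with all points of the zonogon outside the curve that can be connected with a
point of `b` by a continuous path in the zonogon that avoids the curve. -/
def region {n : ℕ} (ξ : Fin n → Plane) (P : List (Finset (Fin n))) (b : Set Plane) : Set Plane :=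
  curve ξ P ∪ {z | ∃ w ∈ b, JoinedIn (zonogon ξ \ curve ξ P) z w}

/-- The subtiling on the left of the path. -/
def leftPart {n : ℕ} (ξ : Fin n → Plane) (K : Set (Tile n)) (P : List (Finset (Fin n))) :
    Set (Tile n) :=
  {τ | τ ∈ K ∧ τ.polygon ξ ⊆ region ξ P (lbd ξ)}

/-- The subtiling on the right of the path. -/
def rightPart {n : ℕ} (ξ : Fin n → Plane) (K : Set (Tile n)) (P : List (Finset (Fin n))) :
    Set (Tile n) :=
  {τ | τ ∈ K ∧ τ.polygon ξ ⊆ region ξ P (rbd ξ)}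

/-- `a, b, c` are consecutive vertices of `P` and `b` is a slope. -/
def IsSlope {n : ℕ} (P : List (Finset (Fin n))) (a b c : Finset (Fin n)) : Prop :=
  [a, b, c] <:+: P ∧ a.card < b.card ∧ b.card < c.card

/-- `a, b, c` are consecutive vertices of `P` and `b` is a peak. -/
def IsPeak {n : ℕ} (P : List (Finset (Fin n))) (a b c : Finset (Fin n)) : Prop :=
  [a, b, c] <:+: P ∧ a.card = c.card ∧ a.card < b.card

/-- `a, b, c` are consecutive vertices of `P` and `b` is a pit. -/
def IsPit {n : ℕ} (P : List (Finset (Fin n))) (a b c : Finset (Fin n)) : Prop :=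
  [a, b, c] <:+: P ∧ a.card = c.card ∧ b.card < a.card

/-- `Y = Y₀ … Y_q` is the vertex sequence, from `a` to `c`, of the bases of the lower filling
`Δ(b|Y₀Y₁), …, Δ(b|Y_{q-1}Y_q)` in `K`. -/
def IsLowerFilling {n : ℕ} (K : Set (Tile n)) (a b c : Finset (Fin n))
    (Y : List (Finset (Fin n))) : Prop :=
  Y.head? = some a ∧ Y.getLast? = some c ∧ Y.IsChain (fun u v => Tile.delta b u v ∈ K)

/-- `X = X₀ … X_p` is the vertex sequence, from `a` to `c`, of the bases of the upper filling
`∇(b|X₀X₁), …, ∇(b|X_{p-1}X_p)` in `K`. -/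
def IsUpperFilling {n : ℕ} (K : Set (Tile n)) (a b c : Finset (Fin n))
    (X : List (Finset (Fin n))) : Prop :=
  X.head? = some a ∧ X.getLast? = some c ∧ X.IsChain (fun u v => Tile.nabla b u v ∈ K)

/-- The tiles in the fillings of the peaks of `P`. -/
def peakFillings {n : ℕ} (K : Set (Tile n)) (P : List (Finset (Fin n))) : Set (Tile n) :=
  {τ | ∃ a b c Y u v, IsPeak P a b c ∧ IsLowerFilling K a b c Y ∧ [u, v] <:+: Y ∧
    τ = Tile.delta b u v}

/-- The tiles in the fillings of the pits of `P`. -/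
def pitFillings {n : ℕ} (K : Set (Tile n)) (P : List (Finset (Fin n))) : Set (Tile n) :=
  {τ | ∃ a b c X u v, IsPit P a b c ∧ IsUpperFilling K a b c X ∧ [u, v] <:+: X ∧
    τ = Tile.nabla b u v}

/-- A subset of the smaller index set as a subset of the larger one. -/
def lo {n : ℕ} (A : Finset (Fin n)) : Finset (Fin (n + 1)) := A.map Fin.castSuccEmb

/-- The shifted vertex `An`, where `n` is the last element of the larger index set. -/
def hi {n : ℕ} (A : Finset (Fin n)) : Finset (Fin (n + 1)) := insert (Fin.last n) (lo A)

/-- The tiles created by the slopes and by the first and last vertices of `P`. -/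
def slopeTiles {n : ℕ} (P : List (Finset (Fin n))) : Set (Tile (n + 1)) :=
  {τ | ∃ a b c, IsSlope P a b c ∧
    (τ = Tile.nabla (lo b) (lo c) (hi b) ∨ τ = Tile.delta (hi b) (lo b) (hi a))} ∪
  {τ | ∃ a b, [a, b] <+: P ∧ τ = Tile.nabla (lo a) (lo b) (hi a)} ∪
  {τ | ∃ a b, [a, b] <:+ P ∧ τ = Tile.delta (hi b) (lo b) (hi a)}

/-- The lenses created by the backward edges of `P`: for consecutive vertices `w, x, y, z` of `P`
with a peak `x` and a pit `y`, the lower filling `Y` at `x` and the upper filling `X` at `y`, the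
lens has the upper path `X₀, …, X_p, yn` and the lower path `x, Y₀n, …, Y_qn`. -/
def newLenses {n : ℕ} (K : Set (Tile n)) (P : List (Finset (Fin n))) : Set (Tile (n + 1)) :=
  {τ | ∃ w x y z X Y, [w, x, y, z] <:+: P ∧ y.card < x.card ∧
    IsLowerFilling K w x y Y ∧ IsUpperFilling K x y z X ∧
    τ = Tile.lens (X.map lo ++ [hi y]) (lo x :: Y.map hi)}

/-- The `n`-expansion of `K` with respect to the path `P`, where `n` is the last element of the
larger index set and `ξ` generates the smaller zonogon. -/
def expansion {n : ℕ} (ξ : Fin n → Plane) (K : Set (Tile n)) (P : List (Finset (Fin n))) :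
    Set (Tile (n + 1)) :=
  (Tile.map lo '' (leftPart ξ K P \ pitFillings K P)) ∪
  (Tile.map hi '' (rightPart ξ K P \ peakFillings K P)) ∪
  slopeTiles P ∪ newLenses K P

end Combi

namespace Combi

open Filter Topology

/-- Vertices are sets of indices. -/
abbrev Vert (n : ℕ) := Finset (Fin n)

/-- Directed edges are pairs of vertices. -/
abbrev Edge (n : ℕ) := Vert n × Vert n

/-! ### Convex polygons in the plane -/

/-- Twice the signed area of the triangle `P, Q, z`; it is positive if and only if `z` lies strictly
on the right of the directed line `P Q`. -/
def side (P Q z : Plane) : ℝ := (z 0 - P 0) * (Q 1 - P 1) - (z 1 - P 1) * (Q 0 - P 0)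

lemma side_left (P Q : Plane) : side P Q P = 0 := by simp [side]

lemma side_right (P Q : Plane) : side P Q Q = 0 := by simp only [side]; ring

lemma side_self (P z : Plane) : side P P z = 0 := by simp [side]

lemma side_swap (P Q z : Plane) : side Q P z = -side P Q z := by simp only [side]; ring

lemma side_rotate (P Q R : Plane) : side Q R P = side P Q R := by simp only [side]; ring

lemma side_add_smul (P Q x y : Plane) {a b : ℝ} (h : a + b = 1) :
    side P Q (a • x + b • y) = a * side P Q x + b * side P Q y := by
  obtain rfl : b = 1 - a := by linarith
  simp only [side, PiLp.add_apply, PiLp.smul_apply, smul_eq_mul]; ring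

lemma continuous_side (P Q : Plane) : Continuous (side P Q) := by
  unfold side; fun_prop

lemma convex_side_nonneg (P Q : Plane) : Convex ℝ {z | 0 ≤ side P Q z} := by
  intro x hx y hy a b ha hb hab
  simp only [Set.mem_ofPred_eq] at *
  rw [side_add_smul _ _ _ _ hab]; positivity

lemma convex_side_pos (P Q : Plane) : Convex ℝ {z | 0 < side P Q z} := by
  intro x hx y hy a b ha hb hab
  simp only [Set.mem_ofPred_eq] at *
  rw [side_add_smul _ _ _ _ hab]
  rcases ha.eq_or_lt with rfl | ha
  · obtain rfl : b = 1 := by linarith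
    simpa using hy
  · have := mul_pos ha hx
    have := mul_nonneg hb hy.le
    linarith

lemma side_eq_zero_of_mem_segment {P Q z : Plane} (h : z ∈ segment ℝ P Q) : side P Q z = 0 := by
  obtain ⟨a, b, _, _, hab, rfl⟩ := h
  rw [side_add_smul _ _ _ _ hab, side_left, side_right]; ring

/-- The sum of a function over the pairs of consecutive elements of a list. -/
def pathSum {α G : Type*} [AddCommGroup G] (φ : α → α → G) : List α → G
  | [] => 0
  | [_] => 0
  | a :: b :: l => φ a b + pathSum φ (b :: l)

@[simp] lemma pathSum_nil {α G : Type*} [AddCommGroup G] (φ : α → α → G) : pathSum φ [] = 0 := rfl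
@[simp] lemma pathSum_singleton {α G : Type*} [AddCommGroup G] (φ : α → α → G) (a : α) : pathSum φ [a] = 0 := rfl
@[simp] lemma pathSum_cons_cons {α G : Type*} [AddCommGroup G] (φ : α → α → G) (a b : α) (l : List α) :
    pathSum φ (a :: b :: l) = φ a b + pathSum φ (b :: l) := rfl

lemma pathSum_append {α G : Type*} [AddCommGroup G] (φ : α → α → G) (l : List α) (b : α) (m : List α) :
    pathSum φ (l ++ b :: m) = pathSum φ (l ++ [b]) + pathSum φ (b :: m) := by
  induction l with
  | nil => simp
  | cons a l ih =>
    cases l with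
    | nil => simp
    | cons c l => simp only [List.cons_append, pathSum_cons_cons] at *; rw [ih, add_assoc]

lemma pathSum_reverse {α G : Type*} [AddCommGroup G] {φ : α → α → G} (hφ : ∀ a b, φ a b = -φ b a) (l : List α) :
    pathSum φ l.reverse = -pathSum φ l := by
  induction l with
  | nil => simp
  | cons a l ih =>
    cases l with
    | nil => simp
    | cons c l =>
      simp only [List.reverse_cons, List.append_assoc, List.cons_append, List.nil_append] at *
      rw [pathSum_append, ih, pathSum_cons_cons, pathSum_cons_cons, hφ a c]; simp [add_comm]

lemma pathSum_map {α β G : Type*} [AddCommGroup G] (φ : β → β → G) (g : α → β) (l : List α) :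
    pathSum φ (l.map g) = pathSum (fun a b => φ (g a) (g b)) l := by
  induction l with
  | nil => simp
  | cons a l ih => cases l with
    | nil => simp
    | cons b l => simpa using ih

lemma pair_infix_cons {α : Type*} {a b x y : α} {l : List α} :
    [a, b] <:+: x :: y :: l ↔ (a = x ∧ b = y) ∨ [a, b] <:+: y :: l := by
  rw [List.infix_cons_iff]; simp

lemma not_pair_infix {α : Type*} {a b x : α} : ¬ [a, b] <:+: [x] := by
  intro h; simpa using h.length_le

lemma pair_infix_append_cons {α : Type*} {a b x : α} {l m : List α} :
    [a, b] <:+: l ++ x :: m ↔ [a, b] <:+: l ++ [x] ∨ [a, b] <:+: x :: m := by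
  induction l with
  | nil => simp [not_pair_infix]
  | cons y l ih =>
    cases l with
    | nil => simp [pair_infix_cons, not_pair_infix]
    | cons z l => simp only [List.cons_append, pair_infix_cons] at *; rw [ih]; tauto

lemma pair_infix_mem {α : Type*} {a b : α} {l : List α} (h : [a, b] <:+: l) : a ∈ l ∧ b ∈ l :=
  ⟨h.subset (by simp), h.subset (by simp)⟩

lemma isChain_of_pair_infix {α : Type*} {R : α → α → Prop} {l : List α}
    (h : ∀ u v, [u, v] <:+: l → R u v) : l.IsChain R := by
  induction l with
  | nil => simp
  | cons a l ih =>
    rcases l with _ | ⟨b, l⟩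
    · simp
    · rw [List.isChain_cons_cons]
      exact ⟨h a b (by simp [pair_infix_cons]),
        ih fun u v huv => h u v (pair_infix_cons.2 (Or.inr huv))⟩

/-- The crossing number of the segment from `P` to `Q` with a ray that starts at `z`, where the
function `p x + q y` serves as first coordinate. -/
noncomputable def crossing (p q : ℝ) (z P Q : Plane) : ℤ :=
  if p * P 0 + q * P 1 < p * z 0 + q * z 1 ∧ p * z 0 + q * z 1 < p * Q 0 + q * Q 1 ∧
    0 < side P Q z then 1
  else if p * Q 0 + q * Q 1 < p * z 0 + q * z 1 ∧ p * z 0 + q * z 1 < p * P 0 + q * P 1 ∧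
    side P Q z < 0 then -1 else 0

lemma crossing_swap (p q : ℝ) (z P Q : Plane) : crossing p q z P Q = -crossing p q z Q P := by
  unfold crossing
  rw [side_swap Q P z]
  by_cases h1 : p * P 0 + q * P 1 < p * z 0 + q * z 1 <;>
  by_cases h2 : p * z 0 + q * z 1 < p * Q 0 + q * Q 1 <;>
  by_cases h3 : p * Q 0 + q * Q 1 < p * z 0 + q * z 1 <;>
  by_cases h4 : p * z 0 + q * z 1 < p * P 0 + q * P 1 <;>
  by_cases h5 : 0 < side Q P z <;>
  by_cases h6 : side Q P z < 0 <;>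
  simp [h1, h2, h3, h4, h5, h6] <;> linarith

lemma crossing_triangle_aux {a b c o x y : ℝ} (ha : a ≠ 0) (hb : b ≠ 0) (hc : c ≠ 0) (ho : o ≠ 0)
    (hx : x ≠ 0) (hy : y ≠ 0) (hs : 0 < a + b + c) (he : a * o + b * x + c * y = 0) :
    ((if o < 0 ∧ 0 < x ∧ 0 < c then 1 else if x < 0 ∧ 0 < o ∧ c < 0 then -1 else 0) +
    (if x < 0 ∧ 0 < y ∧ 0 < a then 1 else if y < 0 ∧ 0 < x ∧ a < 0 then -1 else 0) +
    (if y < 0 ∧ 0 < o ∧ 0 < b then 1 else if o < 0 ∧ 0 < y ∧ b < 0 then -1 else 0) : ℤ) =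
    if 0 < a ∧ 0 < b ∧ 0 < c then 1 else 0 := by
  rcases ha.lt_or_gt with ha | ha <;> rcases hb.lt_or_gt with hb | hb <;>
  rcases hc.lt_or_gt with hc | hc <;> rcases ho.lt_or_gt with ho | ho <;>
  rcases hx.lt_or_gt with hx | hx <;> rcases hy.lt_or_gt with hy | hy <;>
  simp only [ha, hb, hc, ho, hx, hy, ha.not_gt, hb.not_gt, hc.not_gt, ho.not_gt, hx.not_gt,
    hy.not_gt, and_true, and_false, if_true, if_false] <;>
  first
  | norm_num; done
  | (exfalso; linarith)
  | (exfalso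
     first | have := mul_pos_of_neg_of_neg ha ho | have := mul_pos ha ho
           | have := mul_neg_of_neg_of_pos ha ho | have := mul_neg_of_pos_of_neg ha ho
     first | have := mul_pos_of_neg_of_neg hb hx | have := mul_pos hb hx
           | have := mul_neg_of_neg_of_pos hb hx | have := mul_neg_of_pos_of_neg hb hx
     first | have := mul_pos_of_neg_of_neg hc hy | have := mul_pos hc hy
           | have := mul_neg_of_neg_of_pos hc hy | have := mul_neg_of_pos_of_neg hc hy
     linarith)

lemma crossing_triangle {p q : ℝ} {z P Q R : Plane} (h : 0 < side P Q R)
    (h1 : side P Q z ≠ 0) (h2 : side Q R z ≠ 0) (h3 : side R P z ≠ 0)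
    (k1 : p * z 0 + q * z 1 ≠ p * P 0 + q * P 1) (k2 : p * z 0 + q * z 1 ≠ p * Q 0 + q * Q 1)
    (k3 : p * z 0 + q * z 1 ≠ p * R 0 + q * R 1) :
    crossing p q z P Q + crossing p q z Q R + crossing p q z R P =
      if 0 < side Q R z ∧ 0 < side R P z ∧ 0 < side P Q z then 1 else 0 := by
  have := crossing_triangle_aux h2 h3 h1 (o := p * P 0 + q * P 1 - (p * z 0 + q * z 1))
    (x := p * Q 0 + q * Q 1 - (p * z 0 + q * z 1)) (y := p * R 0 + q * R 1 - (p * z 0 + q * z 1))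
    (sub_ne_zero.2 k1.symm) (sub_ne_zero.2 k2.symm) (sub_ne_zero.2 k3.symm)
    (by simp only [side] at *; linarith) (by simp only [side]; ring)
  simpa only [sub_pos, sub_neg, crossing] using this

/-- The list of the vertices of a strictly convex polygon, in clockwise order. -/
def IsConvexList (l : List Plane) : Prop := l.Triplewise (fun a b c => 0 < side a b c)

section polygon

variable {o : Plane} {l : List Plane}

lemma IsConvexList.edge (h : IsConvexList (o :: l)) (hl : 2 ≤ l.length) {P Q : Plane}
    (e : [P, Q] <:+: o :: l ++ [o]) :
    P ∈ o :: l ∧ Q ∈ o :: l ∧ (∀ v ∈ o :: l, v = P ∨ v = Q ∨ 0 < side P Q v) ∧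
      ∃ v ∈ o :: l, 0 < side P Q v := by
  have key : [P, Q] <:+: o :: l ∨ ∃ m, l = m ++ [P] ∧ Q = o := by
    obtain ⟨m, x, rfl⟩ : ∃ m x, l = m ++ [x] := by
      rcases List.eq_nil_or_concat l with rfl | ⟨m, x, rfl⟩
      · simp at hl
      · exact ⟨m, x, by simp⟩
    have e' : [P, Q] <:+: (o :: m) ++ x :: [o] := by simpa using e
    rw [pair_infix_append_cons] at e'
    rcases e' with e' | e'
    · left; simpa using e'
    · rw [pair_infix_cons] at e'
      rcases e' with ⟨rfl, rfl⟩ | e'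
      · exact Or.inr ⟨m, rfl, rfl⟩
      · exact absurd e' not_pair_infix
  rcases key with ⟨s, t, hst⟩ | ⟨m, rfl, rfl⟩
  · rw [IsConvexList, ← hst, List.append_assoc, List.triplewise_append,
      List.triplewise_append] at h
    have hs : ∀ v ∈ s, 0 < side P Q v := by
      intro v hv
      have := h.2.2.1 v hv
      simp only [List.cons_append, List.nil_append, List.pairwise_cons] at this
      have := this.1 Q (by simp)
      rwa [side_rotate]
    have ht : ∀ v ∈ t, 0 < side P Q v := by
      intro v hv
      have := h.2.1.2.2.2 v hv
      simpa using this
    rw [← hst]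
    refine ⟨by simp, by simp, ?_, ?_⟩
    · intro v hv
      simp only [List.append_assoc, List.cons_append, List.nil_append, List.mem_append,
        List.mem_cons] at hv
      rcases hv with hv | rfl | rfl | hv
      · exact Or.inr (Or.inr (hs v hv))
      · simp
      · simp
      · exact Or.inr (Or.inr (ht v hv))
    · rcases s with _ | ⟨v, s⟩
      · rcases t with _ | ⟨v, t⟩
        · simp at hst; simp [← hst.2] at hl
        · exact ⟨v, by simp, ht v (by simp)⟩
      · exact ⟨v, by simp, hs v (by simp)⟩
  · have hm : ∀ v ∈ m, 0 < side P Q v := by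
      intro v hv
      rw [IsConvexList, List.triplewise_cons, List.pairwise_append] at h
      have := h.1.2.2 v hv P (by simp)
      rwa [side_rotate] at this
    refine ⟨by simp, by simp, ?_, ?_⟩
    · aesop
    · rcases m with _ | ⟨v, m⟩
      · simp at hl
      · exact ⟨v, by simp, hm v (by simp)⟩

lemma IsConvexList.edge_ne (h : IsConvexList (o :: l)) (hl : 2 ≤ l.length) {P Q : Plane}
    (e : [P, Q] <:+: o :: l ++ [o]) : P ≠ Q := by
  rintro rfl
  obtain ⟨v, _, hv⟩ := (h.edge hl e).2.2.2
  simp [side_self] at hv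

lemma IsConvexList.edge_nonneg (h : IsConvexList (o :: l)) (hl : 2 ≤ l.length) {P Q : Plane}
    (e : [P, Q] <:+: o :: l ++ [o]) {v : Plane} (hv : v ∈ o :: l) : 0 ≤ side P Q v := by
  rcases (h.edge hl e).2.2.1 v hv with rfl | rfl | h
  · rw [side_left]
  · rw [side_right]
  · exact h.le

lemma IsConvexList.side_nonneg (h : IsConvexList (o :: l)) (hl : 2 ≤ l.length) {P Q z : Plane}
    (e : [P, Q] <:+: o :: l ++ [o]) (hz : z ∈ convexHull ℝ {v | v ∈ o :: l}) :
    0 ≤ side P Q z :=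
  convexHull_min (t := {z | 0 ≤ side P Q z}) (fun _ hv => h.edge_nonneg hl e hv)
    (convex_side_nonneg P Q) hz

lemma mem_triangle {P Q R z : Plane} (h : 0 < side P Q R) (h1 : 0 ≤ side P Q z)
    (h2 : 0 ≤ side Q R z) (h3 : 0 ≤ side R P z) {s : Set Plane} (hP : P ∈ s) (hQ : Q ∈ s)
    (hR : R ∈ s) : z ∈ convexHull ℝ s := by
  have hsum : side Q R z + side R P z + side P Q z = side P Q R := by simp only [side]; ring
  have hz : z = (side Q R z / side P Q R) • P + (side R P z / side P Q R) • Q +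
      (side P Q z / side P Q R) • R := by
    ext i
    simp only [PiLp.add_apply, PiLp.smul_apply, smul_eq_mul]
    field_simp
    fin_cases i <;> simp only [side, Fin.zero_eta, Fin.mk_one] <;> ring
  have hP := subset_convexHull ℝ s hP
  have hQ := subset_convexHull ℝ s hQ
  have hR := subset_convexHull ℝ s hR
  have := (convex_convexHull ℝ s).sum_mem (t := Finset.univ)
    (w := ![side Q R z / side P Q R, side R P z / side P Q R, side P Q z / side P Q R])
    (z := ![P, Q, R]) (by intro i _; fin_cases i <;> simp <;> positivity)
    (by simp [Fin.sum_univ_succ]; field_simp; linarith)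
    (by intro i _; fin_cases i <;> simp [hP, hQ, hR])
  rw [hz]
  simpa [Fin.sum_univ_succ, add_assoc] using this

lemma IsConvexList.tail (h : IsConvexList (o :: l)) (a : Plane) (ha : l = a :: l.tail) :
    IsConvexList (o :: l.tail) := by
  rw [ha, IsConvexList, List.triplewise_cons, List.pairwise_cons, List.triplewise_cons] at h
  rw [IsConvexList, List.triplewise_cons]
  exact ⟨h.1.2, h.2.2⟩

lemma mem_convexHull_of_side_nonneg {z : Plane} : ∀ {l : List Plane}, IsConvexList (o :: l) →
    2 ≤ l.length → (∀ P Q, [P, Q] <:+: o :: l ++ [o] → 0 ≤ side P Q z) →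
    z ∈ convexHull ℝ {v | v ∈ o :: l}
  | [], _, hl, _ => by simp at hl
  | [_], _, hl, _ => by simp at hl
  | [a, b], h, _, hz => by
    rw [IsConvexList, List.triplewise_triple] at h
    exact mem_triangle h (hz o a (by simp [pair_infix_cons]))
      (hz a b (by simp [pair_infix_cons])) (hz b o (by simp [pair_infix_cons]))
      (by simp) (by simp) (by simp)
  | a :: b :: c :: r, h, _, hz => by
    rcases le_or_gt 0 (side o b z) with hb | hb
    · refine convexHull_mono ?_ (mem_convexHull_of_side_nonneg (l := b :: c :: r)
        (h.tail a rfl) (by simp) ?_)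
      · intro v; simp; tauto
      · intro P Q e
        rw [List.cons_append, List.cons_append, pair_infix_cons] at e
        rcases e with ⟨rfl, rfl⟩ | e
        · exact hb
        · exact hz P Q (e.trans ⟨[o, a], [], by simp⟩)
    · have h3 : 0 < side o a b := by
        rw [IsConvexList, List.triplewise_cons, List.pairwise_cons] at h
        exact h.1.1 b (by simp)
      refine mem_triangle h3 (hz o a (by simp [pair_infix_cons]))
        (hz a b (by simp [pair_infix_cons])) (by rw [side_swap]; linarith)
        (by simp) (by simp) (by simp)

lemma pathSum_crossing_triangle {p q : ℝ} {z a b : Plane} (h : IsConvexList [o, a, b])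
    (hz : ∀ P ∈ [o, a, b], ∀ Q ∈ [o, a, b], P ≠ Q → side P Q z ≠ 0)
    (hk : ∀ P ∈ [o, a, b], p * z 0 + q * z 1 ≠ p * P 0 + q * P 1) :
    (z ∈ convexHull ℝ {v | v ∈ [o, a, b]} → pathSum (crossing p q z) [o, a, b, o] = 1) ∧
    (z ∉ convexHull ℝ {v | v ∈ [o, a, b]} → pathSum (crossing p q z) [o, a, b, o] = 0) := by
  have hl : 2 ≤ [a, b].length := by simp
  have h' := h
  rw [IsConvexList, List.triplewise_triple] at h
  have e1 : [o, a] <:+: o :: [a, b] ++ [o] := by simp [pair_infix_cons]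
  have e2 : [a, b] <:+: o :: [a, b] ++ [o] := by simp [pair_infix_cons]
  have e3 : [b, o] <:+: o :: [a, b] ++ [o] := by simp [pair_infix_cons]
  have n1 := hz o (by simp) a (by simp) (h'.edge_ne hl e1)
  have n2 := hz a (by simp) b (by simp) (h'.edge_ne hl e2)
  have n3 := hz b (by simp) o (by simp) (h'.edge_ne hl e3)
  have := crossing_triangle h n1 n2 n3
    (hk o (by simp)) (hk a (by simp)) (hk b (by simp))
  simp only [pathSum_cons_cons, pathSum_singleton, add_zero]
  rw [← add_assoc, this]
  constructor
  · intro hm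
    rw [if_pos]
    exact ⟨(h'.side_nonneg hl e2 hm).lt_of_ne n2.symm,
      (h'.side_nonneg hl e3 hm).lt_of_ne n3.symm, (h'.side_nonneg hl e1 hm).lt_of_ne n1.symm⟩
  · intro hm
    rw [if_neg]
    rintro ⟨k2, k3, k1⟩
    exact hm (mem_triangle h k1.le k2.le k3.le (by simp) (by simp) (by simp))

lemma IsConvexList.mem_tail_or_mem_triangle {z a b c : Plane} {r : List Plane}
    (h : IsConvexList (o :: a :: b :: c :: r))
    (hm : z ∈ convexHull ℝ {v | v ∈ o :: a :: b :: c :: r}) :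
    (0 ≤ side o b z ∧ z ∈ convexHull ℝ {v | v ∈ o :: b :: c :: r}) ∨
      (side o b z < 0 ∧ z ∈ convexHull ℝ {v | v ∈ [o, a, b]}) := by
  rcases lt_or_ge (side o b z) 0 with hb | hb
  · have h3 : 0 < side o a b := by
      rw [IsConvexList, List.triplewise_cons, List.pairwise_cons] at h
      exact h.1.1 b (by simp)
    refine Or.inr ⟨hb, mem_triangle h3 ?_ ?_ ?_ (by simp) (by simp) (by simp)⟩
    · exact h.side_nonneg (P := o) (Q := a) (by simp) ⟨[], b :: c :: r ++ [o], by simp⟩ hm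
    · exact h.side_nonneg (P := a) (Q := b) (by simp) ⟨[o], c :: r ++ [o], by simp⟩ hm
    · rw [side_swap]; linarith
  · refine Or.inl ⟨hb, mem_convexHull_of_side_nonneg (h.tail a rfl) (by simp) ?_⟩
    intro P Q e
    rw [List.cons_append, List.cons_append, pair_infix_cons] at e
    rcases e with ⟨rfl, rfl⟩ | e
    · exact hb
    · exact h.side_nonneg (by simp) (e.trans ⟨[o, a], [], by simp⟩) hm

/-- The crossing numbers of the sides of a convex polygon sum up to the indicator function of the
polygon, at every point in general position. -/
lemma pathSum_crossing {p q : ℝ} {z : Plane} (h : IsConvexList (o :: l))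
    (hl : 2 ≤ l.length) (hz : ∀ P ∈ o :: l, ∀ Q ∈ o :: l, P ≠ Q → side P Q z ≠ 0)
    (hk : ∀ P ∈ o :: l, p * z 0 + q * z 1 ≠ p * P 0 + q * P 1) :
    (z ∈ convexHull ℝ {v | v ∈ o :: l} → pathSum (crossing p q z) (o :: l ++ [o]) = 1) ∧
    (z ∉ convexHull ℝ {v | v ∈ o :: l} → pathSum (crossing p q z) (o :: l ++ [o]) = 0) := by
  induction l with
  | nil => simp at hl
  | cons a l ih =>
  rcases l with _ | ⟨b, _ | ⟨c, r⟩⟩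
  · simp at hl
  · exact pathSum_crossing_triangle h hz hk
  · have ht : IsConvexList (o :: b :: c :: r) := h.tail a rfl
    have h3 : IsConvexList (o :: [a, b]) := by
      rw [IsConvexList, List.triplewise_triple]
      rw [IsConvexList, List.triplewise_cons, List.pairwise_cons] at h
      exact h.1.1 b (by simp)
    have hob : o ≠ b := ht.edge_ne (by simp) (by simp [pair_infix_cons])
    have s1 : o :: b :: c :: r ⊆ o :: a :: b :: c :: r :=
      List.cons_subset_cons _ (List.subset_cons_self _ _)
    have s2 : [o, a, b] ⊆ o :: a :: b :: c :: r :=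
      List.cons_subset_cons _ (List.cons_subset_cons _ (by simp))
    have i1 := ih ht (by simp) (fun P hP Q hQ => hz P (s1 hP) Q (s1 hQ)) (fun P hP => hk P (s1 hP))
    have i2 := pathSum_crossing_triangle (p := p) (q := q) (z := z) h3
      (fun P hP Q hQ => hz P (s2 hP) Q (s2 hQ)) (fun P hP => hk P (s2 hP))
    have hsum : pathSum (crossing p q z) (o :: (a :: b :: c :: r) ++ [o]) =
        pathSum (crossing p q z) [o, a, b, o] +
        pathSum (crossing p q z) (o :: (b :: c :: r) ++ [o]) := by
      simp only [List.cons_append, pathSum_cons_cons, pathSum_singleton]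
      rw [crossing_swap p q z b o]; ring
    have m1 : z ∈ convexHull ℝ {v | v ∈ o :: b :: c :: r} →
        z ∈ convexHull ℝ {v | v ∈ o :: a :: b :: c :: r} :=
      fun h => convexHull_mono (fun _ hv => s1 hv) h
    have m2 : z ∈ convexHull ℝ {v | v ∈ o :: [a, b]} →
        z ∈ convexHull ℝ {v | v ∈ o :: a :: b :: c :: r} :=
      fun h => convexHull_mono (fun _ hv => s2 hv) h
    have d1 : z ∈ convexHull ℝ {v | v ∈ o :: b :: c :: r} → 0 < side o b z := fun hm =>
      (ht.side_nonneg (by simp) (by simp [pair_infix_cons]) hm).lt_of_ne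
        (hz o (by simp) b (by simp) hob).symm
    have d2 : z ∈ convexHull ℝ {v | v ∈ o :: [a, b]} → side o b z < 0 := fun hm => by
      have := (h3.side_nonneg (by simp) (P := b) (Q := o) (by simp [pair_infix_cons]) hm)
      rw [side_swap] at this
      exact lt_of_le_of_ne (by linarith) (hz o (by simp) b (by simp) hob)
    rw [hsum]
    constructor
    · intro hm
      rcases h.mem_tail_or_mem_triangle hm with ⟨hb, hm'⟩ | ⟨hb, hm'⟩
      · rw [i1.1 hm', i2.2 (fun h' => (d2 h').not_ge hb)]; rfl
      · rw [i2.1 hm', i1.2 (fun h' => (d1 h').not_gt hb)]; rfl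
    · intro hm
      rw [i1.2 (fun h => hm (m1 h)), i2.2 (fun h => hm (m2 h))]; rfl

lemma IsConvexList.mem_segment (h : IsConvexList (o :: l)) (hl : 2 ≤ l.length) {P Q z : Plane}
    (e : [P, Q] <:+: o :: l ++ [o]) (hz : z ∈ convexHull ℝ {v | v ∈ o :: l})
    (h0 : side P Q z = 0) : z ∈ segment ℝ P Q := by
  have : z ∈ {z | 0 ≤ side P Q z ∧ (side P Q z = 0 → z ∈ segment ℝ P Q)} := by
    refine convexHull_min ?_ ?_ hz
    · intro v hv
      refine ⟨h.edge_nonneg hl e hv, fun h0 => ?_⟩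
      rcases (h.edge hl e).2.2.1 v hv with rfl | rfl | h
      · exact left_mem_segment ℝ _ _
      · exact right_mem_segment ℝ _ _
      · linarith
    · rintro x ⟨hx, hx'⟩ y ⟨hy, hy'⟩ a b ha hb hab
      refine ⟨convex_side_nonneg P Q hx hy ha hb hab, fun h0 => ?_⟩
      rw [side_add_smul _ _ _ _ hab] at h0
      rcases ha.eq_or_lt with rfl | ha'
      · obtain rfl : b = 1 := by linarith
        simpa using hy' (by simpa using h0)
      rcases hb.eq_or_lt with rfl | hb'
      · obtain rfl : a = 1 := by linarith
        simpa using hx' (by simpa using h0)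
      have h1 := mul_nonneg ha hx
      have h2 := mul_nonneg hb hy
      have h3 : a * side P Q x = 0 := by linarith
      have h4 : b * side P Q y = 0 := by linarith
      exact convex_segment P Q (hx' (by simpa [ha'.ne'] using h3))
        (hy' (by simpa [hb'.ne'] using h4)) ha hb hab
  exact this.2 h0

lemma IsConvexList.edge_unique (h : IsConvexList (o :: l)) (hl : 2 ≤ l.length) {P Q P' Q' z : Plane}
    (e : [P, Q] <:+: o :: l ++ [o]) (e' : [P', Q'] <:+: o :: l ++ [o])
    (hz : z ∈ openSegment ℝ P Q) (h0 : side P' Q' z = 0) : P' = P ∧ Q' = Q := by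
  obtain ⟨a, b, ha, hb, hab, rfl⟩ := hz
  have hE := h.edge hl e
  have hE' := h.edge hl e'
  have hne := h.edge_ne hl e
  rw [side_add_smul _ _ _ _ hab] at h0
  have h1 := h.edge_nonneg hl e' hE.1
  have h2 := h.edge_nonneg hl e' hE.2.1
  have h1' := mul_nonneg ha.le h1
  have h2' := mul_nonneg hb.le h2
  have h3 : a * side P' Q' P = 0 := by linarith
  have h4 : b * side P' Q' Q = 0 := by linarith
  have h5 : side P' Q' P = 0 := by simpa [ha.ne'] using h3
  have h6 : side P' Q' Q = 0 := by simpa [hb.ne'] using h4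
  rcases hE'.2.2.1 P hE.1 with rfl | rfl | h
  · grind
  · rcases hE'.2.2.1 Q hE.2.1 with rfl | rfl | h
    · obtain ⟨v, hv, hv'⟩ := hE.2.2.2
      have := IsConvexList.edge_nonneg ‹_› hl e' hv
      rw [side_swap] at this
      linarith
    · exact absurd rfl hne
    · linarith
  · linarith

lemma IsConvexList.eventually_mem (h : IsConvexList (o :: l)) (hl : 2 ≤ l.length)
    {P Q z : Plane} (e : [P, Q] <:+: o :: l ++ [o]) (hz : z ∈ openSegment ℝ P Q) :
    ∀ᶠ y in 𝓝 z, 0 ≤ side P Q y → y ∈ convexHull ℝ {v | v ∈ o :: l} := by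
  have hE := h.edge hl e
  have hfin : {e : Plane × Plane | [e.1, e.2] <:+: o :: l ++ [o]}.Finite := by
    refine ((List.finite_toSet (o :: l ++ [o])).prod (List.finite_toSet (o :: l ++ [o]))).subset ?_
    intro e he
    exact pair_infix_mem he
  have hzm : z ∈ convexHull ℝ {v | v ∈ o :: l} :=
    (convex_convexHull ℝ {v | v ∈ o :: l}).openSegment_subset
      (subset_convexHull ℝ {v | v ∈ o :: l} hE.1)
      (subset_convexHull ℝ {v | v ∈ o :: l} hE.2.1) hz
  have : ∀ᶠ y in 𝓝 z, ∀ e' ∈ {e : Plane × Plane | [e.1, e.2] <:+: o :: l ++ [o]},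
      e' ≠ (P, Q) → 0 < side e'.1 e'.2 y := by
    rw [Filter.eventually_all_finite hfin]
    rintro ⟨P', Q'⟩ he'
    by_cases hn : (P', Q') = (P, Q)
    · simp [hn]
    · have h1 := (h.side_nonneg hl he' hzm).lt_of_ne (fun h0 => hn (by
        obtain ⟨rfl, rfl⟩ := h.edge_unique hl e he' hz h0.symm; rfl))
      filter_upwards [(continuous_side P' Q').continuousAt.eventually (lt_mem_nhds h1)] with y hy _
      exact hy
  filter_upwards [this] with y hy hPQ
  refine mem_convexHull_of_side_nonneg h hl ?_
  intro P' Q' e'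
  by_cases hn : (P', Q') = (P, Q)
  · simp only [Prod.mk.injEq] at hn
    rw [hn.1, hn.2]; exact hPQ
  · exact (hy (P', Q') e' hn).le

lemma IsConvexList.exists_center (h : IsConvexList (o :: l)) (hl : 2 ≤ l.length) :
    ∃ c : Plane, ∀ P Q, [P, Q] <:+: o :: l ++ [o] → 0 < side P Q c := by
  match l, hl with
  | a :: b :: r, hl =>
    refine ⟨(1 / 3 : ℝ) • o + (2 / 3 : ℝ) • ((1 / 2 : ℝ) • a + (1 / 2 : ℝ) • b), ?_⟩
    intro P Q e
    rw [side_add_smul _ _ _ _ (by norm_num), side_add_smul _ _ _ _ (by norm_num)]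
    have h1 := h.edge_nonneg hl e (v := o) (by simp)
    have h2 := h.edge_nonneg hl e (v := a) (by simp)
    have h3 := h.edge_nonneg hl e (v := b) (by simp)
    by_contra hn
    have k1 : side P Q o = 0 := by linarith
    have k2 : side P Q a = 0 := by linarith
    have k3 : side P Q b = 0 := by linarith
    have hp : 0 < side o a b := by
      rw [IsConvexList, List.triplewise_cons, List.pairwise_cons] at h
      exact h.1.1 b (by simp)
    have g1 : o ≠ a := by rintro rfl; simp [side_self] at hp
    have g2 : o ≠ b := by rintro rfl; simp [side_left] at hp
    have g3 : a ≠ b := by rintro rfl; simp [side_right] at hp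
    have q1 := (h.edge hl e).2.2.1 o (by simp)
    have q2 := (h.edge hl e).2.2.1 a (by simp)
    have q3 := (h.edge hl e).2.2.1 b (by simp)
    simp only [k1, k2, k3, lt_irrefl, or_false] at q1 q2 q3
    rcases q1 with rfl | rfl <;> rcases q2 with rfl | rfl <;> rcases q3 with rfl | rfl <;>
      simp_all

end polygon

lemma dense_affine_ne {α β γ : ℝ} (h : α ≠ 0 ∨ β ≠ 0) :
    Dense {z : Plane | α * z 0 + β * z 1 + γ ≠ 0} := by
  intro z
  rw [mem_closure_iff_frequently]
  by_cases hz : α * z 0 + β * z 1 + γ ≠ 0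
  · exact (Filter.Eventually.frequently
      (((by fun_prop : Continuous fun z : Plane => α * z 0 + β * z 1 + γ).continuousAt
        |>.eventually_ne hz)))
  push Not at hz
  have hpos : 0 < α ^ 2 + β ^ 2 := by
    rcases h with h | h <;> positivity
  have hc : Tendsto (fun t : ℝ => z + t • (!₂[α, β] : Plane)) (𝓝[≠] 0) (𝓝 z) := by
    have : Continuous (fun t : ℝ => z + t • (!₂[α, β] : Plane)) := by fun_prop
    have := this.tendsto 0
    simp only [zero_smul, add_zero] at this
    exact this.mono_left nhdsWithin_le_nhds
  refine hc.frequently (Filter.Eventually.frequently ?_)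
  filter_upwards [self_mem_nhdsWithin] with t ht
  simp only [PiLp.add_apply, PiLp.smul_apply, smul_eq_mul, Fin.isValue, Matrix.cons_val_zero, Matrix.cons_val_one]
  have : α * (z 0 + t * α) + β * (z 1 + t * β) + γ = t * (α ^ 2 + β ^ 2) := by linarith
  rw [this]
  exact mul_ne_zero ht hpos.ne'

/-- `z` is not on a line through two points of `S`, and no point of `S` has the same value of
`p x + q y` as `z`. -/
def InGeneralPosition (p q : ℝ) (S : Set Plane) (z : Plane) : Prop :=
  (∀ P ∈ S, ∀ Q ∈ S, P ≠ Q → side P Q z ≠ 0) ∧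
  ∀ P ∈ S, p * z 0 + q * z 1 ≠ p * P 0 + q * P 1

lemma dense_inGeneralPosition {p q : ℝ} (hpq : p ≠ 0 ∨ q ≠ 0) {S : Set Plane} (hS : S.Finite) :
    Dense {z | InGeneralPosition p q S z} := by
  have : Finite S := hS
  have h1 : Dense (⋂ x : {x : S × S // x.1.1 ≠ x.2.1}, {z | side x.1.1.1 x.1.2.1 z ≠ 0}) := by
    refine dense_iInter_of_isOpen (fun x => ?_) (fun x => ?_)
    · exact isOpen_ne_fun (continuous_side _ _) continuous_const
    · obtain ⟨⟨⟨P, hP⟩, ⟨Q, hQ⟩⟩, hx⟩ := x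
      have := dense_affine_ne (α := Q 1 - P 1) (β := -(Q 0 - P 0))
        (γ := - P 0 * (Q 1 - P 1) + P 1 * (Q 0 - P 0)) (by
          by_contra hn
          push Not at hn
          apply hx
          ext i
          fin_cases i
          · simp; linarith [hn.2]
          · simp; linarith [hn.1])
      convert this using 4
      simp only [side]; ring
  have h2 : Dense (⋂ x : S, {z : Plane | p * z 0 + q * z 1 ≠ p * x.1 0 + q * x.1 1}) := by
    refine dense_iInter_of_isOpen (fun x => ?_) (fun x => ?_)
    · exact isOpen_ne_fun (by fun_prop) continuous_const
    · have := dense_affine_ne (α := p) (β := q) (γ := - (p * x.1 0 + q * x.1 1)) hpq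
      exact this.mono (fun z (hz : _ ≠ _) h => hz (by linarith))
  have h3 : IsOpen (⋂ x : S, {z : Plane | p * z 0 + q * z 1 ≠ p * x.1 0 + q * x.1 1}) := by
    refine isOpen_iInter_of_finite (fun x => ?_)
    exact isOpen_ne_fun (by fun_prop) continuous_const
  refine (h1.inter_of_isOpen_right h2 h3).mono ?_
  rintro z ⟨hz1, hz2⟩
  simp only [Set.mem_iInter, Set.mem_ofPred_eq] at hz1 hz2
  exact ⟨fun P hP Q hQ hn => hz1 ⟨(⟨P, hP⟩, ⟨Q, hQ⟩), hn⟩, fun P hP => hz2 ⟨P, hP⟩⟩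

end Combi

namespace Combi

open Filter Topology

/-! ### Generators -/

section generators

variable {n : ℕ} {ξ : Fin n → Plane}

lemma IsGenerators.sq_add_sq (hξ : IsGenerators ξ) (i : Fin n) :
    ξ i 0 ^ 2 + ξ i 1 ^ 2 = 1 := by
  have := hξ.norm_eq i
  rw [EuclideanSpace.norm_eq, Real.sqrt_eq_one] at this
  simpa [Fin.sum_univ_two] using this

lemma IsGenerators.cross_neg (hξ : IsGenerators ξ) {i j : Fin n} (h : i < j) :
    ξ i 0 * ξ j 1 - ξ i 1 * ξ j 0 < 0 := hξ.clockwise i j h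

lemma IsGenerators.fst_lt (hξ : IsGenerators ξ) {i j : Fin n} (h : i < j) :
    ξ i 0 < ξ j 0 := by
  have hc := hξ.cross_neg h
  have ha := hξ.sq_add_sq i
  have hb := hξ.sq_add_sq j
  have ha1 := hξ.upper i
  have hb1 := hξ.upper j
  by_contra hle
  push Not at hle
  rcases le_or_gt 0 (ξ i 0) with h0 | h0
  · rcases le_or_gt (ξ j 0) 0 with h1 | h1
    · nlinarith
    · have : ξ i 1 ≤ ξ j 1 := by
        by_contra hn
        push Not at hn
        nlinarith
      nlinarith
  · have : ξ j 1 ≤ ξ i 1 := by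
      by_contra hn
      push Not at hn
      nlinarith
    nlinarith

lemma IsGenerators.side_pos (hξ : IsGenerators ξ) {i j k : Fin n} (h : i < j) (h' : j < k) :
    0 < side (ξ i) (ξ j) (ξ k) := by
  have h1 := hξ.cross_neg h
  have h2 := hξ.cross_neg h'
  have hb := hξ.sq_add_sq j
  have ha := hξ.sq_add_sq i
  have hc := hξ.sq_add_sq k
  have d1 : ξ i 0 * ξ j 0 + ξ i 1 * ξ j 1 < 1 := by
    have := hξ.fst_lt h
    nlinarith [sq_nonneg (ξ i 1 - ξ j 1), mul_pos (sub_pos.2 this) (sub_pos.2 this)]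
  have d2 : ξ j 0 * ξ k 0 + ξ j 1 * ξ k 1 < 1 := by
    have := hξ.fst_lt h'
    nlinarith [sq_nonneg (ξ j 1 - ξ k 1), mul_pos (sub_pos.2 this) (sub_pos.2 this)]
  have key : ξ i 0 * ξ k 1 - ξ i 1 * ξ k 0 =
      (ξ i 0 * ξ j 1 - ξ i 1 * ξ j 0) * (ξ j 0 * ξ k 0 + ξ j 1 * ξ k 1) +
      (ξ i 0 * ξ j 0 + ξ i 1 * ξ j 1) * (ξ j 0 * ξ k 1 - ξ j 1 * ξ k 0) := by
    linear_combination (-(ξ i 0 * ξ k 1 - ξ i 1 * ξ k 0)) * hb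
  have e : side (ξ i) (ξ j) (ξ k) = (ξ i 0 * ξ k 1 - ξ i 1 * ξ k 0) -
      (ξ i 0 * ξ j 1 - ξ i 1 * ξ j 0) - (ξ j 0 * ξ k 1 - ξ j 1 * ξ k 0) := by
    simp only [side]; ring
  rw [e, key]
  nlinarith

lemma IsGenerators.castSucc {ξ : Fin (n + 1) → Plane} (hξ : IsGenerators ξ) :
    IsGenerators (fun i : Fin n => ξ i.castSucc) where
  upper i := hξ.upper _
  norm_eq i := hξ.norm_eq _
  clockwise i j h := hξ.clockwise _ _ (by simpa using h)
  indep := hξ.indep.comp _ (Fin.castSucc_injective n)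

lemma IsGenerators.exists_height (hξ : IsGenerators ξ) (hn : 2 ≤ n) :
    ∃ p q : ℝ, q ≠ 0 ∧ ∀ i, 0 < p * ξ i 0 + q * ξ i 1 := by
  obtain ⟨m, rfl⟩ : ∃ m, n = m + 2 := ⟨n - 2, by omega⟩
  refine ⟨-(ξ (Fin.last _) 1 - ξ 0 1), ξ (Fin.last _) 0 - ξ 0 0, ?_, fun i => ?_⟩
  · have := hξ.fst_lt (i := 0) (j := Fin.last (m + 1)) (Fin.last_pos)
    linarith
  · have e : -(ξ (Fin.last _) 1 - ξ 0 1) * ξ i 0 + (ξ (Fin.last _) 0 - ξ 0 0) * ξ i 1 =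
        - (ξ i 0 * ξ (Fin.last _) 1 - ξ i 1 * ξ (Fin.last _) 0)
        - (ξ 0 0 * ξ i 1 - ξ 0 1 * ξ i 0) := by ring
    rw [e]
    rcases eq_or_ne i 0 with rfl | h0
    · have := hξ.cross_neg (i := 0) (j := Fin.last (m + 1)) (Fin.last_pos)
      linarith
    · have h1 := hξ.cross_neg (i := 0) (j := i) (Fin.pos_iff_ne_zero.2 h0)
      rcases eq_or_ne i (Fin.last _) with rfl | hl
      · linarith
      · have h2 := hξ.cross_neg (i := i) (j := Fin.last (m + 1)) (Fin.lt_last_iff_ne_last.2 hl)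
        linarith

lemma IsGenerators.point_injective (hξ : IsGenerators ξ) : Function.Injective (point ξ) := by
  intro X Y h
  have := hξ.indep
  rw [Fintype.linearIndependent_iff] at this
  have h0 := this (fun i => (if i ∈ X then 1 else 0) - (if i ∈ Y then 1 else 0)) (by
    simp only [sub_smul, Finset.sum_sub_distrib, ite_smul, one_smul, zero_smul,
      Finset.sum_ite_mem, Finset.univ_inter]
    exact sub_eq_zero.2 h)
  ext i
  have := h0 i
  by_cases h1 : i ∈ X <;> by_cases h2 : i ∈ Y <;> simp [h1, h2] at this ⊢

lemma point_insert {X : Vert n} {i : Fin n} (h : i ∉ X) :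
    point ξ (insert i X) = point ξ X + ξ i := by
  rw [point, Finset.sum_insert h, add_comm]; rfl

lemma point_erase {X : Vert n} {i : Fin n} (h : i ∈ X) :
    point ξ (X.erase i) = point ξ X - ξ i := by
  rw [eq_sub_iff_add_eq, ← point_insert (X.notMem_erase i), Finset.insert_erase h]

end generators

/-! ### Tiles as convex polygons -/

namespace Tile

variable {n : ℕ}

/-- The left boundary path of a tile. -/
def lpath : Tile n → List (Vert n)
  | delta A B _ => [B, A]
  | nabla A B C => [A, B, C]
  | lens U _ => U

/-- The right boundary path of a tile. -/
def rpath : Tile n → List (Vert n)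
  | delta A B C => [B, C, A]
  | nabla A _ C => [A, C]
  | lens _ L => L

/-- The boundary of a tile as a functional on the functions of directed edges. -/
def bdry (φ : Vert n → Vert n → ℤ) (τ : Tile n) : ℤ :=
  pathSum φ τ.lpath - pathSum φ τ.rpath

/-- `(A, B)` is a side of the tile and the tile lies on the right of it. -/
def Border (τ : Tile n) (A B : Vert n) : Prop :=
  [A, B] <:+: τ.lpath ∨ [B, A] <:+: τ.rpath

lemma mem_edges_iff {τ : Tile n} {A B : Vert n} :
    (A, B) ∈ τ.edges ↔ [A, B] <:+: τ.lpath ∨ [A, B] <:+: τ.rpath := by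
  cases τ with
  | lens U L => rfl
  | _ => simp [edges, lpath, rpath, pair_infix_cons, not_pair_infix]; try tauto

lemma mem_verts_iff {τ : Tile n} {v : Vert n} :
    v ∈ τ.verts ↔ v ∈ τ.lpath ∨ v ∈ τ.rpath := by
  cases τ <;> simp [verts, lpath, rpath] <;> try tauto

end Tile

lemma IsVEdge.symmDiff {n : ℕ} {i : Fin n} {A B : Vert n} (h : IsVEdge i A B)
    {ξ : Fin n → Plane} : point ξ B = point ξ A + ξ i := by
  rw [h.2, point_insert h.1]

section lensGeometry

variable {n : ℕ} {ξ : Fin n → Plane}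

lemma IsGenerators.side_lens_pos (hξ : IsGenerators ξ) {a c i j m : Fin n} (p : Plane)
    (hai : a ≤ i) (hij : i < j) (hjc : j ≤ c) (ham : a ≤ m) (hmc : m ≤ c)
    (h : a < m ∧ m < c ∨ a < i ∧ j < c) :
    0 < side (p + ξ i) (p + ξ j) (p + ξ a + ξ c - ξ m) := by
  have hac : a < c := hai.trans_lt (hij.trans_le hjc)
  have e : (ξ c 0 - ξ a 0) * side (p + ξ i) (p + ξ j) (p + ξ a + ξ c - ξ m) =
      (ξ m 0 - ξ a 0) * side (ξ i) (ξ j) (ξ a) + (ξ c 0 - ξ m 0) * side (ξ i) (ξ j) (ξ c) +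
      (ξ j 0 - ξ i 0) * side (ξ a) (ξ m) (ξ c) := by
    simp only [side, PiLp.add_apply, PiLp.sub_apply]; ring
  have h1 : 0 ≤ side (ξ i) (ξ j) (ξ a) := by
    rw [side_rotate]
    rcases hai.eq_or_lt with rfl | h
    · rw [side_self]
    · exact (hξ.side_pos h hij).le
  have h2 : 0 ≤ side (ξ i) (ξ j) (ξ c) := by
    rcases hjc.eq_or_lt with rfl | h
    · rw [side_right]
    · exact (hξ.side_pos hij h).le
  have h3 : 0 ≤ side (ξ a) (ξ m) (ξ c) := by
    rcases ham.eq_or_lt with rfl | h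
    · rw [side_self]
    rcases hmc.eq_or_lt with rfl | h'
    · rw [side_right]
    · exact (hξ.side_pos h h').le
  have hac' := hξ.fst_lt hac
  have hij' := hξ.fst_lt hij
  have ham' : ξ a 0 ≤ ξ m 0 := by
    rcases ham.eq_or_lt with rfl | h
    · exact le_rfl
    · exact (hξ.fst_lt h).le
  have hmc' : ξ m 0 ≤ ξ c 0 := by
    rcases hmc.eq_or_lt with rfl | h
    · exact le_rfl
    · exact (hξ.fst_lt h).le
  have g1 := mul_nonneg (sub_nonneg.2 ham') h1
  have g2 := mul_nonneg (sub_nonneg.2 hmc') h2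
  have g3 := mul_nonneg (sub_nonneg.2 hij'.le) h3
  have : 0 < (ξ c 0 - ξ a 0) * side (p + ξ i) (p + ξ j) (p + ξ a + ξ c - ξ m) := by
    rw [e]
    rcases h with ⟨k1, k2⟩ | ⟨k1, k2⟩
    · have := mul_pos (sub_pos.2 hij') (hξ.side_pos k1 k2)
      linarith
    · have l1 := hξ.side_pos k1 hij
      rw [← side_rotate] at l1
      have l2 := hξ.side_pos hij k2
      rcases ham'.eq_or_lt with h | h
      · have := mul_pos (show 0 < ξ c 0 - ξ m 0 by linarith) l2
        linarith
      · have := mul_pos (sub_pos.2 h) l1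
        linarith
  exact pos_of_mul_pos_right this (sub_nonneg.2 hac'.le)

lemma side_reflect (p P Q z : Plane) : side (p - P) (p - Q) (p - z) = side P Q z := by
  simp only [side, PiLp.sub_apply]; ring

lemma IsGenerators.isConvexList_lens (hξ : IsGenerators ξ) {a c : Fin n} {I M : List (Fin n)}
    (p : Plane) (hI : (a :: (I ++ [c])).Pairwise (· < ·)) (hM : (a :: (M ++ [c])).Pairwise (· < ·)) :
    IsConvexList ((a :: (I ++ [c])).map (fun i => p + ξ i) ++
      M.map (fun m => p + ξ a + ξ c - ξ m)) := by
  have hIm : ∀ i ∈ a :: (I ++ [c]), a ≤ i ∧ i ≤ c := by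
    rw [List.pairwise_cons, List.pairwise_append] at hI
    intro i hi
    simp only [List.mem_cons, List.mem_append, List.not_mem_nil, or_false] at hi
    rcases hi with rfl | hi | rfl
    · exact ⟨le_rfl, (hI.1 c (by simp)).le⟩
    · exact ⟨(hI.1 i (by simp [hi])).le, (hI.2.2.2 i hi c (by simp)).le⟩
    · exact ⟨(hI.1 i (by simp)).le, le_rfl⟩
  have hMm : ∀ m ∈ M, a < m ∧ m < c := by
    rw [List.pairwise_cons, List.pairwise_append] at hM
    intro m hm
    exact ⟨hM.1 m (by simp [hm]), hM.2.2.2 m hm c (by simp)⟩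
  have hMs : M.Pairwise (· < ·) := by
    rw [List.pairwise_cons, List.pairwise_append] at hM
    exact hM.2.1
  have htri : ∀ l : List (Fin n), l.Pairwise (· < ·) →
      l.Triplewise (fun i j k => i < j ∧ j < k) := by
    intro l hl
    induction l with
    | nil => simp
    | cons x l ih =>
      rw [List.pairwise_cons] at hl
      rw [List.triplewise_cons]
      refine ⟨?_, ih hl.2⟩
      exact hl.2.imp_of_mem (fun {y z} hy _ hyz => ⟨hl.1 y hy, hyz⟩)
  rw [IsConvexList, List.triplewise_append]
  refine ⟨?_, ?_, ?_, ?_⟩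
  · refine List.Triplewise.map (p := fun i j k => i < j ∧ j < k) ?_ (htri _ hI)
    rintro i j k ⟨h, h'⟩
    have := hξ.side_pos h h'
    simpa [side] using this
  · refine List.Triplewise.map (p := fun i j k => i < j ∧ j < k) ?_ (htri _ hMs)
    rintro i j k ⟨h, h'⟩
    rw [side_reflect]
    exact hξ.side_pos h h'
  · intro u hu
    rw [List.mem_map] at hu
    obtain ⟨i, hi, rfl⟩ := hu
    rw [List.pairwise_map]
    refine hMs.imp_of_mem (fun {m m'} hm hm' hlt => ?_)
    have := hξ.side_lens_pos p (hMm m hm).1.le hlt (hMm m' hm').2.le (hIm i hi).1 (hIm i hi).2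
      (Or.inr ⟨(hMm m hm).1, (hMm m' hm').2⟩)
    rw [← side_rotate, ← side_reflect (p + p + ξ a + ξ c)]
    convert this using 2 <;> abel
  · intro v hv
    rw [List.mem_map] at hv
    obtain ⟨m, hm, rfl⟩ := hv
    rw [List.pairwise_map]
    refine hI.imp_of_mem (fun {i j} hi hj hlt => ?_)
    exact hξ.side_lens_pos p (hIm i hi).1 hlt (hIm j hj).2 (hMm m hm).1.le (hMm m hm).2.le
      (Or.inl (hMm m hm))

end lensGeometry

lemma exists_eq_cons_append {α : Type*} {l : List α} (h : 3 ≤ l.length) :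
    ∃ a m c, l = a :: (m ++ [c]) ∧ m ≠ [] := by
  rcases l with _ | ⟨a, l⟩
  · simp at h
  · rcases List.eq_nil_or_concat l with rfl | ⟨m, c, rfl⟩
    · simp at h
    · refine ⟨a, m, c, by simp, ?_⟩
      rintro rfl
      simp at h

/-- The combinatorial structure of a lens. -/
lemma isValid_lens_iff {n : ℕ} {U L : List (Vert n)} :
    (Tile.lens U L).IsValid ↔ ∃ (X : Vert n) (a c : Fin n) (I J : List (Fin n)),
      (a :: (I ++ [c])).Pairwise (· < ·) ∧ I ≠ [] ∧ (∀ i ∈ a :: (I ++ [c]), i ∉ X) ∧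
      U = (a :: (I ++ [c])).map (fun i => insert i X) ∧
      (c :: (J ++ [a])).Pairwise (· > ·) ∧ J ≠ [] ∧
      (∀ j ∈ c :: (J ++ [a]), j ∈ insert a (insert c X)) ∧
      L = (c :: (J ++ [a])).map (fun j => (insert a (insert c X)).erase j) := by
  constructor
  · rintro ⟨X, Y, I, J, hI, hI3, hIX, rfl, hJ, hJ3, hJY, rfl, hh, hl⟩
    obtain ⟨a, I, c, rfl, hI0⟩ := exists_eq_cons_append hI3
    obtain ⟨c', J, a', rfl, hJ0⟩ := exists_eq_cons_append hJ3
    have hac : a < c := by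
      rw [List.pairwise_cons] at hI; exact hI.1 c (by simp)
    have hca' : a' < c' := by
      rw [List.pairwise_cons] at hJ; exact hJ.1 a' (by simp)
    simp only [List.map_cons, List.head?_cons, Option.some.injEq, List.map_append,
      List.map_nil] at hh hl
    rw [← List.cons_append, ← List.cons_append, List.getLast?_concat, List.getLast?_concat,
      Option.some.injEq] at hl
    have haX := hIX a (by simp)
    have hcX := hIX c (by simp)
    have ha'Y := hJY a' (by simp)
    have hc'Y := hJY c' (by simp)
    have hY1 : Y = insert c' (insert a X) := by rw [hh, Finset.insert_erase hc'Y]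
    have hY2 : Y = insert a' (insert c X) := by rw [hl, Finset.insert_erase ha'Y]
    have hcc : c' = c := by grind
    have haa : a' = a := by grind
    subst hcc haa
    subst hY2
    exact ⟨X, a', c', I, J, hI, hI0, hIX, rfl, hJ, hJ0, hJY, rfl⟩
  · rintro ⟨X, a, c, I, J, hI, hI0, hIX, rfl, hJ, hJ0, hJY, rfl⟩
    have hac : a < c := by
      rw [List.pairwise_cons] at hI; exact hI.1 c (by simp)
    have haX := hIX a (by simp)
    have hcX := hIX c (by simp)
    refine ⟨X, insert a (insert c X), _, _, hI, ?_, hIX, rfl, hJ, ?_, hJY, rfl, ?_, ?_⟩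
    · simp only [List.length_cons, List.length_append, List.length_nil]
      have := List.length_pos_of_ne_nil hI0
      omega
    · simp only [List.length_cons, List.length_append, List.length_nil]
      have := List.length_pos_of_ne_nil hJ0
      omega
    · simp only [List.map_cons, List.head?_cons, Option.some.injEq]
      rw [Finset.insert_comm, Finset.erase_insert]
      simp [hac.ne', hcX]
    · simp only [List.map_cons, List.map_append, List.map_nil]
      rw [← List.cons_append, ← List.cons_append, List.getLast?_concat, List.getLast?_concat,
        Option.some.injEq, Finset.erase_insert]
      simp [hac.ne, haX]

lemma Tile.IsValid.exists_convexList {n : ℕ} {ξ : Fin n → Plane} (hξ : IsGenerators ξ)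
    {τ : Tile n} (hτ : τ.IsValid) :
    ∃ o l, IsConvexList (((o :: l : List (Vert n))).map (point ξ)) ∧ 2 ≤ l.length ∧
      o :: l ++ [o] = τ.lpath ++ τ.rpath.reverse.tail ∧ (∀ v, v ∈ τ.verts ↔ v ∈ o :: l) ∧
      ∃ m, τ.lpath.getLast? = some m ∧ τ.rpath.getLast? = some m := by
  cases τ with
  | delta A B C =>
    obtain ⟨i, j, ⟨hij, X, hi, hj, rfl, rfl⟩, ⟨h1, rfl⟩, -⟩ := hτ
    refine ⟨insert i X, [insert j (insert i X), insert j X], ?_, by simp,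
      by simp [lpath, rpath], by simp [verts]; tauto, by simp [lpath, rpath]⟩
    simp only [IsConvexList, List.map_cons, List.map_nil, List.triplewise_triple]
    rw [point_insert h1, point_insert hi, point_insert hj]
    have := hξ.cross_neg hij
    simp only [side, PiLp.add_apply]
    linarith
  | nabla A B C =>
    obtain ⟨i, j, ⟨hij, -⟩, ⟨hi, rfl⟩, ⟨hj, rfl⟩⟩ := hτ
    refine ⟨A, [insert i A, insert j A], ?_, by simp, by simp [lpath, rpath],
      by simp [verts], by simp [lpath, rpath]⟩
    simp only [IsConvexList, List.map_cons, List.map_nil, List.triplewise_triple]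
    rw [point_insert hi, point_insert hj]
    have := hξ.cross_neg hij
    simp only [side, PiLp.add_apply]
    linarith
  | lens U L =>
    obtain ⟨X, a, c, I, J, hI, hI0, hIX, rfl, hJ, hJ0, hJY, rfl⟩ := isValid_lens_iff.1 hτ
    have hac : a < c := by
      rw [List.pairwise_cons] at hI; exact hI.1 c (by simp)
    have haX := hIX a (by simp)
    have hcX := hIX c (by simp)
    have hca : (insert a (insert c X)).erase c = insert a X := by
      rw [Finset.insert_comm, Finset.erase_insert]; simp [hac.ne', hcX]
    have haa : (insert a (insert c X)).erase a = insert c X := by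
      rw [Finset.erase_insert]; simp [hac.ne, haX]
    refine ⟨insert a X, (I ++ [c]).map (fun i => insert i X) ++
      J.reverse.map (fun j => (insert a (insert c X)).erase j), ?_, ?_, ?_, ?_, ?_⟩
    · have := hξ.isConvexList_lens (a := a) (c := c) (I := I) (M := J.reverse) (point ξ X) hI (by
        rw [← List.pairwise_reverse]
        simpa using hJ)
      convert this using 1
      rw [← List.cons_append, ← List.map_cons (f := fun i => insert i X), List.map_append,
        List.map_map, List.map_map]
      congr 1
      · refine List.map_congr_left (fun i hi => ?_)
        simp only [Function.comp_apply]
        rw [point_insert (hIX i hi)]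
      · refine List.map_congr_left (fun j hj => ?_)
        simp only [Function.comp_apply]
        rw [point_erase (hJY j (by simp at hj; simp [hj])),
          point_insert (by simp [hac.ne, haX]), point_insert hcX]
        abel
    · simp only [List.length_append, List.length_map, List.length_cons, List.length_nil]
      have := List.length_pos_of_ne_nil hI0
      omega
    · simp [lpath, rpath, hca]
    · intro v
      simp only [mem_verts_iff, lpath, rpath, List.map_cons, List.map_append, List.mem_cons,
        List.mem_append, List.map_nil, List.map_reverse, List.mem_reverse, hca, haa]
      tauto
    · refine ⟨insert c X, ?_, ?_⟩
      · simp [lpath, List.getLast?_cons]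
      · simp [rpath, List.getLast?_cons, haa]

end Combi

namespace Combi

open Filter Topology

lemma pair_infix_map {α β : Type*} {g : α → β} {x y : β} {l : List α} :
    [x, y] <:+: l.map g ↔ ∃ a b, [a, b] <:+: l ∧ g a = x ∧ g b = y := by
  constructor
  · induction l with
    | nil => intro h; simp at h
    | cons c l ih =>
      cases l with
      | nil => intro h; exact absurd h not_pair_infix
      | cons d l =>
        simp only [List.map_cons, pair_infix_cons] at *
        rintro (⟨rfl, rfl⟩ | h)
        · exact ⟨c, d, Or.inl ⟨rfl, rfl⟩, rfl, rfl⟩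
        · obtain ⟨a, b, h, h'⟩ := ih h
          exact ⟨a, b, Or.inr h, h'⟩
  · rintro ⟨a, b, h, rfl, rfl⟩
    exact h.map g

/-- The points that the subsets of the index set are identified with. -/
def nodes {n : ℕ} (ξ : Fin n → Plane) : Set Plane := Set.range (point ξ)

lemma finite_nodes {n : ℕ} (ξ : Fin n → Plane) : (nodes ξ).Finite := Set.finite_range _

namespace Tile

variable {n : ℕ} {ξ : Fin n → Plane} {τ : Tile n} {A B A' B' : Vert n} {z : Plane}

lemma IsValid.exists_cycle (hξ : IsGenerators ξ) (hτ : τ.IsValid) :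
    ∃ o l, IsConvexList (((o :: l : List (Vert n))).map (point ξ)) ∧ 2 ≤ l.length ∧
      (∀ A B, τ.Border A B ↔ [A, B] <:+: o :: l ++ [o]) ∧
      (∀ φ : Vert n → Vert n → ℤ, (∀ A B, φ A B = -φ B A) →
        τ.bdry φ = pathSum φ (o :: l ++ [o])) ∧
      (∀ v, v ∈ τ.verts ↔ v ∈ o :: l) ∧
      τ.polygon ξ = convexHull ℝ {x | x ∈ (o :: l).map (point ξ)} := by
  obtain ⟨o, l, hc, hl, he, hv, m, hm1, hm2⟩ := hτ.exists_convexList hξ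
  obtain ⟨s, hs⟩ : ∃ s, τ.lpath = s ++ [m] := by
    obtain ⟨h, h'⟩ := List.mem_getLast?_eq_getLast hm1
    exact ⟨_, by rw [h']; exact (List.dropLast_append_getLast h).symm⟩
  obtain ⟨t, ht⟩ : ∃ t, τ.rpath = t ++ [m] := by
    obtain ⟨h, h'⟩ := List.mem_getLast?_eq_getLast hm2
    exact ⟨_, by rw [h']; exact (List.dropLast_append_getLast h).symm⟩
  have hclosed : o :: l ++ [o] = s ++ m :: t.reverse := by
    rw [he, hs, ht]; simp
  refine ⟨o, l, hc, hl, ?_, ?_, hv, ?_⟩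
  · intro A B
    rw [hclosed, pair_infix_append_cons, Border, hs, ht]
    refine or_congr Iff.rfl ?_
    rw [← List.reverse_infix]
    simp
  · intro φ hφ
    rw [hclosed, pathSum_append, bdry, hs, ht, sub_eq_add_neg, ← pathSum_reverse hφ]
    simp
  · rw [polygon]
    congr 1
    ext x
    simp only [Set.mem_image, hv, Set.mem_ofPred_eq, List.mem_map]

lemma exists_border_edge {o : Vert n} {l : List (Vert n)}
    (hb : ∀ A B, τ.Border A B ↔ [A, B] <:+: o :: l ++ [o]) (h : τ.Border A B) :
    [point ξ A, point ξ B] <:+: point ξ o :: l.map (point ξ) ++ [point ξ o] := by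
  have := ((hb A B).1 h).map (point ξ)
  simpa using this

lemma exists_border_of_edge {o : Vert n} {l : List (Vert n)} {P Q : Plane}
    (hb : ∀ A B, τ.Border A B ↔ [A, B] <:+: o :: l ++ [o])
    (h : [P, Q] <:+: point ξ o :: l.map (point ξ) ++ [point ξ o]) :
    ∃ A B, τ.Border A B ∧ point ξ A = P ∧ point ξ B = Q := by
  have h' : [P, Q] <:+: (o :: l ++ [o]).map (point ξ) := by simpa using h
  obtain ⟨A, B, h, h'⟩ := pair_infix_map.1 h'
  exact ⟨A, B, (hb A B).2 h, h'⟩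

lemma point_mem_polygon {v : Vert n} (hv : v ∈ τ.verts) : point ξ v ∈ τ.polygon ξ :=
  subset_convexHull ℝ _ ⟨v, hv, rfl⟩

lemma convex_polygon : Convex ℝ (τ.polygon ξ) := convex_convexHull ℝ _

lemma isClosed_polygon (hξ : IsGenerators ξ) (hτ : τ.IsValid) : IsClosed (τ.polygon ξ) := by
  obtain ⟨o, l, -, -, -, -, hv, -⟩ := hτ.exists_cycle hξ
  refine Set.Finite.isClosed_convexHull ℝ ?_
  refine Set.Finite.image _ ((List.finite_toSet (o :: l)).subset fun v h => (hv v).1 h)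

lemma Border.mem_verts (h : τ.Border A B) : A ∈ τ.verts ∧ B ∈ τ.verts := by
  rw [mem_verts_iff, mem_verts_iff]
  rcases h with h | h
  · exact ⟨Or.inl (pair_infix_mem h).1, Or.inl (pair_infix_mem h).2⟩
  · exact ⟨Or.inr (pair_infix_mem h).2, Or.inr (pair_infix_mem h).1⟩

lemma IsValid.side_nonneg (hξ : IsGenerators ξ) (hτ : τ.IsValid) (h : τ.Border A B)
    (hz : z ∈ τ.polygon ξ) : 0 ≤ side (point ξ A) (point ξ B) z := by
  obtain ⟨o, l, hc, hl, hb, -, -, hp⟩ := hτ.exists_cycle hξ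
  rw [hp] at hz
  exact hc.side_nonneg (by simpa using hl) (exists_border_edge hb h) hz

lemma IsValid.point_ne (hξ : IsGenerators ξ) (hτ : τ.IsValid) (h : τ.Border A B) :
    point ξ A ≠ point ξ B := by
  obtain ⟨o, l, hc, hl, hb, -, -, hp⟩ := hτ.exists_cycle hξ
  exact hc.edge_ne (by simpa using hl) (exists_border_edge hb h)

lemma IsValid.exists_vert_pos (hξ : IsGenerators ξ) (hτ : τ.IsValid) (h : τ.Border A B) :
    ∃ v ∈ τ.verts, 0 < side (point ξ A) (point ξ B) (point ξ v) := by
  obtain ⟨o, l, hc, hl, hb, -, hv, hp⟩ := hτ.exists_cycle hξ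
  obtain ⟨x, hx, hx'⟩ := (hc.edge (by simpa using hl) (exists_border_edge hb h)).2.2.2
  rw [← List.map_cons, List.mem_map] at hx
  obtain ⟨v, hv', rfl⟩ := hx
  exact ⟨v, (hv v).2 hv', hx'⟩

lemma IsValid.side_vert (hξ : IsGenerators ξ) (hτ : τ.IsValid) (h : τ.Border A B)
    {v : Vert n} (hv : v ∈ τ.verts) :
    v = A ∨ v = B ∨ 0 < side (point ξ A) (point ξ B) (point ξ v) := by
  obtain ⟨o, l, hc, hl, hb, -, hv', hp⟩ := hτ.exists_cycle hξ
  have := (hc.edge (by simpa using hl) (exists_border_edge hb h)).2.2.1 (point ξ v) (by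
    rw [← List.map_cons, List.mem_map]
    exact ⟨v, (hv' v).1 hv, rfl⟩)
  rwa [hξ.point_injective.eq_iff, hξ.point_injective.eq_iff] at this

lemma IsValid.mem_segment (hξ : IsGenerators ξ) (hτ : τ.IsValid) (h : τ.Border A B)
    (hz : z ∈ τ.polygon ξ) (h0 : side (point ξ A) (point ξ B) z = 0) :
    z ∈ segment ℝ (point ξ A) (point ξ B) := by
  obtain ⟨o, l, hc, hl, hb, -, -, hp⟩ := hτ.exists_cycle hξ
  rw [hp] at hz
  exact hc.mem_segment (by simpa using hl) (exists_border_edge hb h) hz h0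

lemma IsValid.border_unique (hξ : IsGenerators ξ) (hτ : τ.IsValid) (h : τ.Border A B)
    (h' : τ.Border A' B') (hz : z ∈ openSegment ℝ (point ξ A) (point ξ B))
    (h0 : side (point ξ A') (point ξ B') z = 0) : A' = A ∧ B' = B := by
  obtain ⟨o, l, hc, hl, hb, -, -, hp⟩ := hτ.exists_cycle hξ
  have := hc.edge_unique (by simpa using hl) (exists_border_edge hb h) (exists_border_edge hb h')
    hz h0
  exact ⟨hξ.point_injective this.1, hξ.point_injective this.2⟩

lemma IsValid.eventually_mem (hξ : IsGenerators ξ) (hτ : τ.IsValid) (h : τ.Border A B)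
    (hz : z ∈ openSegment ℝ (point ξ A) (point ξ B)) :
    ∀ᶠ y in 𝓝 z, 0 ≤ side (point ξ A) (point ξ B) y → y ∈ τ.polygon ξ := by
  obtain ⟨o, l, hc, hl, hb, -, -, hp⟩ := hτ.exists_cycle hξ
  rw [hp]
  exact hc.eventually_mem (by simpa using hl) (exists_border_edge hb h) hz

lemma IsValid.exists_center (hξ : IsGenerators ξ) (hτ : τ.IsValid) :
    ∃ c, ∀ A B, τ.Border A B → 0 < side (point ξ A) (point ξ B) c := by
  obtain ⟨o, l, hc, hl, hb, -, -, hp⟩ := hτ.exists_cycle hξ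
  obtain ⟨c, h⟩ := hc.exists_center (by simpa using hl)
  exact ⟨c, fun A B hAB => h _ _ (exists_border_edge hb hAB)⟩

lemma IsValid.mem_polygon (hξ : IsGenerators ξ) (hτ : τ.IsValid)
    (h : ∀ A B, τ.Border A B → 0 ≤ side (point ξ A) (point ξ B) z) : z ∈ τ.polygon ξ := by
  obtain ⟨o, l, hc, hl, hb, -, -, hp⟩ := hτ.exists_cycle hξ
  rw [hp]
  refine mem_convexHull_of_side_nonneg hc (by simpa using hl) ?_
  intro P Q e
  obtain ⟨A, B, hAB, rfl, rfl⟩ := exists_border_of_edge hb e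
  exact h A B hAB

lemma bdry_crossing (hξ : IsGenerators ξ) (hτ : τ.IsValid) {p q : ℝ}
    (hz : InGeneralPosition p q (nodes ξ) z) :
    (z ∈ τ.polygon ξ → τ.bdry (fun A B => crossing p q z (point ξ A) (point ξ B)) = 1) ∧
    (z ∉ τ.polygon ξ → τ.bdry (fun A B => crossing p q z (point ξ A) (point ξ B)) = 0) := by
  obtain ⟨o, l, hc, hl, hb, hbd, hv, hp⟩ := hτ.exists_cycle hξ
  rw [hbd _ (fun A B => crossing_swap _ _ _ _ _), hp]
  have e : pathSum (fun A B => crossing p q z (point ξ A) (point ξ B)) (o :: l ++ [o]) =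
      pathSum (crossing p q z) (point ξ o :: l.map (point ξ) ++ [point ξ o]) := by
    rw [← pathSum_map]; simp
  rw [e]
  have hmem : ∀ P ∈ point ξ o :: l.map (point ξ), P ∈ nodes ξ := by
    intro P hP
    rw [← List.map_cons, List.mem_map] at hP
    obtain ⟨v, -, rfl⟩ := hP
    exact ⟨v, rfl⟩
  exact pathSum_crossing hc (by simpa using hl)
    (fun P hP Q hQ => hz.1 P (hmem P hP) Q (hmem Q hQ)) (fun P hP => hz.2 P (hmem P hP))

/-- The interior of the polygon. -/
def inner (ξ : Fin n → Plane) (τ : Tile n) : Set Plane :=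
  {z | ∀ A B, τ.Border A B → 0 < side (point ξ A) (point ξ B) z}

lemma IsValid.inner_subset (hξ : IsGenerators ξ) (hτ : τ.IsValid) :
    τ.inner ξ ⊆ τ.polygon ξ := fun _ hz => hτ.mem_polygon hξ fun A B h => (hz A B h).le

lemma isOpen_inner : IsOpen (τ.inner ξ) := by
  have : τ.inner ξ = ⋂ e : {e : Edge n // τ.Border e.1 e.2},
      {z | 0 < side (point ξ e.1.1) (point ξ e.1.2) z} := by
    ext z; simp [inner]
  rw [this]
  exact isOpen_iInter_of_finite fun e => isOpen_lt continuous_const (continuous_side _ _)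

lemma IsValid.inner_nonempty (hξ : IsGenerators ξ) (hτ : τ.IsValid) : (τ.inner ξ).Nonempty :=
  hτ.exists_center hξ

lemma IsValid.combo_mem_inner (hξ : IsGenerators ξ) (hτ : τ.IsValid) {c : Plane}
    (hz : z ∈ τ.polygon ξ) (hc : c ∈ τ.inner ξ) {a b : ℝ} (ha : 0 ≤ a) (hb : 0 < b)
    (hab : a + b = 1) : a • z + b • c ∈ τ.inner ξ := by
  intro A B h
  rw [side_add_smul _ _ _ _ hab]
  have := mul_nonneg ha (hτ.side_nonneg hξ h hz)
  have := mul_pos hb (hc A B h)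
  linarith

lemma IsValid.mem_closure_inner (hξ : IsGenerators ξ) (hτ : τ.IsValid) (hz : z ∈ τ.polygon ξ) :
    z ∈ closure (τ.inner ξ) := by
  obtain ⟨c, hc⟩ := hτ.inner_nonempty hξ
  have ht : Tendsto (fun t : ℝ => (1 - t) • z + t • c) (𝓝[>] 0) (𝓝 z) := by
    have : Continuous (fun t : ℝ => (1 - t) • z + t • c) := by fun_prop
    have := this.tendsto 0
    simp only [sub_zero, one_smul, zero_smul, add_zero] at this
    exact this.mono_left nhdsWithin_le_nhds
  refine mem_closure_of_tendsto ht ?_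
  filter_upwards [Ioo_mem_nhdsGT (show (0 : ℝ) < 1 by norm_num)] with t ht
  exact hτ.combo_mem_inner hξ hz hc (by linarith [ht.2]) ht.1 (by ring)

/-- A point of a tile is an inner point, a vertex, or a point between the ends of a side. -/
lemma IsValid.trichotomy (hξ : IsGenerators ξ) (hτ : τ.IsValid) (hz : z ∈ τ.polygon ξ) :
    z ∈ τ.inner ξ ∨ (∃ v ∈ τ.verts, z = point ξ v) ∨
      ∃ A B, τ.Border A B ∧ z ∈ openSegment ℝ (point ξ A) (point ξ B) := by
  by_cases h : z ∈ τ.inner ξ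
  · exact Or.inl h
  right
  simp only [inner, Set.mem_ofPred_eq, not_forall] at h
  obtain ⟨A, B, hAB, h⟩ := h
  have h0 : side (point ξ A) (point ξ B) z = 0 :=
    le_antisymm (not_lt.1 h) (hτ.side_nonneg hξ hAB hz)
  have hs := hτ.mem_segment hξ hAB hz h0
  rw [← insert_endpoints_openSegment] at hs
  rcases hs with rfl | rfl | hs
  · exact Or.inl ⟨A, hAB.mem_verts.1, rfl⟩
  · exact Or.inl ⟨B, hAB.mem_verts.2, rfl⟩
  · exact Or.inr ⟨A, B, hAB, hs⟩

lemma IsValid.vert_notMem_openSegment (hξ : IsGenerators ξ) (hτ : τ.IsValid) (h : τ.Border A B)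
    {v : Vert n} (hv : v ∈ τ.verts) :
    point ξ v ∉ openSegment ℝ (point ξ A) (point ξ B) := by
  intro hm
  rcases hτ.side_vert hξ h hv with rfl | rfl | hpos
  · exact hτ.point_ne hξ h (left_mem_openSegment_iff.1 hm)
  · exact hτ.point_ne hξ h (right_mem_openSegment_iff.1 hm)
  · rw [side_eq_zero_of_mem_segment (openSegment_subset_segment ℝ _ _ hm)] at hpos
    exact lt_irrefl _ hpos

lemma mem_verts_of_edge (h : (A, B) ∈ τ.edges) : A ∈ τ.verts ∧ B ∈ τ.verts := by
  rw [mem_verts_iff, mem_verts_iff]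
  exact (mem_edges_iff.1 h).elim (fun h => (pair_infix_mem h).imp .inl .inl)
    fun h => (pair_infix_mem h).imp .inr .inr

lemma segment_subset_polygon (h : (A, B) ∈ τ.edges) :
    segment ℝ (point ξ A) (point ξ B) ⊆ τ.polygon ξ :=
  convex_polygon.segment_subset (point_mem_polygon (mem_verts_of_edge h).1)
    (point_mem_polygon (mem_verts_of_edge h).2)

/-- Only the side itself contains a point between its ends. -/
lemma IsValid.edge_unique (hξ : IsGenerators ξ) (hτ : τ.IsValid) (h : (A, B) ∈ τ.edges)
    (h' : (A', B') ∈ τ.edges) (hz : z ∈ openSegment ℝ (point ξ A) (point ξ B))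
    (hz' : z ∈ segment ℝ (point ξ A') (point ξ B')) :
    (A' = A ∧ B' = B) ∨ (A' = B ∧ B' = A) := by
  have h0 := side_eq_zero_of_mem_segment hz'
  have h0' : side (point ξ B') (point ξ A') z = 0 := by rw [side_swap, h0, neg_zero]
  have hzs := hz
  rw [openSegment_symm] at hzs
  rw [mem_edges_iff] at h h'
  rcases h with h | h <;> rcases h' with h' | h'
  · exact Or.inl (hτ.border_unique hξ (Or.inl h) (Or.inl h') hz h0)
  · obtain ⟨h1, h2⟩ := hτ.border_unique hξ (Or.inl h) (Or.inr h') hz h0'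
    exact Or.inr ⟨h2, h1⟩
  · obtain ⟨h1, h2⟩ := hτ.border_unique hξ (Or.inr h) (Or.inl h') hzs h0
    exact Or.inr ⟨h1, h2⟩
  · obtain ⟨h1, h2⟩ := hτ.border_unique hξ (Or.inr h) (Or.inr h') hzs h0'
    exact Or.inl ⟨h2, h1⟩

lemma IsValid.edge_notMem_inner (hτ : (A, B) ∈ τ.edges)
    (hz : z ∈ segment ℝ (point ξ A) (point ξ B)) : z ∉ τ.inner ξ := by
  intro hi
  have h0 := side_eq_zero_of_mem_segment hz
  rw [mem_edges_iff] at hτ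
  rcases hτ with h | h
  · exact (hi A B (Or.inl h)).ne' h0
  · have := hi B A (Or.inr h)
    rw [side_swap, h0] at this
    simp at this

end Tile

/-! ### Weights and directed edges -/

/-- A weight of sets that increases along V-edges and H-edges. -/
def weight {n : ℕ} (A : Vert n) : ℕ := ∑ i ∈ A, (i.val + 1)

lemma weight_insert {n : ℕ} {A : Vert n} {i : Fin n} (h : i ∉ A) :
    weight (insert i A) = weight A + (i.val + 1) := by
  rw [weight, Finset.sum_insert h, add_comm]; rfl

lemma IsVEdge.weight_lt {n : ℕ} {A B : Vert n} {i : Fin n} (h : IsVEdge i A B) :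
    weight A < weight B := by
  rw [h.2, weight_insert h.1]; omega

lemma IsHEdge.weight_lt {n : ℕ} {A B : Vert n} {i j : Fin n} (h : IsHEdge i j A B) :
    weight A < weight B := by
  obtain ⟨hij, X, hi, hj, rfl, rfl⟩ := h
  rw [weight_insert hi, weight_insert hj]
  have : i.val < j.val := hij
  omega

lemma IsVEdge.card_eq {n : ℕ} {A B : Vert n} {i : Fin n} (h : IsVEdge i A B) :
    B.card = A.card + 1 := by
  rw [h.2, Finset.card_insert_of_notMem h.1]

lemma IsHEdge.card_eq {n : ℕ} {A B : Vert n} {i j : Fin n} (h : IsHEdge i j A B) :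
    B.card = A.card := by
  obtain ⟨-, X, hi, hj, rfl, rfl⟩ := h
  rw [Finset.card_insert_of_notMem hi, Finset.card_insert_of_notMem hj]

lemma isHEdge_erase {n : ℕ} {Y : Vert n} {j j' : Fin n} (h : j' < j) (hj : j ∈ Y)
    (hj' : j' ∈ Y) : IsHEdge j' j (Y.erase j) (Y.erase j') := by
  refine ⟨h, (Y.erase j).erase j', by simp, by simp, ?_, ?_⟩
  · rw [Finset.insert_erase]; simp [h.ne, hj']
  · rw [Finset.erase_right_comm, Finset.insert_erase]; simp [h.ne', hj]

lemma pair_infix_pairwise {α : Type*} {R : α → α → Prop} {l : List α} (h : l.Pairwise R) {a b : α}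
    (hab : [a, b] <:+: l) : R a b := by
  have := h.sublist hab.sublist
  simpa using this

lemma lens_upper_edge {n : ℕ} {X : Vert n} {I : List (Fin n)} (hI : I.Pairwise (· < ·))
    (hX : ∀ i ∈ I, i ∉ X) {A B : Vert n}
    (h : [A, B] <:+: I.map (fun i => insert i X)) :
    ∃ i j, [i, j] <:+: I ∧ A = insert i X ∧ B = insert j X ∧ IsHEdge i j A B := by
  obtain ⟨i, j, hij, rfl, rfl⟩ := pair_infix_map.1 h
  exact ⟨i, j, hij, rfl, rfl, pair_infix_pairwise hI hij, X, hX i (pair_infix_mem hij).1,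
    hX j (pair_infix_mem hij).2, rfl, rfl⟩

lemma lens_lower_edge {n : ℕ} {Y : Vert n} {J : List (Fin n)} (hJ : J.Pairwise (· > ·))
    (hY : ∀ j ∈ J, j ∈ Y) {A B : Vert n}
    (h : [A, B] <:+: J.map (fun j => Y.erase j)) :
    ∃ i j, [j, i] <:+: J ∧ A = Y.erase j ∧ B = Y.erase i ∧ IsHEdge i j A B := by
  obtain ⟨j, i, hij, rfl, rfl⟩ := pair_infix_map.1 h
  exact ⟨i, j, hij, rfl, rfl, isHEdge_erase (pair_infix_pairwise hJ hij)
    (hY j (pair_infix_mem hij).1) (hY i (pair_infix_mem hij).2)⟩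

namespace Tile

variable {n : ℕ} {τ : Tile n} {A B C : Vert n}

/-- The tiles on the right of a directed edge. -/
lemma IsValid.of_lpath (hτ : τ.IsValid) (h : [A, B] <:+: τ.lpath) :
    (∃ C, τ = delta B A C ∧ ∃ i, IsVEdge i A B) ∨ (∃ C, τ = nabla A B C ∧ ∃ i, IsVEdge i A B) ∨
    (∃ X, τ = nabla X A B ∧ ∃ i j, IsHEdge i j A B) ∨
    (∃ U L, τ = lens U L ∧ [A, B] <:+: U ∧ ∃ i j, IsHEdge i j A B) := by
  cases τ with
  | delta A' B' C' =>
    simp only [lpath, pair_infix_cons, not_pair_infix, or_false] at h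
    obtain ⟨rfl, rfl⟩ := h
    obtain ⟨i, j, -, h, -⟩ := hτ
    exact Or.inl ⟨C', rfl, j, h⟩
  | nabla A' B' C' =>
    simp only [lpath, pair_infix_cons, not_pair_infix, or_false] at h
    obtain ⟨i, j, h1, h2, -⟩ := hτ
    rcases h with ⟨rfl, rfl⟩ | ⟨rfl, rfl⟩
    · exact Or.inr (Or.inl ⟨C', rfl, i, h2⟩)
    · exact Or.inr (Or.inr (Or.inl ⟨A', rfl, i, j, h1⟩))
  | lens U L =>
    obtain ⟨X, Y, I, J, hI, -, hX, rfl, -⟩ := hτ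
    obtain ⟨i, j, -, -, -, he⟩ := lens_upper_edge hI hX h
    exact Or.inr (Or.inr (Or.inr ⟨_, L, rfl, h, i, j, he⟩))

/-- The tiles on the left of a directed edge. -/
lemma IsValid.of_rpath (hτ : τ.IsValid) (h : [A, B] <:+: τ.rpath) :
    (∃ C, τ = delta B C A ∧ ∃ i, IsVEdge i A B) ∨ (∃ C, τ = nabla A C B ∧ ∃ i, IsVEdge i A B) ∨
    (∃ X, τ = delta X A B ∧ ∃ i j, IsHEdge i j A B) ∨
    (∃ U L, τ = lens U L ∧ [A, B] <:+: L ∧ ∃ i j, IsHEdge i j A B) := by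
  cases τ with
  | delta A' B' C' =>
    simp only [rpath, pair_infix_cons, not_pair_infix, or_false] at h
    obtain ⟨i, j, h1, -, h2⟩ := hτ
    rcases h with ⟨rfl, rfl⟩ | ⟨rfl, rfl⟩
    · exact Or.inr (Or.inr (Or.inl ⟨A', rfl, i, j, h1⟩))
    · exact Or.inl ⟨B', rfl, i, h2⟩
  | nabla A' B' C' =>
    simp only [rpath, pair_infix_cons, not_pair_infix, or_false] at h
    obtain ⟨rfl, rfl⟩ := h
    obtain ⟨i, j, h1, -, h2⟩ := hτ
    exact Or.inr (Or.inl ⟨B', rfl, j, h2⟩)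
  | lens U L =>
    obtain ⟨X, Y, I, J, -, -, -, -, hJ, -, hY, rfl, -⟩ := hτ
    obtain ⟨i, j, -, -, -, he⟩ := lens_lower_edge hJ hY h
    exact Or.inr (Or.inr (Or.inr ⟨U, _, rfl, h, i, j, he⟩))

/-- The sides of a valid tile are V-edges or H-edges. -/
lemma IsValid.isVEdge_or_isHEdge (hτ : τ.IsValid) (h : (A, B) ∈ τ.edges) :
    (∃ i, IsVEdge i A B) ∨ ∃ i j, IsHEdge i j A B := by
  rw [mem_edges_iff] at h
  rcases h with h | h
  · rcases hτ.of_lpath h with ⟨_, _, h⟩ | ⟨_, _, h⟩ | ⟨_, _, h⟩ | ⟨_, _, _, _, h⟩ <;> simp [h]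
  · rcases hτ.of_rpath h with ⟨_, _, h⟩ | ⟨_, _, h⟩ | ⟨_, _, h⟩ | ⟨_, _, _, _, h⟩ <;> simp [h]

lemma IsValid.weight_lt (hτ : τ.IsValid) (h : (A, B) ∈ τ.edges) : weight A < weight B := by
  rcases hτ.isVEdge_or_isHEdge h with ⟨i, h⟩ | ⟨i, j, h⟩
  · exact h.weight_lt
  · exact h.weight_lt

end Tile

end Combi

namespace Combi

open Filter Topology

/-! ### The zonogon -/

section zonogon

variable {n : ℕ} {ξ : Fin n → Plane}

lemma point_eq_sum (X : Vert n) :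
    point ξ X = ∑ i, (if i ∈ X then (1 : ℝ) else 0) • ξ i := by
  simp [point, ite_smul]

lemma point_mem_zonogon (X : Vert n) : point ξ X ∈ zonogon ξ :=
  ⟨fun i => if i ∈ X then 1 else 0, fun i => by dsimp only; split_ifs <;> simp, point_eq_sum X⟩

lemma convex_zonogon : Convex ℝ (zonogon ξ) := by
  rintro _ ⟨c, hc, rfl⟩ _ ⟨d, hd, rfl⟩ a b ha hb hab
  refine ⟨fun i => a * c i + b * d i, fun i => ⟨?_, ?_⟩, ?_⟩
  · have := mul_nonneg ha (hc i).1
    have := mul_nonneg hb (hd i).1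
    linarith
  · have := mul_le_mul_of_nonneg_left (hc i).2 ha
    have := mul_le_mul_of_nonneg_left (hd i).2 hb
    linarith
  · rw [Finset.smul_sum, Finset.smul_sum, ← Finset.sum_add_distrib]
    exact Finset.sum_congr rfl fun i _ => by rw [smul_smul, smul_smul, add_smul]

lemma Tile.polygon_subset_zonogon {τ : Tile n} : τ.polygon ξ ⊆ zonogon ξ :=
  convexHull_min (by rintro _ ⟨v, -, rfl⟩; exact point_mem_zonogon v) convex_zonogon

lemma plane_sum_apply (c : Fin n → ℝ) (m : Fin 2) : (∑ i, c i • ξ i) m = ∑ i, c i * ξ i m := by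
  simp

lemma side_sum (X : Vert n) (i : Fin n) (c : Fin n → ℝ) :
    side (point ξ X) (point ξ X + ξ i) (∑ k, c k • ξ k) =
      ∑ k, (c k - if k ∈ X then 1 else 0) * (ξ k 0 * ξ i 1 - ξ k 1 * ξ i 0) := by
  rw [point_eq_sum]
  simp only [side, PiLp.add_apply, plane_sum_apply, add_sub_cancel_left, ← Finset.sum_sub_distrib,
    Finset.sum_mul]
  exact Finset.sum_congr rfl fun k _ => by ring

lemma isVEdge_leftBoundaryEdge (i : Fin n) :
    IsVEdge i (leftBoundaryEdge i).1 (leftBoundaryEdge i).2 := by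
  refine ⟨by simp [leftBoundaryEdge], ?_⟩
  ext k
  simp [leftBoundaryEdge, le_iff_eq_or_lt]

lemma isVEdge_rightBoundaryEdge (i : Fin n) :
    IsVEdge i (rightBoundaryEdge i).1 (rightBoundaryEdge i).2 := by
  refine ⟨by simp [rightBoundaryEdge], ?_⟩
  ext k
  simp [rightBoundaryEdge, le_iff_eq_or_lt, eq_comm]

lemma IsGenerators.side_leftBoundaryEdge (hξ : IsGenerators ξ) (i : Fin n) {z : Plane}
    (hz : z ∈ zonogon ξ) :
    0 ≤ side (point ξ (leftBoundaryEdge i).1) (point ξ (leftBoundaryEdge i).2) z := by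
  obtain ⟨c, hc, rfl⟩ := hz
  rw [(isVEdge_leftBoundaryEdge i).symmDiff, side_sum]
  refine Finset.sum_nonneg fun k _ => ?_
  simp only [leftBoundaryEdge, Finset.mem_filter, Finset.mem_univ, true_and]
  have := hc k
  rcases lt_trichotomy k i with h | rfl | h
  · rw [if_pos h]
    exact mul_nonneg_of_nonpos_of_nonpos (by linarith) (hξ.cross_neg h).le
  · rw [mul_comm (ξ k 0)]; simp
  · rw [if_neg h.not_gt]
    have := hξ.cross_neg h
    exact mul_nonneg (by linarith) (by linarith)

lemma IsGenerators.side_rightBoundaryEdge (hξ : IsGenerators ξ) (i : Fin n) {z : Plane}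
    (hz : z ∈ zonogon ξ) :
    side (point ξ (rightBoundaryEdge i).1) (point ξ (rightBoundaryEdge i).2) z ≤ 0 := by
  obtain ⟨c, hc, rfl⟩ := hz
  rw [(isVEdge_rightBoundaryEdge i).symmDiff, side_sum]
  refine Finset.sum_nonpos fun k _ => ?_
  simp only [rightBoundaryEdge, Finset.mem_filter, Finset.mem_univ, true_and]
  have := hc k
  rcases lt_trichotomy k i with h | rfl | h
  · rw [if_neg h.not_gt]
    exact mul_nonpos_of_nonneg_of_nonpos (by linarith) (hξ.cross_neg h).le
  · rw [mul_comm (ξ k 0)]; simp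
  · rw [if_pos h]
    have := hξ.cross_neg h
    exact mul_nonpos_of_nonpos_of_nonneg (by linarith) (by linarith)

/-- The boundary of the zonogon as a functional on the functions of directed edges. -/
def zonogonBdry {n : ℕ} (φ : Vert n → Vert n → ℤ) : ℤ :=
  ∑ i, φ (leftBoundaryEdge i).1 (leftBoundaryEdge i).2 -
    ∑ i, φ (rightBoundaryEdge i).1 (rightBoundaryEdge i).2

lemma point_height {p q : ℝ} (X : Vert n) :
    p * point ξ X 0 + q * point ξ X 1 = ∑ i ∈ X, (p * ξ i 0 + q * ξ i 1) := by
  simp [point, Finset.mul_sum, Finset.sum_add_distrib]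

lemma zonogonBdry_crossing (hξ : IsGenerators ξ) {p q : ℝ}
    (hpq : ∀ i, 0 < p * ξ i 0 + q * ξ i 1) {z : Plane}
    (hz : InGeneralPosition p q (nodes ξ) z) (hzz : z ∈ zonogon ξ) :
    zonogonBdry (fun A B => crossing p q z (point ξ A) (point ξ B)) = 1 := by
  set H := p * z 0 + q * z 1 with hH
  let g : ℕ → ℤ := fun k =>
    if p * point ξ (Finset.univ.filter (fun i : Fin n => i.val < k)) 0 +
      q * point ξ (Finset.univ.filter (fun i : Fin n => i.val < k)) 1 < H then 1 else 0
  have hVne : ∀ {i : Fin n} {A B}, IsVEdge i A B → point ξ A ≠ point ξ B := fun h =>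
    hξ.point_injective.ne (by rintro rfl; exact h.1 (h.2 ▸ Finset.mem_insert_self _ _))
  have hVh : ∀ {i : Fin n} {A B}, IsVEdge i A B →
      p * point ξ A 0 + q * point ξ A 1 < p * point ξ B 0 + q * point ξ B 1 := by
    intro i A B h
    rw [h.symmDiff (ξ := ξ)]
    simp only [PiLp.add_apply]
    linarith [hpq i]
  have hl : ∀ i : Fin n, crossing p q z (point ξ (leftBoundaryEdge i).1)
      (point ξ (leftBoundaryEdge i).2) = g i.val - g (i.val + 1) := by
    intro i
    have h1 := (hξ.side_leftBoundaryEdge i hzz).lt_of_ne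
      (hz.1 _ ⟨_, rfl⟩ _ ⟨_, rfl⟩ (hVne (isVEdge_leftBoundaryEdge i))).symm
    have e1 : (leftBoundaryEdge i).1 = Finset.univ.filter (fun k : Fin n => k.val < i.val) := rfl
    have e2 : (leftBoundaryEdge i).2 = Finset.univ.filter (fun k : Fin n => k.val < i.val + 1) := by
      aesop
    have h2 := hVh (isVEdge_leftBoundaryEdge i)
    have h3 := hz.2 (point ξ (leftBoundaryEdge i).2) ⟨_, rfl⟩
    simp only [crossing, h1, h1.not_gt, and_true, and_false, if_false, g, ← e1, ← e2, ← hH]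
    rw [← hH] at h3
    rcases lt_or_gt_of_ne h3 with h3 | h3
    · simp [h3, h3.not_gt]
    · simp [h3, h3.not_gt, h2.trans h3]
  have hr : ∀ i : Fin n, crossing p q z (point ξ (rightBoundaryEdge i).1)
      (point ξ (rightBoundaryEdge i).2) = 0 := by
    intro i
    have h1 := hξ.side_rightBoundaryEdge i hzz
    have h2 := hVh (isVEdge_rightBoundaryEdge i)
    rw [crossing, if_neg (fun h => h1.not_gt h.2.2), if_neg]
    rintro ⟨h3, h4, -⟩
    linarith
  rw [zonogonBdry, Finset.sum_congr rfl (fun i _ => hl i), Finset.sum_congr rfl (fun i _ => hr i),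
    Finset.sum_const_zero, sub_zero, Finset.sum_range (fun k => g k - g (k + 1)) |>.symm,
    Finset.sum_range_sub']
  obtain ⟨c, hc, hcz⟩ := hzz
  have hHc : H = ∑ i, c i * (p * ξ i 0 + q * ξ i 1) := by
    rw [hH, hcz, plane_sum_apply, plane_sum_apply, Finset.mul_sum, Finset.mul_sum,
      ← Finset.sum_add_distrib]
    exact Finset.sum_congr rfl fun i _ => by ring
  have h0 : g 0 = 1 := by
    have e : Finset.univ.filter (fun i : Fin n => i.val < 0) = ∅ := by simp
    have := hz.2 (point ξ ∅) ⟨_, rfl⟩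
    simp only [g, e]
    rw [point_height, Finset.sum_empty] at this ⊢
    rw [if_pos]
    refine lt_of_le_of_ne ?_ this.symm
    rw [hHc]
    exact Finset.sum_nonneg fun i _ => mul_nonneg (hc i).1 (hpq i).le
  have hn : g n = 0 := by
    have e : Finset.univ.filter (fun i : Fin n => i.val < n) = Finset.univ := by simp
    simp only [g, e]
    rw [point_height, if_neg]
    rw [hHc, not_lt]
    refine Finset.sum_le_sum fun i _ => ?_
    have := mul_le_mul_of_nonneg_right (hc i).2 (hpq i).le
    linarith
  rw [h0, hn]; rfl

lemma exists_open_subset_zonogon (hξ : IsGenerators ξ) (hn : 2 ≤ n) :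
    (interior (zonogon ξ)).Nonempty := by
  obtain ⟨m, rfl⟩ : ∃ m, n = m + 2 := ⟨n - 2, by omega⟩
  have hv : (Tile.nabla ∅ {0} {1} : Tile (m + 2)).IsValid :=
    ⟨0, 1, ⟨by simp, ∅, by simp, by simp, by simp, by simp⟩, ⟨by simp, by simp⟩,
      ⟨by simp, by simp⟩⟩
  refine (hv.inner_nonempty hξ).mono ?_
  exact interior_maximal ((hv.inner_subset hξ).trans Tile.polygon_subset_zonogon)
    Tile.isOpen_inner

lemma zonogon_subset_closure (hξ : IsGenerators ξ) (hn : 2 ≤ n) {G : Set Plane} (hG : Dense G) :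
    zonogon ξ ⊆ closure (zonogon ξ ∩ G) := by
  refine subset_closure.trans ((convex_zonogon.closure_interior_eq_closure_of_nonempty_interior
    (exists_open_subset_zonogon hξ hn)).ge.trans ?_)
  rw [← closure_closure (s := zonogon ξ ∩ G)]
  refine closure_mono ((hG.open_subset_closure_inter isOpen_interior).trans ?_)
  exact closure_mono (Set.inter_subset_inter_left _ interior_subset)

lemma side_midpoint_add_smul (A B : Vert n) (k : Fin n) (t : ℝ) :
    side (point ξ A) (point ξ B) ((1 / 2 : ℝ) • point ξ A + (1 / 2 : ℝ) • point ξ B + t • ξ k) =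
      t * (ξ k 0 * (point ξ B 1 - point ξ A 1) - ξ k 1 * (point ξ B 0 - point ξ A 0)) := by
  simp only [side, PiLp.add_apply, PiLp.smul_apply, smul_eq_mul]; ring

lemma midpoint_add_smul_mem_zonogon {A B : Vert n} {k : Fin n} {t : ℝ}
    (h : 0 ≤ t ∧ t ≤ 1 / 2 ∧ (k ∉ A ∨ k ∉ B) ∨ -(1 / 2) ≤ t ∧ t ≤ 0 ∧ (k ∈ A ∨ k ∈ B)) :
    (1 / 2 : ℝ) • point ξ A + (1 / 2 : ℝ) • point ξ B + t • ξ k ∈ zonogon ξ := by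
  refine ⟨fun i => 1 / 2 * (if i ∈ A then 1 else 0) + 1 / 2 * (if i ∈ B then 1 else 0) +
    t * (if i = k then 1 else 0), fun i => ?_, ?_⟩
  · by_cases hi : i = k
    · subst hi
      by_cases h1 : i ∈ A <;> by_cases h2 : i ∈ B <;> simp [h1, h2] at h ⊢ <;>
        constructor <;> first
          | linarith [h.1, h.2]
          | (rcases h with ⟨_, _⟩ | ⟨_, _⟩ <;> linarith)
    · by_cases h1 : i ∈ A <;> by_cases h2 : i ∈ B <;> simp [h1, h2, hi] <;> norm_num
  · simp only [add_smul, Finset.sum_add_distrib, mul_smul, ← Finset.smul_sum, ← point_eq_sum]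
    simp [ite_smul]

/-- From the middle of an edge that is not on the left boundary one can go to the left. -/
lemma IsGenerators.exists_left (hξ : IsGenerators ξ) {A B : Vert n}
    (h : (∃ i, IsVEdge i A B) ∨ ∃ i j, IsHEdge i j A B) (hb : ∀ i, (A, B) ≠ leftBoundaryEdge i) :
    ∃ w : Plane, ∀ t : ℝ, 0 < t → t ≤ 1 / 2 →
      (1 / 2 : ℝ) • point ξ A + (1 / 2 : ℝ) • point ξ B + t • w ∈ zonogon ξ ∧
      side (point ξ A) (point ξ B) ((1 / 2 : ℝ) • point ξ A + (1 / 2 : ℝ) • point ξ B + t • w) < 0 := by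
  rcases h with ⟨i, h⟩ | ⟨i, j, hij, X, hi, hj, rfl, rfl⟩
  · have hP := h.symmDiff (ξ := ξ)
    by_cases h1 : ∃ k < i, k ∉ A
    · obtain ⟨k, hk, hkA⟩ := h1
      refine ⟨ξ k, fun t ht ht' => ⟨midpoint_add_smul_mem_zonogon (Or.inl ⟨ht.le, ht',
        Or.inl hkA⟩), ?_⟩⟩
      rw [side_midpoint_add_smul, hP]
      simp only [PiLp.add_apply, add_sub_cancel_left]
      exact mul_neg_of_pos_of_neg ht (hξ.cross_neg hk)
    by_cases h2 : ∃ k, i < k ∧ k ∈ A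
    · obtain ⟨k, hk, hkA⟩ := h2
      refine ⟨-ξ k, fun t ht ht' => ?_⟩
      rw [smul_neg, ← neg_smul]
      refine ⟨midpoint_add_smul_mem_zonogon (Or.inr ⟨by linarith, by linarith, Or.inl hkA⟩), ?_⟩
      rw [side_midpoint_add_smul, hP]
      simp only [PiLp.add_apply, add_sub_cancel_left]
      have := mul_pos ht (sub_pos.2 (sub_neg.1 (hξ.cross_neg hk)))
      linarith
    push Not at h1 h2
    exfalso
    have hA : A = Finset.univ.filter (· < i) := by
      ext k
      simp only [Finset.mem_filter, Finset.mem_univ, true_and]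
      refine ⟨fun hk => ?_, fun hk => h1 k hk⟩
      by_contra hn
      rcases (not_lt.1 hn).eq_or_lt with rfl | hlt
      · exact h.1 hk
      · exact h2 k hlt hk
    refine hb i ?_
    have := (isVEdge_leftBoundaryEdge i).2
    rw [Prod.ext_iff, this, h.2, hA]
    exact ⟨rfl, rfl⟩
  · have hne : i ≠ j := hij.ne
    refine ⟨ξ i, fun t ht ht' => ⟨midpoint_add_smul_mem_zonogon (Or.inl ⟨ht.le, ht',
        Or.inr (by simp [hne, hi])⟩), ?_⟩⟩
    rw [side_midpoint_add_smul, point_insert hi, point_insert hj]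
    simp only [PiLp.add_apply, add_sub_add_left_eq_sub]
    have := mul_neg_of_pos_of_neg ht (hξ.cross_neg hij)
    linarith

/-- From the middle of an edge that is not on the right boundary one can go to the right. -/
lemma IsGenerators.exists_right (hξ : IsGenerators ξ) {A B : Vert n}
    (h : (∃ i, IsVEdge i A B) ∨ ∃ i j, IsHEdge i j A B) (hb : ∀ i, (A, B) ≠ rightBoundaryEdge i) :
    ∃ w : Plane, ∀ t : ℝ, 0 < t → t ≤ 1 / 2 →
      (1 / 2 : ℝ) • point ξ A + (1 / 2 : ℝ) • point ξ B + t • w ∈ zonogon ξ ∧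
      0 < side (point ξ A) (point ξ B) ((1 / 2 : ℝ) • point ξ A + (1 / 2 : ℝ) • point ξ B + t • w) := by
  rcases h with ⟨i, h⟩ | ⟨i, j, hij, X, hi, hj, rfl, rfl⟩
  · have hP := h.symmDiff (ξ := ξ)
    by_cases h1 : ∃ k, i < k ∧ k ∉ A
    · obtain ⟨k, hk, hkA⟩ := h1
      refine ⟨ξ k, fun t ht ht' => ⟨midpoint_add_smul_mem_zonogon (Or.inl ⟨ht.le, ht',
        Or.inl hkA⟩), ?_⟩⟩
      rw [side_midpoint_add_smul, hP]
      simp only [PiLp.add_apply, add_sub_cancel_left]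
      have := mul_pos ht (sub_pos.2 (sub_neg.1 (hξ.cross_neg hk)))
      linarith
    by_cases h2 : ∃ k < i, k ∈ A
    · obtain ⟨k, hk, hkA⟩ := h2
      refine ⟨-ξ k, fun t ht ht' => ?_⟩
      rw [smul_neg, ← neg_smul]
      refine ⟨midpoint_add_smul_mem_zonogon (Or.inr ⟨by linarith, by linarith, Or.inl hkA⟩), ?_⟩
      rw [side_midpoint_add_smul, hP]
      simp only [PiLp.add_apply, add_sub_cancel_left]
      have := mul_neg_of_pos_of_neg ht (hξ.cross_neg hk)
      linarith
    push Not at h1 h2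
    exfalso
    have hA : A = Finset.univ.filter (i < ·) := by
      ext k
      simp only [Finset.mem_filter, Finset.mem_univ, true_and]
      refine ⟨fun hk => ?_, fun hk => h1 k hk⟩
      by_contra hn
      rcases (not_lt.1 hn).eq_or_lt with rfl | hlt
      · exact h.1 hk
      · exact h2 k hlt hk
    refine hb i ?_
    have := (isVEdge_rightBoundaryEdge i).2
    rw [Prod.ext_iff, this, h.2, hA]
    exact ⟨rfl, rfl⟩
  · have hne : i ≠ j := hij.ne
    refine ⟨-ξ i, fun t ht ht' => ?_⟩
    rw [smul_neg, ← neg_smul]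
    refine ⟨midpoint_add_smul_mem_zonogon (Or.inr ⟨by linarith, by linarith, Or.inl (by simp)⟩), ?_⟩
    rw [side_midpoint_add_smul, point_insert hi, point_insert hj]
    simp only [PiLp.add_apply, add_sub_add_left_eq_sub]
    have := mul_neg_of_pos_of_neg ht (hξ.cross_neg hij)
    linarith

end zonogon

end Combi

namespace Combi

open Filter Topology

/-! ### Tilings in terms of their edges -/

section tiling

variable {n : ℕ} {ξ : Fin n → Plane} {K : Set (Tile n)}

lemma mem_closure_pos_side {P Q z : Plane} (hPQ : P ≠ Q) (h0 : side P Q z = 0) {G : Set Plane}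
    (hG : Dense G) : z ∈ closure ({y | 0 < side P Q y} ∩ G) := by
  have hopen : IsOpen {y | 0 < side P Q y} := isOpen_lt continuous_const (continuous_side P Q)
  rw [← closure_closure]
  refine closure_mono (hG.open_subset_closure_inter hopen) ?_
  have hc : Tendsto (fun t : ℝ => z + t • (!₂[Q 1 - P 1, -(Q 0 - P 0)] : Plane)) (𝓝[>] 0)
      (𝓝 z) := by
    have : Continuous (fun t : ℝ => z + t • (!₂[Q 1 - P 1, -(Q 0 - P 0)] : Plane)) := by fun_prop
    have := this.tendsto 0
    simp only [zero_smul, add_zero] at this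
    exact this.mono_left nhdsWithin_le_nhds
  refine mem_closure_of_tendsto hc ?_
  filter_upwards [self_mem_nhdsWithin] with t (ht : 0 < t)
  have hpos : 0 < (Q 1 - P 1) ^ 2 + (Q 0 - P 0) ^ 2 := by
    by_contra hn
    apply hPQ
    have h1 : Q 1 - P 1 = 0 := by nlinarith [sq_nonneg (Q 1 - P 1), sq_nonneg (Q 0 - P 0)]
    have h2 : Q 0 - P 0 = 0 := by nlinarith [sq_nonneg (Q 1 - P 1), sq_nonneg (Q 0 - P 0)]
    ext i
    fin_cases i
    · simp; linarith
    · simp; linarith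
  have : side P Q (z + t • (!₂[Q 1 - P 1, -(Q 0 - P 0)] : Plane)) =
      side P Q z + t * ((Q 1 - P 1) ^ 2 + (Q 0 - P 0) ^ 2) := by
    simp [side]; ring
  change 0 < side P Q _
  rw [this, h0, zero_add]
  exact mul_pos ht hpos

/-- The description of a tiling by the tiles on both sides of its edges. -/
structure EdgeTiling (ξ : Fin n → Plane) (K : Set (Tile n)) : Prop where
  valid : ∀ τ ∈ K, τ.IsValid
  finite : K.Finite
  dense : ∃ G, Dense G ∧ (∀ z ∈ G, ∀ τ ∈ K, ∀ τ' ∈ K, z ∈ τ.polygon ξ → z ∈ τ'.polygon ξ → τ = τ') ∧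
    ∀ z ∈ G, z ∈ zonogon ξ → ∃ τ ∈ K, z ∈ τ.polygon ξ
  left_exists : ∀ τ ∈ K, ∀ A B, [A, B] <:+: τ.lpath →
    (∃ i, (A, B) = leftBoundaryEdge i) ∨ ∃ τ' ∈ K, [A, B] <:+: τ'.rpath
  right_exists : ∀ τ ∈ K, ∀ A B, [A, B] <:+: τ.rpath →
    (∃ i, (A, B) = rightBoundaryEdge i) ∨ ∃ τ' ∈ K, [A, B] <:+: τ'.lpath
  left_boundary : ∀ i, ∃ τ ∈ K, [(leftBoundaryEdge i).1, (leftBoundaryEdge i).2] <:+: τ.lpath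
  right_boundary : ∀ i, ∃ τ ∈ K, [(rightBoundaryEdge i).1, (rightBoundaryEdge i).2] <:+: τ.rpath

lemma openSegment_midpoint (x y : Plane) :
    (1 / 2 : ℝ) • x + (1 / 2 : ℝ) • y ∈ openSegment ℝ x y :=
  ⟨1 / 2, 1 / 2, by norm_num, by norm_num, by norm_num, rfl⟩

lemma border_unique_of_dense (hξ : IsGenerators ξ) {G : Set Plane} (hG : Dense G) {τ τ' : Tile n}
    (hτ : τ.IsValid) (hτ' : τ'.IsValid)
    (hu : ∀ z ∈ G, z ∈ τ.polygon ξ → z ∈ τ'.polygon ξ → τ = τ')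
    {A B : Vert n} (h : τ.Border A B) (h' : τ'.Border A B) : τ = τ' := by
  have hm := openSegment_midpoint (point ξ A) (point ξ B)
  have h0 := side_eq_zero_of_mem_segment (openSegment_subset_segment ℝ _ _ hm)
  have hf := mem_closure_iff_frequently.1 (mem_closure_pos_side (hτ.point_ne hξ h) h0 hG)
  obtain ⟨y, ⟨hy, hyG⟩, h1, h2⟩ := (hf.and_eventually
    ((hτ.eventually_mem hξ h hm).and (hτ'.eventually_mem hξ h' hm))).exists
  exact hu y hyG (h1 (le_of_lt hy)) (h2 (le_of_lt hy))

lemma Tile.IsValid.leftBoundaryEdge_not_rpath (hξ : IsGenerators ξ) {τ : Tile n} (hτ : τ.IsValid)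
    (i : Fin n) : ¬ [(leftBoundaryEdge i).1, (leftBoundaryEdge i).2] <:+: τ.rpath := by
  intro h
  obtain ⟨v, hv, hv'⟩ := hτ.exists_vert_pos hξ (Or.inr h)
  have := hξ.side_leftBoundaryEdge i (Tile.polygon_subset_zonogon (Tile.point_mem_polygon hv))
  rw [side_swap] at hv'
  linarith

lemma Tile.IsValid.rightBoundaryEdge_not_lpath (hξ : IsGenerators ξ) {τ : Tile n} (hτ : τ.IsValid)
    (i : Fin n) : ¬ [(rightBoundaryEdge i).1, (rightBoundaryEdge i).2] <:+: τ.lpath := by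
  intro h
  obtain ⟨v, hv, hv'⟩ := hτ.exists_vert_pos hξ (Or.inl h)
  have := hξ.side_rightBoundaryEdge i (Tile.polygon_subset_zonogon (Tile.point_mem_polygon hv))
  linarith

namespace EdgeTiling

lemma left_unique (hξ : IsGenerators ξ) (hK : EdgeTiling ξ K) {τ τ' : Tile n} (hτ : τ ∈ K)
    (hτ' : τ' ∈ K) {A B : Vert n} (h : [A, B] <:+: τ.lpath) (h' : [A, B] <:+: τ'.lpath) :
    τ = τ' := by
  obtain ⟨G, hG, hu, -⟩ := hK.dense
  exact border_unique_of_dense hξ hG (hK.valid _ hτ) (hK.valid _ hτ')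
    (fun z hz => hu z hz τ hτ τ' hτ') (Or.inl h) (Or.inl h')

lemma right_unique (hξ : IsGenerators ξ) (hK : EdgeTiling ξ K) {τ τ' : Tile n} (hτ : τ ∈ K)
    (hτ' : τ' ∈ K) {A B : Vert n} (h : [A, B] <:+: τ.rpath) (h' : [A, B] <:+: τ'.rpath) :
    τ = τ' := by
  obtain ⟨G, hG, hu, -⟩ := hK.dense
  exact border_unique_of_dense hξ hG (hK.valid _ hτ) (hK.valid _ hτ')
    (fun z hz => hu z hz τ hτ τ' hτ') (Or.inr h) (Or.inr h')

lemma inter_of_openSegment (hξ : IsGenerators ξ) (hK : EdgeTiling ξ K) {τ τ' : Tile n}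
    (hτ : τ ∈ K) (hτ' : τ' ∈ K) (hne : τ ≠ τ') {A B : Vert n} (h : τ.Border A B)
    {z : Plane} (hz : z ∈ openSegment ℝ (point ξ A) (point ξ B)) (hz' : z ∈ τ'.polygon ξ) :
    ∃ e ∈ τ.edges ∩ τ'.edges, τ.polygon ξ ∩ τ'.polygon ξ = seg ξ e := by
  obtain ⟨G, hG, hu, -⟩ := hK.dense
  have hv := hK.valid _ hτ
  have hv' := hK.valid _ hτ'
  have hcl : z ∈ closure (τ'.inner ξ ∩ G) := by
    rw [← closure_closure]
    exact closure_mono (hG.open_subset_closure_inter Tile.isOpen_inner)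
      (hv'.mem_closure_inner hξ hz')
  have hf := mem_closure_iff_frequently.1 hcl
  have key : τ'.Border B A ∧ ((A, B) ∈ τ.edges ∩ τ'.edges ∨ (B, A) ∈ τ.edges ∩ τ'.edges) := by
    have hb : (∀ y ∈ zonogon ξ, 0 ≤ side (point ξ A) (point ξ B) y) ∨
        ∃ τ'' ∈ K, τ''.Border B A ∧
        ((A, B) ∈ τ.edges ∩ τ''.edges ∨ (B, A) ∈ τ.edges ∩ τ''.edges) := by
      rcases h with h | h
      · rcases hK.left_exists τ hτ A B h with ⟨i, hi⟩ | ⟨τ'', h'', he⟩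
        · left
          intro y hy
          have := hξ.side_leftBoundaryEdge i hy
          rwa [← hi] at this
        · exact Or.inr ⟨τ'', h'', Or.inr he, Or.inl ⟨Tile.mem_edges_iff.2 (Or.inl h),
            Tile.mem_edges_iff.2 (Or.inr he)⟩⟩
      · rcases hK.right_exists τ hτ B A h with ⟨i, hi⟩ | ⟨τ'', h'', he⟩
        · left
          intro y hy
          have := hξ.side_rightBoundaryEdge i hy
          rw [← hi] at this
          rw [side_swap]
          linarith
        · exact Or.inr ⟨τ'', h'', Or.inl he, Or.inr ⟨Tile.mem_edges_iff.2 (Or.inr h),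
            Tile.mem_edges_iff.2 (Or.inl he)⟩⟩
    rcases hb with hb | ⟨τ'', h'', hbd, hed⟩
    · obtain ⟨y, ⟨hy, hyG⟩, h1⟩ := (hf.and_eventually (hv.eventually_mem hξ h hz)).exists
      have hy' := hv'.inner_subset hξ hy
      exact absurd (hu y hyG τ hτ τ' hτ' (h1 (hb y (Tile.polygon_subset_zonogon hy'))) hy') hne
    · have hv'' := hK.valid _ h''
      obtain ⟨y, ⟨hy, hyG⟩, h1, h2⟩ := (hf.and_eventually ((hv.eventually_mem hξ h hz).and
        (hv''.eventually_mem hξ hbd (by rwa [openSegment_symm])))).exists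
      have hy' := hv'.inner_subset hξ hy
      rcases le_total 0 (side (point ξ A) (point ξ B) y) with hs | hs
      · exact absurd (hu y hyG τ hτ τ' hτ' (h1 hs) hy') hne
      · have := hu y hyG τ'' h'' τ' hτ' (h2 (by rw [side_swap]; linarith)) hy'
        subst this
        exact ⟨hbd, hed⟩
  have hS : τ.polygon ξ ∩ τ'.polygon ξ = segment ℝ (point ξ A) (point ξ B) := by
    refine Set.Subset.antisymm ?_ ?_
    · rintro x ⟨hx, hx'⟩
      have h1 := hv.side_nonneg hξ h hx
      have h2 := hv'.side_nonneg hξ key.1 hx'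
      rw [side_swap] at h2
      exact hv.mem_segment hξ h hx (by linarith)
    · refine Set.subset_inter ?_ ?_
      · exact Tile.convex_polygon.segment_subset (Tile.point_mem_polygon h.mem_verts.1)
          (Tile.point_mem_polygon h.mem_verts.2)
      · exact Tile.convex_polygon.segment_subset (Tile.point_mem_polygon key.1.mem_verts.2)
          (Tile.point_mem_polygon key.1.mem_verts.1)
  rcases key.2 with he | he
  · exact ⟨(A, B), he, hS⟩
  · exact ⟨(B, A), he, by rw [hS, seg, segment_symm]⟩

lemma inner_disjoint_polygon (hξ : IsGenerators ξ) (hK : EdgeTiling ξ K) {τ τ' : Tile n}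
    (hτ : τ ∈ K) (hτ' : τ' ∈ K) (hne : τ ≠ τ') {z : Plane} (hz : z ∈ τ.inner ξ) :
    z ∉ τ'.polygon ξ := by
  intro hz'
  obtain ⟨G, hG, hu, -⟩ := hK.dense
  have hcl : z ∈ closure (τ'.inner ξ ∩ G) := by
    rw [← closure_closure]
    exact closure_mono (hG.open_subset_closure_inter Tile.isOpen_inner)
      ((hK.valid _ hτ').mem_closure_inner hξ hz')
  obtain ⟨y, ⟨hy, hyG⟩, hy'⟩ := (mem_closure_iff_frequently.1 hcl).and_eventually
    (Tile.isOpen_inner.mem_nhds hz) |>.exists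
  exact hne (hu y hyG τ hτ τ' hτ' ((hK.valid _ hτ).inner_subset hξ hy')
    ((hK.valid _ hτ').inner_subset hξ hy))

theorem isCTiling (hξ : IsGenerators ξ) (hn : 2 ≤ n) (hK : EdgeTiling ξ K) : IsCTiling ξ K where
  valid := hK.valid
  cover := by
    obtain ⟨G, hG, -, hc⟩ := hK.dense
    refine Set.Subset.antisymm (Set.iUnion₂_subset fun τ _ => Tile.polygon_subset_zonogon) ?_
    refine (zonogon_subset_closure hξ hn hG).trans ?_
    refine closure_minimal ?_ (hK.finite.isClosed_biUnion fun τ hτ =>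
      Tile.isClosed_polygon hξ (hK.valid τ hτ))
    rintro z ⟨hz, hzG⟩
    obtain ⟨τ, hτ, h⟩ := hc z hzG hz
    exact Set.mem_biUnion hτ h
  inter := by
    intro τ hτ τ' hτ' hne
    rcases Set.eq_empty_or_nonempty (τ.polygon ξ ∩ τ'.polygon ξ) with h | ⟨z, hz⟩
    · exact Or.inl h
    right
    by_cases h1 : ∃ z ∈ τ.polygon ξ ∩ τ'.polygon ξ, ∃ A B, τ.Border A B ∧
        z ∈ openSegment ℝ (point ξ A) (point ξ B)
    · obtain ⟨z, hz, A, B, hb, hzo⟩ := h1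
      exact Or.inr (hK.inter_of_openSegment hξ hτ hτ' hne hb hzo hz.2)
    by_cases h2 : ∃ z ∈ τ.polygon ξ ∩ τ'.polygon ξ, ∃ A B, τ'.Border A B ∧
        z ∈ openSegment ℝ (point ξ A) (point ξ B)
    · obtain ⟨z, hz, A, B, hb, hzo⟩ := h2
      obtain ⟨e, he, h⟩ := hK.inter_of_openSegment hξ hτ' hτ hne.symm hb hzo hz.1
      exact Or.inr ⟨e, he.symm, by rw [Set.inter_comm, h]⟩
    left
    push Not at h1 h2
    have hvert : ∀ z ∈ τ.polygon ξ ∩ τ'.polygon ξ,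
        ∃ v ∈ τ.verts ∩ τ'.verts, z = point ξ v := by
      intro z hz
      rcases (hK.valid _ hτ).trichotomy hξ hz.1 with h | ⟨v, hv, rfl⟩ | ⟨A, B, hb, h⟩
      · exact absurd hz.2 (hK.inner_disjoint_polygon hξ hτ hτ' hne h)
      · rcases (hK.valid _ hτ').trichotomy hξ hz.2 with h | ⟨v', hv', h⟩ | ⟨A, B, hb, h⟩
        · exact absurd hz.1 (hK.inner_disjoint_polygon hξ hτ' hτ hne.symm h)
        · obtain rfl := hξ.point_injective h
          exact ⟨v, ⟨hv, hv'⟩, rfl⟩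
        · exact absurd h (h2 _ hz A B hb)
      · exact absurd h (h1 z hz A B hb)
    have hsub : (τ.polygon ξ ∩ τ'.polygon ξ).Subsingleton := by
      by_contra hns
      rw [Set.not_subsingleton_iff] at hns
      have hinf := ((Tile.convex_polygon (ξ := ξ) (τ := τ)).inter
        (Tile.convex_polygon (ξ := ξ) (τ := τ'))).isPreconnected.infinite_of_nontrivial hns
      refine hinf ((finite_nodes ξ).subset ?_)
      intro x hx
      obtain ⟨v, -, rfl⟩ := hvert x hx
      exact ⟨v, rfl⟩
    obtain ⟨v, hv, rfl⟩ := hvert z hz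
    exact ⟨v, hv, hsub.eq_singleton_of_mem hz⟩
  left_boundary := by
    intro i
    obtain ⟨τ, hτ, h⟩ := hK.left_boundary i
    refine ⟨τ, ⟨hτ, Tile.mem_edges_iff.2 (Or.inl h)⟩, ?_⟩
    rintro τ' ⟨hτ', h'⟩
    rcases Tile.mem_edges_iff.1 h' with h' | h'
    · exact hK.left_unique hξ hτ' hτ h' h
    · exact absurd h' ((hK.valid _ hτ').leftBoundaryEdge_not_rpath hξ i)
  right_boundary := by
    intro i
    obtain ⟨τ, hτ, h⟩ := hK.right_boundary i
    refine ⟨τ, ⟨hτ, Tile.mem_edges_iff.2 (Or.inr h)⟩, ?_⟩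
    rintro τ' ⟨hτ', h'⟩
    rcases Tile.mem_edges_iff.1 h' with h' | h'
    · exact absurd h' ((hK.valid _ hτ').rightBoundaryEdge_not_lpath hξ i)
    · exact hK.right_unique hξ hτ' hτ h' h

end EdgeTiling

lemma finite_valid (n : ℕ) : {τ : Tile n | τ.IsValid}.Finite := by
  have hl := List.finite_length_le (Vert n) n
  refine ((Set.finite_range fun x : Vert n × Edge n =>
    Tile.delta x.1 x.2.1 x.2.2).union ((Set.finite_range fun x : Vert n ×
    Edge n => Tile.nabla x.1 x.2.1 x.2.2).union
    (hl.image2 Tile.lens hl))).subset ?_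
  rintro (⟨A, B, C⟩ | ⟨A, B, C⟩ | ⟨U, L⟩) h
  · exact Or.inl ⟨(A, B, C), rfl⟩
  · exact Or.inr (Or.inl ⟨(A, B, C), rfl⟩)
  · obtain ⟨X, Y, I, J, hI, -, -, rfl, hJ, -, -, rfl, -⟩ := h
    refine Or.inr (Or.inr ⟨_, ?_, _, ?_, rfl⟩)
    · have := List.Nodup.length_le_card (l := I) (hI.imp (fun h => ne_of_lt h))
      simpa using this
    · have := List.Nodup.length_le_card (l := J) (hJ.imp (fun h => ne_of_gt h))
      simpa using this

lemma dense_compl_seg {e : Edge n} {p q : ℝ} {z : Plane}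
    (hz : InGeneralPosition p q (nodes ξ) z) (hne : point ξ e.1 ≠ point ξ e.2) : z ∉ seg ξ e :=
  fun h => hz.1 _ ⟨_, rfl⟩ _ ⟨_, rfl⟩ hne (side_eq_zero_of_mem_segment h)

theorem IsCTiling.edgeTiling (hξ : IsGenerators ξ) (hn : 2 ≤ n) (hK : IsCTiling ξ K) :
    EdgeTiling ξ K := by
  obtain ⟨p, q, hq, hpq⟩ := hξ.exists_height hn
  have hG := dense_inGeneralPosition (p := p) (q := q) (Or.inr hq) (finite_nodes ξ)
  have hfin : K.Finite := (finite_valid n).subset hK.valid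
  have hu : ∀ z, InGeneralPosition p q (nodes ξ) z → ∀ τ ∈ K, ∀ τ' ∈ K, z ∈ τ.polygon ξ →
      z ∈ τ'.polygon ξ → τ = τ' := by
    intro z hz τ hτ τ' hτ' h h'
    by_contra hne
    have hzi : z ∈ τ.polygon ξ ∩ τ'.polygon ξ := ⟨h, h'⟩
    rcases hK.inter τ hτ τ' hτ' hne with h | ⟨v, -, h⟩ | ⟨e, he, h⟩
    · rw [h] at hzi; exact hzi
    · rw [h] at hzi
      exact hz.2 _ ⟨v, rfl⟩ (by rw [hzi])
    · rw [h] at hzi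
      refine dense_compl_seg hz (hξ.point_injective.ne fun hh => ?_) hzi
      have := (hK.valid τ hτ).weight_lt (A := e.1) (B := e.2) he.1
      rw [hh] at this
      exact lt_irrefl _ this
  have across : ∀ τ ∈ K, ∀ A B, (A, B) ∈ τ.edges → ∀ w : Plane, (∀ t : ℝ, 0 < t → t ≤ 1 / 2 →
      (1 / 2 : ℝ) • point ξ A + (1 / 2 : ℝ) • point ξ B + t • w ∈ zonogon ξ ∧
      (1 / 2 : ℝ) • point ξ A + (1 / 2 : ℝ) • point ξ B + t • w ∉ τ.polygon ξ) →
      ∃ τ' ∈ K, τ' ≠ τ ∧ (A, B) ∈ τ'.edges := by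
    intro τ hτ A B he w hw
    set m := (1 / 2 : ℝ) • point ξ A + (1 / 2 : ℝ) • point ξ B with hm
    have hmo : m ∈ openSegment ℝ (point ξ A) (point ξ B) := openSegment_midpoint _ _
    have hc : Tendsto (fun t : ℝ => m + t • w) (𝓝[>] 0) (𝓝 m) := by
      have : Continuous (fun t : ℝ => m + t • w) := by fun_prop
      have := this.tendsto 0
      simp only [zero_smul, add_zero] at this
      exact this.mono_left nhdsWithin_le_nhds
    have hex : ∃ τ' ∈ K, ∃ᶠ t in 𝓝[>] (0 : ℝ), m + t • w ∈ τ'.polygon ξ ∧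
        m + t • w ∉ τ.polygon ξ := by
      by_contra hno
      push Not at hno
      rw [← Filter.eventually_all_finite hfin] at hno
      obtain ⟨t, ht, ht1, ht2⟩ := (hno.and (Ioo_mem_nhdsGT
        (show (0 : ℝ) < 1 / 2 by norm_num))).exists
      have h1 := hw t ht1 ht2.le
      have h2 := h1.1
      rw [← hK.cover, Set.mem_iUnion₂] at h2
      obtain ⟨τ', hτ', h2⟩ := h2
      exact h1.2 (ht τ' hτ' h2)
    obtain ⟨τ', hτ', hf⟩ := hex
    have hmτ' : m ∈ τ'.polygon ξ :=
      (Tile.isClosed_polygon hξ (hK.valid _ hτ')).mem_of_frequently_of_tendsto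
        (hf.mono fun _ h => h.1) hc
    have hmτ := Tile.segment_subset_polygon he (openSegment_subset_segment ℝ _ _ hmo)
    have hne : τ' ≠ τ := by
      rintro rfl
      obtain ⟨t, ht⟩ := hf.exists
      exact ht.2 ht.1
    refine ⟨τ', hτ', hne, ?_⟩
    have hzi : m ∈ τ.polygon ξ ∩ τ'.polygon ξ := ⟨hmτ, hmτ'⟩
    rcases hK.inter τ hτ τ' hτ' hne.symm with h | ⟨v, hv, h⟩ | ⟨e, he', h⟩
    · rw [h] at hzi; exact absurd hzi (Set.notMem_empty _)
    · rw [h] at hzi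
      rw [Tile.mem_edges_iff] at he
      rcases he with he | he
      · exact absurd (hzi ▸ hmo) ((hK.valid _ hτ).vert_notMem_openSegment hξ (Or.inl he) hv.1)
      · rw [openSegment_symm] at hmo
        exact absurd (hzi ▸ hmo) ((hK.valid _ hτ).vert_notMem_openSegment hξ (Or.inr he) hv.1)
    · rw [h] at hzi
      rcases (hK.valid _ hτ).edge_unique hξ he (A' := e.1) (B' := e.2) he'.1 hmo hzi with
        ⟨h1, h2⟩ | ⟨h1, h2⟩
      · rw [← h1, ← h2]; exact he'.2
      · have h3 := (hK.valid _ hτ).weight_lt he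
        have h4 := (hK.valid _ hτ).weight_lt (A := e.1) (B := e.2) he'.1
        rw [h1, h2] at h4
        exact absurd h3 h4.not_gt
  refine ⟨hK.valid, hfin, ⟨_, hG, hu, ?_⟩, ?_, ?_, ?_, ?_⟩
  · intro z _ hz
    rw [← hK.cover, Set.mem_iUnion₂] at hz
    obtain ⟨τ, hτ, h⟩ := hz
    exact ⟨τ, hτ, h⟩
  · intro τ hτ A B h
    by_contra hno
    push Not at hno
    obtain ⟨h1, h2⟩ := hno
    have he : (A, B) ∈ τ.edges := Tile.mem_edges_iff.2 (Or.inl h)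
    obtain ⟨w, hw⟩ := hξ.exists_left ((hK.valid _ hτ).isVEdge_or_isHEdge he) h1
    obtain ⟨τ', hτ', hne, he'⟩ := across τ hτ A B he w (fun t h3 h4 => ⟨(hw t h3 h4).1, fun h5 =>
      ((hK.valid _ hτ).side_nonneg hξ (Or.inl h) h5).not_gt (hw t h3 h4).2⟩)
    rcases Tile.mem_edges_iff.1 he' with he' | he'
    · exact hne (border_unique_of_dense hξ hG (hK.valid _ hτ') (hK.valid _ hτ)
        (fun z hz => hu z hz τ' hτ' τ hτ) (Or.inl he') (Or.inl h))
    · exact h2 τ' hτ' he'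
  · intro τ hτ A B h
    by_contra hno
    push Not at hno
    obtain ⟨h1, h2⟩ := hno
    have he : (A, B) ∈ τ.edges := Tile.mem_edges_iff.2 (Or.inr h)
    obtain ⟨w, hw⟩ := hξ.exists_right ((hK.valid _ hτ).isVEdge_or_isHEdge he) h1
    obtain ⟨τ', hτ', hne, he'⟩ := across τ hτ A B he w (fun t h3 h4 => ⟨(hw t h3 h4).1, fun h5 => by
      have := (hK.valid _ hτ).side_nonneg hξ (Or.inr h) h5
      rw [side_swap] at this
      linarith [(hw t h3 h4).2]⟩)
    rcases Tile.mem_edges_iff.1 he' with he' | he'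
    · exact h2 τ' hτ' he'
    · exact hne (border_unique_of_dense hξ hG (hK.valid _ hτ') (hK.valid _ hτ)
        (fun z hz => hu z hz τ' hτ' τ hτ) (Or.inr he') (Or.inr h))
  · intro i
    obtain ⟨τ, ⟨hτ, h⟩, -⟩ := hK.left_boundary i
    rcases Tile.mem_edges_iff.1 h with h | h
    · exact ⟨τ, hτ, h⟩
    · exact absurd h ((hK.valid _ hτ).leftBoundaryEdge_not_rpath hξ i)
  · intro i
    obtain ⟨τ, ⟨hτ, h⟩, -⟩ := hK.right_boundary i
    rcases Tile.mem_edges_iff.1 h with h | h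
    · exact absurd h ((hK.valid _ hτ).rightBoundaryEdge_not_lpath hξ i)
    · exact ⟨τ, hτ, h⟩

end tiling

end Combi

namespace Combi

/-! ### Tilings and boundary sums -/

section boundarySums

variable {n : ℕ} {ξ : Fin n → Plane} {K : Set (Tile n)}

/-- The antisymmetric indicator function of a directed edge. -/
def edgeIndicator (e : Edge n) (A B : Vert n) : ℤ :=
  (if (A, B) = e then 1 else 0) - (if (B, A) = e then 1 else 0)

lemma edgeIndicator_swap (e : Edge n) (A B : Vert n) :
    edgeIndicator e A B = -edgeIndicator e B A := by simp [edgeIndicator]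

lemma edgeIndicator_of_weight_lt {e : Edge n} (he : weight e.1 < weight e.2)
    {A B : Vert n} (h : weight A < weight B) :
    edgeIndicator e A B = if (A, B) = e then 1 else 0 := by
  rw [edgeIndicator, if_neg (c := (B, A) = e), sub_zero]
  rintro rfl
  exact absurd he h.not_gt

lemma pathSum_edgeIndicator {e : Edge n} (he : weight e.1 < weight e.2)
    {l : List (Vert n)} (hl : ∀ A B, [A, B] <:+: l → weight A < weight B) :
    0 ≤ pathSum (edgeIndicator e) l ∧ ([e.1, e.2] <:+: l → 1 ≤ pathSum (edgeIndicator e) l) ∧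
      (¬ [e.1, e.2] <:+: l → pathSum (edgeIndicator e) l = 0) := by
  induction l with
  | nil => simp
  | cons a l ih =>
    rcases l with _ | ⟨b, l⟩
    · simp [not_pair_infix]
    · simp only [pair_infix_cons] at hl ⊢
      obtain ⟨h1, h2, h3⟩ := ih (fun A B h => hl A B (Or.inr h))
      rw [pathSum_cons_cons, edgeIndicator_of_weight_lt he (hl a b (Or.inl ⟨rfl, rfl⟩))]
      split_ifs with h
      · grind
      · grind

lemma Tile.IsValid.lpath_weight_lt {τ : Tile n} (hτ : τ.IsValid) (A B : Vert n)
    (h : [A, B] <:+: τ.lpath) : weight A < weight B :=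
  hτ.weight_lt (Tile.mem_edges_iff.2 (Or.inl h))

lemma Tile.IsValid.rpath_weight_lt {τ : Tile n} (hτ : τ.IsValid) (A B : Vert n)
    (h : [A, B] <:+: τ.rpath) : weight A < weight B :=
  hτ.weight_lt (Tile.mem_edges_iff.2 (Or.inr h))

lemma leftBoundaryEdge_ne_rightBoundaryEdge (hn : 2 ≤ n) (i j : Fin n) :
    leftBoundaryEdge i ≠ rightBoundaryEdge j := by
  intro h
  have h1 := congrArg Prod.fst h
  have h2 := congrArg Prod.snd h
  simp only [leftBoundaryEdge, rightBoundaryEdge, Finset.ext_iff, Finset.mem_filter,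
    Finset.mem_univ, true_and] at h1 h2
  have hij : i = j := by
    have e1 := (h1 j).not.2 (lt_irrefl j)
    have e2 := (h2 j).2 le_rfl
    exact le_antisymm (not_lt.1 e1) e2 |>.symm.symm
  subst hij
  obtain ⟨k, hk⟩ : ∃ k : Fin n, k ≠ i := by
    have : Nontrivial (Fin n) := Fin.nontrivial_iff_two_le.2 hn
    exact exists_ne i
  have := h1 k
  rcases hk.lt_or_gt with h | h
  · exact absurd (this.1 h) h.not_gt
  · exact absurd (this.2 h) h.not_gt

lemma leftBoundaryEdge_injective : Function.Injective (leftBoundaryEdge (n := n)) := by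
  intro i j h
  have h2 := congrArg Prod.snd h
  simp only [leftBoundaryEdge, Finset.ext_iff, Finset.mem_filter, Finset.mem_univ, true_and] at h2
  exact le_antisymm ((h2 i).1 le_rfl) ((h2 j).2 le_rfl)

lemma rightBoundaryEdge_injective : Function.Injective (rightBoundaryEdge (n := n)) := by
  intro i j h
  have h2 := congrArg Prod.snd h
  simp only [rightBoundaryEdge, Finset.ext_iff, Finset.mem_filter, Finset.mem_univ, true_and] at h2
  exact le_antisymm ((h2 j).2 le_rfl) ((h2 i).1 le_rfl)

lemma multiset_sum_nonpos {s : Multiset ℤ} (h : ∀ x ∈ s, x ≤ 0) : s.sum ≤ 0 := by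
  induction s using Multiset.induction with
  | empty => simp
  | cons a s ih => simp_all; omega

/-- Tiles whose boundaries sum up to the boundary of the zonogon form a tiling. -/
theorem edgeTiling_of_boundary (hξ : IsGenerators ξ) (hn : 2 ≤ n) (T : Multiset (Tile n))
    (hT : ∀ τ ∈ T, τ.IsValid)
    (hb : ∀ φ : Vert n → Vert n → ℤ, (∀ A B, φ A B = -φ B A) →
      (T.map (Tile.bdry φ)).sum = zonogonBdry φ) :
    EdgeTiling ξ {τ | τ ∈ T} := by
  classical
  obtain ⟨p, q, hq, hpq⟩ := hξ.exists_height hn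
  have hG := dense_inGeneralPosition (p := p) (q := q) (Or.inr hq) (finite_nodes ξ)
  have hbd : ∀ e : Edge n, weight e.1 < weight e.2 → ∀ τ ∈ T,
      ((¬ [e.1, e.2] <:+: τ.rpath → 0 ≤ τ.bdry (edgeIndicator e)) ∧
      (¬ [e.1, e.2] <:+: τ.lpath → τ.bdry (edgeIndicator e) ≤ 0)) ∧
      (¬ [e.1, e.2] <:+: τ.rpath → [e.1, e.2] <:+: τ.lpath → 1 ≤ τ.bdry (edgeIndicator e)) ∧
      (¬ [e.1, e.2] <:+: τ.lpath → [e.1, e.2] <:+: τ.rpath → τ.bdry (edgeIndicator e) ≤ -1) := by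
    intro e he τ hτ
    obtain ⟨a1, a2, a3⟩ := pathSum_edgeIndicator he (hT τ hτ).lpath_weight_lt
    obtain ⟨b1, b2, b3⟩ := pathSum_edgeIndicator he (hT τ hτ).rpath_weight_lt
    rw [Tile.bdry]
    refine ⟨⟨fun h => ?_, fun h => ?_⟩, fun h h' => ?_, fun h h' => ?_⟩
    · rw [b3 h]; linarith
    · rw [a3 h]; linarith
    · rw [b3 h]; linarith [a2 h']
    · rw [a3 h]; linarith [b2 h']
  have hlw : ∀ i : Fin n, weight (leftBoundaryEdge i).1 < weight (leftBoundaryEdge i).2 :=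
    fun i => (isVEdge_leftBoundaryEdge i).weight_lt
  have hrw : ∀ i : Fin n, weight (rightBoundaryEdge i).1 < weight (rightBoundaryEdge i).2 :=
    fun i => (isVEdge_rightBoundaryEdge i).weight_lt
  have hz : ∀ e : Edge n, weight e.1 < weight e.2 →
      zonogonBdry (edgeIndicator e) =
      ∑ i, (if leftBoundaryEdge i = e then 1 else 0) -
        ∑ i, (if rightBoundaryEdge i = e then 1 else 0) := by
    intro e he
    rw [zonogonBdry]
    congr 1
    · exact Finset.sum_congr rfl fun i _ => edgeIndicator_of_weight_lt he (hlw i)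
    · exact Finset.sum_congr rfl fun i _ => edgeIndicator_of_weight_lt he (hrw i)
  refine ⟨hT, (Multiset.finite_toSet T), ⟨_, hG, ?_, ?_⟩, ?_, ?_, ?_, ?_⟩
  · intro z hz τ hτ τ' hτ' h h'
    by_contra hne
    obtain ⟨T', rfl⟩ := Multiset.exists_cons_of_mem (show τ ∈ T from hτ)
    have hτ'' : τ' ∈ T' := by grind
    obtain ⟨T'', rfl⟩ := Multiset.exists_cons_of_mem hτ''
    have hs := hb _ (fun A B => crossing_swap p q z (point ξ A) (point ξ B))
    rw [zonogonBdry_crossing hξ hpq hz (Tile.polygon_subset_zonogon h), Multiset.map_cons,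
      Multiset.map_cons, Multiset.sum_cons, Multiset.sum_cons,
      (Tile.bdry_crossing hξ (hT _ hτ) hz).1 h, (Tile.bdry_crossing hξ (hT _ hτ') hz).1 h'] at hs
    have : 0 ≤ (T''.map (Tile.bdry fun A B => crossing p q z (point ξ A) (point ξ B))).sum := by
      refine Multiset.sum_nonneg ?_
      intro x hx
      obtain ⟨σ, hσ, rfl⟩ := Multiset.mem_map.1 hx
      have hσv := hT σ (by simp [hσ])
      by_cases hm : z ∈ σ.polygon ξ
      · rw [(Tile.bdry_crossing hξ hσv hz).1 hm]; norm_num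
      · rw [(Tile.bdry_crossing hξ hσv hz).2 hm]
    linarith
  · intro z hz hzz
    by_contra hno
    push Not at hno
    have hs := hb _ (fun A B => crossing_swap p q z (point ξ A) (point ξ B))
    rw [zonogonBdry_crossing hξ hpq hz hzz, Multiset.sum_eq_zero] at hs
    · norm_num at hs
    · intro x hx
      obtain ⟨σ, hσ, rfl⟩ := Multiset.mem_map.1 hx
      exact (Tile.bdry_crossing hξ (hT σ hσ) hz).2 (hno σ hσ)
  · intro τ hτ A B h
    by_contra hno
    push Not at hno
    obtain ⟨h1, h2⟩ := hno
    have hw := (hT τ hτ).lpath_weight_lt A B h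
    have hs := hb _ (edgeIndicator_swap (A, B))
    rw [hz _ hw, Finset.sum_eq_zero (fun i _ => if_neg (h1 i).symm)] at hs
    have h3 : 0 ≤ ∑ i : Fin n, (if rightBoundaryEdge i = (A, B) then (1 : ℤ) else 0) :=
      Finset.sum_nonneg fun i _ => by split_ifs <;> simp
    obtain ⟨T', rfl⟩ := Multiset.exists_cons_of_mem (show τ ∈ T from hτ)
    rw [Multiset.map_cons, Multiset.sum_cons] at hs
    have h4 := (hbd (A, B) hw τ hτ).2.1 (h2 τ hτ) h
    have h5 : 0 ≤ (T'.map (Tile.bdry (edgeIndicator (A, B)))).sum := by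
      refine Multiset.sum_nonneg ?_
      intro x hx
      obtain ⟨σ, hσ, rfl⟩ := Multiset.mem_map.1 hx
      exact (hbd (A, B) hw σ (by simp [hσ])).1.1 (h2 σ (by simp [hσ]))
    linarith
  · intro τ hτ A B h
    by_contra hno
    push Not at hno
    obtain ⟨h1, h2⟩ := hno
    have hw := (hT τ hτ).rpath_weight_lt A B h
    have hs := hb _ (edgeIndicator_swap (A, B))
    rw [hz _ hw, Finset.sum_eq_zero (f := fun i => if rightBoundaryEdge i = (A, B) then (1 : ℤ)
      else 0) (fun i _ => if_neg (h1 i).symm)] at hs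
    have h3 : 0 ≤ ∑ i : Fin n, (if leftBoundaryEdge i = (A, B) then (1 : ℤ) else 0) :=
      Finset.sum_nonneg fun i _ => by split_ifs <;> simp
    obtain ⟨T', rfl⟩ := Multiset.exists_cons_of_mem (show τ ∈ T from hτ)
    rw [Multiset.map_cons, Multiset.sum_cons] at hs
    have h4 := (hbd (A, B) hw τ hτ).2.2 (h2 τ hτ) h
    have h5 : (T'.map (Tile.bdry (edgeIndicator (A, B)))).sum ≤ 0 := by
      refine multiset_sum_nonpos ?_
      intro x hx
      obtain ⟨σ, hσ, rfl⟩ := Multiset.mem_map.1 hx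
      exact (hbd (A, B) hw σ (by simp [hσ])).1.2 (h2 σ (by simp [hσ]))
    linarith
  · intro i
    by_contra hno
    push Not at hno
    have hs := hb _ (edgeIndicator_swap (leftBoundaryEdge i))
    rw [hz _ (hlw i), Finset.sum_eq_zero (f := fun j => if rightBoundaryEdge j = leftBoundaryEdge i
      then (1 : ℤ) else 0)
      (fun j _ => if_neg (leftBoundaryEdge_ne_rightBoundaryEdge hn i j).symm)] at hs
    have h3 : (1 : ℤ) ≤ ∑ j : Fin n, (if leftBoundaryEdge j = leftBoundaryEdge i then 1 else 0) := by
      refine le_trans (by simp) (Finset.single_le_sum (f := fun j : Fin n =>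
        if leftBoundaryEdge j = leftBoundaryEdge i then (1 : ℤ) else 0) (fun j _ => ?_)
        (Finset.mem_univ i))
      split_ifs <;> simp
    have h5 : (T.map (Tile.bdry (edgeIndicator (leftBoundaryEdge i)))).sum ≤ 0 := by
      refine multiset_sum_nonpos ?_
      intro x hx
      obtain ⟨σ, hσ, rfl⟩ := Multiset.mem_map.1 hx
      exact (hbd _ (hlw i) σ hσ).1.2 (hno σ hσ)
    linarith
  · intro i
    by_contra hno
    push Not at hno
    have hs := hb _ (edgeIndicator_swap (rightBoundaryEdge i))
    rw [hz _ (hrw i), Finset.sum_eq_zero (f := fun j => if leftBoundaryEdge j = rightBoundaryEdge i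
      then (1 : ℤ) else 0)
      (fun j _ => if_neg (leftBoundaryEdge_ne_rightBoundaryEdge hn j i))] at hs
    have h3 : (1 : ℤ) ≤ ∑ j : Fin n,
        (if rightBoundaryEdge j = rightBoundaryEdge i then 1 else 0) := by
      refine le_trans (by simp) (Finset.single_le_sum (f := fun j : Fin n =>
        if rightBoundaryEdge j = rightBoundaryEdge i then (1 : ℤ) else 0) (fun j _ => ?_)
        (Finset.mem_univ i))
      split_ifs <;> simp
    have h5 : 0 ≤ (T.map (Tile.bdry (edgeIndicator (rightBoundaryEdge i)))).sum := by
      refine Multiset.sum_nonneg ?_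
      intro x hx
      obtain ⟨σ, hσ, rfl⟩ := Multiset.mem_map.1 hx
      exact (hbd _ (hrw i) σ hσ).1.1 (hno σ hσ)
    linarith

open Classical in
lemma pathSum_eq_sum (φ : Vert n → Vert n → ℤ) {l : List (Vert n)}
    (hl : l.Nodup) : pathSum φ l =
      ∑ e : Edge n, φ e.1 e.2 * (if [e.1, e.2] <:+: l then 1 else 0) := by
  induction l with
  | nil => simp
  | cons a l ih =>
    rcases l with _ | ⟨b, l⟩
    · simp [not_pair_infix]
    · rw [pathSum_cons_cons, ih (List.nodup_cons.1 hl).2]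
      have : ∀ e : Edge n,
          φ e.1 e.2 * (if [e.1, e.2] <:+: a :: b :: l then 1 else 0) =
          (if e = (a, b) then φ a b else 0) +
          φ e.1 e.2 * (if [e.1, e.2] <:+: b :: l then 1 else 0) := by
        rintro ⟨x, y⟩
        by_cases he : (x, y) = (a, b)
        · have hn : ¬ [x, y] <:+: b :: l := fun h => by
            simp only [Prod.mk.injEq] at he
            exact (List.nodup_cons.1 hl).1 (he.1 ▸ (pair_infix_mem h).1)
          simp only [Prod.mk.injEq] at he
          obtain ⟨rfl, rfl⟩ := he
          simp [pair_infix_cons, hn]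
        · rw [if_neg he, zero_add]
          simp only [Prod.mk.injEq] at he
          simp [pair_infix_cons, he]
      rw [Finset.sum_congr rfl (fun e _ => this e), Finset.sum_add_distrib]
      simp

lemma pairwise_weight_lt {l : List (Vert n)} (hl : ∀ A B, [A, B] <:+: l → weight A < weight B) :
    l.Pairwise (fun A B => weight A < weight B) := by
  rw [← List.isChain_iff_pairwise]; exact isChain_of_pair_infix hl

lemma nodup_of_weight_lt {l : List (Vert n)}
    (hl : ∀ A B, [A, B] <:+: l → weight A < weight B) : l.Nodup :=
  (pairwise_weight_lt hl).imp fun h h' => by simp [h'] at h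

open Classical in
lemma EdgeTiling.sum_bdry (hξ : IsGenerators ξ) (hK : EdgeTiling ξ K) (S : Finset (Tile n))
    (hS : ∀ τ ∈ S, τ ∈ K) (φ : Vert n → Vert n → ℤ) :
    ∑ τ ∈ S, τ.bdry φ = ∑ e : Edge n, φ e.1 e.2 *
      ((if ∃ τ ∈ S, [e.1, e.2] <:+: τ.lpath then 1 else 0) -
        (if ∃ τ ∈ S, [e.1, e.2] <:+: τ.rpath then 1 else 0)) := by
  have key : ∀ (g : Tile n → List (Vert n)),
      (∀ τ ∈ S, ∀ τ' ∈ S, ∀ A B, [A, B] <:+: g τ → [A, B] <:+: g τ' → τ = τ') →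
      ∀ e : Edge n,
      ∑ τ ∈ S, (if [e.1, e.2] <:+: g τ then (1 : ℤ) else 0) =
        if ∃ τ ∈ S, [e.1, e.2] <:+: g τ then 1 else 0 := by
    intro g hg e
    split_ifs with h
    · obtain ⟨τ, hτ, h⟩ := h
      rw [Finset.sum_eq_single_of_mem τ hτ, if_pos h]
      intro τ' hτ' hne
      rw [if_neg]
      exact fun h' => hne (hg τ' hτ' τ hτ _ _ h' h)
    · push Not at h
      exact Finset.sum_eq_zero fun τ hτ => if_neg (h τ hτ)
  have h1 : ∀ τ ∈ S, τ.bdry φ = ∑ e : Edge n, φ e.1 e.2 *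
      ((if [e.1, e.2] <:+: τ.lpath then 1 else 0) - (if [e.1, e.2] <:+: τ.rpath then 1 else 0)) := by
    intro τ hτ
    have hv := hK.valid τ (hS τ hτ)
    rw [Tile.bdry, pathSum_eq_sum φ (nodup_of_weight_lt hv.lpath_weight_lt),
      pathSum_eq_sum φ (nodup_of_weight_lt hv.rpath_weight_lt), ← Finset.sum_sub_distrib]
    exact Finset.sum_congr rfl fun e _ => by ring
  rw [Finset.sum_congr rfl h1, Finset.sum_comm]
  refine Finset.sum_congr rfl fun e _ => ?_
  rw [← Finset.mul_sum, Finset.sum_sub_distrib,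
    key Tile.lpath (fun τ hτ τ' hτ' A B => hK.left_unique hξ (hS τ hτ) (hS τ' hτ')),
    key Tile.rpath (fun τ hτ τ' hτ' A B => hK.right_unique hξ (hS τ hτ) (hS τ' hτ'))]

open Classical in
lemma zonogonBdry_eq_sum (φ : Vert n → Vert n → ℤ) :
    zonogonBdry φ = ∑ e : Edge n, φ e.1 e.2 *
      ((if ∃ i, e = leftBoundaryEdge i then 1 else 0) -
        (if ∃ i, e = rightBoundaryEdge i then 1 else 0)) := by
  have key : ∀ g : Fin n → Edge n, Function.Injective g →
      ∑ i, φ (g i).1 (g i).2 = ∑ e : Edge n, φ e.1 e.2 *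
        (if ∃ i, e = g i then 1 else 0) := by
    intro g hg
    rw [← Finset.sum_image (f := fun e : Edge n => φ e.1 e.2)
      (s := Finset.univ) (fun i _ j _ h => hg h)]
    rw [← Finset.sum_filter_add_sum_filter_not Finset.univ (fun e => ∃ i, e = g i)]
    have h1 : Finset.univ.filter (fun e => ∃ i, e = g i) = Finset.univ.image g := by
      ext e; simp [eq_comm]
    rw [h1, Finset.sum_eq_zero (s := Finset.univ.filter _), add_zero]
    · simp_all
    · intro e he
      rw [if_neg (Finset.mem_filter.1 he).2, mul_zero]
  rw [zonogonBdry, key _ leftBoundaryEdge_injective, key _ rightBoundaryEdge_injective,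
    ← Finset.sum_sub_distrib]
  exact Finset.sum_congr rfl fun e _ => by ring

lemma indicator_sub_eq {a b c d : Prop} [Decidable a] [Decidable b] [Decidable c] [Decidable d]
    (hl : a → c ∨ b) (hr : b → d ∨ a) (hl' : c → a ∧ ¬ b) (hr' : d → b ∧ ¬ a) :
    (if a then (1 : ℤ) else 0) - (if b then 1 else 0) =
      (if c then 1 else 0) - (if d then 1 else 0) := by
  by_cases a <;> by_cases b <;> by_cases c <;> by_cases d <;> simp_all

/-- The boundaries of the tiles of a tiling sum up to the boundary of the zonogon. -/
lemma EdgeTiling.sum_bdry_eq (hξ : IsGenerators ξ) (hK : EdgeTiling ξ K)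
    (φ : Vert n → Vert n → ℤ) :
    ∑ τ ∈ hK.finite.toFinset, τ.bdry φ = zonogonBdry φ := by
  classical
  rw [hK.sum_bdry hξ _ (by simp), zonogonBdry_eq_sum]
  refine Finset.sum_congr rfl fun e _ => ?_
  congr 1
  simp only [Set.Finite.mem_toFinset]
  have hl : (∃ τ ∈ K, [e.1, e.2] <:+: τ.lpath) →
      (∃ i, e = leftBoundaryEdge i) ∨ ∃ τ ∈ K, [e.1, e.2] <:+: τ.rpath := by
    rintro ⟨τ, hτ, h⟩; exact hK.left_exists τ hτ _ _ h
  have hr : (∃ τ ∈ K, [e.1, e.2] <:+: τ.rpath) →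
      (∃ i, e = rightBoundaryEdge i) ∨ ∃ τ ∈ K, [e.1, e.2] <:+: τ.lpath := by
    rintro ⟨τ, hτ, h⟩; exact hK.right_exists τ hτ _ _ h
  have hl' : (∃ i, e = leftBoundaryEdge i) → (∃ τ ∈ K, [e.1, e.2] <:+: τ.lpath) ∧
      ¬ ∃ τ ∈ K, [e.1, e.2] <:+: τ.rpath := by
    rintro ⟨i, rfl⟩
    exact ⟨hK.left_boundary i, fun ⟨τ, hτ, h⟩ =>
      (hK.valid τ hτ).leftBoundaryEdge_not_rpath hξ i h⟩
  have hr' : (∃ i, e = rightBoundaryEdge i) → (∃ τ ∈ K, [e.1, e.2] <:+: τ.rpath) ∧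
      ¬ ∃ τ ∈ K, [e.1, e.2] <:+: τ.lpath := by
    rintro ⟨i, rfl⟩
    exact ⟨hK.right_boundary i, fun ⟨τ, hτ, h⟩ =>
      (hK.valid τ hτ).rightBoundaryEdge_not_lpath hξ i h⟩
  exact indicator_sub_eq hl hr hl' hr'

end boundarySums

end Combi

namespace Combi

/-! ### Strips -/

section strips

variable {n : ℕ} {ξ : Fin n → Plane} {K : Set (Tile n)}

lemma IsVEdge.not_isHEdge {A B : Vert n} {i j k : Fin n} (h : IsVEdge i A B) :
    ¬ IsHEdge j k A B := fun h' => by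
  have h1 := h.card_eq
  have h2 := h'.card_eq
  omega

lemma EdgeTiling.left_tile (hK : EdgeTiling ξ K) {A B : Vert n} (h : IsVEdgeOf K A B) :
    (∃ i, (A, B) = leftBoundaryEdge i) ∨ (∃ C, Tile.delta B C A ∈ K) ∨
      ∃ C, Tile.nabla A C B ∈ K := by
  obtain ⟨⟨τ, hτ, he⟩, i, hi⟩ := h
  have key : ∀ τ ∈ K, [A, B] <:+: τ.rpath →
      (∃ C, Tile.delta B C A ∈ K) ∨ ∃ C, Tile.nabla A C B ∈ K := by
    intro τ hτ h
    rcases (hK.valid τ hτ).of_rpath h with ⟨C, rfl, -⟩ | ⟨C, rfl, -⟩ | ⟨X, -, j, k, hh⟩ |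
      ⟨U, L, -, -, j, k, hh⟩
    · exact Or.inl ⟨C, hτ⟩
    · exact Or.inr ⟨C, hτ⟩
    · exact absurd hh hi.not_isHEdge
    · exact absurd hh hi.not_isHEdge
  rcases Tile.mem_edges_iff.1 he with h | h
  · rcases hK.left_exists τ hτ A B h with h | ⟨τ', hτ', h⟩
    · exact Or.inl h
    · exact Or.inr (key τ' hτ' h)
  · exact Or.inr (key τ hτ h)

/-- `StripTile τ e e'`: the tile `τ` is a triangle with left V-edge `e` and right V-edge `e'`. -/
def StripTile (τ : Tile n) (e e' : Edge n) : Prop :=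
  (∃ A B C, τ = Tile.delta A B C ∧ e = (B, A) ∧ e' = (C, A)) ∨
  (∃ A B C, τ = Tile.nabla A B C ∧ e = (A, B) ∧ e' = (A, C))

/-- The V-edge `e'` follows the V-edge `e` in its strip. -/
def Next (K : Set (Tile n)) (e e' : Edge n) : Prop :=
  ∃ τ ∈ K, StripTile τ e e'

lemma StripTile.lpath {τ : Tile n} {e e' : Edge n}
    (h : StripTile τ e e') : [e.1, e.2] <:+: τ.lpath := by
  rcases h with ⟨A, B, C, rfl, rfl, rfl⟩ | ⟨A, B, C, rfl, rfl, rfl⟩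
  · exact ⟨[], [], rfl⟩
  · exact ⟨[], [C], rfl⟩

lemma StripTile.rpath {τ : Tile n} {e e' : Edge n}
    (h : StripTile τ e e') : [e'.1, e'.2] <:+: τ.rpath := by
  rcases h with ⟨A, B, C, rfl, rfl, rfl⟩ | ⟨A, B, C, rfl, rfl, rfl⟩
  · exact ⟨[B], [], rfl⟩
  · exact ⟨[], [], rfl⟩

lemma StripTile.isVEdge {τ : Tile n} {e e' : Edge n}
    (h : StripTile τ e e') (hτ : τ.IsValid) :
    (∃ i, IsVEdge i e.1 e.2) ∧ ∃ i, IsVEdge i e'.1 e'.2 := by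
  rcases h with ⟨A, B, C, rfl, rfl, rfl⟩ | ⟨A, B, C, rfl, rfl, rfl⟩ <;>
    obtain ⟨i, j, h1, h2, h3⟩ := hτ <;> exact ⟨⟨_, h2⟩, ⟨_, h3⟩⟩

lemma StripTile.isVEdgeOf {τ : Tile n} {e e' : Edge n}
    (h : StripTile τ e e') (hτ : τ.IsValid) (hτK : τ ∈ K) :
    IsVEdgeOf K e.1 e.2 ∧ IsVEdgeOf K e'.1 e'.2 :=
  ⟨⟨⟨τ, hτK, Tile.mem_edges_iff.2 (Or.inl h.lpath)⟩, (h.isVEdge hτ).1⟩,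
    ⟨⟨τ, hτK, Tile.mem_edges_iff.2 (Or.inr h.rpath)⟩, (h.isVEdge hτ).2⟩⟩

lemma StripTile.right_unique {τ : Tile n} {e e' e'' : Edge n}
    (h : StripTile τ e e') (h' : StripTile τ e e'') : e' = e'' := by
  rcases h with ⟨A, B, C, rfl, rfl, rfl⟩ | ⟨A, B, C, rfl, rfl, rfl⟩ <;>
  rcases h' with ⟨A', B', C', h1, h2, rfl⟩ | ⟨A', B', C', h1, h2, rfl⟩ <;>
  simp_all

lemma StripTile.left_unique {τ : Tile n} {e e' e'' : Edge n}
    (h : StripTile τ e' e) (h' : StripTile τ e'' e) : e' = e'' := by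
  rcases h with ⟨A, B, C, rfl, rfl, rfl⟩ | ⟨A, B, C, rfl, rfl, rfl⟩ <;>
  rcases h' with ⟨A', B', C', h1, rfl, h2⟩ | ⟨A', B', C', h1, rfl, h2⟩ <;>
  simp_all

lemma EdgeTiling.next_right_unique (hξ : IsGenerators ξ) (hK : EdgeTiling ξ K) :
    Relator.RightUnique (Next K) := by
  rintro e e' e'' ⟨τ, hτ, h⟩ ⟨τ', hτ', h'⟩
  obtain rfl := hK.left_unique hξ hτ hτ' h.lpath h'.lpath
  exact h.right_unique h'

lemma EdgeTiling.next_left_unique (hξ : IsGenerators ξ) (hK : EdgeTiling ξ K)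
    {e e' e'' : Edge n} (h : Next K e' e) (h' : Next K e'' e) :
    e' = e'' := by
  obtain ⟨τ, hτ, h⟩ := h
  obtain ⟨τ', hτ', h'⟩ := h'
  obtain rfl := hK.right_unique hξ hτ hτ' h.rpath h'.rpath
  exact h.left_unique h'

lemma EdgeTiling.exists_prev (hK : EdgeTiling ξ K) {e : Edge n}
    (h : IsVEdgeOf K e.1 e.2) (hl : ∀ i, e ≠ leftBoundaryEdge i) : ∃ e', Next K e' e := by
  rcases hK.left_tile h with ⟨i, hi⟩ | ⟨C, hC⟩ | ⟨C, hC⟩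
  · exact absurd hi (hl i)
  · exact ⟨(C, e.2), _, hC, Or.inl ⟨_, _, _, rfl, rfl, rfl⟩⟩
  · exact ⟨(e.1, C), _, hC, Or.inr ⟨_, _, _, rfl, rfl, rfl⟩⟩

/-- The order of the V-edges in a strip. -/
abbrev StripLE (K : Set (Tile n)) := Relation.ReflTransGen (Next K)

/-- A step along a strip to the right moves one end of the V-edge along an H-edge and fixes the
other end. -/
lemma StripTile.step {τ : Tile n} {e e' : Edge n}
    (h : StripTile τ e e') (hτ : τ.IsValid) :
    (τ = Tile.delta e.2 e.1 e'.1 ∧ e'.2 = e.2 ∧ weight e.1 < weight e'.1 ∧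
      e'.1.card = e.1.card) ∨
    (τ = Tile.nabla e.1 e.2 e'.2 ∧ e'.1 = e.1 ∧ weight e.2 < weight e'.2 ∧
      e'.2.card = e.2.card) := by
  rcases h with ⟨A, B, C, rfl, rfl, rfl⟩ | ⟨A, B, C, rfl, rfl, rfl⟩ <;>
    obtain ⟨i, j, h1, h2, h3⟩ := hτ
  · exact Or.inl ⟨rfl, rfl, h1.weight_lt, h1.card_eq⟩
  · exact Or.inr ⟨rfl, rfl, h1.weight_lt, h1.card_eq⟩

lemma StripLE.card_weight (hK : ∀ τ ∈ K, τ.IsValid) {e e' : Edge n}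
    (h : StripLE K e e') :
    e'.1.card = e.1.card ∧ weight e.1 ≤ weight e'.1 ∧ weight e.2 ≤ weight e'.2 := by
  induction h with
  | refl => exact ⟨rfl, le_rfl, le_rfl⟩
  | tail _ h ih =>
    obtain ⟨τ, hτ, h⟩ := h
    rcases h.step (hK τ hτ) with ⟨-, h1, h2, h3⟩ | ⟨-, h1, h2, h3⟩
    · exact ⟨h3.trans ih.1, ih.2.1.trans h2.le, h1 ▸ ih.2.2⟩
    · exact ⟨h1 ▸ ih.1, h1 ▸ ih.2.1, ih.2.2.trans h2.le⟩

lemma Next.weight_lt (hK : ∀ τ ∈ K, τ.IsValid) {e e' : Edge n}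
    (h : Next K e e') : weight e.1 + weight e.2 < weight e'.1 + weight e'.2 := by
  obtain ⟨τ, hτ, h⟩ := h
  rcases h.step (hK τ hτ) with ⟨-, h1, h2, -⟩ | ⟨-, h1, h2, -⟩ <;> rw [h1] <;> omega

lemma StripLE.antisymm (hK : ∀ τ ∈ K, τ.IsValid) {e e' : Edge n}
    (h : StripLE K e e') (h' : StripLE K e' e) : e = e' := by
  rcases Relation.ReflTransGen.cases_head h with rfl | ⟨f, h1, h2⟩
  · rfl
  · have a1 := h1.weight_lt hK
    have a2 := StripLE.card_weight hK h2
    have a3 := StripLE.card_weight hK h'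
    omega

lemma Next.not_stripLE (hK : ∀ τ ∈ K, τ.IsValid) {e e' : Edge n}
    (h : Next K e e') : ¬ StripLE K e' e := fun h' => by
  have a1 := h.weight_lt hK
  have a2 := StripLE.card_weight hK h'
  omega

lemma EdgeTiling.leftBoundaryEdge_stripLE (hK : EdgeTiling ξ K)
    {e : Edge n} (h : IsVEdgeOf K e.1 e.2) :
    ∃ i : Fin n, i.val = e.1.card ∧ StripLE K (leftBoundaryEdge i) e := by
  induction hw : weight e.1 + weight e.2 using Nat.strong_induction_on generalizing e with
  | _ w ih =>
    by_cases hl : ∃ i, e = leftBoundaryEdge i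
    · obtain ⟨i, rfl⟩ := hl
      refine ⟨i, ?_, .refl⟩
      simp [leftBoundaryEdge, Finset.filter_gt_eq_Iio]
    · push Not at hl
      obtain ⟨e', τ, hτ, he'⟩ := hK.exists_prev h hl
      have hn : Next K e' e := ⟨τ, hτ, he'⟩
      obtain ⟨i, hi, hle⟩ := ih _ (hw ▸ hn.weight_lt hK.valid)
        (he'.isVEdgeOf (hK.valid τ hτ) hτ).1 rfl
      refine ⟨i, ?_, hle.tail hn⟩
      rw [hi, (StripLE.card_weight hK.valid (Relation.ReflTransGen.single hn)).1]

lemma EdgeTiling.stripLE_total (hξ : IsGenerators ξ) (hK : EdgeTiling ξ K)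
    {e e' : Edge n} (h : IsVEdgeOf K e.1 e.2)
    (h' : IsVEdgeOf K e'.1 e'.2) (hc : e.1.card = e'.1.card) : StripLE K e e' ∨ StripLE K e' e := by
  obtain ⟨i, hi, hle⟩ := hK.leftBoundaryEdge_stripLE h
  obtain ⟨j, hj, hle'⟩ := hK.leftBoundaryEdge_stripLE h'
  obtain rfl : i = j := Fin.ext (by omega)
  exact Relation.ReflTransGen.total_of_right_unique (hK.next_right_unique hξ) hle hle'

lemma EdgeTiling.stripLE_prev (hξ : IsGenerators ξ) (hK : EdgeTiling ξ K)
    {e g g' : Edge n} (h : StripLE K e g') (hg : Next K g g')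
    (hne : e ≠ g') : StripLE K e g := by
  rcases Relation.ReflTransGen.cases_tail h with rfl | ⟨f, h1, h2⟩
  · exact absurd rfl hne
  · rwa [hK.next_left_unique hξ hg h2]

/-- Edges of a strip with the same top vertex bound a lower filling. -/
lemma StripLE.exists_lowerFilling (hK : ∀ τ ∈ K, τ.IsValid) {a b c : Vert n}
    (h : StripLE K (a, b) (c, b)) : ∃ Y, IsLowerFilling K a b c Y := by
  suffices ∀ e : Edge n, StripLE K e (c, b) → e.2 = b →
      ∃ Y, IsLowerFilling K e.1 b c Y from this _ h rfl
  intro e h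
  induction h using Relation.ReflTransGen.head_induction_on with
  | refl => exact fun _ => ⟨[c], rfl, rfl, by simp⟩
  | head h1 h2 ih =>
    intro he
    obtain ⟨τ, hτ, h1⟩ := h1
    rcases h1.step (hK τ hτ) with ⟨rfl, h3, -, -⟩ | ⟨rfl, h3, h4, -⟩
    · obtain ⟨Y, hY1, hY2, hY3⟩ := ih (h3.trans he)
      rcases Y with _ | ⟨y, Y⟩
      · simp at hY1
      · simp only [List.head?_cons, Option.some.injEq] at hY1
        subst hY1 he
        exact ⟨_ :: _ :: Y, rfl, by simpa using hY2, List.isChain_cons_cons.2 ⟨hτ, hY3⟩⟩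
    · have := (StripLE.card_weight hK h2).2.2
      rw [he] at h4
      simp only at this
      omega

/-- Edges of a strip with the same bottom vertex bound an upper filling. -/
lemma StripLE.exists_upperFilling (hK : ∀ τ ∈ K, τ.IsValid) {a b c : Vert n}
    (h : StripLE K (b, a) (b, c)) : ∃ X, IsUpperFilling K a b c X := by
  suffices ∀ e : Edge n, StripLE K e (b, c) → e.1 = b →
      ∃ X, IsUpperFilling K e.2 b c X from this _ h rfl
  intro e h
  induction h using Relation.ReflTransGen.head_induction_on with
  | refl => exact fun _ => ⟨[c], rfl, rfl, by simp⟩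
  | head h1 h2 ih =>
    intro he
    obtain ⟨τ, hτ, h1⟩ := h1
    rcases h1.step (hK τ hτ) with ⟨rfl, h3, h4, -⟩ | ⟨rfl, h3, -, -⟩
    · have := (StripLE.card_weight hK h2).2.1
      rw [he] at h4
      simp only at this
      omega
    · obtain ⟨Y, hY1, hY2, hY3⟩ := ih (h3.trans he)
      rcases Y with _ | ⟨y, Y⟩
      · simp at hY1
      · simp only [List.head?_cons, Option.some.injEq] at hY1
        subst hY1 he
        exact ⟨_ :: _ :: Y, rfl, by simpa using hY2, List.isChain_cons_cons.2 ⟨hτ, hY3⟩⟩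

lemma head_eq_of_head? {α : Type*} {l : List α} {a : α} (h : l.head? = some a) :
    ∃ t, l = a :: t := by
  cases l with
  | nil => simp at h
  | cons b t => exact ⟨t, by simpa using h⟩

lemma chain_of_pair_infix {α : Type*} {R : α → α → Prop} {l : List α} (h : l.IsChain R) {u v : α}
    (huv : [u, v] <:+: l) : R u v :=
  List.isChain_pair.1 (h.infix huv)

lemma reflTransGen_of_isChain {α : Type*} {R : α → α → Prop} {l : List α} {a c : α}
    (h : l.IsChain R) (ha : l.head? = some a) (hc : l.getLast? = some c) :
    Relation.ReflTransGen R a c := by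
  obtain ⟨t, rfl⟩ := head_eq_of_head? ha
  exact List.relationReflTransGen_of_exists_isChain_cons t h
    (Option.some.inj ((List.getLast?_eq_some_getLast _).symm.trans hc))

lemma reflTransGen_of_pair_infix {α : Type*} {R : α → α → Prop} {l : List α} {a c u v : α}
    (h : l.IsChain R) (ha : l.head? = some a) (hc : l.getLast? = some c) (huv : [u, v] <:+: l) :
    Relation.ReflTransGen R a u ∧ Relation.ReflTransGen R v c := by
  obtain ⟨p, q, rfl⟩ := huv
  constructor
  · refine reflTransGen_of_isChain (l := p ++ [u]) (h.infix ⟨[], v :: q, by simp⟩) ?_ (by simp)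
    cases p <;> simpa using ha
  · refine reflTransGen_of_isChain (l := v :: q) (h.infix ⟨p ++ [u], [], by simp⟩) rfl ?_
    simpa [List.getLast?_append, List.getLast?_cons] using hc

lemma steps_of_isChain {α : Type*} {R : α → α → Prop} (f : α → ℕ) (hf : ∀ u v, R u v → f u < f v)
    {l : List α} {a c : α} (h : l.IsChain R) (ha : l.head? = some a) (hc : l.getLast? = some c)
    (hne : a ≠ c) : (∃ u, R a u) ∧ (∃ u, R u c) ∧ f a < f c := by
  have hr := reflTransGen_of_isChain h ha hc
  obtain ⟨u, hu, h1⟩ := hr.cases_head.resolve_left hne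
  obtain ⟨v, -, hv⟩ := hr.cases_tail.resolve_left hne.symm
  have := h1.lift (p := (· ≤ ·)) f fun u v h => (hf u v h).le
  rw [Relation.reflTransGen_eq_self] at this
  exact ⟨⟨u, hu⟩, ⟨v, hv⟩, (hf _ _ hu).trans_le this⟩

lemma eq_of_isChain {α : Type*} {R : α → α → Prop} (f : α → ℕ) (hf : ∀ u v, R u v → f u < f v)
    (hR : Relator.RightUnique R) {l l' : List α} {a c : α} (h : l.IsChain R) (h' : l'.IsChain R)
    (ha : l.head? = some a) (ha' : l'.head? = some a) (hc : l.getLast? = some c)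
    (hc' : l'.getLast? = some c) : l = l' := by
  have hlt : ∀ {u v : α} {t : List α}, (u :: v :: t).IsChain R → (v :: t).getLast? = some c →
      f u < f c := fun {u v t} h hc => by
    rw [List.isChain_cons_cons] at h
    have := (reflTransGen_of_isChain h.2 rfl hc).lift (p := (· ≤ ·)) f fun u v h => (hf u v h).le
    rw [Relation.reflTransGen_eq_self] at this
    exact (hf _ _ h.1).trans_le this
  induction l generalizing a l' with
  | nil => simp at ha
  | cons y t ih =>
    obtain ⟨t', rfl⟩ := head_eq_of_head? ha'
    obtain rfl : y = a := by simpa using ha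
    rcases t with _ | ⟨z, t⟩ <;> rcases t' with _ | ⟨z', t'⟩
    · rfl
    · obtain rfl : y = c := by simpa using hc
      exact absurd (hlt h' (by simpa using hc')) (lt_irrefl _)
    · obtain rfl : y = c := by simpa using hc'
      exact absurd (hlt h (by simpa using hc)) (lt_irrefl _)
    · rw [List.isChain_cons_cons] at h h'
      obtain rfl := hR h.1 h'.1
      rw [ih h.2 h'.2 rfl rfl (by simpa using hc) (by simpa using hc')]

lemma IsLowerFilling.stripLE {a b c : Vert n} {Y : List (Vert n)}
    (h : IsLowerFilling K a b c Y) : StripLE K (a, b) (c, b) ∧ ∀ u v, [u, v] <:+: Y →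
      StripLE K (a, b) (u, b) ∧ StripLE K (v, b) (c, b) := by
  have hn : ∀ u v, Tile.delta b u v ∈ K → Next K (u, b) (v, b) :=
    fun u v h => ⟨_, h, Or.inl ⟨_, _, _, rfl, rfl, rfl⟩⟩
  exact ⟨(reflTransGen_of_isChain h.2.2 h.1 h.2.1).lift _ hn, fun u v huv =>
    (reflTransGen_of_pair_infix h.2.2 h.1 h.2.1 huv).imp (·.lift _ hn) (·.lift _ hn)⟩

lemma IsUpperFilling.stripLE {a b c : Vert n} {X : List (Vert n)}
    (h : IsUpperFilling K a b c X) : StripLE K (b, a) (b, c) ∧ ∀ u v, [u, v] <:+: X →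
      StripLE K (b, a) (b, u) ∧ StripLE K (b, v) (b, c) := by
  have hn : ∀ u v, Tile.nabla b u v ∈ K → Next K (b, u) (b, v) :=
    fun u v h => ⟨_, h, Or.inr ⟨_, _, _, rfl, rfl, rfl⟩⟩
  exact ⟨(reflTransGen_of_isChain h.2.2 h.1 h.2.1).lift _ hn, fun u v huv =>
    (reflTransGen_of_pair_infix h.2.2 h.1 h.2.1 huv).imp (·.lift _ hn) (·.lift _ hn)⟩

lemma delta_weight_lt (hK : ∀ τ ∈ K, τ.IsValid) {A u v : Vert n} (h : Tile.delta A u v ∈ K) :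
    weight u < weight v := by
  obtain ⟨i, j, h1, -⟩ := hK _ h
  exact h1.weight_lt

lemma nabla_weight_lt (hK : ∀ τ ∈ K, τ.IsValid) {A u v : Vert n} (h : Tile.nabla A u v ∈ K) :
    weight u < weight v := by
  obtain ⟨i, j, h1, -⟩ := hK _ h
  exact h1.weight_lt

/-- The lower filling between two vertices is unique. -/
lemma IsLowerFilling.unique (hξ : IsGenerators ξ) (hK : EdgeTiling ξ K) {a b c : Vert n}
    {Y Y' : List (Vert n)} (h : IsLowerFilling K a b c Y)
    (h' : IsLowerFilling K a b c Y') : Y = Y' := by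
  refine eq_of_isChain weight (fun _ _ => delta_weight_lt hK.valid) (fun u v w h1 h2 => ?_) h.2.2
    h'.2.2 h.1 h'.1 h.2.1 h'.2.1
  simpa using hK.left_unique hξ h1 h2 (A := u) (B := b) ⟨[], [], rfl⟩ ⟨[], [], rfl⟩

/-- The upper filling between two vertices is unique. -/
lemma IsUpperFilling.unique (hξ : IsGenerators ξ) (hK : EdgeTiling ξ K) {a b c : Vert n}
    {Y Y' : List (Vert n)} (h : IsUpperFilling K a b c Y)
    (h' : IsUpperFilling K a b c Y') : Y = Y' := by
  refine eq_of_isChain weight (fun _ _ => nabla_weight_lt hK.valid) (fun u v w h1 h2 => ?_) h.2.2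
    h'.2.2 h.1 h'.1 h.2.1 h'.2.1
  simpa using hK.left_unique hξ h1 h2 (A := b) (B := u) ⟨[], [v], rfl⟩ ⟨[], [w], rfl⟩

end strips

end Combi

namespace Combi

/-! ### Walking through the lenses -/

section lenses

variable {n : ℕ} {ξ : Fin n → Plane} {K : Set (Tile n)}

lemma IsHEdge.unique {A B : Vert n} {i j i' j' : Fin n} (h : IsHEdge i j A B)
    (h' : IsHEdge i' j' A B) : i = i' ∧ j = j' := by
  obtain ⟨hij, X, hi, hj, rfl, rfl⟩ := h
  obtain ⟨hij', Y, hi', hj', h1, h2⟩ := h'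
  have e1 : ∀ k, k ∈ insert i X \ insert j X ↔ k = i := fun k => by grind
  have e2 : ∀ k, k ∈ insert j X \ insert i X ↔ k = j := fun k => by grind
  rw [h1, h2] at e1 e2
  constructor
  · refine ((e1 i').1 ?_).symm
    simp only [Finset.mem_sdiff, Finset.mem_insert]
    exact ⟨by simp, fun h => h.elim hij'.ne hi'⟩
  · refine ((e2 j').1 ?_).symm
    simp only [Finset.mem_sdiff, Finset.mem_insert]
    exact ⟨by simp, fun h => h.elim hij'.ne' hj'⟩

lemma pair_infix_cons_pairwise {α : Type*} {R : α → α → Prop} {a b : α} {l : List α}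
    (h : (a :: b :: l).Pairwise R) {u v : α} (huv : [u, v] <:+: a :: b :: l) :
    (u = a ∧ v = b) ∨ R a u := by
  rcases pair_infix_cons.1 huv with h' | h'
  · exact Or.inl h'
  · exact Or.inr ((List.pairwise_cons.1 h).1 u (pair_infix_mem h').1)

/-- The first edges of the two boundary paths of a lens. -/
lemma lens_first_edges {U L : List (Vert n)} (h : (Tile.lens U L).IsValid) :
    ∃ l m m' i i' j j', [l, m] <:+: U ∧ [l, m'] <:+: L ∧ IsHEdge i i' l m ∧ IsHEdge j j' l m' ∧
      i < j ∧ i' < j' ∧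
      (∀ A B, [A, B] <:+: U → (A = l ∧ B = m) ∨ weight l < weight A) ∧
      (∀ A B, [A, B] <:+: L → (A = l ∧ B = m') ∨ weight l < weight A) ∧
      U.head? = some l ∧ L.head? = some l := by
  have hw : ∀ A B, (A, B) ∈ (Tile.lens U L).edges → weight A < weight B :=
    fun A B hh => h.weight_lt hh
  obtain ⟨X, a, c, I, J, hI, hI0, hIX, rfl, hJ, hJ0, hJX, rfl⟩ := isValid_lens_iff.1 h
  obtain ⟨i, I, rfl⟩ := List.exists_cons_of_ne_nil hI0
  obtain ⟨j, J, rfl⟩ := List.exists_cons_of_ne_nil hJ0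
  have hac : a < c := (List.pairwise_cons.1 hI).1 c (by simp)
  have hl : (insert a (insert c X)).erase c = insert a X := by grind
  have e1 : [insert a X, insert i X] <:+: List.map (fun i => insert i X) (a :: (i :: I ++ [c])) :=
    ⟨[], _, rfl⟩
  have e2 : [insert a X, (insert a (insert c X)).erase j] <:+:
      List.map (fun j => (insert a (insert c X)).erase j) (c :: (j :: J ++ [a])) := by
    rw [← hl]; exact ⟨[], _, rfl⟩
  obtain ⟨p, q, hpq, h1, h2, hh⟩ := lens_upper_edge hI hIX e1
  obtain ⟨p', q', hpq', h1', h2', hh'⟩ := lens_lower_edge hJ hJX e2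
  have hpa : IsHEdge a i (insert a X) (insert i X) :=
    ⟨(List.pairwise_cons.1 hI).1 i (by simp), X, hIX a (by simp), hIX i (by simp), rfl, rfl⟩
  have hpj : IsHEdge j c (insert a X) ((insert a (insert c X)).erase j) := by
    rw [← hl]
    exact isHEdge_erase ((List.pairwise_cons.1 hJ).1 j (by simp)) (hJX c (by simp))
      (hJX j (by simp))
  refine ⟨insert a X, insert i X, _, a, i, j, c, e1, e2, hpa, hpj, ?_, ?_, ?_, ?_, rfl,
    congrArg some hl⟩
  · exact (List.pairwise_cons.1 (List.pairwise_cons.1 hJ).2).1 a (by simp)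
  · exact (List.pairwise_cons.1 (List.pairwise_cons.1 hI).2).1 c (by simp)
  · intro A B hAB
    exact pair_infix_cons_pairwise (pairwise_weight_lt fun A B h => hw A B (Or.inl h)) hAB
  · intro A B hAB
    have := pair_infix_cons_pairwise (pairwise_weight_lt fun A B h => hw A B (Or.inr h)) hAB
    simpa only [hl] using this

lemma lens_edge_isHEdge {U L : List (Vert n)} (h : (Tile.lens U L).IsValid)
    {A B : Vert n} (hAB : (A, B) ∈ (Tile.lens U L).edges) : ∃ i j, IsHEdge i j A B := by
  rcases hAB with hAB | hAB
  · rcases h.of_lpath (A := A) (B := B) hAB with ⟨C, h, -⟩ | ⟨C, h, -⟩ | ⟨C, h, -⟩ |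
      ⟨U, L, -, -, h⟩
    · cases h
    · cases h
    · cases h
    · exact h
  · rcases h.of_rpath (A := A) (B := B) hAB with ⟨C, h, -⟩ | ⟨C, h, -⟩ | ⟨C, h, -⟩ |
      ⟨U, L, -, -, h⟩
    · cases h
    · cases h
    · cases h
    · exact h

lemma isHEdge_ne_leftBoundaryEdge {A B : Vert n} (h : ∃ i j, IsHEdge i j A B)
    (i : Fin n) : (A, B) ≠ leftBoundaryEdge i := by
  intro e
  obtain ⟨j, k, h⟩ := h
  have := (isVEdge_leftBoundaryEdge i).not_isHEdge (j := j) (k := k)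
  rw [← e] at this
  exact this h

lemma isHEdge_ne_rightBoundaryEdge {A B : Vert n} (h : ∃ i j, IsHEdge i j A B)
    (i : Fin n) : (A, B) ≠ rightBoundaryEdge i := by
  intro e
  obtain ⟨j, k, h⟩ := h
  have := (isVEdge_rightBoundaryEdge i).not_isHEdge (j := j) (k := k)
  rw [← e] at this
  exact this h

lemma EdgeTiling.tile_above (hK : EdgeTiling ξ K) {τ : Tile n} (hτ : τ ∈ K)
    {A B : Vert n} (h : [A, B] <:+: τ.lpath) (hH : ∃ i j, IsHEdge i j A B) :
    (∃ X, Tile.delta X A B ∈ K) ∨ ∃ U L, Tile.lens U L ∈ K ∧ [A, B] <:+: L := by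
  rcases hK.left_exists τ hτ A B h with ⟨i, hi⟩ | ⟨τ', hτ', h'⟩
  · exact absurd hi (isHEdge_ne_leftBoundaryEdge hH i)
  · obtain ⟨i, j, hij⟩ := hH
    rcases (hK.valid τ' hτ').of_rpath h' with ⟨C, rfl, k, hh⟩ | ⟨C, rfl, k, hh⟩ | ⟨X, rfl, -⟩ |
      ⟨U, L, rfl, hL, -⟩
    · exact absurd hij hh.not_isHEdge
    · exact absurd hij hh.not_isHEdge
    · exact Or.inl ⟨X, hτ'⟩
    · exact Or.inr ⟨U, L, hτ', hL⟩

lemma EdgeTiling.tile_below (hK : EdgeTiling ξ K) {τ : Tile n} (hτ : τ ∈ K)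
    {A B : Vert n} (h : [A, B] <:+: τ.rpath) (hH : ∃ i j, IsHEdge i j A B) :
    (∃ X, Tile.nabla X A B ∈ K) ∨ ∃ U L, Tile.lens U L ∈ K ∧ [A, B] <:+: U := by
  rcases hK.right_exists τ hτ A B h with ⟨i, hi⟩ | ⟨τ', hτ', h'⟩
  · exact absurd hi (isHEdge_ne_rightBoundaryEdge hH i)
  · obtain ⟨i, j, hij⟩ := hH
    rcases (hK.valid τ' hτ').of_lpath h' with ⟨C, rfl, k, hh⟩ | ⟨C, rfl, k, hh⟩ | ⟨X, rfl, -⟩ |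
      ⟨U, L, rfl, hL, -⟩
    · exact absurd hij hh.not_isHEdge
    · exact absurd hij hh.not_isHEdge
    · exact Or.inl ⟨X, hτ'⟩
    · exact Or.inr ⟨U, L, hτ', hL⟩

/-- Induction from the `Δ`-tiles downwards through the H-edges. -/
lemma EdgeTiling.induction_above (hK : EdgeTiling ξ K) {p : Tile n → Prop}
    (hp : ∀ A B C, Tile.delta A B C ∈ K → p (Tile.delta A B C))
    (hs : ∀ τ ∈ K, ∀ τ' ∈ K, ∀ A B, (∃ i j, IsHEdge i j A B) → [A, B] <:+: τ.lpath →
      [A, B] <:+: τ'.rpath → p τ' → p τ) : ∀ τ ∈ K, p τ := by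
  have hlens : ∀ w, ∀ U L, Tile.lens U L ∈ K → ∀ l m i i', [l, m] <:+: U → IsHEdge i i' l m →
      (∀ A B, [A, B] <:+: U → (A = l ∧ B = m) ∨ weight l < weight A) →
      weight l * (n + 1) + i = w → p (Tile.lens U L) := by
    intro w
    induction w using Nat.strong_induction_on with
    | _ w ih =>
      intro U L hUL l m i i' hlm hi hU hw
      rcases hK.tile_above hUL (show [l, m] <:+: (Tile.lens U L).lpath from hlm) ⟨i, i', hi⟩ with
        ⟨X, hX⟩ | ⟨U', L', hUL', hL'⟩
      · exact hs _ hUL _ hX l m ⟨i, i', hi⟩ hlm ⟨[], [X], rfl⟩ (hp _ _ _ hX)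
      · refine hs _ hUL _ hUL' l m ⟨i, i', hi⟩ hlm hL' ?_
        obtain ⟨l1, m1, m1', j, j', k, k', h1, h2, h3, h4, h5, h6, h7, h8, -⟩ :=
          lens_first_edges (hK.valid _ hUL')
        refine ih _ ?_ U' L' hUL' l1 m1 j j' h1 h3 h7 rfl
        rcases h8 l m hL' with ⟨rfl, rfl⟩ | hlt
        · have := (hi.unique h4).1
          rw [← hw]
          have : j.val < i.val := this ▸ h5
          omega
        · rw [← hw]
          have := j.isLt
          nlinarith
  have hl : ∀ U L, Tile.lens U L ∈ K → p (Tile.lens U L) := by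
    intro U L h
    obtain ⟨l1, m1, m1', j, j', k, k', h1, h2, h3, h4, h5, h6, h7, h8, -⟩ :=
      lens_first_edges (hK.valid _ h)
    exact hlens _ U L h l1 m1 j j' h1 h3 h7 rfl
  rintro (⟨A, B, C⟩ | ⟨A, B, C⟩ | ⟨U, L⟩) hτ
  · exact hp _ _ _ hτ
  · have hB : [B, C] <:+: (Tile.nabla A B C).lpath := ⟨[A], [], rfl⟩
    obtain ⟨i, j, hH, -⟩ := hK.valid _ hτ
    rcases hK.tile_above hτ hB ⟨i, j, hH⟩ with ⟨X, hX⟩ | ⟨U', L', hUL', hL'⟩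
    · exact hs _ hτ _ hX B C ⟨i, j, hH⟩ hB ⟨[], [X], rfl⟩ (hp _ _ _ hX)
    · exact hs _ hτ _ hUL' B C ⟨i, j, hH⟩ hB hL' (hl _ _ hUL')
  · exact hl U L hτ

/-- Induction from the `∇`-tiles upwards through the H-edges. -/
lemma EdgeTiling.induction_below (hK : EdgeTiling ξ K) {p : Tile n → Prop}
    (hp : ∀ A B C, Tile.nabla A B C ∈ K → p (Tile.nabla A B C))
    (hs : ∀ τ ∈ K, ∀ τ' ∈ K, ∀ A B, (∃ i j, IsHEdge i j A B) → [A, B] <:+: τ.rpath →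
      [A, B] <:+: τ'.lpath → p τ' → p τ) : ∀ τ ∈ K, p τ := by
  have hlens : ∀ w, ∀ U L, Tile.lens U L ∈ K → ∀ l m i i', [l, m] <:+: L → IsHEdge i i' l m →
      (∀ A B, [A, B] <:+: L → (A = l ∧ B = m) ∨ weight l < weight A) →
      weight l * (n + 1) + (n - i) = w → p (Tile.lens U L) := by
    intro w
    induction w using Nat.strong_induction_on with
    | _ w ih =>
      intro U L hUL l m i i' hlm hi hU hw
      rcases hK.tile_below hUL (show [l, m] <:+: (Tile.lens U L).rpath from hlm) ⟨i, i', hi⟩ with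
        ⟨X, hX⟩ | ⟨U', L', hUL', hL'⟩
      · exact hs _ hUL _ hX l m ⟨i, i', hi⟩ hlm ⟨[X], [], rfl⟩ (hp _ _ _ hX)
      · refine hs _ hUL _ hUL' l m ⟨i, i', hi⟩ hlm hL' ?_
        obtain ⟨l1, m1, m1', j, j', k, k', h1, h2, h3, h4, h5, h6, h7, h8, -⟩ :=
          lens_first_edges (hK.valid _ hUL')
        refine ih _ ?_ U' L' hUL' l1 m1' k k' h2 h4 h8 rfl
        have := k.isLt
        rcases h7 l m hL' with ⟨rfl, rfl⟩ | hlt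
        · have := (hi.unique h3).1
          rw [← hw]
          have : i.val < k.val := this ▸ h5
          omega
        · rw [← hw]
          have : n - k.val ≤ n := Nat.sub_le _ _
          nlinarith
  have hl : ∀ U L, Tile.lens U L ∈ K → p (Tile.lens U L) := by
    intro U L h
    obtain ⟨l1, m1, m1', j, j', k, k', h1, h2, h3, h4, h5, h6, h7, h8, -⟩ :=
      lens_first_edges (hK.valid _ h)
    exact hlens _ U L h l1 m1' k k' h2 h4 h8 rfl
  rintro (⟨A, B, C⟩ | ⟨A, B, C⟩ | ⟨U, L⟩) hτ
  · have hB : [B, C] <:+: (Tile.delta A B C).rpath := ⟨[], [A], rfl⟩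
    obtain ⟨i, j, hH, -⟩ := hK.valid _ hτ
    rcases hK.tile_below hτ hB ⟨i, j, hH⟩ with ⟨X, hX⟩ | ⟨U', L', hUL', hL'⟩
    · exact hs _ hτ _ hX B C ⟨i, j, hH⟩ hB ⟨[X], [], rfl⟩ (hp _ _ _ hX)
    · exact hs _ hτ _ hUL' B C ⟨i, j, hH⟩ hB hL' (hl _ _ hUL')
  · exact hp _ _ _ hτ
  · exact hl U L hτ

end lenses

/-! ### Legal paths -/

section legal

variable {n : ℕ} {ξ : Fin n → Plane} {K : Set (Tile n)}

/-- The final segments, starting with the forward edge from `a` to `b`, of legal paths. -/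
inductive Leg (K : Set (Tile n)) : Vert n → Vert n → List (Vert n) → Prop
  | base {a} (h : IsVEdgeOf K a Finset.univ) : Leg K a Finset.univ [a, Finset.univ]
  | up {a b c P} (h : IsVEdgeOf K a b) (hP : Leg K b c P) : Leg K a b (a :: P)
  | turn {a b y z P} (h : IsVEdgeOf K a b) (h' : IsVEdgeOf K y b) (hay : weight a < weight y)
      (hbz : weight b < weight z) (hP : Leg K y z P) : Leg K a b (a :: b :: P)

lemma Leg.shape {a b : Vert n} {P : List (Vert n)} (h : Leg K a b P) :
    IsVEdgeOf K a b ∧ ∃ t, P = a :: b :: t := by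
  induction h with
  | base h => exact ⟨h, [], rfl⟩
  | up h hP ih => obtain ⟨-, t, rfl⟩ := ih; exact ⟨h, _, rfl⟩
  | turn h h' hay hbz hP ih => exact ⟨h, _, rfl⟩

lemma IsVEdgeOf.card_eq {A B : Vert n} (h : IsVEdgeOf K A B) : B.card = A.card + 1 := by
  obtain ⟨-, i, h⟩ := h
  exact h.card_eq

lemma IsVEdgeOf.weight_lt {A B : Vert n} (h : IsVEdgeOf K A B) : weight A < weight B := by
  obtain ⟨-, i, h⟩ := h
  exact h.weight_lt

lemma exists_of_common_top {a b c : Vert n} (ha : ∃ i, IsVEdge i a b)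
    (hc : ∃ i, IsVEdge i c b) (h : weight a < weight c) :
    ∃ i j, j < i ∧ IsVEdge i a b ∧ IsVEdge j c b := by
  obtain ⟨i, hi⟩ := ha
  obtain ⟨j, hj⟩ := hc
  refine ⟨i, j, ?_, hi, hj⟩
  have h1 := weight_insert hi.1
  have h2 := weight_insert hj.1
  rw [← hi.2] at h1
  rw [← hj.2] at h2
  exact Fin.lt_def.2 (by omega)

lemma exists_of_common_bottom {a b c : Vert n} (ha : ∃ i, IsVEdge i b a)
    (hc : ∃ i, IsVEdge i b c) (h : weight a < weight c) :
    ∃ i j, i < j ∧ IsVEdge i b a ∧ IsVEdge j b c := by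
  obtain ⟨i, hi⟩ := ha
  obtain ⟨j, hj⟩ := hc
  refine ⟨i, j, ?_, hi, hj⟩
  have h1 := weight_insert hi.1
  have h2 := weight_insert hj.1
  rw [← hi.2] at h1
  rw [← hj.2] at h2
  exact Fin.lt_def.2 (by omega)

lemma weight_lt_of_common_top {a b c : Vert n} {i j : Fin n} (ha : IsVEdge i a b)
    (hc : IsVEdge j c b) (h : j < i) : weight a < weight c := by
  have h1 := weight_insert ha.1
  have h2 := weight_insert hc.1
  rw [← ha.2] at h1
  rw [← hc.2] at h2
  have := Fin.lt_def.1 h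
  omega

lemma weight_lt_of_common_bottom {a b c : Vert n} {i j : Fin n} (ha : IsVEdge i b a)
    (hc : IsVEdge j b c) (h : i < j) : weight a < weight c := by
  have h1 := weight_insert ha.1
  have h2 := weight_insert hc.1
  rw [← ha.2] at h1
  rw [← hc.2] at h2
  have := Fin.lt_def.1 h
  omega

lemma triple_infix_cons {α : Type*} {x y z a b c : α} {l : List α} :
    [x, y, z] <:+: a :: b :: c :: l ↔
      (x = a ∧ y = b ∧ z = c) ∨ [x, y, z] <:+: b :: c :: l := by
  rw [List.infix_cons_iff]
  simp [List.cons_prefix_cons]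

lemma not_triple_infix_pair {α : Type*} {x y z a b : α} : ¬ [x, y, z] <:+: [a, b] := fun h => by
  simpa using h.length_le

lemma Leg.isLegal {a b : Vert n} {P : List (Vert n)} (h : Leg K a b P) :
    P.getLast? = some Finset.univ ∧ P.IsChain (fun A B => IsVEdgeOf K A B ∨ IsVEdgeOf K B A) ∧
    (∀ a b c, [a, b, c] <:+: P → b.card < a.card → b.card < c.card) ∧
    (∀ a b c, [a, b, c] <:+: P → a.card = c.card → a.card ≠ b.card →
    (∃ i j, i < j ∧ IsVEdge i b a ∧ IsVEdge j b c) ∨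
    (∃ i j, j < i ∧ IsVEdge i a b ∧ IsVEdge j c b)) := by
  induction h with
  | base h => grind
  | @up a b c P h hP ih =>
    obtain ⟨h1, t, rfl⟩ := hP.shape
    obtain ⟨i1, i2, i3, i4⟩ := ih
    have c1 := h.card_eq
    have c2 := h1.card_eq
    refine ⟨by simpa using i1, List.isChain_cons_cons.2 ⟨Or.inl h, i2⟩, ?_, ?_⟩
    · intro x y z hx
      rcases triple_infix_cons.1 hx with ⟨rfl, rfl, rfl⟩ | hx
      · omega
      · exact i3 x y z hx
    · intro x y z hx
      rcases triple_infix_cons.1 hx with ⟨rfl, rfl, rfl⟩ | hx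
      · omega
      · exact i4 x y z hx
  | @turn a b y z P h h' hay hbz hP ih =>
    obtain ⟨h1, t, rfl⟩ := hP.shape
    obtain ⟨i1, i2, i3, i4⟩ := ih
    have c1 := h.card_eq
    have c2 := h1.card_eq
    have c3 := h'.card_eq
    refine ⟨by simpa using i1, List.isChain_cons_cons.2 ⟨Or.inl h,
      List.isChain_cons_cons.2 ⟨Or.inr h', i2⟩⟩, ?_, ?_⟩
    · intro x' y' z' hx
      rcases triple_infix_cons.1 hx with ⟨rfl, rfl, rfl⟩ | hx
      · omega
      · rcases triple_infix_cons.1 hx with ⟨rfl, rfl, rfl⟩ | hx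
        · omega
        · exact i3 _ _ _ hx
    · intro x' y' z' hx
      rcases triple_infix_cons.1 hx with ⟨rfl, rfl, rfl⟩ | hx
      · exact fun _ _ => Or.inr (exists_of_common_top h.2 h'.2 hay)
      · rcases triple_infix_cons.1 hx with ⟨rfl, rfl, rfl⟩ | hx
        · exact fun _ _ => Or.inl (exists_of_common_bottom h'.2 h1.2 hbz)
        · exact i4 _ _ _ hx

lemma Leg.isLegalPath {b : Vert n} {P : List (Vert n)} (h : Leg K ∅ b P) :
    IsLegalPath K P := by
  obtain ⟨h1, h2, h3, h4⟩ := h.isLegal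
  obtain ⟨-, t, rfl⟩ := h.shape
  exact ⟨rfl, h1, h2, h3, h4⟩

lemma leg_of_legal (m : ℕ) : ∀ (a b : Vert n) (t : List (Vert n)), t.length = m →
    IsVEdgeOf K a b → (a :: b :: t).getLast? = some Finset.univ →
    (a :: b :: t).IsChain (fun A B => IsVEdgeOf K A B ∨ IsVEdgeOf K B A) →
    (∀ x y z, [x, y, z] <:+: a :: b :: t → y.card < x.card → y.card < z.card) →
    (∀ x y z, [x, y, z] <:+: a :: b :: t → x.card = z.card → x.card ≠ y.card →
    (∃ i j, i < j ∧ IsVEdge i y x ∧ IsVEdge j y z) ∨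
    (∃ i j, j < i ∧ IsVEdge i x y ∧ IsVEdge j z y)) → Leg K a b (a :: b :: t) := by
  induction m using Nat.strong_induction_on with
  | _ m ih =>
    intro a b t ht hab hlast hchain hfor hzig
    have inf2 : ∀ {x y z : Vert n} {l : List (Vert n)} {u}, [x, y, z] <:+: l →
        [x, y, z] <:+: u :: l := fun h => List.infix_cons_iff.2 (Or.inr h)
    have cab := hab.card_eq
    rcases t with _ | ⟨c, t⟩
    · simp only [List.getLast?_cons_cons, List.getLast?_singleton, Option.some.injEq] at hlast
      subst hlast
      exact .base hab
    · obtain ⟨-, hch2⟩ := List.isChain_cons_cons.1 hchain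
      obtain ⟨hbc, hch3⟩ := List.isChain_cons_cons.1 hch2
      rcases hbc with hbc | hcb
      · exact .up hab (ih t.length (by simp at ht; omega) b c t rfl hbc (by simpa using hlast) hch2
          (fun x y z h => hfor x y z (inf2 h)) (fun x y z h => hzig x y z (inf2 h)))
      · have ccb := hcb.card_eq
        rcases t with _ | ⟨d, t⟩
        · simp only [List.getLast?_cons_cons, List.getLast?_singleton, Option.some.injEq] at hlast
          subst hlast
          have := Finset.card_le_univ b
          rw [Finset.card_univ] at ccb
          omega
        · have hbcd : [b, c, d] <:+: a :: b :: c :: d :: t := ⟨[a], t, rfl⟩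
          have habc : [a, b, c] <:+: a :: b :: c :: d :: t := ⟨[], d :: t, rfl⟩
          have h1 := hfor b c d hbcd (by omega)
          obtain ⟨hcd, -⟩ := List.isChain_cons_cons.1 hch3
          replace hcd : IsVEdgeOf K c d := hcd.resolve_right fun h => by
            have := h.card_eq
            omega
          have ccd := hcd.card_eq
          refine .turn hab hcb ?_ ?_ (ih t.length (by simp at ht; omega) c d t rfl hcd
            (by simpa using hlast) hch3 (fun x y z h => hfor x y z (inf2 (inf2 h)))
            (fun x y z h => hzig x y z (inf2 (inf2 h))))
          · rcases hzig a b c habc (by omega) (by omega) with ⟨i, j, hij, hi, hj⟩ |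
              ⟨i, j, hij, hi, hj⟩
            · have := hi.card_eq
              omega
            · exact weight_lt_of_common_top hi hj hij
          · rcases hzig b c d hbcd (by omega) (by omega) with ⟨i, j, hij, hi, hj⟩ |
              ⟨i, j, hij, hi, hj⟩
            · exact weight_lt_of_common_bottom hi hj hij
            · have := hi.card_eq
              omega

lemma IsLegalPath.leg (hn : 1 ≤ n) {P : List (Vert n)} (h : IsLegalPath K P) :
    ∃ b, Leg K ∅ b P := by
  obtain ⟨P', rfl⟩ := head_eq_of_head? h.head
  rcases P' with _ | ⟨b, t⟩
  · have := h.last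
    simp only [List.getLast?_singleton, Option.some.injEq] at this
    have h0 := congrArg Finset.card this
    simp at h0
    omega
  · refine ⟨b, leg_of_legal _ ∅ b t rfl ?_ h.last h.chain h.forward h.zigzag⟩
    refine (List.isChain_cons_cons.1 h.chain).1.resolve_right fun h' => ?_
    have := h'.card_eq
    simp at this

/-- The edge from `A` to `B` belongs to the path, in one of the two directions. -/
def InPath (P : List (Vert n)) (e : Edge n) : Prop :=
  [e.1, e.2] <:+: P ∨ [e.2, e.1] <:+: P

lemma Leg.turn_stripLE (hξ : IsGenerators ξ) (hK : EdgeTiling ξ K) {a b y z : Vert n}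
    (h : IsVEdgeOf K a b) (h' : IsVEdgeOf K y b) (h'' : IsVEdgeOf K y z)
    (hay : weight a < weight y) (hbz : weight b < weight z) :
    StripLE K (a, b) (y, b) ∧ StripLE K (y, b) (y, z) := by
  have c1 := h.card_eq
  have c2 := h'.card_eq
  constructor
  · refine (hK.stripLE_total hξ (e := (a, b)) (e' := (y, b)) h h' (by simp; omega)).resolve_right
      fun h => ?_
    have := (StripLE.card_weight hK.valid h).2.1
    simp only at this
    omega
  · refine (hK.stripLE_total hξ (e := (y, b)) (e' := (y, z)) h' h'' rfl).resolve_right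
      fun h => ?_
    have := (StripLE.card_weight hK.valid h).2.2
    simp only at this
    omega

/-- All edges of a final segment of a legal path lie on the right of its first edge or in a
higher strip. -/
lemma Leg.stripLE_of_inPath (hξ : IsGenerators ξ) (hK : EdgeTiling ξ K) {a b : Vert n}
    {P : List (Vert n)} (h : Leg K a b P) {e : Edge n}
    (he : InPath P e) (hc : e.1.card < e.2.card) :
    IsVEdgeOf K e.1 e.2 ∧ (a.card < e.1.card ∨ StripLE K (a, b) e) := by
  obtain ⟨A, B⟩ := e
  simp only at hc
  induction h with
  | base h =>
    have c := h.card_eq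
    rcases he with he | he
    · rcases pair_infix_cons.1 he with ⟨rfl, rfl⟩ | he
      · exact ⟨h, Or.inr .refl⟩
      · exact absurd he not_pair_infix
    · rcases pair_infix_cons.1 he with ⟨rfl, rfl⟩ | he
      · dsimp only at *; omega
      · exact absurd he not_pair_infix
  | @up a b c P h hP ih =>
    obtain ⟨h1, t, rfl⟩ := hP.shape
    have cc := h.card_eq
    have key : InPath (b :: c :: t) (A, B) → IsVEdgeOf K A B ∧
        (a.card < A.card ∨ StripLE K (a, b) (A, B)) := fun h' => by
      obtain ⟨i1, i2⟩ := ih h'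
      refine ⟨i1, Or.inl ?_⟩
      rcases i2 with i2 | i2
      · simp only at i2 ⊢; omega
      · have := (StripLE.card_weight hK.valid i2).1
        simp only at this ⊢; omega
    rcases he with he | he
    · rcases pair_infix_cons.1 he with ⟨rfl, rfl⟩ | he
      · exact ⟨h, Or.inr .refl⟩
      · exact key (Or.inl he)
    · rcases pair_infix_cons.1 he with ⟨rfl, rfl⟩ | he
      · dsimp only at *; omega
      · exact key (Or.inr he)
  | @turn a b y z P h h' hay hbz hP ih =>
    obtain ⟨h1, t, rfl⟩ := hP.shape
    have cc := h.card_eq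
    have cc' := h'.card_eq
    obtain ⟨s1, s2⟩ := Leg.turn_stripLE hξ hK h h' h1 hay hbz
    have key : InPath (y :: z :: t) (A, B) → IsVEdgeOf K A B ∧
        (a.card < A.card ∨ StripLE K (a, b) (A, B)) := fun h' => by
      obtain ⟨i1, i2⟩ := ih h'
      refine ⟨i1, ?_⟩
      rcases i2 with i2 | i2
      · left; simp only at i2 ⊢; omega
      · right; exact (s1.trans s2).trans i2
    rcases he with he | he
    · rcases pair_infix_cons.1 he with ⟨rfl, rfl⟩ | he
      · exact ⟨h, Or.inr .refl⟩
      · rcases pair_infix_cons.1 he with ⟨rfl, rfl⟩ | he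
        · dsimp only at *; omega
        · exact key (Or.inl he)
    · rcases pair_infix_cons.1 he with ⟨rfl, rfl⟩ | he
      · dsimp only at *; omega
      · rcases pair_infix_cons.1 he with ⟨rfl, rfl⟩ | he
        · exact ⟨h', Or.inr s1⟩
        · exact key (Or.inr he)

end legal

end Combi

namespace Combi

open Filter Topology

/-! ### Winding numbers -/

section angle

/-- A point of the plane as a complex number. -/
def toComplex (z : Plane) : ℂ := ⟨z 0, z 1⟩

/-- The angle, in `(-π, π]`, under which the directed segment from `P` to `Q` is seen from `z`. -/
noncomputable def ang (P Q z : Plane) : ℝ :=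
  Complex.arg (toComplex (Q - z) * (starRingEnd ℂ) (toComplex (P - z)))

lemma ang_re (P Q z : Plane) : (toComplex (Q - z) * (starRingEnd ℂ) (toComplex (P - z))).re =
    (Q 0 - z 0) * (P 0 - z 0) + (Q 1 - z 1) * (P 1 - z 1) := by
  simp [toComplex, Complex.mul_re]; ring

lemma ang_im (P Q z : Plane) : (toComplex (Q - z) * (starRingEnd ℂ) (toComplex (P - z))).im =
    -side P Q z := by
  simp [toComplex, Complex.mul_im, side]; ring

lemma continuous_ang_aux (P Q : Plane) :
    Continuous (fun z => toComplex (Q - z) * (starRingEnd ℂ) (toComplex (P - z))) := by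
  have h : ∀ P : Plane, Continuous (fun z => toComplex (P - z)) := by
    intro P
    have : (fun z => toComplex (P - z)) =
        fun z : Plane => ((P 0 - z 0 : ℝ) : ℂ) + ((P 1 - z 1 : ℝ) : ℂ) * Complex.I := by
      ext z
      apply Complex.ext <;> simp [toComplex]
    rw [this]
    fun_prop
  exact (h Q).mul (Complex.continuous_conj.comp (h P))

lemma plane_ext {x y : Plane} (h0 : x 0 = y 0) (h1 : x 1 = y 1) : x = y := by
  ext i
  fin_cases i
  · exact h0
  · exact h1

lemma mem_slitPlane_of_notMem_segment {P Q z : Plane} (h : z ∉ segment ℝ P Q) :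
    toComplex (Q - z) * (starRingEnd ℂ) (toComplex (P - z)) ∈ Complex.slitPlane := by
  rw [Complex.mem_slitPlane_iff, ang_re, ang_im]
  by_contra hn
  push Not at hn
  obtain ⟨h1, h2⟩ := hn
  rw [neg_eq_zero] at h2
  apply h
  by_cases hP : (P 0 - z 0) ^ 2 + (P 1 - z 1) ^ 2 = 0
  · have e0 : P 0 - z 0 = 0 := by nlinarith [sq_nonneg (P 0 - z 0), sq_nonneg (P 1 - z 1)]
    have e1 : P 1 - z 1 = 0 := by nlinarith [sq_nonneg (P 0 - z 0), sq_nonneg (P 1 - z 1)]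
    rw [plane_ext (x := z) (y := P) (by linarith) (by linarith)]
    exact left_mem_segment ℝ P Q
  · have hpos : 0 < (P 0 - z 0) ^ 2 + (P 1 - z 1) ^ 2 := by positivity
    set d := (P 0 - z 0) ^ 2 + (P 1 - z 1) ^ 2 with hd
    set r := (Q 0 - z 0) * (P 0 - z 0) + (Q 1 - z 1) * (P 1 - z 1) with hr
    have hc : (P 0 - z 0) * (Q 1 - z 1) = (P 1 - z 1) * (Q 0 - z 0) := by
      simp only [side] at h2; linarith
    have hdr : 0 < d - r := by linarith
    have e0 : (-r) * (P 0 - z 0) + d * (Q 0 - z 0) = 0 := by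
      rw [hr, hd]; linear_combination (-(P 1 - z 1)) * hc
    have e1 : (-r) * (P 1 - z 1) + d * (Q 1 - z 1) = 0 := by
      rw [hr, hd]; linear_combination (P 0 - z 0) * hc
    refine ⟨-r / (d - r), d / (d - r), div_nonneg (by linarith) hdr.le, by positivity, ?_, ?_⟩
    · field_simp; ring
    · refine plane_ext ?_ ?_
      · simp only [PiLp.add_apply, PiLp.smul_apply, smul_eq_mul]
        field_simp
        linarith
      · simp only [PiLp.add_apply, PiLp.smul_apply, smul_eq_mul]
        field_simp
        linarith

lemma continuousAt_ang {P Q z : Plane} (h : z ∉ segment ℝ P Q) : ContinuousAt (ang P Q) z :=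
  ContinuousAt.comp (f := fun z => toComplex (Q - z) * (starRingEnd ℂ) (toComplex (P - z)))
    (g := Complex.arg) (Complex.continuousAt_arg (mem_slitPlane_of_notMem_segment h))
    (continuous_ang_aux P Q).continuousAt

lemma toComplex_ne_zero {P z : Plane} (h : z ≠ P) : toComplex (P - z) ≠ 0 := by
  intro e
  have h0 := congrArg Complex.re e
  have h1 := congrArg Complex.im e
  simp only [toComplex, PiLp.sub_apply, Complex.zero_re, Complex.zero_im] at h0 h1
  exact h (plane_ext (by linarith) (by linarith))

lemma ang_coe {P Q z : Plane} (hP : z ≠ P) (hQ : z ≠ Q) :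
    (ang P Q z : Real.Angle) =
      ((toComplex (Q - z)).arg : Real.Angle) - ((toComplex (P - z)).arg : Real.Angle) := by
  rw [ang, Complex.arg_mul_coe_angle (toComplex_ne_zero hQ)
    ((map_ne_zero _).2 (toComplex_ne_zero hP)), Complex.arg_conj_coe_angle, ← sub_eq_add_neg]

/-- In a half-plane, angles are differences of a function of the points. -/
lemma ang_eq_sub {P Q z : Plane} {u : ℂ} (hP : 0 < (toComplex (P - z) * u).re)
    (hQ : 0 < (toComplex (Q - z) * u).re) :
    ang P Q z = (toComplex (Q - z) * u).arg - (toComplex (P - z) * u).arg := by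
  have hu : u ≠ 0 := by rintro rfl; simp at hP
  have e : toComplex (Q - z) * (starRingEnd ℂ) (toComplex (P - z)) * ((Complex.normSq u : ℝ) : ℂ) =
      (toComplex (Q - z) * u) * (starRingEnd ℂ) (toComplex (P - z) * u) := by
    rw [map_mul, ← Complex.mul_conj]; ring
  have hpos : 0 < Complex.normSq u := Complex.normSq_pos.2 hu
  rw [ang, ← Complex.arg_mul_real hpos, e]
  have h1 := Complex.abs_arg_lt_pi_div_two_iff.2 (Or.inl hP)
  have h2 := Complex.abs_arg_lt_pi_div_two_iff.2 (Or.inl hQ)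
  rw [abs_lt] at h1 h2
  have h3 : (starRingEnd ℂ (toComplex (P - z) * u)).arg = -(toComplex (P - z) * u).arg := by
    rw [Complex.arg_conj, if_neg]
    intro h
    linarith [Real.pi_pos]
  rw [(Complex.arg_mul_eq_add_arg_iff ?_ ?_).2, h3, ← sub_eq_add_neg]
  · rw [h3]
    constructor <;> linarith
  · rintro h; rw [h] at hQ; simp at hQ
  · rw [map_ne_zero]; rintro h; rw [h] at hP; simp at hP

lemma pathSum_sub {α G : Type*} [AddCommGroup G] (g : α → G) {l : List α} {a b : α}
    (ha : l.head? = some a) (hb : l.getLast? = some b) :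
    pathSum (fun x y => g y - g x) l = g b - g a := by
  induction l generalizing a with
  | nil => simp at ha
  | cons x l ih =>
    simp only [List.head?_cons, Option.some.injEq] at ha
    subst ha
    rcases l with _ | ⟨y, l⟩
    · simp only [List.getLast?_singleton, Option.some.injEq] at hb
      simp [hb]
    · rw [pathSum_cons_cons, ih rfl (by simpa using hb)]
      abel

lemma pathSum_congr {α G : Type*} [AddCommGroup G] {φ ψ : α → α → G} {l : List α}
    (h : ∀ a b, [a, b] <:+: l → φ a b = ψ a b) : pathSum φ l = pathSum ψ l := by
  induction l with
  | nil => rfl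
  | cons x l ih =>
    rcases l with _ | ⟨y, l⟩
    · rfl
    · rw [pathSum_cons_cons, pathSum_cons_cons, h x y (pair_infix_cons.2 (Or.inl ⟨rfl, rfl⟩)),
        ih fun a b hab => h a b (pair_infix_cons.2 (Or.inr hab))]

lemma map_pathSum {α G H : Type*} [AddCommGroup G] [AddCommGroup H] (f : G →+ H) (φ : α → α → G)
    (l : List α) : f (pathSum φ l) = pathSum (fun a b => f (φ a b)) l := by
  induction l with
  | nil => simp
  | cons x l ih =>
    rcases l with _ | ⟨y, l⟩
    · simp
    · rw [pathSum_cons_cons, pathSum_cons_cons, map_add, ih]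

lemma sum_leftBoundaryEdge_sub {n : ℕ} {G : Type*} [AddCommGroup G] (g : Vert n → G) :
    ∑ i, (g (leftBoundaryEdge i).2 - g (leftBoundaryEdge i).1) = g Finset.univ - g ∅ := by
  set h : ℕ → G := fun k => g (Finset.univ.filter (fun j : Fin n => j.val < k)) with hh
  have : ∀ i : Fin n, g (leftBoundaryEdge i).2 - g (leftBoundaryEdge i).1 =
      h (i.val + 1) - h i.val := by aesop
  rw [Finset.sum_congr rfl fun i _ => this i,
    Fin.sum_univ_eq_sum_range (fun k => h (k + 1) - h k) n, Finset.sum_range_sub]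
  simp [hh]

end angle

section winding

variable {n : ℕ} {ξ : Fin n → Plane} {K : Set (Tile n)}

/-- The total angle under which the closed curve formed by a path from the bottom to the top and
the left boundary is seen from a point. -/
noncomputable def totalAng (ξ : Fin n → Plane) (P : List (Vert n)) (z : Plane) : ℝ :=
  pathSum (fun A B => ang (point ξ A) (point ξ B) z) P -
    ∑ i, ang (point ξ (leftBoundaryEdge i).1) (point ξ (leftBoundaryEdge i).2) z

/-- The point `z` lies on none of the edges of `K`. -/
def OffEdges (ξ : Fin n → Plane) (K : Set (Tile n)) (z : Plane) : Prop :=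
  ∀ A B, (A, B) ∈ edges K → z ∉ segment ℝ (point ξ A) (point ξ B)

/-- `P` is a path in the graph of `K` from the bottom to the top. -/
structure IsPathOf (K : Set (Tile n)) (P : List (Vert n)) : Prop where
  head : P.head? = some ∅
  last : P.getLast? = some Finset.univ
  edge : ∀ A B, [A, B] <:+: P → (A, B) ∈ edges K ∨ (B, A) ∈ edges K

lemma EdgeTiling.leftBoundaryEdge_mem (hK : EdgeTiling ξ K) (i : Fin n) :
    leftBoundaryEdge i ∈ edges K := by
  obtain ⟨τ, hτ, h⟩ := hK.left_boundary i
  exact ⟨τ, hτ, Tile.mem_edges_iff.2 (Or.inl h)⟩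

lemma EdgeTiling.rightBoundaryEdge_mem (hK : EdgeTiling ξ K) (i : Fin n) :
    rightBoundaryEdge i ∈ edges K := by
  obtain ⟨τ, hτ, h⟩ := hK.right_boundary i
  exact ⟨τ, hτ, Tile.mem_edges_iff.2 (Or.inr h)⟩

lemma EdgeTiling.point_ne (hξ : IsGenerators ξ) (hK : EdgeTiling ξ K) {A B : Vert n}
    (h : (A, B) ∈ edges K) : point ξ A ≠ point ξ B := fun e => by
  obtain ⟨τ, hτ, he⟩ := h
  have := (hK.valid _ hτ).weight_lt he
  exact this.ne (by rw [hξ.point_injective e])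

lemma EdgeTiling.edge_unique (hξ : IsGenerators ξ) (hK : EdgeTiling ξ K) {A B A' B' : Vert n}
    (h : (A, B) ∈ edges K) (h' : (A', B') ∈ edges K) {z : Plane}
    (hz : z ∈ openSegment ℝ (point ξ A) (point ξ B))
    (hz' : z ∈ segment ℝ (point ξ A') (point ξ B')) : A' = A ∧ B' = B ∨ A' = B ∧ B' = A := by
  obtain ⟨τ, hτ, he⟩ := h
  obtain ⟨τ', hτ', he'⟩ := h'
  have hv := hK.valid _ hτ
  have hv' := hK.valid _ hτ'
  have hm := Tile.segment_subset_polygon he' hz'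
  by_cases hne : τ = τ'
  · subst hne
    exact hv.edge_unique hξ he he' hz hz'
  · obtain ⟨⟨C, D⟩, ⟨h1, h2⟩, h3⟩ : ∃ e ∈ τ.edges ∩ τ'.edges,
        τ.polygon ξ ∩ τ'.polygon ξ = seg ξ e := by
      rcases Tile.mem_edges_iff.1 he with h | h
      · exact hK.inter_of_openSegment hξ hτ hτ' hne (Or.inl h) hz hm
      · rw [openSegment_symm] at hz
        exact hK.inter_of_openSegment hξ hτ hτ' hne (Or.inr h) hz hm
    have hzz : z ∈ seg ξ (C, D) :=
      h3 ▸ ⟨Tile.segment_subset_polygon he (openSegment_subset_segment ℝ _ _ hz), hm⟩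
    rcases hv.edge_unique hξ he h1 hz hzz with ⟨rfl, rfl⟩ | ⟨rfl, rfl⟩
    · exact hv'.edge_unique hξ h2 he' hz hz'
    · rw [openSegment_symm] at hz
      exact (hv'.edge_unique hξ h2 he' hz hz').symm

lemma offEdges_of_inner (hξ : IsGenerators ξ) (hK : EdgeTiling ξ K) {τ : Tile n} (hτ : τ ∈ K)
    {z : Plane} (hz : z ∈ τ.inner ξ) : OffEdges ξ K z := by
  intro A B h hm
  obtain ⟨τ', hτ', he⟩ := h
  by_cases hne : τ = τ'
  · subst hne
    exact Tile.IsValid.edge_notMem_inner he hm hz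
  · exact hK.inner_disjoint_polygon hξ hτ hτ' hne hz (Tile.segment_subset_polygon he hm)

lemma inner_of_offEdges (hξ : IsGenerators ξ) (hK : EdgeTiling ξ K) {τ : Tile n} (hτ : τ ∈ K)
    {z : Plane} (hz : z ∈ τ.polygon ξ) (h : OffEdges ξ K z) : z ∈ τ.inner ξ := by
  have hmem : ∀ A B, τ.Border A B → z ∉ segment ℝ (point ξ A) (point ξ B) := by
    rintro A B (hb | hb)
    · exact h A B ⟨τ, hτ, Tile.mem_edges_iff.2 (Or.inl hb)⟩
    · rw [segment_symm]
      exact h B A ⟨τ, hτ, Tile.mem_edges_iff.2 (Or.inr hb)⟩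
  intro A B hb
  rcases ((hK.valid _ hτ).side_nonneg hξ hb hz).eq_or_lt with h0 | h0
  · exact absurd ((hK.valid _ hτ).mem_segment hξ hb hz h0.symm) (hmem A B hb)
  · exact h0

variable {P : List (Vert n)}

lemma IsPathOf.notMem (hP : IsPathOf K P) {z : Plane} (hz : OffEdges ξ K z)
    {A B : Vert n} (h : [A, B] <:+: P) : z ∉ segment ℝ (point ξ A) (point ξ B) := by
  rcases hP.edge A B h with h | h
  · exact hz A B h
  · rw [segment_symm]; exact hz B A h

lemma continuousAt_pathSum {l : List (Vert n)} {z : Plane}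
    (h : ∀ A B, [A, B] <:+: l → z ∉ segment ℝ (point ξ A) (point ξ B)) :
    ContinuousAt (fun z => pathSum (fun A B => ang (point ξ A) (point ξ B) z) l) z := by
  induction l with
  | nil => exact continuousAt_const
  | cons a l ih =>
    rcases l with _ | ⟨b, l⟩
    · exact continuousAt_const
    · exact (continuousAt_ang (h a b (pair_infix_cons.2 (Or.inl ⟨rfl, rfl⟩)))).add
        (ih fun A B hAB => h A B (pair_infix_cons.2 (Or.inr hAB)))

lemma continuousAt_totalAng (hK : EdgeTiling ξ K) (hP : IsPathOf K P) {z : Plane}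
    (hz : OffEdges ξ K z) : ContinuousAt (totalAng ξ P) z := by
  refine (continuousAt_pathSum fun A B h => hP.notMem hz h).sub ?_
  exact tendsto_finsetSum _ fun i _ => continuousAt_ang (hz _ _ (hK.leftBoundaryEdge_mem i))

lemma exists_totalAng_eq (hK : EdgeTiling ξ K) (hP : IsPathOf K P) {z : Plane}
    (hz : OffEdges ξ K z) : ∃ k : ℤ, totalAng ξ P z = 2 * Real.pi * k := by
  set g : Vert n → Real.Angle := fun A => ((toComplex (point ξ A - z)).arg : Real.Angle)
  have hne : ∀ {A B}, z ∉ segment ℝ (point ξ A) (point ξ B) →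
      (ang (point ξ A) (point ξ B) z : Real.Angle) = g B - g A := by
    intro A B h
    refine ang_coe ?_ ?_
    · rintro rfl; exact h (left_mem_segment ℝ _ _)
    · rintro rfl; exact h (right_mem_segment ℝ _ _)
  have h1 : (totalAng ξ P z : Real.Angle) = 0 := by
    rw [totalAng, Real.Angle.coe_sub]
    have e1 : ((pathSum (fun A B => ang (point ξ A) (point ξ B) z) P : ℝ) : Real.Angle) =
        g Finset.univ - g ∅ := by
      have := map_pathSum Real.Angle.coeHom (fun A B => ang (point ξ A) (point ξ B) z) P
      rw [Real.Angle.coe_coeHom] at this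
      rw [this, ← pathSum_sub g hP.head hP.last]
      exact pathSum_congr fun A B h => hne (hP.notMem hz h)
    have e2 : ((∑ i, ang (point ξ (leftBoundaryEdge i).1) (point ξ (leftBoundaryEdge i).2) z : ℝ) :
        Real.Angle) = g Finset.univ - g ∅ := by
      have := map_sum Real.Angle.coeHom
        (fun i => ang (point ξ (leftBoundaryEdge i).1) (point ξ (leftBoundaryEdge i).2) z)
        (Finset.univ : Vert n)
      rw [Real.Angle.coe_coeHom] at this
      rw [this, ← sum_leftBoundaryEdge_sub g]
      exact Finset.sum_congr rfl fun i _ => hne (hz _ _ (hK.leftBoundaryEdge_mem i))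
    rw [e1, e2, sub_self]
  have h2 : (totalAng ξ P z : Real.Angle) = ((0 : ℝ) : Real.Angle) := by rw [h1, Real.Angle.coe_zero]
  obtain ⟨k, hk⟩ := Real.Angle.angle_eq_iff_two_pi_dvd_sub.1 h2
  exact ⟨k, by linarith⟩

lemma totalAng_eq_of_inner (hξ : IsGenerators ξ) (hK : EdgeTiling ξ K) (hP : IsPathOf K P)
    {τ : Tile n} (hτ : τ ∈ K) {x y : Plane} (hx : x ∈ τ.inner ξ) (hy : y ∈ τ.inner ξ) :
    totalAng ξ P x = totalAng ξ P y := by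
  have hpre : IsPreconnected (τ.inner ξ) := by
    refine Convex.isPreconnected ?_
    have : τ.inner ξ = ⋂ (A) (B) (_ : τ.Border A B),
        {z | 0 < side (point ξ A) (point ξ B) z} := by
      ext z; simp [Tile.inner]
    rw [this]
    exact convex_iInter fun A => convex_iInter fun B => convex_iInter fun _ => convex_side_pos _ _
  have hc : ContinuousOn (totalAng ξ P) (τ.inner ξ) := fun z hz =>
    (continuousAt_totalAng hK hP (offEdges_of_inner hξ hK hτ hz)).continuousWithinAt
  have key : ∀ x ∈ τ.inner ξ, ∀ y ∈ τ.inner ξ, ¬ totalAng ξ P x < totalAng ξ P y := by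
    intro x hx y hy hlt
    obtain ⟨k, hk⟩ := exists_totalAng_eq hK hP (offEdges_of_inner hξ hK hτ hx)
    obtain ⟨l, hl⟩ := exists_totalAng_eq hK hP (offEdges_of_inner hξ hK hτ hy)
    have hpi := Real.pi_pos
    have hkl : k < l := by
      rw [hk, hl] at hlt
      exact_mod_cast lt_of_mul_lt_mul_left hlt (by positivity)
    have hkl' : (k : ℝ) + 1 ≤ l := by exact_mod_cast hkl
    have hm : 2 * Real.pi * k + Real.pi ∈ Set.Icc (totalAng ξ P x) (totalAng ξ P y) := by
      rw [hk, hl]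
      constructor <;> nlinarith
    obtain ⟨v, hv, hv'⟩ := hpre.intermediate_value hx hy hc hm
    obtain ⟨m, hm⟩ := exists_totalAng_eq hK hP (offEdges_of_inner hξ hK hτ hv)
    rw [hm] at hv'
    have : Real.pi * (2 * m) = Real.pi * (2 * k + 1) := by linarith
    have := mul_left_cancel₀ hpi.ne' this
    have h2 : (2 * m : ℤ) = 2 * k + 1 := by exact_mod_cast this
    omega
  exact le_antisymm (not_lt.1 (key y hy x hx)) (not_lt.1 (key x hx y hy))

/-- Outside of a half-plane that contains the zonogon the total angle vanishes. -/
lemma totalAng_eq_zero (hP : IsPathOf K P) {Q R z : Plane}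
    (h : ∀ y ∈ zonogon ξ, side Q R y ≤ 0) (hz : 0 < side Q R z) : totalAng ξ P z = 0 := by
  set u : ℂ := ⟨-(R 1 - Q 1), -(R 0 - Q 0)⟩ with hu
  have hpos : ∀ A, 0 < (toComplex (point ξ A - z) * u).re := by
    intro A
    have := h _ (point_mem_zonogon A)
    simp only [side] at this hz
    simp only [toComplex, hu, Complex.mul_re, PiLp.sub_apply]
    nlinarith
  set g : Vert n → ℝ := fun A => (toComplex (point ξ A - z) * u).arg
  have e : ∀ A B, ang (point ξ A) (point ξ B) z = g B - g A := fun A B =>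
    ang_eq_sub (hpos A) (hpos B)
  simp only [totalAng, e]
  rw [pathSum_sub g hP.head hP.last, sum_leftBoundaryEdge_sub, sub_self]


/-- The normal vector, pointing to the right, of the segment from `P` to `Q`. -/
noncomputable def normalVec (P Q : Plane) : Plane := !₂[Q 1 - P 1, -(Q 0 - P 0)]

/-- The points of the normal line through the midpoint of a segment. -/
noncomputable def normalPt (P Q : Plane) (t : ℝ) : Plane :=
  ((1 / 2 : ℝ) • P + (1 / 2 : ℝ) • Q) + t • normalVec P Q

lemma side_normalPt (P Q : Plane) (t : ℝ) :
    side P Q (normalPt P Q t) = t * ((Q 0 - P 0) ^ 2 + (Q 1 - P 1) ^ 2) := by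
  simp [side, normalPt, normalVec]; ring

lemma tendsto_normalPt (P Q : Plane) :
    Tendsto (normalPt P Q) (𝓝 0) (𝓝 ((1 / 2 : ℝ) • P + (1 / 2 : ℝ) • Q)) := by
  have : Continuous (normalPt P Q) := by unfold normalPt; fun_prop
  have := this.tendsto 0
  simpa [normalPt] using this

lemma length_pos {P Q : Plane} (h : P ≠ Q) : 0 < (Q 0 - P 0) ^ 2 + (Q 1 - P 1) ^ 2 := by
  by_contra hn
  apply h
  have h1 : Q 1 - P 1 = 0 := by nlinarith [sq_nonneg (Q 1 - P 1), sq_nonneg (Q 0 - P 0)]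
  have h2 : Q 0 - P 0 = 0 := by nlinarith [sq_nonneg (Q 1 - P 1), sq_nonneg (Q 0 - P 0)]
  exact plane_ext (by linarith) (by linarith)

lemma tendsto_ang_right {P Q : Plane} (h : P ≠ Q) :
    Tendsto (fun t => ang P Q (normalPt P Q t)) (𝓝[>] 0) (𝓝 (-Real.pi)) ∧
    Tendsto (fun t => ang P Q (normalPt P Q t)) (𝓝[<] 0) (𝓝 Real.pi) ∧
    Tendsto (fun t => ang Q P (normalPt P Q t)) (𝓝[>] 0) (𝓝 Real.pi) ∧
    Tendsto (fun t => ang Q P (normalPt P Q t)) (𝓝[<] 0) (𝓝 (-Real.pi)) := by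
  have hl := length_pos h
  set m := (1 / 2 : ℝ) • P + (1 / 2 : ℝ) • Q with hm
  have hsm : side P Q m = 0 :=
    side_eq_zero_of_mem_segment (openSegment_subset_segment ℝ _ _ (openSegment_midpoint P Q))
  have hre : ∀ P Q : Plane, P ≠ Q → m = (1 / 2 : ℝ) • P + (1 / 2 : ℝ) • Q →
      (toComplex (Q - m) * (starRingEnd ℂ) (toComplex (P - m))).re < 0 := by
    intro P Q hPQ hm
    have hl := length_pos hPQ
    rw [ang_re, hm]
    simp only [PiLp.add_apply, PiLp.smul_apply, smul_eq_mul]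
    nlinarith
  have him : (toComplex (Q - m) * (starRingEnd ℂ) (toComplex (P - m))).im = 0 := by
    rw [ang_im, hsm, neg_zero]
  have him' : (toComplex (P - m) * (starRingEnd ℂ) (toComplex (Q - m))).im = 0 := by
    rw [ang_im, side_swap, hsm, neg_zero, neg_zero]
  have hre1 := hre P Q h hm
  have hre2 := hre Q P h.symm (by rw [hm, add_comm])
  have ht : ∀ P' Q' : Plane, Tendsto (fun t => toComplex (Q' - normalPt P Q t) *
      (starRingEnd ℂ) (toComplex (P' - normalPt P Q t))) (𝓝 0)
      (𝓝 (toComplex (Q' - m) * (starRingEnd ℂ) (toComplex (P' - m)))) := fun P' Q' =>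
    ((continuous_ang_aux P' Q').tendsto m).comp (tendsto_normalPt P Q)
  have hneg : ∀ {w : ℂ}, w.re < 0 → w.im = 0 → w.arg = Real.pi := fun h1 h2 =>
    Complex.arg_eq_pi_iff.2 ⟨h1, h2⟩
  refine ⟨?_, ?_, ?_, ?_⟩
  · refine (Complex.tendsto_arg_nhdsWithin_im_neg_of_re_neg_of_im_zero hre1 him).comp
      (tendsto_nhdsWithin_iff.2 ⟨(ht P Q).mono_left nhdsWithin_le_nhds, ?_⟩)
    filter_upwards [self_mem_nhdsWithin] with t (ht : 0 < t)
    rw [ang_im, side_normalPt, neg_lt_zero]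
    positivity
  · have := (Complex.continuousWithinAt_arg_of_re_neg_of_im_zero hre1 him).tendsto
    rw [hneg hre1 him] at this
    refine this.comp (tendsto_nhdsWithin_iff.2 ⟨(ht P Q).mono_left nhdsWithin_le_nhds, ?_⟩)
    filter_upwards [self_mem_nhdsWithin] with t (ht : t < 0)
    rw [ang_im, side_normalPt]
    nlinarith
  · have := (Complex.continuousWithinAt_arg_of_re_neg_of_im_zero hre2 him').tendsto
    rw [hneg hre2 him'] at this
    refine this.comp (tendsto_nhdsWithin_iff.2 ⟨(ht Q P).mono_left nhdsWithin_le_nhds, ?_⟩)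
    filter_upwards [self_mem_nhdsWithin] with t (ht : 0 < t)
    rw [ang_im, side_swap, side_normalPt]
    nlinarith
  · refine (Complex.tendsto_arg_nhdsWithin_im_neg_of_re_neg_of_im_zero hre2 him').comp
      (tendsto_nhdsWithin_iff.2 ⟨(ht Q P).mono_left nhdsWithin_le_nhds, ?_⟩)
    filter_upwards [self_mem_nhdsWithin] with t (ht : t < 0)
    rw [ang_im, side_swap, side_normalPt]
    nlinarith

/-- The jump of the angle of an edge at the midpoint of another edge. -/
lemma exists_ang_jump (hξ : IsGenerators ξ) (hK : EdgeTiling ξ K) {A B A' B' : Vert n}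
    (h : (A, B) ∈ edges K) (h' : (A', B') ∈ edges K ∨ (B', A') ∈ edges K) :
    ∃ r l : ℝ, Tendsto (fun t => ang (point ξ A') (point ξ B')
        (normalPt (point ξ A) (point ξ B) t)) (𝓝[>] 0) (𝓝 r) ∧
      Tendsto (fun t => ang (point ξ A') (point ξ B')
        (normalPt (point ξ A) (point ξ B) t)) (𝓝[<] 0) (𝓝 l) ∧
      l - r = 2 * Real.pi * edgeIndicator (A, B) A' B' := by
  have hm := openSegment_midpoint (point ξ A) (point ξ B)
  have hne := hK.point_ne hξ h
  have hAB : A ≠ B := fun e => hne (by rw [e])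
  obtain ⟨t1, t2, t3, t4⟩ := tendsto_ang_right hne
  by_cases hs : (1 / 2 : ℝ) • point ξ A + (1 / 2 : ℝ) • point ξ B ∈
      segment ℝ (point ξ A') (point ξ B')
  · have : (A' = A ∧ B' = B) ∨ (A' = B ∧ B' = A) := by
      rcases h' with h' | h'
      · exact hK.edge_unique hξ h h' hm hs
      · rw [segment_symm] at hs
        have := hK.edge_unique hξ h h' hm hs
        tauto
    rcases this with ⟨rfl, rfl⟩ | ⟨rfl, rfl⟩
    · refine ⟨_, _, t1, t2, ?_⟩
      simp [edgeIndicator, hAB]; ring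
    · refine ⟨_, _, t3, t4, ?_⟩
      simp [edgeIndicator, hAB]; ring
  · have hc := ((continuousAt_ang hs).tendsto.comp (tendsto_normalPt (point ξ A) (point ξ B)))
    refine ⟨_, _, hc.mono_left nhdsWithin_le_nhds, hc.mono_left nhdsWithin_le_nhds, ?_⟩
    have h1 : ¬ (A' = A ∧ B' = B) := by
      rintro ⟨rfl, rfl⟩; exact hs (openSegment_subset_segment ℝ _ _ hm)
    have h2 : ¬ (B' = A ∧ A' = B) := by
      rintro ⟨rfl, rfl⟩
      rw [segment_symm] at hs
      exact hs (openSegment_subset_segment ℝ _ _ hm)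
    simp [edgeIndicator, h1, h2]

lemma exists_pathSum_jump (hξ : IsGenerators ξ) (hK : EdgeTiling ξ K) {A B : Vert n}
    (h : (A, B) ∈ edges K) {l : List (Vert n)}
    (hl : ∀ A' B', [A', B'] <:+: l → (A', B') ∈ edges K ∨ (B', A') ∈ edges K) :
    ∃ r s : ℝ, Tendsto (fun t => pathSum (fun A' B' => ang (point ξ A') (point ξ B')
        (normalPt (point ξ A) (point ξ B) t)) l) (𝓝[>] 0) (𝓝 r) ∧
      Tendsto (fun t => pathSum (fun A' B' => ang (point ξ A') (point ξ B')
        (normalPt (point ξ A) (point ξ B) t)) l) (𝓝[<] 0) (𝓝 s) ∧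
      s - r = 2 * Real.pi * (pathSum (edgeIndicator (A, B)) l : ℤ) := by
  induction l with
  | nil => exact ⟨0, 0, tendsto_const_nhds, tendsto_const_nhds, by simp⟩
  | cons a l ih =>
    rcases l with _ | ⟨b, l⟩
    · exact ⟨0, 0, tendsto_const_nhds, tendsto_const_nhds, by simp⟩
    · obtain ⟨r, s, h1, h2, h3⟩ := ih fun A' B' h' => hl A' B' (pair_infix_cons.2 (Or.inr h'))
      obtain ⟨r', s', h1', h2', h3'⟩ := exists_ang_jump hξ hK h
        (hl a b (pair_infix_cons.2 (Or.inl ⟨rfl, rfl⟩)))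
      refine ⟨r' + r, s' + s, h1'.add h1, h2'.add h2, ?_⟩
      rw [pathSum_cons_cons]
      push_cast
      linarith

lemma exists_totalAng_jump (hξ : IsGenerators ξ) (hK : EdgeTiling ξ K) (hP : IsPathOf K P)
    {A B : Vert n} (h : (A, B) ∈ edges K) :
    ∃ r s : ℝ, Tendsto (fun t => totalAng ξ P (normalPt (point ξ A) (point ξ B) t))
        (𝓝[>] 0) (𝓝 r) ∧
      Tendsto (fun t => totalAng ξ P (normalPt (point ξ A) (point ξ B) t)) (𝓝[<] 0) (𝓝 s) ∧
      s - r = 2 * Real.pi * ((pathSum (edgeIndicator (A, B)) P -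
        ∑ i, edgeIndicator (A, B) (leftBoundaryEdge i).1 (leftBoundaryEdge i).2 : ℤ) : ℝ) := by
  obtain ⟨r, s, h1, h2, h3⟩ := exists_pathSum_jump hξ hK h hP.edge
  choose r' s' h1' h2' h3' using fun i => exists_ang_jump hξ hK h
    (A' := (leftBoundaryEdge i).1) (B' := (leftBoundaryEdge i).2)
    (Or.inl (hK.leftBoundaryEdge_mem i))
  refine ⟨r - ∑ i, r' i, s - ∑ i, s' i, h1.sub (tendsto_finsetSum _ fun i _ => h1' i),
    h2.sub (tendsto_finsetSum _ fun i _ => h2' i), ?_⟩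
  have : ∑ i, s' i - ∑ i, r' i = 2 * Real.pi *
      (∑ i, edgeIndicator (A, B) (leftBoundaryEdge i).1 (leftBoundaryEdge i).2 : ℤ) := by
    rw [← Finset.sum_sub_distrib, Finset.sum_congr rfl fun i _ => h3' i, ← Finset.mul_sum]
    push_cast
    rfl
  push_cast at *
  linarith

lemma eventually_offEdges (hξ : IsGenerators ξ) (hK : EdgeTiling ξ K) {A B : Vert n}
    (h : (A, B) ∈ edges K) :
    ∀ᶠ t in 𝓝[≠] 0, OffEdges ξ K (normalPt (point ξ A) (point ξ B) t) := by
  have hm := openSegment_midpoint (point ξ A) (point ξ B)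
  have hne := hK.point_ne hξ h
  have key : ∀ e : Edge n, ∀ᶠ t in 𝓝[≠] (0 : ℝ), e ∈ edges K →
      normalPt (point ξ A) (point ξ B) t ∉ segment ℝ (point ξ e.1) (point ξ e.2) := by
    rintro ⟨A', B'⟩
    by_cases hs : (A', B') ∈ edges K ∧ (1 / 2 : ℝ) • point ξ A + (1 / 2 : ℝ) • point ξ B ∈
        segment ℝ (point ξ A') (point ξ B')
    · filter_upwards [self_mem_nhdsWithin] with t (ht : t ≠ 0) _ hmem
      have h0 := side_eq_zero_of_mem_segment hmem
      have h1 : side (point ξ A) (point ξ B) (normalPt (point ξ A) (point ξ B) t) = 0 := by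
        rcases hK.edge_unique hξ h hs.1 hm hs.2 with ⟨rfl, rfl⟩ | ⟨rfl, rfl⟩
        · exact h0
        · rw [side_swap, h0, neg_zero]
      rw [side_normalPt] at h1
      exact (mul_ne_zero ht (length_pos hne).ne') h1
    · have hcl : IsClosed (segment ℝ (point ξ A') (point ξ B')) := by
        rw [← convexHull_pair]
        exact (Set.toFinite _).isClosed_convexHull ℝ
      by_cases hmem : (A', B') ∈ edges K
      · have := (tendsto_normalPt (point ξ A) (point ξ B)).eventually
          (hcl.isOpen_compl.mem_nhds (show _ ∈ (_)ᶜ from fun h => hs ⟨hmem, h⟩))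
        exact (this.filter_mono nhdsWithin_le_nhds).mono fun t ht _ => ht
      · exact Eventually.of_forall fun t h => absurd h hmem
  have := eventually_all.2 key
  exact this.mono fun t ht A' B' h => ht (A', B') h

lemma sum_edgeIndicator_leftBoundaryEdge {e : Edge n}
    (he : weight e.1 < weight e.2) [Decidable (∃ i, e = leftBoundaryEdge i)] :
    ∑ i, edgeIndicator e (leftBoundaryEdge i).1 (leftBoundaryEdge i).2 =
      if ∃ i, e = leftBoundaryEdge i then 1 else 0 := by
  have : ∀ i : Fin n, edgeIndicator e (leftBoundaryEdge i).1 (leftBoundaryEdge i).2 =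
      if leftBoundaryEdge i = e then 1 else 0 := fun i =>
    edgeIndicator_of_weight_lt he (isVEdge_leftBoundaryEdge i).weight_lt
  rw [Finset.sum_congr rfl fun i _ => this i]
  split_ifs with h
  · obtain ⟨i, rfl⟩ := h
    rw [Finset.sum_eq_single_of_mem i (Finset.mem_univ i), if_pos rfl]
    exact fun j _ hj => if_neg fun h => hj (leftBoundaryEdge_injective h)
  · exact Finset.sum_eq_zero fun i _ => if_neg fun hi => h ⟨i, hi.symm⟩

/-- The multiplicity, counted with signs, of a directed edge in a path. -/
abbrev mult (P : List (Vert n)) (e : Edge n) : ℤ :=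
  pathSum (edgeIndicator e) P

/-- The function `w` jumps by the multiplicity of the path across the edges. -/
structure IsWinding (K : Set (Tile n)) (P : List (Vert n)) (w : Tile n → ℤ) : Prop where
  jump : ∀ τ ∈ K, ∀ τ' ∈ K, ∀ A B, [A, B] <:+: τ.lpath → [A, B] <:+: τ'.rpath →
    w τ' - w τ = mult P (A, B)
  left : ∀ τ ∈ K, ∀ i, [(leftBoundaryEdge i).1, (leftBoundaryEdge i).2] <:+: τ.lpath →
    w τ = 1 - mult P (leftBoundaryEdge i)
  right : ∀ τ ∈ K, ∀ i, [(rightBoundaryEdge i).1, (rightBoundaryEdge i).2] <:+: τ.rpath →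
    w τ = mult P (rightBoundaryEdge i)

/-- The winding numbers of a path from the bottom to the top, completed by the left boundary, around
the tiles. -/
theorem exists_winding (hξ : IsGenerators ξ) (hn : 2 ≤ n) (hK : EdgeTiling ξ K)
    (hP : IsPathOf K P) : ∃ w, IsWinding K P w := by
  classical
  have hex : ∀ τ, ∃ k : ℤ, τ ∈ K → ∀ z ∈ τ.inner ξ, totalAng ξ P z = 2 * Real.pi * k := by
    intro τ
    by_cases hτ : τ ∈ K
    · obtain ⟨x, hx⟩ := (hK.valid τ hτ).inner_nonempty hξ
      obtain ⟨k, hk⟩ := exists_totalAng_eq hK hP (offEdges_of_inner hξ hK hτ hx)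
      exact ⟨k, fun _ z hz => by rw [totalAng_eq_of_inner hξ hK hP hτ hz hx, hk]⟩
    · exact ⟨0, fun h => absurd h hτ⟩
  choose w hw using hex
  have hle : ∀ s : Set ℝ, (0 : ℝ) ∉ s → 𝓝[s] (0 : ℝ) ≤ 𝓝[≠] 0 := fun s hs =>
    nhdsWithin_mono _ fun x hx (h : x = 0) => hs (h ▸ hx)
  -- the limits from the tiles on the two sides
  have hright : ∀ τ ∈ K, ∀ A B, [A, B] <:+: τ.lpath → ∀ r,
      Tendsto (fun t => totalAng ξ P (normalPt (point ξ A) (point ξ B) t)) (𝓝[>] 0) (𝓝 r) →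
      r = 2 * Real.pi * w τ := by
    intro τ hτ A B h r hr
    have he : (A, B) ∈ edges K := ⟨τ, hτ, Tile.mem_edges_iff.2 (Or.inl h)⟩
    refine tendsto_nhds_unique hr (tendsto_const_nhds.congr' ?_)
    have e1 := (eventually_offEdges hξ hK he).filter_mono (hle (Set.Ioi 0) (lt_irrefl (0 : ℝ)))
    have e2 := ((tendsto_normalPt (point ξ A) (point ξ B)).eventually
      ((hK.valid _ hτ).eventually_mem hξ (Or.inl h) (openSegment_midpoint _ _))).filter_mono
      (nhdsWithin_le_nhds (s := Set.Ioi (0 : ℝ)))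
    filter_upwards [e1, e2, self_mem_nhdsWithin] with t h1 h2 (ht : 0 < t)
    have h3 := h2 (by rw [side_normalPt]; positivity)
    rw [hw τ hτ _ (inner_of_offEdges hξ hK hτ h3 h1)]
  have hleft : ∀ τ ∈ K, ∀ A B, [A, B] <:+: τ.rpath → ∀ r,
      Tendsto (fun t => totalAng ξ P (normalPt (point ξ A) (point ξ B) t)) (𝓝[<] 0) (𝓝 r) →
      r = 2 * Real.pi * w τ := by
    intro τ hτ A B h r hr
    have he : (A, B) ∈ edges K := ⟨τ, hτ, Tile.mem_edges_iff.2 (Or.inr h)⟩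
    refine tendsto_nhds_unique hr (tendsto_const_nhds.congr' ?_)
    have e1 := (eventually_offEdges hξ hK he).filter_mono (hle (Set.Iio 0) (lt_irrefl (0 : ℝ)))
    have hmid := openSegment_midpoint (point ξ A) (point ξ B)
    rw [openSegment_symm] at hmid
    have e2 := ((tendsto_normalPt (point ξ A) (point ξ B)).eventually
      ((hK.valid _ hτ).eventually_mem hξ (Or.inr h) hmid)).filter_mono
      (nhdsWithin_le_nhds (s := Set.Iio (0 : ℝ)))
    filter_upwards [e1, e2, self_mem_nhdsWithin] with t h1 h2 (ht : t < 0)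
    have h3 := h2 (by
      rw [side_swap, side_normalPt]
      nlinarith [sq_nonneg ((point ξ B) 0 - (point ξ A) 0), sq_nonneg ((point ξ B) 1 - (point ξ A) 1)])
    rw [hw τ hτ _ (inner_of_offEdges hξ hK hτ h3 h1)]
  have hpi := Real.pi_pos
  refine ⟨w, ?_, ?_, ?_⟩
  · intro τ hτ τ' hτ' A B h h'
    have he : (A, B) ∈ edges K := ⟨τ, hτ, Tile.mem_edges_iff.2 (Or.inl h)⟩
    obtain ⟨r, s, h1, h2, h3⟩ := exists_totalAng_jump hξ hK hP he
    rw [hright τ hτ A B h r h1, hleft τ' hτ' A B h' s h2, sum_edgeIndicator_leftBoundaryEdge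
      ((hK.valid _ hτ).lpath_weight_lt A B h), if_neg, sub_zero, ← mul_sub] at h3
    · have := mul_left_cancel₀ (by positivity) h3
      exact_mod_cast this
    · rintro ⟨i, hi⟩
      refine (hK.valid _ hτ').leftBoundaryEdge_not_rpath hξ i ?_
      rw [← hi]; exact h'
  · intro τ hτ i h
    obtain ⟨r, s, h1, h2, h3⟩ := exists_totalAng_jump hξ hK hP (A := (leftBoundaryEdge i).1)
      (B := (leftBoundaryEdge i).2) (hK.leftBoundaryEdge_mem i)
    simp only [Prod.mk.eta] at h3
    have hs : s = 0 := by
      refine tendsto_nhds_unique h2 (tendsto_const_nhds.congr' ?_)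
      filter_upwards [self_mem_nhdsWithin] with t (ht : t < 0)
      refine (totalAng_eq_zero hP (Q := point ξ (leftBoundaryEdge i).2)
        (R := point ξ (leftBoundaryEdge i).1) ?_ ?_).symm
      · intro y hy
        rw [side_swap]
        linarith [hξ.side_leftBoundaryEdge i hy]
      · rw [side_swap, side_normalPt]
        exact neg_pos.2 (mul_neg_of_neg_of_pos ht (length_pos (hK.point_ne hξ (hK.leftBoundaryEdge_mem i))))
    rw [hright τ hτ _ _ h r h1, hs, sum_edgeIndicator_leftBoundaryEdge
      (isVEdge_leftBoundaryEdge i).weight_lt, if_pos ⟨i, rfl⟩] at h3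
    have h4 : 2 * Real.pi * (w τ : ℝ) = 2 * Real.pi *
        ((1 - pathSum (edgeIndicator (leftBoundaryEdge i)) P : ℤ) : ℝ) := by
      push_cast at h3 ⊢
      linarith
    have := mul_left_cancel₀ (by positivity) h4
    exact_mod_cast this
  · intro τ hτ i h
    obtain ⟨r, s, h1, h2, h3⟩ := exists_totalAng_jump hξ hK hP (A := (rightBoundaryEdge i).1)
      (B := (rightBoundaryEdge i).2) (hK.rightBoundaryEdge_mem i)
    simp only [Prod.mk.eta] at h3
    have hs : r = 0 := by
      refine tendsto_nhds_unique h1 (tendsto_const_nhds.congr' ?_)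
      filter_upwards [self_mem_nhdsWithin] with t (ht : 0 < t)
      refine (totalAng_eq_zero hP (Q := point ξ (rightBoundaryEdge i).1)
        (R := point ξ (rightBoundaryEdge i).2) ?_ ?_).symm
      · intro y hy
        exact hξ.side_rightBoundaryEdge i hy
      · rw [side_normalPt]
        exact mul_pos ht (length_pos (hK.point_ne hξ (hK.rightBoundaryEdge_mem i)))
    rw [hleft τ hτ _ _ h s h2, hs, sum_edgeIndicator_leftBoundaryEdge
      (isVEdge_rightBoundaryEdge i).weight_lt, if_neg
      (fun ⟨j, hj⟩ => leftBoundaryEdge_ne_rightBoundaryEdge hn j i hj.symm), sub_zero,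
      sub_zero] at h3
    have := mul_left_cancel₀ (by positivity) h3
    exact_mod_cast this

end winding

end Combi

namespace Combi

/-! ### The position of the tiles with respect to a legal path -/

section position

variable {n : ℕ} {ξ : Fin n → Plane} {K : Set (Tile n)} {P : List (Vert n)}
  {w : Tile n → ℤ}

lemma mult_eq_zero {e : Edge n} (h : ¬ InPath P e) : mult P e = 0 := by
  have : pathSum (edgeIndicator e) P = pathSum (fun _ _ => (0 : ℤ)) P := by
    refine pathSum_congr fun A B hAB => ?_
    rw [edgeIndicator, if_neg, if_neg, sub_zero]
    · rintro rfl; exact h (Or.inr hAB)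
    · rintro rfl; exact h (Or.inl hAB)
  rw [mult, this]
  clear this h
  induction P with
  | nil => rfl
  | cons a l ih =>
    rcases l with _ | ⟨b, l⟩
    · rfl
    · rw [pathSum_cons_cons, ih, zero_add]

/-- The tiles on the right of `e` have the value `v`. -/
def RightValue (K : Set (Tile n)) (w : Tile n → ℤ) (e : Edge n) (v : ℤ) :
    Prop :=
  ∀ τ ∈ K, [e.1, e.2] <:+: τ.lpath → w τ = v

/-- The tiles on the left of `e` have the value `v`, where the outside of the left boundary has
the value `1`. -/
def LeftValue (K : Set (Tile n)) (w : Tile n → ℤ) (e : Edge n) (v : ℤ) :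
    Prop :=
  (∀ τ ∈ K, [e.1, e.2] <:+: τ.rpath → w τ = v) ∧ ((∃ i, e = leftBoundaryEdge i) → v = 1)

lemma IsWinding.rightValue (hK : EdgeTiling ξ K) (hw : IsWinding K P w)
    {e : Edge n} {v : ℤ} (h : LeftValue K w e v) :
    RightValue K w e (v - mult P e) := by
  intro τ hτ hl
  rcases hK.left_exists τ hτ e.1 e.2 hl with ⟨i, hi⟩ | ⟨τ', hτ', hr⟩
  · rw [Prod.mk.eta] at hi
    subst hi
    rw [hw.left τ hτ i hl, h.2 ⟨i, rfl⟩]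
  · have := hw.jump τ hτ τ' hτ' e.1 e.2 hl hr
    rw [h.1 τ' hτ' hr, Prod.mk.eta] at this
    linarith

lemma RightValue.next (hξ : IsGenerators ξ) (hK : EdgeTiling ξ K)
    {e e' : Edge n} {v : ℤ} (h : RightValue K w e v) (hn : Next K e e') :
    LeftValue K w e' v := by
  obtain ⟨τ, hτ, ht⟩ := hn
  constructor
  · intro τ' hτ' hr
    rw [hK.right_unique hξ hτ' hτ hr ht.rpath]
    exact h τ hτ ht.lpath
  · rintro ⟨i, rfl⟩
    exact absurd ht.rpath ((hK.valid τ hτ).leftBoundaryEdge_not_rpath hξ i)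

lemma RightValue.of_stripLE (hξ : IsGenerators ξ) (hK : EdgeTiling ξ K) (hw : IsWinding K P w)
    {e g : Edge n} {v : ℤ} (h : RightValue K w e v) (hg : StripLE K e g)
    (hno : ∀ f f', StripLE K e f → Next K f f' → StripLE K f' g → ¬ InPath P f') :
    RightValue K w g v := by
  induction hg with
  | refl => exact h
  | @tail f g hf hn ih =>
    have h1 := ih fun f1 f1' h1 h2 h3 => hno f1 f1' h1 h2 (h3.tail hn)
    have h2 := hw.rightValue hK (h1.next hξ hK hn)
    rwa [mult_eq_zero (hno f g hf hn .refl), sub_zero] at h2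

lemma LeftValue.of_stripLE (hξ : IsGenerators ξ) (hK : EdgeTiling ξ K) (hw : IsWinding K P w)
    {e g : Edge n} {v : ℤ} (h : RightValue K w e v) (hg : StripLE K e g)
    (hne : e ≠ g)
    (hno : ∀ f f', StripLE K e f → Next K f f' → StripLE K f' g → f' ≠ g → ¬ InPath P f') :
    LeftValue K w g v := by
  rcases Relation.ReflTransGen.cases_tail hg with rfl | ⟨f, h1, h2⟩
  · exact absurd rfl hne
  · refine (RightValue.of_stripLE hξ hK hw h h1 fun f1 f1' h3 h4 h5 =>
      hno f1 f1' h3 h4 (h5.tail h2) ?_).next hξ hK h2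
    rintro rfl
    exact h2.not_stripLE hK.valid h5

lemma StripLE.top_eq (hK : ∀ τ ∈ K, τ.IsValid) {e e' : Edge n}
    (h : StripLE K e e') (hw : weight e'.2 ≤ weight e.2) : e'.2 = e.2 := by
  induction h with
  | refl => rfl
  | @tail f g hf hn ih =>
    have h1 := (StripLE.card_weight hK hf).2.2
    have h2 := (StripLE.card_weight hK (Relation.ReflTransGen.single hn)).2.2
    obtain ⟨τ, hτ, h⟩ := hn
    rcases h.step (hK τ hτ) with ⟨-, h3, -, -⟩ | ⟨-, -, h4, -⟩
    · rw [h3]; exact ih (h3 ▸ hw)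
    · omega

lemma StripLE.bottom_eq (hK : ∀ τ ∈ K, τ.IsValid) {e e' : Edge n}
    (h : StripLE K e e') (hw : weight e'.1 ≤ weight e.1) : e'.1 = e.1 := by
  induction h with
  | refl => rfl
  | @tail f g hf hn ih =>
    have h1 := (StripLE.card_weight hK hf).2.1
    have h2 := (StripLE.card_weight hK (Relation.ReflTransGen.single hn)).2.1
    obtain ⟨τ, hτ, h⟩ := hn
    rcases h.step (hK τ hτ) with ⟨-, -, h4, -⟩ | ⟨-, h3, -, -⟩
    · omega
    · rw [h3]; exact ih (h3 ▸ hw)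

lemma isChain_append_pair {α : Type*} {R : α → α → Prop} {l m : List α} {u v : α}
    (hl : l.IsChain R) (hm : m.IsChain R) (hu : l.getLast? = some u) (hv : m.head? = some v)
    (h : R u v) : (l ++ m).IsChain R ∧ [u, v] <:+: l ++ m := by
  constructor
  · refine List.isChain_append.2 ⟨hl, hm, fun x hx y hy => ?_⟩
    rw [hu] at hx
    rw [hv] at hy
    simp only [Option.mem_def, Option.some.injEq] at hx hy
    subst hx hy
    exact h
  · obtain ⟨m, rfl⟩ := head_eq_of_head? hv
    obtain ⟨l, rfl⟩ := List.getLast?_eq_some_iff.1 hu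
    exact ⟨l, m, by simp⟩

lemma head?_append_of {α : Type*} {l m : List α} {a : α} (h : l.head? = some a) :
    (l ++ m).head? = some a := by
  obtain ⟨l, rfl⟩ := head_eq_of_head? h
  rfl

lemma getLast?_append_of {α : Type*} {l m : List α} {a : α} (h : m.getLast? = some a) :
    (l ++ m).getLast? = some a := by grind

lemma exists_lowerFilling_mem (hK : ∀ τ ∈ K, τ.IsValid) {a b c : Vert n} {τ : Tile n}
    {g g' : Edge n} (hτ : τ ∈ K) (ht : StripTile τ g g')
    (h1 : StripLE K (a, b) g) (h2 : StripLE K g' (c, b)) :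
    ∃ Y u v, IsLowerFilling K a b c Y ∧ [u, v] <:+: Y ∧ τ = Tile.delta b u v := by
  have w1 := (StripLE.card_weight hK h1).2.2
  have w2 := (StripLE.card_weight hK h2).2.2
  simp only at w1 w2
  rcases ht.step (hK τ hτ) with ⟨rfl, h3, -, -⟩ | ⟨-, -, h4, -⟩
  · have e1 := h1.top_eq hK (by rw [h3] at w2; exact w2)
    have e2 : b = g'.2 := h2.top_eq hK (by simp only; rw [h3, e1])
    obtain ⟨g1, g2⟩ := g
    obtain ⟨g1', g2'⟩ := g'
    simp only at e1 e2
    subst e1 e2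
    obtain ⟨Y1, y1, y2, y3⟩ := h1.exists_lowerFilling hK
    obtain ⟨Y2, z1, z2, z3⟩ := h2.exists_lowerFilling hK
    obtain ⟨h5, h6⟩ := isChain_append_pair y3 z3 y2 z1 hτ
    exact ⟨Y1 ++ Y2, g1, g1', ⟨head?_append_of y1, getLast?_append_of z2, h5⟩, h6, rfl⟩
  · omega

lemma exists_upperFilling_mem (hK : ∀ τ ∈ K, τ.IsValid) {a b c : Vert n} {τ : Tile n}
    {g g' : Edge n} (hτ : τ ∈ K) (ht : StripTile τ g g')
    (h1 : StripLE K (b, a) g) (h2 : StripLE K g' (b, c)) :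
    ∃ X u v, IsUpperFilling K a b c X ∧ [u, v] <:+: X ∧ τ = Tile.nabla b u v := by
  have w1 := (StripLE.card_weight hK h1).2.1
  have w2 := (StripLE.card_weight hK h2).2.1
  simp only at w1 w2
  rcases ht.step (hK τ hτ) with ⟨-, -, h4, -⟩ | ⟨rfl, h3, -, -⟩
  · omega
  · have e1 := h1.bottom_eq hK (by rw [h3] at w2; exact w2)
    have e2 : b = g'.1 := h2.bottom_eq hK (by simp only; rw [h3, e1])
    obtain ⟨g1, g2⟩ := g
    obtain ⟨g1', g2'⟩ := g'
    simp only at e1 e2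
    subst e1 e2
    obtain ⟨Y1, y1, y2, y3⟩ := h1.exists_upperFilling hK
    obtain ⟨Y2, z1, z2, z3⟩ := h2.exists_upperFilling hK
    obtain ⟨h5, h6⟩ := isChain_append_pair y3 z3 y2 z1 hτ
    exact ⟨Y1 ++ Y2, g2, g2', ⟨head?_append_of y1, getLast?_append_of z2, h5⟩, h6, rfl⟩

lemma inPath_cons_cons {a b : Vert n} {l : List (Vert n)}
    {e : Edge n} :
    InPath (a :: b :: l) e ↔ (e = (a, b) ∨ e = (b, a)) ∨ InPath (b :: l) e := by
  obtain ⟨A, B⟩ := e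
  simp only [InPath, pair_infix_cons, Prod.mk.injEq]
  tauto

lemma EdgeTiling.le_or_le (hξ : IsGenerators ξ) (hK : EdgeTiling ξ K)
    {e g g' : Edge n} (he : IsVEdgeOf K e.1 e.2) (hn : Next K g g')
    (hc : e.1.card = g.1.card) : StripLE K g' e ∨ StripLE K e g := by
  have hc' := (StripLE.card_weight hK.valid (Relation.ReflTransGen.single hn)).1
  have hg' : IsVEdgeOf K g'.1 g'.2 := by
    obtain ⟨τ, hτ, ht⟩ := hn
    exact (ht.isVEdgeOf (hK.valid τ hτ) hτ).2
  rcases hK.stripLE_total hξ hg' he (by omega) with h | h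
  · exact Or.inl h
  · by_cases hne : e = g'
    · exact Or.inl (hne ▸ .refl)
    · exact Or.inr (hK.stripLE_prev hξ h hn hne)

/-- The tiles of the strip of the first edge of a final segment of a legal path that lie on the
right of this edge. -/
lemma Leg.position (hξ : IsGenerators ξ) (hK : EdgeTiling ξ K) (hw : IsWinding K P w)
    {a b : Vert n} {P' : List (Vert n)} (hP' : Leg K a b P') (hs : P' <:+ P)
    (hm : ∀ e, StripLE K (a, b) e → mult P e = mult P' e ∧ (InPath P e ↔ InPath P' e))
    (hl : LeftValue K w (a, b) 1) {τ : Tile n} {g g' : Edge n}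
    (hτ : τ ∈ K) (ht : StripTile τ g g') (hg : StripLE K (a, b) g) :
    (w τ = 0 ∧ τ ∈ peakFillings K P) ∨ (w τ = 1 ∧ τ ∈ pitFillings K P) ∨
      (w τ = 0 ∧ ∀ e, StripLE K g' e → ¬ InPath P e) := by
  have hn : Next K g g' := ⟨τ, hτ, ht⟩
  have hv := hK.valid
  have irr : ∀ {e}, StripLE K e g → ¬ StripLE K g' e := fun h1 h2 =>
    hn.not_stripLE hv (h2.trans h1)
  -- the case of a single edge of the path in the strip
  have single : ∀ {a b : Vert n}, IsVEdgeOf K a b → LeftValue K w (a, b) 1 →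
      mult P (a, b) = 1 → (∀ e, StripLE K (a, b) e → InPath P e → e = (a, b)) →
      StripLE K (a, b) g → (w τ = 0 ∧ ∀ e, StripLE K g' e → ¬ InPath P e) := by
    intro a b hab hl hm hno hg
    have h1 := hw.rightValue hK hl
    rw [hm, sub_self] at h1
    refine ⟨(h1.of_stripLE hξ hK hw hg ?_) τ hτ ht.lpath, ?_⟩
    · intro f f' h2 h3 h4 h5
      rw [hno f' (h2.tail h3) h5] at h3
      exact h3.not_stripLE hv h2
    · intro e he he'
      have := hno e ((hg.tail hn).trans he) he'
      subst this
      exact irr hg he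
  induction hP' with
  | @base a h =>
    refine Or.inr (Or.inr (single h hl ?_ ?_ hg))
    · rw [(hm _ .refl).1]
      have := h.weight_lt
      have hne : a ≠ Finset.univ := fun e => by rw [e] at this; exact lt_irrefl _ this
      simp [mult, edgeIndicator, hne.symm]
    · intro e he hP
      rcases inPath_cons_cons.1 ((hm e he).2.1 hP) with (h1 | rfl) | h1
      · exact h1
      · have h2 := (StripLE.card_weight hv he).1
        have := h.card_eq
        simp only at h2
        omega
      · rcases h1 with h1 | h1 <;> exact absurd h1 not_pair_infix
  | @up a b c P' h hP ih =>
    obtain ⟨hbc, t, rfl⟩ := hP.shape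
    have cab := h.card_eq
    have hlater : ∀ e, StripLE K (a, b) e → e.1.card < e.2.card → ¬ InPath (b :: c :: t) e := by
      intro e he hlt h1
      have h2 := (StripLE.card_weight hv he).1
      simp only at h2
      rcases (hP.stripLE_of_inPath hξ hK h1 hlt).2 with h3 | h3
      · omega
      · have := (StripLE.card_weight hv h3).1
        simp only at this
        omega
    refine Or.inr (Or.inr (single h hl ?_ ?_ hg))
    · rw [(hm _ .refl).1]
      have hne : a ≠ b := fun e => by rw [e] at cab; omega
      have : mult (b :: c :: t) (a, b) = 0 :=
        mult_eq_zero (hlater _ Relation.ReflTransGen.refl (by simp only; omega))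
      rw [mult] at this
      rw [mult, pathSum_cons_cons, this]
      simp [edgeIndicator, hne]
    · intro e he hP
      have hee : e.1.card = a.card := (StripLE.card_weight hv he).1
      rcases inPath_cons_cons.1 ((hm e he).2.1 hP) with (h1 | rfl) | h1
      · exact h1
      · simp only at hee
        omega
      · refine absurd h1 ?_
        have hlt : e.1.card < e.2.card := by
          rcases Relation.ReflTransGen.cases_tail he with rfl | ⟨f, -, τ', hτ', hf⟩
          · simp only; omega
          · have := (hf.isVEdgeOf (hv τ' hτ') hτ').2.card_eq
            omega
        exact hlater e he hlt
  | @turn a b y z P' h h' hay hbz hP ih =>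
    obtain ⟨hyz, t, rfl⟩ := hP.shape
    have c1 := h.card_eq
    have c2 := h'.card_eq
    have c3 := hyz.card_eq
    obtain ⟨s1, s2⟩ := Leg.turn_stripLE hξ hK h h' hyz hay hbz
    have hlt : ∀ e, StripLE K (a, b) e → e.1.card < e.2.card := by
      intro e he
      rcases Relation.ReflTransGen.cases_tail he with rfl | ⟨f, -, τ', hτ', hf⟩
      · simp only; omega
      · have := (hf.isVEdgeOf (hv τ' hτ') hτ').2.card_eq
        omega
    have hsplit : ∀ e, StripLE K (a, b) e → InPath P e →
        e = (a, b) ∨ e = (y, b) ∨ StripLE K (y, z) e := by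
      intro e he hP0
      have hee : e.1.card = a.card := (StripLE.card_weight hv he).1
      rcases inPath_cons_cons.1 ((hm e he).2.1 hP0) with (h1 | rfl) | h1
      · exact Or.inl h1
      · simp only at hee; omega
      · rcases inPath_cons_cons.1 h1 with (rfl | h1) | h1
        · simp only at hee; omega
        · exact Or.inr (Or.inl h1)
        · rcases (hP.stripLE_of_inPath hξ hK h1 (hlt e he)).2 with h3 | h3
          · omega
          · exact Or.inr (Or.inr h3)
    have hay' : a ≠ y := fun e => by rw [e] at hay; exact lt_irrefl _ hay
    have hbz' : b ≠ z := fun e => by rw [e] at hbz; exact lt_irrefl _ hbz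
    have hab' : a ≠ b := fun e => by rw [e] at c1; omega
    have hyb' : y ≠ b := fun e => by rw [e] at c2; omega
    have later : ∀ e, StripLE K (a, b) e → e.2 = b → mult (y :: z :: t) e = 0 := by
      intro e he heb
      refine mult_eq_zero fun h1 => ?_
      have hee : e.1.card = a.card := (StripLE.card_weight hv he).1
      rcases (hP.stripLE_of_inPath hξ hK h1 (hlt e he)).2 with h3 | h3
      · omega
      · have := (StripLE.card_weight hv h3).2.2
        rw [heb] at this
        simp only at this
        omega
    have m1 : mult P (a, b) = 1 := by
      rw [(hm _ .refl).1, mult, pathSum_cons_cons, pathSum_cons_cons]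
      have := later (a, b) Relation.ReflTransGen.refl rfl
      rw [mult] at this
      rw [this]
      simp [edgeIndicator, hab', hab'.symm, hay'.symm]
    have m2 : mult P (y, b) = -1 := by
      rw [(hm _ s1).1, mult, pathSum_cons_cons, pathSum_cons_cons]
      have := later (y, b) s1 rfl
      rw [mult] at this
      rw [this]
      simp [edgeIndicator, hay', hyb'.symm]
    have r1 : RightValue K w (a, b) 0 := by
      have := hw.rightValue hK hl
      rwa [m1, sub_self] at this
    have n12 : ∀ f f', StripLE K (a, b) f → Next K f f' → StripLE K f' (y, b) → f' ≠ (y, b) →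
        ¬ InPath P f' := by
      intro f f' h1 h2 h3 h4 h5
      rcases hsplit f' (h1.tail h2) h5 with rfl | rfl | h6
      · exact h2.not_stripLE hv h1
      · exact h4 rfl
      · exact hbz' ((Prod.mk.inj (StripLE.antisymm hv s2 (h6.trans h3))).2)
    have n23 : ∀ f f', StripLE K (y, b) f → Next K f f' → StripLE K f' (y, z) → f' ≠ (y, z) →
        ¬ InPath P f' := by
      intro f f' h1 h2 h3 h4 h5
      rcases hsplit f' ((s1.trans h1).tail h2) h5 with rfl | rfl | h6
      · exact h2.not_stripLE hv (s1.trans h1)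
      · exact h2.not_stripLE hv h1
      · exact h4 (StripLE.antisymm hv h3 h6)
    have l2 : LeftValue K w (y, b) 0 :=
      LeftValue.of_stripLE hξ hK hw r1 s1 (by simp [hay']) n12
    have r2 : RightValue K w (y, b) 1 := by
      have := hw.rightValue hK l2
      rwa [m2, zero_sub, neg_neg] at this
    have l3 : LeftValue K w (y, z) 1 :=
      LeftValue.of_stripLE hξ hK hw r2 s2 (by simp [hbz']) n23
    have hcg : a.card = g.1.card := (StripLE.card_weight hv hg).1.symm
    rcases hK.le_or_le hξ (e := (y, b)) h' hn (by simp only; omega) with hA | hB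
    · left
      refine ⟨(r1.of_stripLE hξ hK hw hg fun f f' h1 h2 h3 => n12 f f' h1 h2
        ((h3.tail hn).trans hA) ?_) τ hτ ht.lpath, ?_⟩
      · rintro rfl
        exact irr h3 hA
      · obtain ⟨Y, u, v, h1, h2, h3⟩ := exists_lowerFilling_mem hv hτ ht hg hA
        exact ⟨a, b, y, Y, u, v, ⟨List.IsInfix.trans ⟨[], z :: t, rfl⟩ hs.isInfix, by omega, by omega⟩, h1, h2, h3⟩
    · rcases hK.le_or_le hξ (e := (y, z)) hyz hn (by simp only; omega) with hA | hC
      · right; left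
        refine ⟨(r2.of_stripLE hξ hK hw hB fun f f' h1 h2 h3 => n23 f f' h1 h2
          ((h3.tail hn).trans hA) ?_) τ hτ ht.lpath, ?_⟩
        · rintro rfl
          exact irr h3 hA
        · obtain ⟨Y, u, v, h1, h2, h3⟩ := exists_upperFilling_mem hv hτ ht hB hA
          exact ⟨b, y, z, Y, u, v, ⟨List.IsInfix.trans ⟨[a], t, rfl⟩ hs.isInfix, by omega, by omega⟩, h1, h2, h3⟩
      · refine ih (List.IsSuffix.trans ⟨[a, b], rfl⟩ hs) ?_ l3 hC
        intro e he
        have he' := (s1.trans s2).trans he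
        obtain ⟨q1, q2⟩ := hm e he'
        have hee : e.1.card = a.card := (StripLE.card_weight hv he').1
        have x1 : e ≠ (a, b) := by
          rintro rfl
          exact hay' (Prod.mk.inj (StripLE.antisymm hv s1 (s2.trans he))).1
        have x2 : e ≠ (b, a) := by rintro rfl; simp only at hee; omega
        have x3 : e ≠ (y, b) := by
          rintro rfl
          exact hbz' (Prod.mk.inj (StripLE.antisymm hv s2 he)).2
        have x4 : e ≠ (b, y) := by rintro rfl; simp only at hee; omega
        constructor
        · rw [q1, mult, pathSum_cons_cons, pathSum_cons_cons]
          simp [edgeIndicator, x1.symm, x2.symm, x3.symm, x4.symm, mult]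
        · rw [q2, inPath_cons_cons, inPath_cons_cons]
          simp [x1, x2, x3, x4]

/-- The final segment of a legal path that starts at a given level. -/
lemma Leg.exists_level (k : ℕ) (hk : k < n) {a b : Vert n} (hP : Leg K a b P)
    (hak : a.card ≤ k) : ∃ a' b' P', Leg K a' b' P' ∧ P' <:+ P ∧ a'.card = k ∧
      ∀ e : Edge n, e.1.card = k → e.1.card < e.2.card →
        (mult P e = mult P' e ∧ (InPath P e ↔ InPath P' e)) := by
  induction hP with
  | @base a h =>
    have := h.card_eq
    rw [Finset.card_univ, Fintype.card_fin] at this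
    exact ⟨_, _, _, .base h, List.suffix_refl _, by omega, fun e _ _ => ⟨rfl, Iff.rfl⟩⟩
  | @up a b c P h hP ih =>
    rcases hak.eq_or_lt with rfl | hlt
    · exact ⟨_, _, _, .up h hP, List.suffix_refl _, rfl, fun e _ _ => ⟨rfl, Iff.rfl⟩⟩
    · have cab := h.card_eq
      obtain ⟨a', b', P', h1, h2, h3, h4⟩ := ih (by omega)
      obtain ⟨-, t, rfl⟩ := hP.shape
      refine ⟨a', b', P', h1, h2.trans ⟨[a], rfl⟩, h3, fun e he he' => ?_⟩
      have x1 : e ≠ (a, b) := by rintro rfl; simp only at he; omega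
      have x2 : e ≠ (b, a) := by rintro rfl; simp only at he'; omega
      rw [← (h4 e he he').1, ← (h4 e he he').2, inPath_cons_cons, mult, pathSum_cons_cons]
      simp [x1, x2, edgeIndicator, x1.symm, x2.symm, mult]
  | @turn a b y z P h h' hay hbz hP ih =>
    rcases hak.eq_or_lt with rfl | hlt
    · exact ⟨_, _, _, .turn h h' hay hbz hP, List.suffix_refl _, rfl, fun e _ _ => ⟨rfl, Iff.rfl⟩⟩
    · have cab := h.card_eq
      have cyb := h'.card_eq
      obtain ⟨a', b', P', h1, h2, h3, h4⟩ := ih (by omega)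
      obtain ⟨-, t, rfl⟩ := hP.shape
      refine ⟨a', b', P', h1, h2.trans ⟨[a, b], rfl⟩, h3, fun e he he' => ?_⟩
      have x1 : e ≠ (a, b) := by rintro rfl; simp only at he; omega
      have x2 : e ≠ (b, a) := by rintro rfl; simp only at he'; omega
      have x3 : e ≠ (y, b) := by rintro rfl; simp only at he; omega
      have x4 : e ≠ (b, y) := by rintro rfl; simp only at he'; omega
      rw [← (h4 e he he').1, ← (h4 e he he').2, inPath_cons_cons, inPath_cons_cons, mult,
        pathSum_cons_cons, pathSum_cons_cons]
      simp [x1, x2, x3, x4, edgeIndicator, x1.symm, x2.symm, x3.symm, x4.symm, mult]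

/-- The position of the triangles with respect to a legal path. -/
theorem strip_position (hξ : IsGenerators ξ) (hK : EdgeTiling ξ K) (hw : IsWinding K P w)
    {b : Vert n} (hP : Leg K ∅ b P) {τ : Tile n} {g g' : Edge n}
    (hτ : τ ∈ K) (ht : StripTile τ g g') :
    (w τ = 1 ∧ ∀ e, StripLE K e g → ¬ InPath P e) ∨ (w τ = 0 ∧ τ ∈ peakFillings K P) ∨
      (w τ = 1 ∧ τ ∈ pitFillings K P) ∨ (w τ = 0 ∧ ∀ e, StripLE K g' e → ¬ InPath P e) := by
  have hv := hK.valid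
  have hn : Next K g g' := ⟨τ, hτ, ht⟩
  have hg := (ht.isVEdgeOf (hv τ hτ) hτ).1
  have hgk : g.1.card < n := by
    have := hg.card_eq
    have := Finset.card_le_univ g.2
    rw [Fintype.card_fin] at this
    omega
  obtain ⟨a, b', P', h1, h2, h3, h4⟩ := hP.exists_level g.1.card hgk (by simp)
  obtain ⟨hab, t, rfl⟩ := h1.shape
  have hlt : ∀ {e e' : Edge n}, e.1.card < e.2.card → StripLE K e e' →
      e'.1.card < e'.2.card := by
    intro e e' h he
    rcases Relation.ReflTransGen.cases_tail he with rfl | ⟨f, -, τ', hτ', hf⟩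
    · exact h
    · have := (hf.isVEdgeOf (hv τ' hτ') hτ').2.card_eq
      omega
  have hmin : ∀ e : Edge n, e.1.card = g.1.card →
      e.1.card < e.2.card → InPath P e → StripLE K (a, b') e := by
    intro e he he' hin
    rcases (h1.stripLE_of_inPath hξ hK ((h4 e he he').2.1 hin) he').2 with h5 | h5
    · omega
    · exact h5
  have cab := hab.card_eq
  obtain ⟨i, hi, hle⟩ := hK.leftBoundaryEdge_stripLE (e := (a, b')) hab
  have hlb : LeftValue K w (leftBoundaryEdge i) 1 :=
    ⟨fun τ hτ h => absurd h ((hv τ hτ).leftBoundaryEdge_not_rpath hξ i), fun _ => rfl⟩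
  have hlbc := (isVEdge_leftBoundaryEdge i).card_eq
  have hlbk : (leftBoundaryEdge i).1.card = g.1.card := by
    rw [← (StripLE.card_weight hv hle).1]; exact h3
  have hbelow : ∀ e, StripLE K (leftBoundaryEdge i) e → StripLE K e (a, b') → e ≠ (a, b') →
      ¬ InPath P e := by
    intro e he he' hne hin
    refine hne (StripLE.antisymm hv he' (hmin e ?_ (hlt (by omega) he) hin))
    rw [(StripLE.card_weight hv he).1, hlbk]
  have hrb : leftBoundaryEdge i ≠ (a, b') → RightValue K w (leftBoundaryEdge i) 1 := by
    intro hne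
    have := hw.rightValue hK hlb
    rwa [mult_eq_zero (hbelow _ Relation.ReflTransGen.refl hle hne), sub_zero] at this
  have hl : LeftValue K w (a, b') 1 := by
    by_cases hne : leftBoundaryEdge i = (a, b')
    · rwa [← hne]
    · exact LeftValue.of_stripLE hξ hK hw (hrb hne) hle hne fun f f' q1 q2 q3 q4 =>
        hbelow f' (q1.tail q2) q3 q4
  rcases hK.le_or_le hξ (e := (a, b')) hab hn h3 with hA | hB
  · left
    obtain ⟨j, hj, hlg⟩ := hK.leftBoundaryEdge_stripLE hg
    obtain rfl : i = j := Fin.ext (by rw [hi, hj]; exact h3)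
    have hgne : ∀ e, StripLE K e g → e ≠ (a, b') := by
      rintro e he rfl
      exact hn.not_stripLE hv (hA.trans he)
    have hlne : leftBoundaryEdge i ≠ (a, b') := hgne _ hlg
    refine ⟨((hrb hlne).of_stripLE hξ hK hw hlg fun f f' q1 q2 q3 =>
      hbelow f' (q1.tail q2) ((q3.tail hn).trans hA) (hgne f' q3)) τ hτ ht.lpath, ?_⟩
    intro e he hin
    have hec : g.1.card = e.1.card := (StripLE.card_weight hv he).1
    have hev : e.1.card < e.2.card := by
      rcases Relation.ReflTransGen.cases_head he with rfl | ⟨f, ⟨τ', hτ', hf⟩, -⟩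
      · have := hg.card_eq
        omega
      · have := (hf.isVEdgeOf (hv τ' hτ') hτ').1.card_eq
        omega
    exact hn.not_stripLE hv (hA.trans ((hmin e hec.symm hev hin).trans he))
  · exact Or.inr (h1.position hξ hK hw h2 (fun e he => h4 e
      (by rw [(StripLE.card_weight hv he).1]; exact h3) (hlt (by simp only; omega) he)) hl hτ ht hB)

end position

end Combi

namespace Combi

open Filter Topology

/-! ### The regions of a legal path -/

section plane

lemma isPreconnected_ball_diff (x : Plane) (r : ℝ) : IsPreconnected (Metric.ball x r \ {x}) := by
  rcases le_or_gt r 0 with hr | hr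
  · rw [Metric.ball_eq_empty.2 hr, Set.empty_sdiff]
    exact isPreconnected_empty
  · have hpt : ∀ a b : ℝ, ∃ t : ℝ, 0 < t ∧ x + t • (!₂[a, b] : Plane) ∈ Metric.ball x r := by
      intro a b
      have hc : Continuous (fun t : ℝ => x + t • (!₂[a, b] : Plane)) := by fun_prop
      have := hc.tendsto 0
      simp only [zero_smul, add_zero] at this
      have h1 := (this.eventually (Metric.ball_mem_nhds x hr)).filter_mono
        (nhdsWithin_le_nhds (s := Set.Ioi 0))
      obtain ⟨t, h1, h2⟩ := (h1.and self_mem_nhdsWithin).exists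
      exact ⟨t, h2, h1⟩
    have hconv : ∀ (i : Fin 2) (s : ℝ), Convex ℝ {z : Plane | 0 < s * (z i - x i)} := by
      intro i s y hy z hz a b ha hb hab
      simp only [Set.mem_ofPred_eq, PiLp.add_apply, PiLp.smul_apply, smul_eq_mul] at *
      have e : s * (a * y i + b * z i - x i) = a * (s * (y i - x i)) + b * (s * (z i - x i)) := by
        obtain rfl : b = 1 - a := by linarith
        ring
      rw [e]
      rcases ha.eq_or_lt with rfl | ha
      · obtain rfl : b = 1 := by linarith
        simpa using hz
      · have := mul_pos ha hy
        have := mul_nonneg hb hz.le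
        linarith
    have hp : ∀ (i : Fin 2) (s : ℝ),
        IsPreconnected (Metric.ball x r ∩ {z : Plane | 0 < s * (z i - x i)}) := fun i s =>
      ((convex_ball x r).inter (hconv i s)).isPreconnected
    obtain ⟨t1, ht1, hb1⟩ := hpt 1 1
    obtain ⟨t2, ht2, hb2⟩ := hpt (-1) 1
    obtain ⟨t3, ht3, hb3⟩ := hpt (-1) (-1)
    have h1 : IsPreconnected ((Metric.ball x r ∩ {z : Plane | 0 < 1 * (z 0 - x 0)}) ∪
        (Metric.ball x r ∩ {z : Plane | 0 < 1 * (z 1 - x 1)})) :=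
      IsPreconnected.union (x + t1 • (!₂[1, 1] : Plane)) ⟨hb1, by simpa using ht1⟩
      ⟨hb1, by simpa using ht1⟩ (hp 0 1) (hp 1 1)
    have h2 := IsPreconnected.union (x + t2 • (!₂[-1, 1] : Plane))
      (t := Metric.ball x r ∩ {z : Plane | 0 < (-1) * (z 0 - x 0)})
      (Or.inr ⟨hb2, by simpa using ht2⟩) ⟨hb2, by simpa using ht2⟩ h1 (hp 0 (-1))
    have h3 := IsPreconnected.union (x + t3 • (!₂[-1, -1] : Plane))
      (t := Metric.ball x r ∩ {z : Plane | 0 < (-1) * (z 1 - x 1)})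
      (Or.inr ⟨hb3, by simpa using ht3⟩) ⟨hb3, by simpa using ht3⟩ h2 (hp 1 (-1))
    convert h3 using 1
    ext z
    simp only [Set.mem_sdiff, Set.mem_singleton_iff, Set.mem_union, Set.mem_inter_iff,
      Set.mem_ofPred_eq]
    constructor
    · rintro ⟨hz, hne⟩
      by_contra hno
      push Not at hno
      obtain ⟨⟨⟨a1, a2⟩, a3⟩, a4⟩ := hno
      have a1 := a1 hz
      have a2 := a2 hz
      have a3 := a3 hz
      have a4 := a4 hz
      exact hne (plane_ext (by linarith) (by linarith))
    · grind

end plane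

section regions

variable {n : ℕ} {ξ : Fin n → Plane} {K : Set (Tile n)} {P : List (Vert n)}
  {w : Tile n → ℤ}

lemma Leg.isPathOf {b : Vert n} (hP : Leg K ∅ b P) : IsPathOf K P := by
  have h := hP.isLegalPath
  exact ⟨h.head, h.last, fun A B hAB => (chain_of_pair_infix h.chain hAB).imp And.left And.left⟩

lemma Leg.not_inPath_of_isHEdge {a b A B : Vert n} (hP : Leg K a b P)
    (h : ∃ i j, IsHEdge i j A B) : ¬ InPath P (A, B) := by
  obtain ⟨i, j, h⟩ := h
  have hc := h.card_eq
  rintro (h1 | h1) <;> rcases chain_of_pair_infix hP.isLegal.2.1 h1 with h2 | h2 <;>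
    have := h2.card_eq <;> simp only at this <;> omega

lemma IsWinding.eq_of_not_inPath (hw : IsWinding K P w) {τ τ' : Tile n} (hτ : τ ∈ K) (hτ' : τ' ∈ K)
    {A B : Vert n} (h : [A, B] <:+: τ.lpath) (h' : [A, B] <:+: τ'.rpath)
    (hn : ¬ InPath P (A, B)) : w τ = w τ' := by
  have := hw.jump τ hτ τ' hτ' A B h h'
  rw [mult_eq_zero hn] at this
  linarith

lemma exists_stripTile_delta (A B C : Vert n) :
    StripTile (Tile.delta A B C) (B, A) (C, A) := Or.inl ⟨_, _, _, rfl, rfl, rfl⟩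

lemma exists_stripTile_nabla (A B C : Vert n) :
    StripTile (Tile.nabla A B C) (A, B) (A, C) := Or.inr ⟨_, _, _, rfl, rfl, rfl⟩

theorem winding_eq_zero_or_one (hξ : IsGenerators ξ) (hK : EdgeTiling ξ K) (hw : IsWinding K P w)
    {b : Vert n} (hP : Leg K ∅ b P) : ∀ τ ∈ K, w τ = 0 ∨ w τ = 1 := by
  refine hK.induction_above ?_ ?_
  · intro A B C h
    rcases strip_position hξ hK hw hP h (exists_stripTile_delta A B C) with h | h | h | h
    · exact Or.inr h.1
    · exact Or.inl h.1
    · exact Or.inr h.1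
    · exact Or.inl h.1
  · intro τ hτ τ' hτ' A B hH h h' hp
    rwa [hw.eq_of_not_inPath hτ hτ' h h' (hP.not_inPath_of_isHEdge hH)]

lemma exists_edge_of_mem_curve (hP : IsPathOf K P) {z : Plane} (hz : z ∈ curve ξ P) :
    ∃ A B, (A, B) ∈ edges K ∧ InPath P (A, B) ∧ z ∈ segment ℝ (point ξ A) (point ξ B) := by
  obtain ⟨A, B, h, hz⟩ := hz
  rcases hP.edge A B h with he | he
  · exact ⟨A, B, he, Or.inl h, hz⟩
  · exact ⟨B, A, he, Or.inr h, by rw [segment_symm]; exact hz⟩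

lemma segment_subset_curve {A B : Vert n} (h : InPath P (A, B)) :
    segment ℝ (point ξ A) (point ξ B) ⊆ curve ξ P := by
  intro z hz
  rcases h with h | h
  · exact ⟨A, B, h, hz⟩
  · exact ⟨B, A, h, by rw [seg, segment_symm]; exact hz⟩

lemma OffEdges.notMem_curve (hP : IsPathOf K P) {z : Plane} (hz : OffEdges ξ K z) :
    z ∉ curve ξ P := fun h => by
  obtain ⟨A, B, he, -, hm⟩ := exists_edge_of_mem_curve hP h
  exact hz A B he hm

lemma midpoint_notMem_curve (hξ : IsGenerators ξ) (hK : EdgeTiling ξ K) (hP : IsPathOf K P)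
    {A B : Vert n} (h : (A, B) ∈ edges K) (hn : ¬ InPath P (A, B)) :
    (1 / 2 : ℝ) • point ξ A + (1 / 2 : ℝ) • point ξ B ∉ curve ξ P := fun hm => by
  obtain ⟨A', B', he, hi, hm⟩ := exists_edge_of_mem_curve hP hm
  rcases hK.edge_unique hξ h he (openSegment_midpoint _ _) hm with ⟨rfl, rfl⟩ | ⟨rfl, rfl⟩
  · exact hn hi
  · exact hn hi.symm

lemma isClosed_curve : IsClosed (curve ξ P) := by
  have : curve ξ P = ⋃ (A : Vert n) (B : Vert n),
      {z | [A, B] <:+: P ∧ z ∈ segment ℝ (point ξ A) (point ξ B)} := by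
    ext z; simp [curve, seg]
  rw [this]
  refine isClosed_iUnion_of_finite fun A => isClosed_iUnion_of_finite fun B => ?_
  by_cases h : [A, B] <:+: P
  · simp only [h, true_and, Set.ofPred_mem_eq]
    rw [← convexHull_pair]
    exact (Set.toFinite _).isClosed_convexHull ℝ
  · simp [h]

/-! #### Joining points inside of the tiles -/

lemma joinedIn_inner (hξ : IsGenerators ξ) (hK : EdgeTiling ξ K) (hP : IsPathOf K P) {τ : Tile n}
    (hτ : τ ∈ K) {z c : Plane} (hz : z ∈ τ.polygon ξ) (hzc : z ∉ curve ξ P) (hc : c ∈ τ.inner ξ) :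
    JoinedIn (zonogon ξ \ curve ξ P) z c := by
  refine JoinedIn.of_segment_subset ?_
  rintro y ⟨a, b, ha, hb, hab, rfl⟩
  rcases hb.eq_or_lt with rfl | hb
  · obtain rfl : a = 1 := by linarith
    simpa using ⟨Tile.polygon_subset_zonogon hz, hzc⟩
  · have := (hK.valid τ hτ).combo_mem_inner hξ hz hc ha hb hab
    exact ⟨Tile.polygon_subset_zonogon ((hK.valid τ hτ).inner_subset hξ this),
      (offEdges_of_inner hξ hK hτ this).notMem_curve hP⟩

/-- The inner points of the tile can be joined with the set outside the curve. -/
def TileJoined (ξ : Fin n → Plane) (P : List (Vert n)) (b : Set Plane) (τ : Tile n) : Prop :=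
  ∀ c ∈ τ.inner ξ, ∃ w ∈ b, JoinedIn (zonogon ξ \ curve ξ P) c w

lemma midpoint_mem_polygon {τ : Tile n} {A B : Vert n} (h : (A, B) ∈ τ.edges) :
    (1 / 2 : ℝ) • point ξ A + (1 / 2 : ℝ) • point ξ B ∈ τ.polygon ξ :=
  Tile.segment_subset_polygon h (openSegment_subset_segment ℝ _ _ (openSegment_midpoint _ _))

lemma TileJoined.cross (hξ : IsGenerators ξ) (hK : EdgeTiling ξ K) (hP : IsPathOf K P)
    {b : Set Plane} {τ τ' : Tile n} (hτ : τ ∈ K) (hτ' : τ' ∈ K) {A B : Vert n}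
    (h : (A, B) ∈ τ.edges) (h' : (A, B) ∈ τ'.edges) (hn : ¬ InPath P (A, B))
    (hj : TileJoined ξ P b τ') : TileJoined ξ P b τ := by
  intro c hc
  obtain ⟨c', hc'⟩ := (hK.valid τ' hτ').inner_nonempty hξ
  obtain ⟨x, hx, hj⟩ := hj c' hc'
  have hm := midpoint_notMem_curve hξ hK hP ⟨τ, hτ, h⟩ hn
  exact ⟨x, hx, ((joinedIn_inner hξ hK hP hτ (midpoint_mem_polygon h) hm hc).symm.trans
    (joinedIn_inner hξ hK hP hτ' (midpoint_mem_polygon h') hm hc')).trans hj⟩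

lemma tileJoined_boundary (hξ : IsGenerators ξ) (hK : EdgeTiling ξ K) (hP : IsPathOf K P)
    {b : Set Plane} {τ : Tile n} (hτ : τ ∈ K) {A B : Vert n} (h : (A, B) ∈ τ.edges)
    (hn : ¬ InPath P (A, B)) (hb : segment ℝ (point ξ A) (point ξ B) ⊆ b) :
    TileJoined ξ P b τ := by
  intro c hc
  exact ⟨_, hb (openSegment_subset_segment ℝ _ _ (openSegment_midpoint _ _)),
    (joinedIn_inner hξ hK hP hτ (midpoint_mem_polygon h)
      (midpoint_notMem_curve hξ hK hP ⟨τ, hτ, h⟩ hn) hc).symm⟩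

lemma tileJoined_lbd_of_stripLE (hξ : IsGenerators ξ) (hK : EdgeTiling ξ K) (hP : IsPathOf K P)
    {i : Fin n} {g : Edge n} (hg : StripLE K (leftBoundaryEdge i) g)
    (hn : ∀ e, StripLE K e g → ¬ InPath P e) {τ : Tile n} (hτ : τ ∈ K)
    (h : [g.1, g.2] <:+: τ.lpath) : TileJoined ξ P (lbd ξ) τ := by
  induction hg generalizing τ with
  | refl =>
    exact tileJoined_boundary hξ hK hP hτ (Tile.mem_edges_iff.2 (Or.inl h))
      (hn _ .refl) (Set.subset_iUnion (fun i => seg ξ (leftBoundaryEdge i)) i)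
  | @tail f g hf hfg ih =>
    obtain ⟨τ', hτ', ht⟩ := id hfg
    exact TileJoined.cross hξ hK hP hτ hτ' (Tile.mem_edges_iff.2 (Or.inl h))
      (Tile.mem_edges_iff.2 (Or.inr ht.rpath)) (hn _ .refl)
      (ih (fun e he => hn e (he.tail hfg)) hτ' ht.lpath)

lemma tileJoined_rbd_of_stripLE (hξ : IsGenerators ξ) (hK : EdgeTiling ξ K) (hP : IsPathOf K P)
    {i : Fin n} {g : Edge n} (hg : StripLE K g (rightBoundaryEdge i))
    (hn : ∀ e, StripLE K g e → ¬ InPath P e) {τ : Tile n} (hτ : τ ∈ K)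
    (h : [g.1, g.2] <:+: τ.rpath) : TileJoined ξ P (rbd ξ) τ := by
  induction hg using Relation.ReflTransGen.head_induction_on generalizing τ with
  | refl =>
    exact tileJoined_boundary hξ hK hP hτ (Tile.mem_edges_iff.2 (Or.inr h))
      (hn _ .refl)
      (Set.subset_iUnion (fun i => seg ξ (rightBoundaryEdge i)) i)
  | @head g f hgf hf ih =>
    obtain ⟨τ', hτ', ht⟩ := id hgf
    exact TileJoined.cross hξ hK hP hτ hτ' (Tile.mem_edges_iff.2 (Or.inr h))
      (Tile.mem_edges_iff.2 (Or.inl ht.lpath)) (hn _ .refl)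
      (ih (fun e he => hn e (he.head hgf)) hτ' ht.rpath)

lemma EdgeTiling.stripLE_rightBoundaryEdge (hξ : IsGenerators ξ) (hK : EdgeTiling ξ K)
    {e : Edge n} (h : IsVEdgeOf K e.1 e.2) :
    ∃ i : Fin n, StripLE K e (rightBoundaryEdge i) := by
  have hlt : e.1.card < n := by
    have := h.card_eq
    have := Finset.card_le_univ e.2
    rw [Fintype.card_fin] at this
    omega
  obtain ⟨i, hi⟩ : ∃ i : Fin n, (rightBoundaryEdge i).1.card = e.1.card := by
    refine ⟨⟨n - 1 - e.1.card, by omega⟩, ?_⟩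
    simp only [rightBoundaryEdge]
    rw [Finset.filter_lt_eq_Ioi, Fin.card_Ioi]
    simp only
    omega
  refine ⟨i, ?_⟩
  rcases hK.stripLE_total hξ h (e' := rightBoundaryEdge i)
    ⟨hK.rightBoundaryEdge_mem i, _, isVEdge_rightBoundaryEdge i⟩ hi.symm with h | h
  · exact h
  · rcases Relation.ReflTransGen.cases_head h with h | ⟨f, ⟨τ, hτ, ht⟩, -⟩
    · rw [h]
    · exact absurd ht.lpath ((hK.valid τ hτ).rightBoundaryEdge_not_lpath hξ i)

lemma tileJoined_lbd (hξ : IsGenerators ξ) (hK : EdgeTiling ξ K) (hw : IsWinding K P w)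
    {b : Vert n} (hP : Leg K ∅ b P) : ∀ τ ∈ K, w τ = 1 → TileJoined ξ P (lbd ξ) τ := by
  refine hK.induction_above ?_ ?_
  · intro A B C h h1
    have ht := exists_stripTile_delta A B C
    rcases strip_position hξ hK hw hP h ht with h2 | h2 | h2 | h2
    · obtain ⟨i, -, hi⟩ := hK.leftBoundaryEdge_stripLE (ht.isVEdgeOf (hK.valid _ h) h).1
      exact tileJoined_lbd_of_stripLE hξ hK hP.isPathOf hi h2.2 h ht.lpath
    · omega
    · obtain ⟨-, a, b, c, X, u, v, -, -, -, h3⟩ := h2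
      cases h3
    · omega
  · intro τ hτ τ' hτ' A B hH h h' hp h1
    have hn := hP.not_inPath_of_isHEdge hH
    exact TileJoined.cross hξ hK hP.isPathOf hτ hτ' (Tile.mem_edges_iff.2 (Or.inl h))
      (Tile.mem_edges_iff.2 (Or.inr h')) hn (hp (hw.eq_of_not_inPath hτ hτ' h h' hn ▸ h1))

lemma tileJoined_rbd (hξ : IsGenerators ξ) (hK : EdgeTiling ξ K) (hw : IsWinding K P w)
    {b : Vert n} (hP : Leg K ∅ b P) : ∀ τ ∈ K, w τ = 0 → TileJoined ξ P (rbd ξ) τ := by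
  refine hK.induction_below ?_ ?_
  · intro A B C h h1
    have ht := exists_stripTile_nabla A B C
    rcases strip_position hξ hK hw hP h ht with h2 | h2 | h2 | h2
    · omega
    · obtain ⟨-, a, b, c, X, u, v, -, -, -, h3⟩ := h2
      cases h3
    · omega
    · obtain ⟨i, hi⟩ := hK.stripLE_rightBoundaryEdge hξ (ht.isVEdgeOf (hK.valid _ h) h).2
      exact tileJoined_rbd_of_stripLE hξ hK hP.isPathOf hi h2.2 h ht.rpath
  · intro τ hτ τ' hτ' A B hH h h' hp h1
    have hn := hP.not_inPath_of_isHEdge hH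
    exact TileJoined.cross hξ hK hP.isPathOf hτ hτ' (Tile.mem_edges_iff.2 (Or.inr h))
      (Tile.mem_edges_iff.2 (Or.inl h')) hn (hp (hw.eq_of_not_inPath hτ' hτ h' h hn ▸ h1))

lemma polygon_subset_region (hξ : IsGenerators ξ) (hK : EdgeTiling ξ K) (hP : IsPathOf K P)
    {b : Set Plane} {τ : Tile n} (hτ : τ ∈ K) (h : TileJoined ξ P b τ) :
    τ.polygon ξ ⊆ region ξ P b := by
  intro z hz
  by_cases hzc : z ∈ curve ξ P
  · exact Or.inl hzc
  · obtain ⟨c, hc⟩ := (hK.valid τ hτ).inner_nonempty hξ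
    obtain ⟨x, hx, hj⟩ := h c hc
    exact Or.inr ⟨x, hx, (joinedIn_inner hξ hK hP hτ hz hzc hc).trans hj⟩

/-! #### Separation -/

lemma mem_curve_or_node (hξ : IsGenerators ξ) (hn : 2 ≤ n) (hK : EdgeTiling ξ K)
    (hw : IsWinding K P w) {τ τ' : Tile n} (hτ : τ ∈ K) (hτ' : τ' ∈ K) (hne : w τ ≠ w τ')
    {z : Plane} (hz : z ∈ τ.polygon ξ) (hz' : z ∈ τ'.polygon ξ) :
    z ∈ curve ξ P ∨ z ∈ nodes ξ := by
  have hne' : τ ≠ τ' := fun e => hne (by rw [e])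
  have key : ∀ σ ∈ K, ∀ σ' ∈ K, w σ ≠ w σ' → ∀ A B, [A, B] <:+: σ.lpath → [A, B] <:+: σ'.rpath →
      InPath P (A, B) := by
    intro σ hσ σ' hσ' hne A B h h'
    by_contra hn
    exact hne (hw.eq_of_not_inPath hσ hσ' h h' hn)
  rcases (hK.isCTiling hξ hn).inter τ hτ τ' hτ' hne' with h | ⟨v, -, h⟩ | ⟨⟨A, B⟩, ⟨h1, h2⟩, h⟩
  · exact absurd (show z ∈ τ.polygon ξ ∩ τ'.polygon ξ from ⟨hz, hz'⟩) (by rw [h]; simp)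
  · right
    have : z ∈ τ.polygon ξ ∩ τ'.polygon ξ := ⟨hz, hz'⟩
    rw [h] at this
    exact ⟨v, this.symm⟩
  · left
    have hm : z ∈ τ.polygon ξ ∩ τ'.polygon ξ := ⟨hz, hz'⟩
    rw [h] at hm
    refine segment_subset_curve ?_ hm
    rcases Tile.mem_edges_iff.1 h1 with h1 | h1 <;> rcases Tile.mem_edges_iff.1 h2 with h2 | h2
    · exact absurd (hK.left_unique hξ hτ hτ' h1 h2) hne'
    · exact key τ hτ τ' hτ' hne A B h1 h2
    · exact key τ' hτ' τ hτ hne.symm A B h2 h1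
    · exact absurd (hK.right_unique hξ hτ hτ' h1 h2) hne'

lemma isClosed_union_tiles (hξ : IsGenerators ξ) (hK : EdgeTiling ξ K) (p : Tile n → Prop) :
    IsClosed (⋃ τ ∈ {τ | τ ∈ K ∧ p τ}, τ.polygon ξ) :=
  (hK.finite.subset fun _ h => h.1).isClosed_biUnion fun τ h =>
    Tile.isClosed_polygon hξ (hK.valid τ h.1)

lemma inner_subset_interior (hξ : IsGenerators ξ) {τ : Tile n} (hτ : τ.IsValid) :
    τ.inner ξ ⊆ interior (zonogon ξ) :=
  interior_maximal ((hτ.inner_subset hξ).trans Tile.polygon_subset_zonogon) Tile.isOpen_inner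

/-- Tiles with different values of `w` meet only in the curve. -/
theorem mem_curve_of_ne (hξ : IsGenerators ξ) (hn : 2 ≤ n) (hK : EdgeTiling ξ K)
    (hw : IsWinding K P w) (h01 : ∀ τ ∈ K, w τ = 0 ∨ w τ = 1) {τ τ' : Tile n} (hτ : τ ∈ K)
    (hτ' : τ' ∈ K) (h1 : w τ = 1) (h0 : w τ' = 0) {z : Plane} (hz : z ∈ τ.polygon ξ)
    (hz' : z ∈ τ'.polygon ξ) : z ∈ curve ξ P := by
  by_contra hzc
  have hzz := Tile.polygon_subset_zonogon hz
  have hne : τ ≠ τ' := by rintro rfl; omega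
  -- a small ball around `z`
  have hN : IsClosed (nodes ξ \ {z}) := ((finite_nodes ξ).subset Set.sdiff_subset).isClosed
  have hU : IsOpen ((curve ξ P)ᶜ ∩ (nodes ξ \ {z})ᶜ) :=
    isClosed_curve.isOpen_compl.inter hN.isOpen_compl
  obtain ⟨r, hr, hball, hint⟩ : ∃ r > 0, Metric.ball z r ⊆ (curve ξ P)ᶜ ∩ (nodes ξ \ {z})ᶜ ∧
      (z ∈ interior (zonogon ξ) → Metric.ball z r ⊆ interior (zonogon ξ)) := by
    have hzU : z ∈ (curve ξ P)ᶜ ∩ (nodes ξ \ {z})ᶜ := ⟨hzc, fun h => h.2 rfl⟩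
    obtain ⟨r1, hr1, hb1⟩ := Metric.isOpen_iff.1 hU z hzU
    by_cases hzi : z ∈ interior (zonogon ξ)
    · obtain ⟨r2, hr2, hb2⟩ := Metric.isOpen_iff.1 isOpen_interior z hzi
      exact ⟨min r1 r2, lt_min hr1 hr2, (Metric.ball_subset_ball (min_le_left _ _)).trans hb1,
        fun _ => (Metric.ball_subset_ball (min_le_right _ _)).trans hb2⟩
    · exact ⟨r1, hr1, hb1, fun h => absurd h hzi⟩
  set S := (interior (zonogon ξ) ∩ Metric.ball z r) \ {z} with hS
  have hpre : IsPreconnected S := by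
    by_cases hzi : z ∈ interior (zonogon ξ)
    · rw [hS, Set.inter_eq_right.2 (hint hzi)]
      exact isPreconnected_ball_diff z r
    · rw [hS, Set.sdiff_singleton_eq_self fun h => hzi h.1]
      exact (convex_zonogon.interior.inter (convex_ball z r)).isPreconnected
  have hmeet : ∀ σ ∈ K, ∀ σ' ∈ K, σ ≠ σ' → z ∈ σ.polygon ξ → z ∈ σ'.polygon ξ →
      ∃ y ∈ S, y ∈ σ.polygon ξ := by
    intro σ hσ σ' hσ' hne hz hz'
    obtain ⟨y, hy, hyb⟩ := (mem_closure_iff_frequently.1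
      ((hK.valid σ hσ).mem_closure_inner hξ hz)).and_eventually (Metric.ball_mem_nhds z hr) |>.exists
    refine ⟨y, ⟨⟨inner_subset_interior hξ (hK.valid σ hσ) hy, hyb⟩, ?_⟩,
      (hK.valid σ hσ).inner_subset hξ hy⟩
    rintro rfl
    exact hK.inner_disjoint_polygon hξ hσ hσ' hne hy hz'
  obtain ⟨y1, hy1, hy1'⟩ := hmeet τ hτ τ' hτ' hne hz hz'
  obtain ⟨y0, hy0, hy0'⟩ := hmeet τ' hτ' τ hτ hne.symm hz' hz
  obtain ⟨y, hyS, hyL, hyR⟩ := isPreconnected_closed_iff.1 hpre _ _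
    (isClosed_union_tiles hξ hK fun τ => w τ = 1) (isClosed_union_tiles hξ hK fun τ => w τ = 0)
    (by
      intro y hy
      have := interior_subset hy.1.1
      rw [← (hK.isCTiling hξ hn).cover, Set.mem_iUnion₂] at this
      obtain ⟨σ, hσ, hyσ⟩ := this
      rcases h01 σ hσ with h | h
      · exact Or.inr (Set.mem_biUnion (show σ ∈ {τ | τ ∈ K ∧ w τ = 0} from ⟨hσ, h⟩) hyσ)
      · exact Or.inl (Set.mem_biUnion (show σ ∈ {τ | τ ∈ K ∧ w τ = 1} from ⟨hσ, h⟩) hyσ))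
    ⟨y1, hy1, Set.mem_biUnion (show τ ∈ {τ | τ ∈ K ∧ w τ = 1} from ⟨hτ, h1⟩) hy1'⟩
    ⟨y0, hy0, Set.mem_biUnion (show τ' ∈ {τ | τ ∈ K ∧ w τ = 0} from ⟨hτ', h0⟩) hy0'⟩
  obtain ⟨σ, hσ, hyσ⟩ := Set.mem_iUnion₂.1 hyL
  obtain ⟨σ', hσ', hyσ'⟩ := Set.mem_iUnion₂.1 hyR
  have hb := hball hyS.1.2
  rcases mem_curve_or_node hξ hn hK hw hσ.1 hσ'.1 (by rw [hσ.2, hσ'.2]; norm_num) hyσ hyσ' with h | h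
  · exact hb.1 h
  · exact hb.2 ⟨h, hyS.2⟩

/-- Two points outside the curve that are joined outside the curve do not belong to tiles with
different values of `w`. -/
lemma not_joinedIn (hξ : IsGenerators ξ) (hn : 2 ≤ n) (hK : EdgeTiling ξ K)
    (hw : IsWinding K P w) (h01 : ∀ τ ∈ K, w τ = 0 ∨ w τ = 1) {τ τ' : Tile n} (hτ : τ ∈ K)
    (hτ' : τ' ∈ K) (h1 : w τ = 1) (h0 : w τ' = 0) {x y : Plane} (hx : x ∈ τ.polygon ξ)
    (hy : y ∈ τ'.polygon ξ) : ¬ JoinedIn (zonogon ξ \ curve ξ P) x y := by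
  rintro ⟨γ, hγ⟩
  have hpre : IsPreconnected (Set.range γ) := isPreconnected_range γ.continuous
  obtain ⟨z, ⟨t, rfl⟩, hL, hR⟩ := isPreconnected_closed_iff.1 hpre _ _
    (isClosed_union_tiles hξ hK fun τ => w τ = 1) (isClosed_union_tiles hξ hK fun τ => w τ = 0)
    (by
      rintro y ⟨t, rfl⟩
      have := (hγ t).1
      rw [← (hK.isCTiling hξ hn).cover, Set.mem_iUnion₂] at this
      obtain ⟨σ, hσ, hyσ⟩ := this
      rcases h01 σ hσ with h | h
      · exact Or.inr (Set.mem_biUnion (show σ ∈ {τ | τ ∈ K ∧ w τ = 0} from ⟨hσ, h⟩) hyσ)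
      · aesop)
    ⟨x, ⟨0, γ.source⟩, Set.mem_biUnion (show τ ∈ {τ | τ ∈ K ∧ w τ = 1} from ⟨hτ, h1⟩) hx⟩
    ⟨y, ⟨1, γ.target⟩, Set.mem_biUnion (show τ' ∈ {τ | τ ∈ K ∧ w τ = 0} from ⟨hτ', h0⟩) hy⟩
  obtain ⟨σ, hσ, hyσ⟩ := Set.mem_iUnion₂.1 hL
  obtain ⟨σ', hσ', hyσ'⟩ := Set.mem_iUnion₂.1 hR
  exact (hγ t).2 (mem_curve_of_ne hξ hn hK hw h01 hσ.1 hσ'.1 hσ.2 hσ'.2 hyσ hyσ')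

theorem mem_leftPart_iff (hξ : IsGenerators ξ) (hn : 2 ≤ n) (hK : EdgeTiling ξ K)
    (hw : IsWinding K P w) {b : Vert n} (hP : Leg K ∅ b P) {τ : Tile n} :
    τ ∈ leftPart ξ K P ↔ τ ∈ K ∧ w τ = 1 := by
  have h01 := winding_eq_zero_or_one hξ hK hw hP
  refine ⟨fun ⟨hτ, h⟩ => ⟨hτ, (h01 τ hτ).resolve_left fun h0 => ?_⟩, fun ⟨hτ, h⟩ => ⟨hτ,
    polygon_subset_region hξ hK hP.isPathOf hτ (tileJoined_lbd hξ hK hw hP τ hτ h)⟩⟩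
  obtain ⟨c, hc⟩ := (hK.valid τ hτ).inner_nonempty hξ
  have hcp := (hK.valid τ hτ).inner_subset hξ hc
  rcases h hcp with h | ⟨x, hx, hj⟩
  · exact (offEdges_of_inner hξ hK hτ hc).notMem_curve hP.isPathOf h
  · obtain ⟨i, hi⟩ := Set.mem_iUnion.1 hx
    obtain ⟨τ', hτ', h'⟩ := hK.left_boundary i
    have hxc : x ∉ curve ξ P := hj.target_mem.2
    have h1 : w τ' = 1 := by
      rw [hw.left τ' hτ' i h', mult_eq_zero, sub_zero]
      exact fun hin => hxc (segment_subset_curve (ξ := ξ) (A := (leftBoundaryEdge i).1)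
        (B := (leftBoundaryEdge i).2) hin hi)
    refine not_joinedIn hξ hn hK hw h01 hτ' hτ h1 h0 (x := x) ?_ hcp hj.symm
    exact Tile.segment_subset_polygon (Tile.mem_edges_iff.2 (Or.inl h')) hi

theorem mem_rightPart_iff (hξ : IsGenerators ξ) (hn : 2 ≤ n) (hK : EdgeTiling ξ K)
    (hw : IsWinding K P w) {b : Vert n} (hP : Leg K ∅ b P) {τ : Tile n} :
    τ ∈ rightPart ξ K P ↔ τ ∈ K ∧ w τ = 0 := by
  have h01 := winding_eq_zero_or_one hξ hK hw hP
  refine ⟨fun ⟨hτ, h⟩ => ⟨hτ, (h01 τ hτ).resolve_right fun h1 => ?_⟩, fun ⟨hτ, h⟩ => ⟨hτ,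
    polygon_subset_region hξ hK hP.isPathOf hτ (tileJoined_rbd hξ hK hw hP τ hτ h)⟩⟩
  obtain ⟨c, hc⟩ := (hK.valid τ hτ).inner_nonempty hξ
  have hcp := (hK.valid τ hτ).inner_subset hξ hc
  rcases h hcp with h | ⟨x, hx, hj⟩
  · exact (offEdges_of_inner hξ hK hτ hc).notMem_curve hP.isPathOf h
  · obtain ⟨i, hi⟩ := Set.mem_iUnion.1 hx
    obtain ⟨τ', hτ', h'⟩ := hK.right_boundary i
    have hxc : x ∉ curve ξ P := hj.target_mem.2
    have h0 : w τ' = 0 := by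
      rw [hw.right τ' hτ' i h', mult_eq_zero]
      exact fun hin => hxc (segment_subset_curve (ξ := ξ) (A := (rightBoundaryEdge i).1)
        (B := (rightBoundaryEdge i).2) hin hi)
    refine not_joinedIn hξ hn hK hw h01 hτ hτ' h1 h0 (y := x) hcp ?_ hj
    exact Tile.segment_subset_polygon (Tile.mem_edges_iff.2 (Or.inr h')) hi

end regions

end Combi

namespace Combi

/-! ### Subsets of the smaller and of the larger index set -/

section lift

variable {n : ℕ}

@[simp] lemma castSucc_mem_lo {A : Vert n} {i : Fin n} : i.castSucc ∈ lo A ↔ i ∈ A := by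
  simp [lo]

@[simp] lemma last_notMem_lo {A : Vert n} : Fin.last n ∉ lo A := by
  simp [lo, Fin.castSucc_ne_last]

@[simp] lemma castSucc_mem_hi {A : Vert n} {i : Fin n} : i.castSucc ∈ hi A ↔ i ∈ A := by
  simp [hi, Fin.castSucc_ne_last]

@[simp] lemma last_mem_hi {A : Vert n} : Fin.last n ∈ hi A := by simp [hi]

@[simp] lemma mem_drop {A : Vert (n + 1)} {i : Fin n} : i ∈ drop A ↔ i.castSucc ∈ A := by
  simp [drop]

lemma ext_castSucc {A B : Vert (n + 1)} (h : ∀ i : Fin n, i.castSucc ∈ A ↔ i.castSucc ∈ B)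
    (hl : Fin.last n ∈ A ↔ Fin.last n ∈ B) : A = B := by
  ext k
  refine Fin.lastCases ?_ (fun i => ?_) k
  · exact hl
  · exact h i

@[simp] lemma drop_lo (A : Vert n) : drop (lo A) = A := by ext; simp

@[simp] lemma drop_hi (A : Vert n) : drop (hi A) = A := by ext; simp

lemma lo_drop {A : Vert (n + 1)} (h : Fin.last n ∉ A) : lo (drop A) = A :=
  ext_castSucc (by simp) (by simp [h])

lemma hi_drop {A : Vert (n + 1)} (h : Fin.last n ∈ A) : hi (drop A) = A :=
  ext_castSucc (by simp) (by simp [h])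

lemma lo_injective : Function.Injective (lo (n := n)) :=
  Function.LeftInverse.injective drop_lo

lemma hi_injective : Function.Injective (hi (n := n)) :=
  Function.LeftInverse.injective drop_hi

lemma lo_ne_hi (A B : Vert n) : lo A ≠ hi B := fun h => by
  have : Fin.last n ∈ lo A := by rw [h]; simp
  simp at this

lemma lo_insert (i : Fin n) (A : Vert n) :
    lo (insert i A) = insert i.castSucc (lo A) :=
  ext_castSucc (by simp [Fin.castSucc_inj]) (by simp [(Fin.castSucc_ne_last _).symm])

lemma hi_insert (i : Fin n) (A : Vert n) :
    hi (insert i A) = insert i.castSucc (hi A) :=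
  ext_castSucc (by simp [Fin.castSucc_inj]) (by simp)

lemma lo_erase (i : Fin n) (A : Vert n) :
    lo (A.erase i) = (lo A).erase i.castSucc :=
  ext_castSucc (by simp [Fin.castSucc_inj]) (by simp)

lemma hi_erase (i : Fin n) (A : Vert n) :
    hi (A.erase i) = (hi A).erase i.castSucc :=
  ext_castSucc (by simp [Fin.castSucc_inj])
    (by simp [(Fin.castSucc_ne_last _).symm])

lemma hi_erase_last (A : Vert n) : (hi A).erase (Fin.last n) = lo A :=
  ext_castSucc (by simp [Fin.castSucc_ne_last]) (by simp)

/-- A map of vertices that preserves the types of edges. -/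
structure IsLift (f : Vert n → Vert (n + 1)) : Prop where
  mem : ∀ i A, Fin.castSucc i ∈ f A ↔ i ∈ A
  insert : ∀ i A, f (insert i A) = insert i.castSucc (f A)
  erase : ∀ i A, f (A.erase i) = (f A).erase i.castSucc

lemma isLift_lo : IsLift (lo (n := n)) := ⟨by simp, lo_insert, lo_erase⟩

lemma isLift_hi : IsLift (hi (n := n)) := ⟨by simp, hi_insert, hi_erase⟩

variable {f : Vert n → Vert (n + 1)}

lemma IsLift.isVEdge (hf : IsLift f) {i : Fin n} {A B : Vert n} (h : IsVEdge i A B) :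
    IsVEdge i.castSucc (f A) (f B) :=
  ⟨fun h' => h.1 ((hf.mem i A).1 h'), by rw [h.2, hf.insert]⟩

lemma IsLift.isHEdge (hf : IsLift f) {i j : Fin n} {A B : Vert n} (h : IsHEdge i j A B) :
    IsHEdge i.castSucc j.castSucc (f A) (f B) := by
  obtain ⟨hij, X, hi, hj, rfl, rfl⟩ := h
  exact ⟨by simpa using hij, f X, fun h => hi ((hf.mem _ _).1 h), fun h => hj ((hf.mem _ _).1 h),
    hf.insert _ _, hf.insert _ _⟩

lemma IsLift.isValid (hf : IsLift f) {τ : Tile n} (h : τ.IsValid) : (τ.map f).IsValid := by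
  cases τ with
  | delta A B C =>
    obtain ⟨i, j, h1, h2, h3⟩ := h
    exact ⟨_, _, hf.isHEdge h1, hf.isVEdge h2, hf.isVEdge h3⟩
  | nabla A B C =>
    obtain ⟨i, j, h1, h2, h3⟩ := h
    exact ⟨_, _, hf.isHEdge h1, hf.isVEdge h2, hf.isVEdge h3⟩
  | lens U L =>
    obtain ⟨X, Y, I, J, h1, h2, h3, rfl, h5, h6, h7, rfl, h9, h10⟩ := h
    refine ⟨f X, f Y, I.map Fin.castSucc, J.map Fin.castSucc, ?_, by simpa using h2, ?_, ?_, ?_,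
      by simpa using h6, ?_, ?_, ?_, ?_⟩
    · rw [List.pairwise_map]; exact h1.imp fun h => by simpa using h
    · simp only [List.mem_map, forall_exists_index, and_imp, forall_apply_eq_imp_iff₂]
      exact fun i hi h => h3 i hi ((hf.mem _ _).1 h)
    · simp [List.map_map, Function.comp_def, hf.insert]
    · rw [List.pairwise_map]; exact h5.imp fun h => by simpa using h
    · simp only [List.mem_map, forall_exists_index, and_imp, forall_apply_eq_imp_iff₂]
      exact fun i hi => (hf.mem _ _).2 (h7 i hi)
    · simp [List.map_map, Function.comp_def, hf.erase]
    · rw [List.head?_map, List.head?_map (f := f), h9]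
    · rw [List.getLast?_map, List.getLast?_map (f := f), h10]

lemma Tile.lpath_map {m k : ℕ} (g : Finset (Fin m) → Finset (Fin k)) (τ : Tile m) :
    (τ.map g).lpath = τ.lpath.map g := by cases τ <;> rfl

lemma Tile.rpath_map {m k : ℕ} (g : Finset (Fin m) → Finset (Fin k)) (τ : Tile m) :
    (τ.map g).rpath = τ.rpath.map g := by cases τ <;> rfl

lemma Tile.bdry_map {m k : ℕ} (g : Finset (Fin m) → Finset (Fin k))
    (φ : Finset (Fin k) → Finset (Fin k) → ℤ) (τ : Tile m) :
    (τ.map g).bdry φ = τ.bdry (fun A B => φ (g A) (g B)) := by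
  rw [Tile.bdry, Tile.lpath_map, Tile.rpath_map, pathSum_map, pathSum_map, Tile.bdry]

lemma leftBoundaryEdge_castSucc (i : Fin n) :
    leftBoundaryEdge i.castSucc = (lo (leftBoundaryEdge i).1, lo (leftBoundaryEdge i).2) := by
  unfold leftBoundaryEdge
  refine Prod.ext (ext_castSucc ?_ ?_) (ext_castSucc ?_ ?_) <;>
    simp [Fin.castSucc_lt_castSucc_iff, Fin.castSucc_le_castSucc_iff,
      (Fin.castSucc_lt_last _).not_ge, (Fin.castSucc_lt_last _).not_gt]

lemma leftBoundaryEdge_last :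
    leftBoundaryEdge (Fin.last n) = (lo Finset.univ, hi Finset.univ) := by
  unfold leftBoundaryEdge
  refine Prod.ext (ext_castSucc ?_ ?_) (ext_castSucc ?_ ?_) <;>
    simp [Fin.castSucc_lt_last, Fin.le_last]

lemma rightBoundaryEdge_castSucc (i : Fin n) :
    rightBoundaryEdge i.castSucc = (hi (rightBoundaryEdge i).1, hi (rightBoundaryEdge i).2) := by
  unfold rightBoundaryEdge
  refine Prod.ext (ext_castSucc ?_ ?_) (ext_castSucc ?_ ?_) <;>
    simp [Fin.castSucc_lt_castSucc_iff, Fin.castSucc_le_castSucc_iff, Fin.le_last,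
      (Fin.castSucc_lt_last _)]

lemma rightBoundaryEdge_last :
    rightBoundaryEdge (Fin.last n) = (lo ∅, hi ∅) := by
  unfold rightBoundaryEdge
  refine Prod.ext (ext_castSucc ?_ ?_) (ext_castSucc ?_ ?_) <;>
    simp [(Fin.castSucc_lt_last _).not_gt]

lemma zonogonBdry_succ (ψ : Vert (n + 1) → Vert (n + 1) → ℤ) :
    zonogonBdry ψ =
      ∑ i : Fin n, ψ (lo (leftBoundaryEdge i).1) (lo (leftBoundaryEdge i).2) +
        ψ (lo Finset.univ) (hi Finset.univ) -
      (∑ i : Fin n, ψ (hi (rightBoundaryEdge i).1) (hi (rightBoundaryEdge i).2) +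
        ψ (lo ∅) (hi ∅)) := by
  unfold zonogonBdry
  simp only [Fin.sum_univ_castSucc, leftBoundaryEdge_castSucc, leftBoundaryEdge_last,
    rightBoundaryEdge_castSucc, rightBoundaryEdge_last]

end lift

/-! ### The boundary sums of the two sides of a legal path -/

section sides

variable {n : ℕ} {ξ : Fin n → Plane} {K : Set (Tile n)} {P : List (Vert n)}
  {w : Tile n → ℤ}

lemma peakFillings_subset (hξ : IsGenerators ξ) (hK : EdgeTiling ξ K) (hw : IsWinding K P w)
    {b : Vert n} (hP : Leg K ∅ b P) {τ : Tile n} (hτ : τ ∈ peakFillings K P) :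
    τ ∈ K ∧ w τ = 0 := by
  obtain ⟨a, b, c, Y, u, v, ⟨hi, h1, h2⟩, hY, huv, rfl⟩ := hτ
  have hm : Tile.delta b u v ∈ K := chain_of_pair_infix hY.2.2 huv
  refine ⟨hm, ?_⟩
  have ⟨_, h⟩ := hY.stripLE
  obtain ⟨hu, hv⟩ := h u v huv
  have ha : InPath P (a, b) := Or.inl (List.IsInfix.trans ⟨[], [c], rfl⟩ hi)
  have hc : InPath P (c, b) := Or.inr (List.IsInfix.trans ⟨[a], [], rfl⟩ hi)
  rcases strip_position hξ hK hw hP hm (exists_stripTile_delta b u v) with h | h | h | h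
  · exact absurd ha (h.2 _ hu)
  · exact h.1
  · obtain ⟨_, _, _, _, _, _, _, _, _, h⟩ := h.2
    cases h
  · exact h.1

lemma pitFillings_subset (hξ : IsGenerators ξ) (hK : EdgeTiling ξ K) (hw : IsWinding K P w)
    {b : Vert n} (hP : Leg K ∅ b P) {τ : Tile n} (hτ : τ ∈ pitFillings K P) :
    τ ∈ K ∧ w τ = 1 := by
  obtain ⟨a, b, c, Y, u, v, ⟨hi, h1, h2⟩, hY, huv, rfl⟩ := hτ
  have hm : Tile.nabla b u v ∈ K := chain_of_pair_infix hY.2.2 huv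
  refine ⟨hm, ?_⟩
  have ⟨_, h⟩ := hY.stripLE
  obtain ⟨hu, hv⟩ := h u v huv
  have ha : InPath P (b, a) := Or.inr (List.IsInfix.trans ⟨[], [c], rfl⟩ hi)
  have hc : InPath P (b, c) := Or.inl (List.IsInfix.trans ⟨[a], [], rfl⟩ hi)
  rcases strip_position hξ hK hw hP hm (exists_stripTile_nabla b u v) with h | h | h | h
  · exact h.1
  · obtain ⟨_, _, _, _, _, _, _, _, _, h⟩ := h.2
    cases h
  · exact h.1
  · exact absurd hc (h.2 _ hv)

lemma pathSum_eq_sum_mult {φ : Vert n → Vert n → ℤ} (hφ : ∀ A B, φ A B = -φ B A)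
    {l : List (Vert n)} (hl : ∀ A B, [A, B] <:+: l → weight A < weight B ∨ weight B < weight A) :
    pathSum φ l = ∑ e : Edge n, φ e.1 e.2 *
      (if weight e.1 < weight e.2 then mult l e else 0) := by
  induction l with
  | nil => simp [mult]
  | cons a t ih =>
    cases t with
    | nil => simp [mult]
    | cons b t =>
      have h0 := ih fun A B h => hl A B (pair_infix_cons.2 (Or.inr h))
      rw [pathSum_cons_cons, h0]
      have key : ∀ e : Edge n, φ e.1 e.2 *
          (if weight e.1 < weight e.2 then mult (a :: b :: t) e else 0) =
          φ e.1 e.2 * (if weight e.1 < weight e.2 then edgeIndicator e a b else 0) +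
          φ e.1 e.2 * (if weight e.1 < weight e.2 then mult (b :: t) e else 0) := by
        intro e
        simp only [mult, pathSum_cons_cons]
        split_ifs <;> ring
      simp only [key, Finset.sum_add_distrib]
      congr 1
      rcases hl a b (pair_infix_cons.2 (Or.inl ⟨rfl, rfl⟩)) with h | h
      · rw [Finset.sum_eq_single (a, b)]
        · have : (b, a) ≠ (a, b) := by rintro ⟨⟩; simp at h
          simp [edgeIndicator, h, this]
        · intro e _ hne
          split_ifs with h'
          · have h2 : (b, a) ≠ e := by rintro rfl; dsimp only at h'; omega
            simp [edgeIndicator, hne.symm, h2]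
          · simp
        · simp
      · rw [Finset.sum_eq_single (b, a)]
        · have : (a, b) ≠ (b, a) := by rintro ⟨⟩; simp at h
          simp [edgeIndicator, h, this, hφ a b]
        · intro e _ hne
          split_ifs with h'
          · have h2 : (a, b) ≠ e := by rintro rfl; dsimp only at h'; omega
            simp [edgeIndicator, hne.symm, h2]
          · simp
        · simp

open Classical in
theorem sum_bdry_left (hξ : IsGenerators ξ) (hn : 2 ≤ n) (hK : EdgeTiling ξ K)
    (hw : IsWinding K P w) {b : Vert n} (hP : Leg K ∅ b P)
    {φ : Vert n → Vert n → ℤ} (hφ : ∀ A B, φ A B = -φ B A) :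
    ∑ τ ∈ hK.finite.toFinset.filter (fun τ => w τ = 1), τ.bdry φ =
      ∑ i, φ (leftBoundaryEdge i).1 (leftBoundaryEdge i).2 - pathSum φ P := by
  have h01 := winding_eq_zero_or_one hξ hK hw hP
  have hpath : IsPathOf K P := hP.isPathOf
  have hedge : ∀ A B, (A, B) ∈ edges K → weight A < weight B := by
    rintro A B ⟨τ, hτ, h⟩
    rcases Tile.mem_edges_iff.1 h with h | h
    exacts [(hK.valid τ hτ).lpath_weight_lt A B h, (hK.valid τ hτ).rpath_weight_lt A B h]
  have hne : ∀ A B, [A, B] <:+: P → weight A < weight B ∨ weight B < weight A := by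
    intro A B h
    rcases hpath.edge A B h with h | h
    exacts [Or.inl (hedge _ _ h), Or.inr (hedge _ _ h)]
  have hl : ∑ i, φ (leftBoundaryEdge i).1 (leftBoundaryEdge i).2 =
      ∑ e : Edge n, φ e.1 e.2 *
        (if ∃ i, e = leftBoundaryEdge i then 1 else 0) := by
    simp only [mul_ite, mul_one, mul_zero]
    rw [← Finset.sum_filter]
    have : (Finset.univ.filter fun e : Edge n =>
        ∃ i, e = leftBoundaryEdge i) = Finset.univ.image leftBoundaryEdge := by
      ext e; simp [eq_comm]
    rw [this, Finset.sum_image fun _ _ _ _ h => leftBoundaryEdge_injective h]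
  rw [hK.sum_bdry hξ _ (by simp +contextual) φ, hl, pathSum_eq_sum_mult hφ hne,
    ← Finset.sum_sub_distrib]
  refine Finset.sum_congr rfl fun e _ => ?_
  rw [← mul_sub]
  congr 1
  obtain ⟨A, B⟩ := e
  simp only [Finset.mem_filter, Set.Finite.mem_toFinset]
  by_cases hAl : ∃ τ ∈ K, [A, B] <:+: τ.lpath <;> by_cases hAr : ∃ τ ∈ K, [A, B] <:+: τ.rpath
  · obtain ⟨τ, hτ, h⟩ := hAl
    obtain ⟨τ', hτ', h'⟩ := hAr
    have hlt := (hK.valid τ hτ).lpath_weight_lt A B h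
    have e1 : (∃ σ, (σ ∈ K ∧ w σ = 1) ∧ [A, B] <:+: σ.lpath) ↔ w τ = 1 :=
      ⟨fun ⟨σ, ⟨h1, h2⟩, h3⟩ => hK.left_unique hξ hτ h1 h h3 ▸ h2, fun h1 => ⟨τ, ⟨hτ, h1⟩, h⟩⟩
    have e2 : (∃ σ, (σ ∈ K ∧ w σ = 1) ∧ [A, B] <:+: σ.rpath) ↔ w τ' = 1 :=
      ⟨fun ⟨σ, ⟨h1, h2⟩, h3⟩ => hK.right_unique hξ hτ' h1 h' h3 ▸ h2,
        fun h1 => ⟨τ', ⟨hτ', h1⟩, h'⟩⟩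
    have e3 : ¬ ∃ i, (A, B) = leftBoundaryEdge i := by
      rintro ⟨i, hi⟩
      have := (hK.valid τ' hτ').leftBoundaryEdge_not_rpath hξ i
      rw [← hi] at this
      exact this h'
    have hj := hw.jump τ hτ τ' hτ' A B h h'
    simp only [e1, e2, e3, hlt, if_true, if_false]
    rcases h01 τ hτ with h1 | h1 <;> rcases h01 τ' hτ' with h2 | h2 <;> simp [h1, h2] at hj ⊢ <;>
      omega
  · obtain ⟨τ, hτ, h⟩ := hAl
    have hlt := (hK.valid τ hτ).lpath_weight_lt A B h
    have e1 : (∃ σ, (σ ∈ K ∧ w σ = 1) ∧ [A, B] <:+: σ.lpath) ↔ w τ = 1 :=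
      ⟨fun ⟨σ, ⟨h1, h2⟩, h3⟩ => hK.left_unique hξ hτ h1 h h3 ▸ h2, fun h1 => ⟨τ, ⟨hτ, h1⟩, h⟩⟩
    have e2 : ¬ ∃ σ, (σ ∈ K ∧ w σ = 1) ∧ [A, B] <:+: σ.rpath :=
      fun ⟨σ, h1, h2⟩ => hAr ⟨σ, h1.1, h2⟩
    obtain ⟨i, hi⟩ := (hK.left_exists τ hτ A B h).resolve_right fun ⟨σ, h1, h2⟩ => hAr ⟨σ, h1, h2⟩
    have hj := hw.left τ hτ i (by rw [← hi]; exact h)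
    rw [← hi] at hj
    have e3 : ∃ i, (A, B) = leftBoundaryEdge i := ⟨i, hi⟩
    simp only [e1, e2, e3, hlt, if_true, if_false]
    rcases h01 τ hτ with h1 | h1 <;> simp [h1] at hj ⊢ <;> omega
  · obtain ⟨τ, hτ, h⟩ := hAr
    have hlt := (hK.valid τ hτ).rpath_weight_lt A B h
    have e1 : (∃ σ, (σ ∈ K ∧ w σ = 1) ∧ [A, B] <:+: σ.rpath) ↔ w τ = 1 :=
      ⟨fun ⟨σ, ⟨h1, h2⟩, h3⟩ => hK.right_unique hξ hτ h1 h h3 ▸ h2, fun h1 => ⟨τ, ⟨hτ, h1⟩, h⟩⟩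
    have e2 : ¬ ∃ σ, (σ ∈ K ∧ w σ = 1) ∧ [A, B] <:+: σ.lpath :=
      fun ⟨σ, h1, h2⟩ => hAl ⟨σ, h1.1, h2⟩
    obtain ⟨i, hi⟩ := (hK.right_exists τ hτ A B h).resolve_right
      fun ⟨σ, h1, h2⟩ => hAl ⟨σ, h1, h2⟩
    have hj := hw.right τ hτ i (by rw [← hi]; exact h)
    rw [← hi] at hj
    have e3 : ¬ ∃ i, (A, B) = leftBoundaryEdge i := by
      rintro ⟨j, hj'⟩
      exact leftBoundaryEdge_ne_rightBoundaryEdge hn j i (hj'.symm.trans hi)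
    simp only [e1, e2, e3, hlt, if_true, if_false]
    rcases h01 τ hτ with h1 | h1 <;> simp [h1] at hj ⊢ <;> omega
  · have e1 : ¬ ∃ σ, (σ ∈ K ∧ w σ = 1) ∧ [A, B] <:+: σ.rpath :=
      fun ⟨σ, h1, h2⟩ => hAr ⟨σ, h1.1, h2⟩
    have e2 : ¬ ∃ σ, (σ ∈ K ∧ w σ = 1) ∧ [A, B] <:+: σ.lpath :=
      fun ⟨σ, h1, h2⟩ => hAl ⟨σ, h1.1, h2⟩
    have e3 : ¬ ∃ i, (A, B) = leftBoundaryEdge i := by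
      rintro ⟨i, hi⟩
      obtain ⟨τ, hτ, h⟩ := hK.left_boundary i
      rw [← hi] at h
      exact hAl ⟨τ, hτ, h⟩
    have e4 : (A, B) ∉ edges K := by
      rintro ⟨τ, hτ, h⟩
      rcases Tile.mem_edges_iff.1 h with h | h
      exacts [hAl ⟨τ, hτ, h⟩, hAr ⟨τ, hτ, h⟩]
    simp only [e1, e2, e3, if_false]
    split_ifs with hlt
    · rw [mult_eq_zero]
      rintro (h | h)
      · rcases hpath.edge A B h with h | h
        · exact e4 h
        · have := hedge _ _ h; omega
      · rcases hpath.edge B A h with h | h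
        · have := hedge _ _ h; omega
        · exact e4 h
    · rfl

open Classical in
theorem sum_bdry_right (hξ : IsGenerators ξ) (hn : 2 ≤ n) (hK : EdgeTiling ξ K)
    (hw : IsWinding K P w) {b : Vert n} (hP : Leg K ∅ b P)
    {φ : Vert n → Vert n → ℤ} (hφ : ∀ A B, φ A B = -φ B A) :
    ∑ τ ∈ hK.finite.toFinset.filter (fun τ => w τ = 0), τ.bdry φ =
      pathSum φ P - ∑ i, φ (rightBoundaryEdge i).1 (rightBoundaryEdge i).2 := by
  have h01 := winding_eq_zero_or_one hξ hK hw hP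
  have h1 := sum_bdry_left hξ hn hK hw hP hφ
  have h := hK.sum_bdry_eq hξ φ
  rw [← Finset.sum_filter_add_sum_filter_not _ (fun τ => w τ = 1), h1, zonogonBdry] at h
  have : hK.finite.toFinset.filter (fun τ => w τ = 0) =
      hK.finite.toFinset.filter (fun τ => ¬ w τ = 1) := by
    refine Finset.filter_congr fun τ hτ => ?_
    rcases h01 τ (by simpa using hτ) with h | h <;> simp [h]
  rw [this]
  linarith

end sides

end Combi

namespace Combi

/-! ### The expansion is a combined tiling -/

section newTiles

variable {n : ℕ} {ξ : Fin n → Plane} {K : Set (Tile n)} {P : List (Vert n)}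

/-- The `∇`-tile of the strip with the left edge `(lo a, lo b)`. -/
abbrev upTile (a b : Vert n) : Tile (n + 1) := Tile.nabla (lo a) (lo b) (hi a)

/-- The `Δ`-tile of the strip with the right edge `(hi a, hi b)`. -/
abbrev downTile (a b : Vert n) : Tile (n + 1) := Tile.delta (hi b) (lo b) (hi a)

lemma isVEdge_last (a : Vert n) : IsVEdge (Fin.last n) (lo a) (hi a) :=
  ⟨last_notMem_lo, rfl⟩

lemma IsVEdge.isHEdge_last {i : Fin n} {a b : Vert n} (h : IsVEdge i a b) :
    IsHEdge i.castSucc (Fin.last n) (lo b) (hi a) :=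
  ⟨Fin.castSucc_lt_last i, lo a, by simpa using h.1, last_notMem_lo,
    (isLift_lo.isVEdge h).2, rfl⟩

lemma isValid_upTile {i : Fin n} {a b : Vert n} (h : IsVEdge i a b) :
    (upTile a b).IsValid :=
  ⟨_, _, h.isHEdge_last, isLift_lo.isVEdge h, isVEdge_last a⟩

lemma isValid_downTile {i : Fin n} {a b : Vert n} (h : IsVEdge i a b) :
    (downTile a b).IsValid :=
  ⟨_, _, h.isHEdge_last, isVEdge_last b, isLift_hi.isVEdge h⟩

lemma exists_map_of_isChain {α ι : Type*} {R : α → α → Prop} {r : ι → ι → Prop} [IsTrans ι r]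
    {p : ι → Prop} {f : ι → α} (hf : ∀ i j, p i → p j → f i = f j → i = j)
    (hR : ∀ u v, R u v → ∃ i j, r i j ∧ p i ∧ p j ∧ u = f i ∧ v = f j) {X : List α}
    (h : X.IsChain R) (hX : 2 ≤ X.length) :
    ∃ I : List ι, I.Pairwise r ∧ (∀ i ∈ I, p i) ∧ X = I.map f := by
  suffices ∃ I : List ι, I.IsChain r ∧ (∀ i ∈ I, p i) ∧ X = I.map f by
    simpa only [List.isChain_iff_pairwise] using this
  induction X with
  | nil => simp at hX
  | cons u t ih =>
    rcases t with _ | ⟨v, t⟩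
    · simp at hX
    obtain ⟨h1, h2⟩ := List.isChain_cons_cons.1 h
    obtain ⟨i, j, hij, hi, hj, rfl, rfl⟩ := hR _ _ h1
    rcases t with _ | ⟨x, t⟩
    · exact ⟨[i, j], by simpa using hij, by simp [hi, hj], rfl⟩
    · obtain ⟨I, hI, hIp, hIX⟩ := ih h2 (by simp)
      rcases I with _ | ⟨k, I⟩
      · simp at hIX
      · simp only [List.map_cons, List.cons.injEq] at hIX
        obtain rfl := hf j k hj (hIp k (by simp)) hIX.1
        exact ⟨i :: j :: I, List.isChain_cons_cons.2 ⟨hij, hI⟩, by simpa [hi] using hIp,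
          by simp [hIX.2]⟩

lemma IsUpperFilling.exists_index (hK : ∀ τ ∈ K, τ.IsValid) {y a c : Vert n}
    {X : List (Vert n)} (h : IsUpperFilling K a y c X) (hX : 2 ≤ X.length) :
    ∃ I : List (Fin n), I.Pairwise (· < ·) ∧ (∀ i ∈ I, i ∉ y) ∧ X = I.map (insert · y) := by
  refine exists_map_of_isChain (fun i j hi hj e => ?_) (fun u v huv => ?_) h.2.2 hX
  · have : i ∈ insert j y := e ▸ Finset.mem_insert_self i y
    exact (Finset.mem_insert.1 this).resolve_right hi
  · obtain ⟨i, j, hij, hi, hj⟩ := hK _ huv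
    exact ⟨i, j, hij.1, hi.1, hj.1, hi.2, hj.2⟩

lemma IsLowerFilling.exists_index (hK : ∀ τ ∈ K, τ.IsValid) {y a c : Vert n}
    {X : List (Vert n)} (h : IsLowerFilling K a y c X) (hX : 2 ≤ X.length) :
    ∃ I : List (Fin n), I.Pairwise (· > ·) ∧ (∀ i ∈ I, i ∈ y) ∧ X = I.map (y.erase ·) := by
  refine exists_map_of_isChain (fun i j hi hj e => ?_) (fun u v huv => ?_) h.2.2 hX
  · by_contra hne
    exact Finset.notMem_erase i y (e ▸ Finset.mem_erase.2 ⟨hne, hi⟩)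
  · obtain ⟨j, i, hij, ⟨hi, rfl⟩, hj, hj'⟩ := hK _ huv
    exact ⟨i, j, hij.1, by simp, by simp [hj'], by simp [hi], by simp [hj', hj]⟩

/-- The lens of the expansion that replaces the backward edge from the peak `x` to the pit `y`. -/
abbrev stripLens (x y : Vert n) (X Y : List (Vert n)) : Tile (n + 1) :=
  Tile.lens (X.map lo ++ [hi y]) (lo x :: Y.map hi)

lemma two_le_length {α : Type*} {l : List α} {a b : α} (h : l.head? = some a)
    (h' : l.getLast? = some b) (hne : a ≠ b) : 2 ≤ l.length := by
  match l with
  | [] => simp at h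
  | [x] => simp at h h'; exact absurd (h.symm.trans h') hne
  | _ :: _ :: _ => simp

lemma isValid_stripLens (hK : ∀ τ ∈ K, τ.IsValid) {a x y z : Vert n}
    {X Y : List (Vert n)} (hY : IsLowerFilling K a x y Y) (hX : IsUpperFilling K x y z X)
    (hay : a ≠ y) (hxz : x ≠ z) : (stripLens x y X Y).IsValid := by
  obtain ⟨I, hI, hIy, hIX⟩ := hX.exists_index hK (two_le_length hX.1 hX.2.1 hxz)
  obtain ⟨J, hJ, hJy, hJY⟩ := hY.exists_index hK (two_le_length hY.1 hY.2.1 hay)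
  have hXl := two_le_length hX.1 hX.2.1 hxz
  have hYl := two_le_length hY.1 hY.2.1 hay
  refine ⟨lo y, hi x, I.map Fin.castSucc ++ [Fin.last n], Fin.last n :: J.map Fin.castSucc,
    ?_, ?_, ?_, ?_, ?_, ?_, ?_, ?_, ?_, ?_⟩
  · grind
  · rw [hIX] at hXl; simp at hXl ⊢; omega
  · aesop
  · simp [hIX, List.map_map, Function.comp_def, lo_insert, hi]
  · rw [List.pairwise_cons, List.pairwise_map]
    refine ⟨by simp [Fin.castSucc_lt_last], hJ.imp fun h => by simpa using h⟩
  · rw [hJY] at hYl; simp at hYl ⊢; omega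
  · simp_all
  · simp [hJY, List.map_map, Function.comp_def, hi_erase, hi_erase_last]
  · obtain ⟨t, ht⟩ := head_eq_of_head? hX.1
    simp [ht]
  · have : (lo x :: Y.map hi).getLast? = some (hi y) := by
      rw [List.getLast?_cons, List.getLast?_map, hY.2.1]; rfl
    rw [this]; simp

open Classical in
lemma exists_finset_pairs {α β : Type*} {f : α → α → β}
    (hf : ∀ u v u' v', f u v = f u' v' → u = u') {X : List α} (hX : X.Nodup) :
    ∃ G : Finset β, (∀ τ, τ ∈ G ↔ ∃ u v, [u, v] <:+: X ∧ τ = f u v) ∧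
      ∀ φ : β → ℤ, ∑ τ ∈ G, φ τ = pathSum (fun u v => φ (f u v)) X := by
  induction X with
  | nil => exact ⟨∅, by simp, by simp⟩
  | cons u t ih =>
    rcases t with _ | ⟨v, t⟩
    · exact ⟨∅, by simp [not_pair_infix], by simp⟩
    · obtain ⟨h1, h2⟩ := List.nodup_cons.1 hX
      obtain ⟨G, hG, hs⟩ := ih h2
      refine ⟨insert (f u v) G, fun τ => ?_, fun φ => ?_⟩
      · rw [Finset.mem_insert, hG]
        simp only [pair_infix_cons]
        grind
      · rw [Finset.sum_insert, hs, pathSum_cons_cons]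
        rw [hG]
        rintro ⟨u', v', h, he⟩
        exact h1 (hf _ _ _ _ he ▸ (pair_infix_mem h).1)

lemma pathSum_telescope {α : Type*} {φ ψ : α → α → ℤ} {g : α → ℤ} {k : ℤ} {X : List α} {a c : α}
    (hψ : ∀ u v, ψ u v = k * φ u v + (g v - g u)) (ha : X.head? = some a)
    (hc : X.getLast? = some c) : pathSum ψ X = k * pathSum φ X + (g c - g a) := by
  induction X generalizing a with
  | nil => simp at ha
  | cons u t ih =>
    obtain rfl : u = a := by simpa using ha
    rcases t with _ | ⟨v, t⟩
    · obtain rfl : u = c := by simpa using hc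
      simp
    · rw [pathSum_cons_cons, pathSum_cons_cons, ih rfl (by simpa using hc), hψ]
      ring

lemma exists_finset_nabla (hK : ∀ τ ∈ K, τ.IsValid) {y a c : Vert n} {X : List (Vert n)}
    (h : IsUpperFilling K a y c X) :
    ∃ G : Finset (Tile n), (∀ τ, τ ∈ G ↔ ∃ u v, [u, v] <:+: X ∧ τ = Tile.nabla y u v) ∧
      ∀ φ : Vert n → Vert n → ℤ, ∑ τ ∈ G, τ.bdry φ = pathSum φ X + φ y a - φ y c := by
  obtain ⟨G, hG, hs⟩ := exists_finset_pairs (f := Tile.nabla y) (by simp)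
    (nodup_of_weight_lt fun _ _ huv => nabla_weight_lt hK (chain_of_pair_infix h.2.2 huv))
  refine ⟨G, hG, fun φ => ?_⟩
  rw [hs, pathSum_telescope (φ := φ) (g := fun u => -φ y u) (k := 1) (fun u v => ?_) h.1 h.2.1]
  · ring
  · simp [Tile.bdry, Tile.lpath, Tile.rpath]; ring

lemma exists_finset_delta (hK : ∀ τ ∈ K, τ.IsValid) {y a c : Vert n} {X : List (Vert n)}
    (h : IsLowerFilling K a y c X) :
    ∃ G : Finset (Tile n), (∀ τ, τ ∈ G ↔ ∃ u v, [u, v] <:+: X ∧ τ = Tile.delta y u v) ∧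
      ∀ φ : Vert n → Vert n → ℤ, ∑ τ ∈ G, τ.bdry φ = φ a y - φ c y - pathSum φ X := by
  obtain ⟨G, hG, hs⟩ := exists_finset_pairs (f := Tile.delta y) (by simp)
    (nodup_of_weight_lt fun _ _ huv => delta_weight_lt hK (chain_of_pair_infix h.2.2 huv))
  refine ⟨G, hG, fun φ => ?_⟩
  rw [hs, pathSum_telescope (φ := φ) (g := fun u => -φ u y) (k := -1) (fun u v => ?_) h.1 h.2.1]
  · ring
  · simp [Tile.bdry, Tile.lpath, Tile.rpath]; ring

/-- The tiles of the strip of the expansion, except the first one. -/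
def stripPart (K : Set (Tile n)) (P : List (Vert n)) : Set (Tile (n + 1)) :=
  {τ | ∃ a b c, IsSlope P a b c ∧ (τ = upTile b c ∨ τ = downTile a b)} ∪
  {τ | ∃ a b, [a, b] <:+ P ∧ τ = downTile a b} ∪ newLenses K P

lemma stripPart_eq {a b : Vert n} {t : List (Vert n)} :
    slopeTiles (a :: b :: t) ∪ newLenses K (a :: b :: t) =
      insert (upTile a b) (stripPart K (a :: b :: t)) := by
  ext τ
  simp only [slopeTiles, stripPart, upTile, downTile, Set.mem_union, Set.mem_insert_iff,
    Set.mem_ofPred_eq]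
  have : (∃ a' b', [a', b'] <+: a :: b :: t ∧ τ = Tile.nabla (lo a') (lo b') (hi a')) ↔
      τ = Tile.nabla (lo a) (lo b) (hi a) := by grind
  rw [this]
  generalize (∃ a' b' c', IsSlope (a :: b :: t) a' b' c' ∧ _) = p
  generalize (∃ a' b', [a', b'] <:+ a :: b :: t ∧ _) = q
  tauto

lemma isSlope_cons {a b c x y z : Vert n} {t : List (Vert n)} :
    IsSlope (a :: b :: c :: t) x y z ↔
      (x = a ∧ y = b ∧ z = c ∧ a.card < b.card ∧ b.card < c.card) ∨
        IsSlope (b :: c :: t) x y z := by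
  unfold IsSlope
  rw [triple_infix_cons]
  constructor <;> grind

lemma isPeak_cons {a b c x y z : Vert n} {t : List (Vert n)} :
    IsPeak (a :: b :: c :: t) x y z ↔
      (x = a ∧ y = b ∧ z = c ∧ a.card = c.card ∧ a.card < b.card) ∨
        IsPeak (b :: c :: t) x y z := by
  unfold IsPeak
  rw [triple_infix_cons]
  constructor <;> grind

lemma isPit_cons {a b c x y z : Vert n} {t : List (Vert n)} :
    IsPit (a :: b :: c :: t) x y z ↔
      (x = a ∧ y = b ∧ z = c ∧ a.card = c.card ∧ b.card < a.card) ∨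
        IsPit (b :: c :: t) x y z := by
  unfold IsPit
  rw [triple_infix_cons]
  constructor <;> grind

lemma quad_infix_cons {α : Type*} {a b c d x y z w : α} {l : List α} :
    [x, y, z, w] <:+: a :: b :: c :: d :: l ↔
      (x = a ∧ y = b ∧ z = c ∧ w = d) ∨ [x, y, z, w] <:+: b :: c :: d :: l := by
  rw [List.infix_cons_iff]; simp

lemma quad_infix_eq {α : Type*} {a b c x y z w : α} {l : List α}
    (h : [x, y, z, w] <:+: a :: b :: c :: l) :
      (x = a ∧ y = b ∧ z = c) ∨ [x, y, z, w] <:+: b :: c :: l := by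
  rw [List.infix_cons_iff] at h
  rcases h with h | h
  · simp at h; tauto
  · exact Or.inr h

lemma pair_suffix_cons {α : Type*} {a b c x y : α} {l : List α} :
    [x, y] <:+ a :: b :: c :: l ↔ [x, y] <:+ b :: c :: l := by
  rw [List.suffix_cons_iff]
  simp

lemma stripPart_stop {a : Vert n} :
    stripPart K [a, Finset.univ] = {downTile a Finset.univ} := by
  ext τ
  simp only [stripPart, IsSlope, newLenses, Set.mem_union, Set.mem_ofPred_eq,
    Set.mem_singleton_iff]
  constructor
  · rintro ((⟨x, y, z, h, _⟩ | ⟨x, y, h, rfl⟩) | ⟨x, y, z, w, _, _, h, _⟩)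
    · exact absurd h.1 not_triple_infix_pair
    · have := h.eq_of_length (by simp)
      cases this; rfl
    · have := h.length_le; simp at this
  · rintro rfl
    exact Or.inl (Or.inr ⟨_, _, List.suffix_rfl, rfl⟩)

lemma stripPart_up {a b c : Vert n} {t : List (Vert n)} (h : a.card < b.card)
    (h' : b.card < c.card) {τ : Tile (n + 1)} :
    τ ∈ stripPart K (a :: b :: c :: t) ↔ τ = downTile a b ∨ τ = upTile b c ∨
      τ ∈ stripPart K (b :: c :: t) := by
  simp only [stripPart, isSlope_cons, pair_suffix_cons, newLenses, Set.mem_union,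
    Set.mem_ofPred_eq]
  constructor
  · rintro ((⟨x, y, z, ⟨rfl, rfl, rfl, _⟩ | h, h2⟩ | h) | ⟨x, y, z, w, X, Y, h1, h2⟩)
    · tauto
    · exact Or.inr (Or.inr (Or.inl (Or.inl ⟨x, y, z, h, h2⟩)))
    · exact Or.inr (Or.inr (Or.inl (Or.inr h)))
    · rcases quad_infix_eq h1 with ⟨rfl, rfl, rfl⟩ | h1
      · omega
      · exact Or.inr (Or.inr (Or.inr ⟨x, y, z, w, X, Y, h1, h2⟩))
  · rintro (rfl | rfl | (⟨x, y, z, h1, h2⟩ | h1) | ⟨x, y, z, w, X, Y, h1, h2⟩)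
    · exact Or.inl (Or.inl ⟨a, b, c, Or.inl ⟨rfl, rfl, rfl, h, h'⟩, Or.inr rfl⟩)
    · exact Or.inl (Or.inl ⟨a, b, c, Or.inl ⟨rfl, rfl, rfl, h, h'⟩, Or.inl rfl⟩)
    · exact Or.inl (Or.inl ⟨x, y, z, Or.inr h1, h2⟩)
    · exact Or.inl (Or.inr h1)
    · exact Or.inr ⟨x, y, z, w, X, Y, h1.trans ⟨[a], [], by simp⟩, h2⟩

lemma stripPart_turn {a b y z : Vert n} {t : List (Vert n)} (h : a.card < b.card)
    (h' : y.card < b.card) (h'' : y.card < z.card) {τ : Tile (n + 1)} :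
    τ ∈ stripPart K (a :: b :: y :: z :: t) ↔
      (∃ X Y, IsLowerFilling K a b y Y ∧ IsUpperFilling K b y z X ∧ τ = stripLens b y X Y) ∨
      τ ∈ stripPart K (y :: z :: t) := by
  simp only [stripPart, isSlope_cons, pair_suffix_cons, newLenses, Set.mem_union,
    Set.mem_ofPred_eq]
  constructor
  · rintro ((⟨u, v, w, ⟨rfl, rfl, rfl, _⟩ | ⟨rfl, rfl, rfl, _⟩ | h1, h2⟩ | h1) |
      ⟨u, v, w, x, X, Y, h1, h2, h3, h4, h5⟩)
    · omega
    · omega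
    · exact Or.inr (Or.inl (Or.inl ⟨_, _, _, h1, h2⟩))
    · exact Or.inr (Or.inl (Or.inr h1))
    · rcases quad_infix_cons.1 h1 with ⟨rfl, rfl, rfl, rfl⟩ | h1
      · exact Or.inl ⟨X, Y, h3, h4, h5⟩
      · rcases quad_infix_eq h1 with ⟨rfl, rfl, rfl⟩ | h1
        · omega
        · exact Or.inr (Or.inr ⟨u, v, w, x, X, Y, h1, h2, h3, h4, h5⟩)
  · rintro (⟨X, Y, h3, h4, h5⟩ | (⟨u, v, w, h1, h2⟩ | h1) | ⟨u, v, w, x, X, Y, h1, h2⟩)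
    · tauto
    · exact Or.inl (Or.inl ⟨u, v, w, Or.inr (Or.inr h1), h2⟩)
    · exact Or.inl (Or.inr h1)
    · exact Or.inr ⟨u, v, w, x, X, Y, h1.trans ⟨[a, b], [], by simp⟩, h2⟩

lemma peakFillings_pair {a b : Vert n} : peakFillings K [a, b] = ∅ := by
  ext τ
  simp only [peakFillings, Set.mem_ofPred_eq, Set.mem_empty_iff_false, iff_false]
  rintro ⟨x, y, z, _, _, _, h, _⟩
  exact not_triple_infix_pair h.1

lemma pitFillings_pair {a b : Vert n} : pitFillings K [a, b] = ∅ := by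
  ext τ
  simp only [pitFillings, Set.mem_ofPred_eq, Set.mem_empty_iff_false, iff_false]
  rintro ⟨x, y, z, _, _, _, h, _⟩
  exact not_triple_infix_pair h.1

lemma peakFillings_up {a b c : Vert n} {t : List (Vert n)} (h : a.card < b.card)
    (h' : b.card < c.card) : peakFillings K (a :: b :: c :: t) = peakFillings K (b :: c :: t) := by
  ext τ
  simp only [peakFillings, isPeak_cons, Set.mem_ofPred_eq]
  have (x y z : Vert n) :
      ¬ (x = a ∧ y = b ∧ z = c ∧ a.card = c.card ∧ a.card < b.card) := by omega
  simp only [this, false_or]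

lemma pitFillings_up {a b c : Vert n} {t : List (Vert n)} (h : a.card < b.card) :
    pitFillings K (a :: b :: c :: t) = pitFillings K (b :: c :: t) := by
  ext τ
  simp only [pitFillings, isPit_cons, Set.mem_ofPred_eq]
  have (x y z : Vert n) :
      ¬ (x = a ∧ y = b ∧ z = c ∧ a.card = c.card ∧ b.card < a.card) := by omega
  simp only [this, false_or]

lemma peakFillings_turn {a b y z : Vert n} {t : List (Vert n)}
    (h : a.card = y.card) (h' : y.card < b.card) {τ : Tile n} :
    τ ∈ peakFillings K (a :: b :: y :: z :: t) ↔
      (∃ Y u v, IsLowerFilling K a b y Y ∧ [u, v] <:+: Y ∧ τ = Tile.delta b u v) ∨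
      τ ∈ peakFillings K (y :: z :: t) := by
  simp only [peakFillings, isPeak_cons, Set.mem_ofPred_eq]
  constructor <;> grind

lemma pitFillings_turn {a b y z : Vert n} {t : List (Vert n)}
    (h : a.card < b.card) (h' : y.card < b.card) (h'' : z.card = b.card) {τ : Tile n} :
    τ ∈ pitFillings K (a :: b :: y :: z :: t) ↔
      (∃ X u v, IsUpperFilling K b y z X ∧ [u, v] <:+: X ∧ τ = Tile.nabla y u v) ∨
      τ ∈ pitFillings K (y :: z :: t) := by
  simp only [pitFillings, isPit_cons, Set.mem_ofPred_eq]
  constructor <;> grind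

lemma Leg.mem_edge (h : Leg K a b P) (hξ : IsGenerators ξ) (hK : EdgeTiling ξ K)
    {x y z : Vert n} : (IsPeak P x y z → a.card < x.card ∨ StripLE K (a, b) (x, y)) ∧
      (IsPit P x y z → a.card < y.card ∨ StripLE K (a, b) (y, x)) := by
  constructor
  · rintro ⟨h1, h2, h3⟩
    exact (h.stripLE_of_inPath hξ hK (e := (x, y))
      (Or.inl (List.IsInfix.trans ⟨[], [z], rfl⟩ h1)) h3).2
  · rintro ⟨h1, h2, h3⟩
    exact (h.stripLE_of_inPath hξ hK (e := (y, x))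
      (Or.inr (List.IsInfix.trans ⟨[], [z], rfl⟩ h1)) h3).2

open Classical in
/-- The boundary sum of the tiles of the strip of the expansion. -/
theorem Leg.exists_stripPart (hξ : IsGenerators ξ) (hK : EdgeTiling ξ K) {a b : Vert n}
    (h : Leg K a b P) : ∃ (T : Multiset (Tile (n + 1))) (F G : Finset (Tile n)),
      (∀ τ, τ ∈ T ↔ τ ∈ stripPart K P) ∧ (∀ τ, τ ∈ F ↔ τ ∈ peakFillings K P) ∧
      (∀ τ, τ ∈ G ↔ τ ∈ pitFillings K P) ∧ (∀ τ ∈ T, τ.IsValid) ∧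
      ∀ ψ : Vert (n + 1) → Vert (n + 1) → ℤ, (∀ A B, ψ A B = -ψ B A) →
        (T.map (Tile.bdry ψ)).sum - ∑ τ ∈ G, τ.bdry (fun A B => ψ (lo A) (lo B)) -
          ∑ τ ∈ F, τ.bdry (fun A B => ψ (hi A) (hi B)) =
        pathSum (fun A B => ψ (lo A) (lo B)) P - ψ (lo a) (lo b) -
          pathSum (fun A B => ψ (hi A) (hi B)) P + ψ (lo Finset.univ) (hi Finset.univ) -
            ψ (lo b) (hi a) := by
  induction h with
  | @base a h =>
    obtain ⟨-, i, hi⟩ := h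
    refine ⟨{downTile a Finset.univ}, ∅, ∅, ?_, ?_, ?_, ?_, ?_⟩
    · simp [stripPart_stop]
    · simp [peakFillings_pair]
    · simp [pitFillings_pair]
    · simpa using isValid_downTile hi
    · intro ψ _
      simp [downTile, Tile.bdry, Tile.lpath, Tile.rpath]
      ring
  | @up a b c P h hP ih =>
    obtain ⟨T, F, G, hT, hF, hG, hv, hs⟩ := ih
    obtain ⟨hbc, t, rfl⟩ := hP.shape
    have h1 := h.card_eq
    have h2 := hbc.card_eq
    refine ⟨downTile a b ::ₘ upTile b c ::ₘ T, F, G, ?_, ?_, ?_, ?_, ?_⟩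
    · intro τ
      rw [stripPart_up (by omega) (by omega), Multiset.mem_cons, Multiset.mem_cons, hT]
    · intro τ; rw [peakFillings_up (by omega) (by omega), hF]
    · intro τ; rw [pitFillings_up (by omega), hG]
    · intro τ hτ
      rw [Multiset.mem_cons, Multiset.mem_cons] at hτ
      obtain ⟨-, i, hi⟩ := h
      obtain ⟨-, j, hj⟩ := hbc
      rcases hτ with rfl | rfl | hτ
      exacts [isValid_downTile hi, isValid_upTile hj, hv _ hτ]
    · intro ψ hψ
      have := hs ψ hψ
      simp only [Multiset.map_cons, Multiset.sum_cons, pathSum_cons_cons, downTile, upTile,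
        Tile.bdry, Tile.lpath, Tile.rpath, pathSum_singleton] at this ⊢
      linarith
  | @turn a b y z P h h' hay hbz hP ih =>
    obtain ⟨T, F, G, hT, hF, hG, hv, hs⟩ := ih
    obtain ⟨hyz, t, rfl⟩ := hP.shape
    have h1 := h.card_eq
    have h2 := h'.card_eq
    have h3 := hyz.card_eq
    obtain ⟨hs1, hs2⟩ := Leg.turn_stripLE hξ hK h h' hyz hay hbz
    obtain ⟨Y, hY⟩ := hs1.exists_lowerFilling hK.valid
    obtain ⟨X, hX⟩ := hs2.exists_upperFilling hK.valid
    obtain ⟨F', hF', hFs⟩ := exists_finset_delta hK.valid hY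
    obtain ⟨G', hG', hGs⟩ := exists_finset_nabla hK.valid hX
    have hFF : Disjoint F' F := by
      rw [Finset.disjoint_left]
      intro τ h4 h5
      obtain ⟨u, v, huv, rfl⟩ := (hF' τ).1 h4
      obtain ⟨a', b', c', Y', u', v', hp, hY', huv', he⟩ := (hF _).1 h5
      cases he
      have hm := chain_of_pair_infix hY.2.2 huv
      have hn : Next K (u, b) (v, b) := ⟨_, hm, exists_stripTile_delta b u v⟩
      have hu := (hY'.stripLE.2 u v huv').1
      have hvb := (hY.stripLE.2 u v huv).2
      rcases (hP.mem_edge hξ hK).1 hp with h6 | h6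
      · have e1 := (StripLE.card_weight hK.valid hu).1
        have e2 := (StripLE.card_weight hK.valid (hY.stripLE.2 u v huv).1).1
        dsimp only at e1 e2
        omega
      · exact hn.not_stripLE hK.valid (hvb.trans (hs2.trans (h6.trans hu)))
    have hGG : Disjoint G' G := by
      rw [Finset.disjoint_left]
      intro τ h4 h5
      obtain ⟨u, v, huv, rfl⟩ := (hG' τ).1 h4
      obtain ⟨a', b', c', Y', u', v', hp, hY', huv', he⟩ := (hG _).1 h5
      cases he
      have hm := chain_of_pair_infix hX.2.2 huv
      have hn : Next K (y, u) (y, v) := ⟨_, hm, exists_stripTile_nabla y u v⟩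
      have hu := (hY'.stripLE.2 u v huv').1
      have hvb := (hX.stripLE.2 u v huv).2
      rcases (hP.mem_edge hξ hK).2 hp with h6 | h6
      · omega
      · exact hn.not_stripLE hK.valid (hvb.trans (h6.trans hu))
    refine ⟨stripLens b y X Y ::ₘ T, F' ∪ F, G' ∪ G, ?_, ?_, ?_, ?_, ?_⟩
    · intro τ
      rw [stripPart_turn (by omega) (by omega) (by omega), Multiset.mem_cons, hT]
      refine or_congr ⟨?_, ?_⟩ Iff.rfl
      · rintro rfl; exact ⟨X, Y, hY, hX, rfl⟩
      · rintro ⟨X', Y', hY', hX', rfl⟩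
        rw [hY.unique hξ hK hY', hX.unique hξ hK hX']
    · intro τ
      rw [peakFillings_turn (by omega) (by omega), Finset.mem_union, hF, hF']
      refine or_congr ⟨?_, ?_⟩ Iff.rfl
      · rintro ⟨u, v, h4, h5⟩; exact ⟨Y, u, v, hY, h4, h5⟩
      · rintro ⟨Y', u, v, hY', h4, h5⟩
        rw [← hY.unique hξ hK hY'] at h4
        exact ⟨u, v, h4, h5⟩
    · intro τ
      rw [pitFillings_turn (by omega) (by omega) (by omega), Finset.mem_union, hG, hG']
      refine or_congr ⟨?_, ?_⟩ Iff.rfl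
      · rintro ⟨u, v, h4, h5⟩; exact ⟨X, u, v, hX, h4, h5⟩
      · rintro ⟨X', u, v, hX', h4, h5⟩
        rw [← hX.unique hξ hK hX'] at h4
        exact ⟨u, v, h4, h5⟩
    · intro τ hτ
      rcases Multiset.mem_cons.1 hτ with rfl | hτ
      · exact isValid_stripLens hK.valid hY hX (by rintro rfl; omega) (by rintro rfl; omega)
      · exact hv τ hτ
    · intro ψ hψ
      have := hs ψ hψ
      rw [Finset.sum_union hFF, Finset.sum_union hGG, hFs, hGs]
      obtain ⟨tY, htY⟩ := head_eq_of_head? hY.1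
      have hXl : pathSum ψ (X.map lo ++ [hi y]) =
          pathSum (fun A B => ψ (lo A) (lo B)) X + ψ (lo z) (hi y) := by
        rw [← pathSum_map ψ lo]
        obtain ⟨m, hm⟩ := List.getLast?_eq_some_iff.1 hX.2.1
        rw [hm, List.map_append, List.append_assoc, List.map_singleton, List.singleton_append,
          pathSum_append]
        simp
      have hYl : pathSum ψ (lo b :: Y.map hi) =
          ψ (lo b) (hi a) + pathSum (fun A B => ψ (hi A) (hi B)) Y := by
        rw [← pathSum_map ψ hi, htY]
        simp
      simp only [Multiset.map_cons, Multiset.sum_cons, pathSum_cons_cons, stripLens, Tile.bdry,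
        Tile.lpath, Tile.rpath, hXl, hYl] at this ⊢
      have e1 := hψ (lo b) (lo y)
      have e2 := hψ (hi b) (hi y)
      linarith

end newTiles

section expansion

variable {n : ℕ} {ξ : Fin (n + 1) → Plane} {K : Set (Tile n)} {P : List (Vert n)}

theorem expansion_eq (hξ : IsGenerators ξ) (hn : 2 ≤ n)
    (hK : EdgeTiling (fun i => ξ i.castSucc) K) {w : Tile n → ℤ} (hw : IsWinding K P w)
    {b : Vert n} (hP : Leg K ∅ b P) :
    expansion (fun i => ξ i.castSucc) K P =
      Tile.map lo '' {τ | (τ ∈ K ∧ w τ = 1) ∧ τ ∉ pitFillings K P} ∪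
      Tile.map hi '' {τ | (τ ∈ K ∧ w τ = 0) ∧ τ ∉ peakFillings K P} ∪
      insert (upTile ∅ b) (stripPart K P) := by
  obtain ⟨-, t, rfl⟩ := hP.shape
  have hl : leftPart (fun i => ξ i.castSucc) K (∅ :: b :: t) = {τ | τ ∈ K ∧ w τ = 1} :=
    Set.ext fun τ => mem_leftPart_iff hξ.castSucc hn hK hw hP
  have hr : rightPart (fun i => ξ i.castSucc) K (∅ :: b :: t) = {τ | τ ∈ K ∧ w τ = 0} :=
    Set.ext fun τ => mem_rightPart_iff hξ.castSucc hn hK hw hP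
  rw [expansion, hl, hr, Set.union_assoc, stripPart_eq]
  rfl

open Classical in
/-- The expansion of a combined tiling is a combined tiling. -/
theorem expansion_edgeTiling (hξ : IsGenerators ξ) (hn : 2 ≤ n)
    (hK : EdgeTiling (fun i => ξ i.castSucc) K) (hP : IsLegalPath K P) :
    EdgeTiling ξ (expansion (fun i => ξ i.castSucc) K P) := by
  obtain ⟨b, hL⟩ := hP.leg (by omega)
  obtain ⟨w, hw⟩ := exists_winding hξ.castSucc hn hK hL.isPathOf
  obtain ⟨T, F, G, hT, hF, hG, hv, hs⟩ := hL.exists_stripPart hξ.castSucc hK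
  have h01 := winding_eq_zero_or_one hξ.castSucc hK hw hL
  have hGs : G ⊆ hK.finite.toFinset.filter (fun τ => w τ = 1) := fun τ hτ => by
    simpa using pitFillings_subset hξ.castSucc hK hw hL ((hG τ).1 hτ)
  have hFs : F ⊆ hK.finite.toFinset.filter (fun τ => w τ = 0) := fun τ hτ => by
    simpa using peakFillings_subset hξ.castSucc hK hw hL ((hF τ).1 hτ)
  obtain ⟨hb, -⟩ := hL.shape
  obtain ⟨-, i, hbi⟩ := hb
  have := edgeTiling_of_boundary hξ (by omega)
    ((((hK.finite.toFinset.filter (fun τ => w τ = 1)) \ G).val.map (Tile.map lo) +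
      ((hK.finite.toFinset.filter (fun τ => w τ = 0)) \ F).val.map (Tile.map hi)) +
        upTile ∅ b ::ₘ T) ?_ ?_
  · rw [expansion_eq hξ hn hK hw hL]
    convert this using 1
    ext τ
    simp only [Set.mem_union, Set.mem_image, Set.mem_ofPred_eq, Set.mem_insert_iff,
      Multiset.mem_add, Multiset.mem_cons, Multiset.mem_map, Finset.mem_val, Finset.mem_sdiff,
      Finset.mem_filter, Set.Finite.mem_toFinset, hG, hF, hT]
  · intro τ hτ
    simp only [Multiset.mem_add, Multiset.mem_cons, Multiset.mem_map, Finset.mem_val,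
      Finset.mem_sdiff, Finset.mem_filter, Set.Finite.mem_toFinset] at hτ
    rcases hτ with (⟨σ, h, rfl⟩ | ⟨σ, h, rfl⟩) | rfl | h
    · exact isLift_lo.isValid (hK.valid σ h.1.1)
    · exact isLift_hi.isValid (hK.valid σ h.1.1)
    · exact isValid_upTile hbi
    · exact hv τ h
  · intro ψ hψ
    have e1 := sum_bdry_left hξ.castSucc hn hK hw hL (φ := fun A B => ψ (lo A) (lo B))
      fun A B => hψ _ _
    have e2 := sum_bdry_right hξ.castSucc hn hK hw hL (φ := fun A B => ψ (hi A) (hi B))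
      fun A B => hψ _ _
    have e3 := hs ψ hψ
    rw [← Finset.sum_sdiff hGs] at e1
    rw [← Finset.sum_sdiff hFs] at e2
    rw [zonogonBdry_succ]
    simp only [Multiset.map_add, Multiset.map_cons, Multiset.sum_add, Multiset.sum_cons,
      Multiset.map_map, Function.comp_def, Tile.bdry_map]
    simp only [Finset.sum, Tile.bdry, Tile.lpath, Tile.rpath, pathSum_cons_cons,
      pathSum_singleton] at e1 e2 e3 ⊢
    linarith

end expansion

end Combi

namespace Combi

/-! ### Incoming and outgoing edges -/

section ends

variable {n : ℕ} {ξ : Fin n → Plane} {K : Set (Tile n)}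

/-- The clockwise position of a directed edge among the edges with the same first vertex. -/
def outRank (v u : Vert n) : ℕ :=
  if v.card < u.card then weight (u \ v) else weight (Finset.univ : Vert n) + 1 + weight (v \ u)

/-- The position of a directed edge among the edges with the same last vertex. -/
def inRank (u v : Vert n) : ℕ :=
  if u.card < v.card then weight (v \ u) else weight (Finset.univ : Vert n) + 1 + weight (v \ u)

lemma weight_singleton (i : Fin n) : weight {i} = i.val + 1 := by simp [weight]

lemma weight_le_univ (A : Vert n) : weight A ≤ weight (Finset.univ : Vert n) :=
  Finset.sum_le_sum_of_subset (Finset.subset_univ _)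

lemma IsVEdge.outRank_eq {i : Fin n} {A B : Vert n} (h : IsVEdge i A B) :
    outRank A B = i.val + 1 ∧ inRank A B = i.val + 1 := by
  have hc := h.card_eq
  have : B \ A = {i} := by
    rw [h.2]; ext k; simp only [Finset.mem_sdiff, Finset.mem_insert, Finset.mem_singleton]
    constructor
    · tauto
    · rintro rfl; exact ⟨Or.inl rfl, h.1⟩
  rw [outRank, inRank, if_pos (by omega), if_pos (by omega), this, weight_singleton]
  simp

lemma IsHEdge.outRank_eq {i j : Fin n} {A B : Vert n} (h : IsHEdge i j A B) :
    outRank A B = weight (Finset.univ : Vert n) + 1 + (i.val + 1) ∧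
      inRank A B = weight (Finset.univ : Vert n) + 1 + (j.val + 1) := by
  have hc := h.card_eq
  obtain ⟨hij, X, hi, hj, rfl, rfl⟩ := h
  have h1 : insert i X \ insert j X = {i} := by grind
  have h2 : insert j X \ insert i X = {j} := by grind
  rw [outRank, inRank, if_neg (by omega), if_neg (by omega), h1, h2, weight_singleton,
    weight_singleton]
  simp

lemma IsVEdge.rank_le {i : Fin n} {A B : Vert n} (h : IsVEdge i A B) :
    outRank A B ≤ weight (Finset.univ : Vert n) ∧
      inRank A B ≤ weight (Finset.univ : Vert n) := by
  rw [h.outRank_eq.1, h.outRank_eq.2, ← weight_singleton]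
  exact ⟨weight_le_univ _, weight_le_univ _⟩

lemma Tile.IsValid.source_edges {τ : Tile n} (h : τ.IsValid) :
    ∃ s u u', τ.lpath.head? = some s ∧ τ.rpath.head? = some s ∧ [s, u] <:+: τ.lpath ∧
      [s, u'] <:+: τ.rpath ∧ outRank s u < outRank s u' := by
  cases τ with
  | delta A B C =>
    obtain ⟨i, j, h1, h2, h3⟩ := h
    refine ⟨B, A, C, rfl, rfl, ⟨[], [], rfl⟩, ⟨[], [A], rfl⟩, ?_⟩
    have := h2.rank_le.1
    rw [h1.outRank_eq.1]
    omega
  | nabla A B C =>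
    obtain ⟨i, j, h1, h2, h3⟩ := h
    refine ⟨A, B, C, rfl, rfl, ⟨[], [C], rfl⟩, ⟨[], [], rfl⟩, ?_⟩
    rw [h2.outRank_eq.1, h3.outRank_eq.1]
    have := h1.1
    omega
  | lens U L =>
    obtain ⟨l, m, m', i, i', j, j', h1, h2, h3, h4, h5, -, -, -, hU, hL⟩ := lens_first_edges h
    refine ⟨l, m, m', hU, hL, h1, h2, ?_⟩
    rw [h3.outRank_eq.1, h4.outRank_eq.1]
    omega

lemma Tile.IsValid.sink_edges {τ : Tile n} (h : τ.IsValid) :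
    ∃ t u u', τ.lpath.getLast? = some t ∧ τ.rpath.getLast? = some t ∧ [u, t] <:+: τ.lpath ∧
      [u', t] <:+: τ.rpath ∧ inRank u' t < inRank u t := by
  cases τ with
  | delta A B C =>
    obtain ⟨i, j, h1, h2, h3⟩ := h
    refine ⟨A, B, C, rfl, rfl, ⟨[], [], rfl⟩, ⟨[B], [], rfl⟩, ?_⟩
    rw [h2.outRank_eq.2, h3.outRank_eq.2]
    have := h1.1
    omega
  | nabla A B C =>
    obtain ⟨i, j, h1, h2, h3⟩ := h
    refine ⟨C, B, A, rfl, rfl, ⟨[A], [], rfl⟩, ⟨[], [], rfl⟩, ?_⟩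
    have := h3.rank_le.2
    rw [h1.outRank_eq.2]
    omega
  | lens U L =>
    obtain ⟨X, a, c, I, J, hI, hI0, hIX, rfl, hJ, hJ0, hJX, rfl⟩ := isValid_lens_iff.1 h
    obtain ⟨I, i, rfl⟩ := (List.eq_nil_or_concat I).resolve_left hI0
    obtain ⟨J, j, rfl⟩ := (List.eq_nil_or_concat J).resolve_left hJ0
    rw [List.concat_eq_append] at *
    have hac : a < c := (List.pairwise_cons.1 hI).1 c (by simp)
    have hl : (insert a (insert c X)).erase a = insert c X :=
      Finset.erase_insert (by simp [hac.ne, hIX a (by simp)])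
    have hic : i < c := by grind
    have hja : a < j := by grind
    have hjc : j < c := (List.pairwise_cons.1 hJ).1 j (by simp)
    have hpa : IsHEdge i c (insert i X) (insert c X) :=
      ⟨hic, X, hIX i (by simp), hIX c (by simp), rfl, rfl⟩
    have hpj : IsHEdge a j ((insert a (insert c X)).erase j) (insert c X) := by
      have := isHEdge_erase hja (hJX j (by simp)) (hJX a (by simp))
      rwa [hl] at this
    refine ⟨insert c X, insert i X, (insert a (insert c X)).erase j, ?_, ?_, ?_, ?_, ?_⟩
    · rw [Tile.lpath, List.getLast?_map, ← List.cons_append, List.getLast?_concat]; rfl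
    · rw [Tile.rpath, List.getLast?_map, ← List.cons_append, List.getLast?_concat,
        Option.map_some, hl]
    · exact ⟨insert a X :: I.map (fun i => insert i X), [], by simp [Tile.lpath]⟩
    · exact ⟨(insert a (insert c X)).erase c ::
        J.map (fun j => (insert a (insert c X)).erase j), [], by simp [Tile.rpath, hl]⟩
    · rw [hpa.outRank_eq.2, hpj.outRank_eq.2]
      omega

lemma head?_or_exists_pair {α : Type*} {l : List α} {v : α} (h : v ∈ l) :
    l.head? = some v ∨ ∃ u, [u, v] <:+: l := by
  obtain ⟨p, q, rfl⟩ := List.append_of_mem h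
  rcases List.eq_nil_or_concat p with rfl | ⟨p, u, rfl⟩
  · left; rfl
  · right; exact ⟨u, p, q, by simp⟩

lemma getLast?_or_exists_pair {α : Type*} {l : List α} {v : α} (h : v ∈ l) :
    l.getLast? = some v ∨ ∃ u, [v, u] <:+: l := by
  obtain ⟨p, q, rfl⟩ := List.append_of_mem h
  rcases q with _ | ⟨u, q⟩
  · left; simp
  · right; exact ⟨u, p, q, by simp⟩

lemma pair_infix_right_unique {α : Type*} {l : List α} (hl : l.Nodup) {v u u' : α}
    (h : [v, u] <:+: l) (h' : [v, u'] <:+: l) : u = u' := by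
  induction l with
  | nil => simp at h
  | cons a l ih =>
    rcases l with _ | ⟨b, l⟩
    · exact absurd h not_pair_infix
    · have hnd := List.nodup_cons.1 hl
      rcases pair_infix_cons.1 h with ⟨rfl, rfl⟩ | h1 <;>
        rcases pair_infix_cons.1 h' with ⟨h2, rfl⟩ | h2
      · rfl
      · exact absurd (pair_infix_mem h2).1 hnd.1
      · subst h2; exact absurd (pair_infix_mem h1).1 hnd.1
      · exact ih hnd.2 h1 h2

lemma pair_infix_left_unique {α : Type*} {l : List α} (hl : l.Nodup) {v u u' : α}
    (h : [u, v] <:+: l) (h' : [u', v] <:+: l) : u = u' := by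
  refine pair_infix_right_unique (List.nodup_reverse.2 hl) (v := v) ?_ ?_
  · rw [← List.reverse_infix]; simpa using h
  · rw [← List.reverse_infix]; simpa using h'

lemma EdgeTiling.exists_incoming (hK : EdgeTiling ξ K) {v : Vert n}
    (hv : v ∈ vertices K) (h0 : v ≠ ∅) : ∃ u, (u, v) ∈ edges K := by
  by_contra hno
  push Not at hno
  have hsource : ∀ τ ∈ K, (v ∈ τ.lpath ∨ v ∈ τ.rpath) →
      τ.lpath.head? = some v ∧ τ.rpath.head? = some v := by
    intro τ hτ h
    obtain ⟨s, u, u', h1, h2, -⟩ := (hK.valid τ hτ).source_edges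
    have : s = v := by
      rcases h with h | h
      · rcases head?_or_exists_pair h with h | ⟨u, h⟩
        · exact Option.some.inj (h1.symm.trans h)
        · exact absurd ⟨τ, hτ, Tile.mem_edges_iff.2 (Or.inl h)⟩ (hno u)
      · rcases head?_or_exists_pair h with h | ⟨u, h⟩
        · exact Option.some.inj (h2.symm.trans h)
        · exact absurd ⟨τ, hτ, Tile.mem_edges_iff.2 (Or.inr h)⟩ (hno u)
    exact this ▸ ⟨h1, h2⟩
  have key : ∀ N, ∀ τ ∈ K, ∀ u, [v, u] <:+: τ.lpath → outRank v u = N → False := by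
    intro N
    induction N using Nat.strong_induction_on with
    | _ N ih =>
      rintro τ hτ u hu rfl
      rcases hK.left_exists τ hτ v u hu with ⟨i, hi⟩ | ⟨τ', hτ', hu'⟩
      · have hvi : v = (leftBoundaryEdge i).1 := congrArg Prod.fst hi
        have hpos : 0 < i.val := by
          by_contra h
          apply h0
          rw [hvi, leftBoundaryEdge]
          refine Finset.filter_eq_empty_iff.2 fun k _ hk => ?_
          have : k.val < i.val := hk
          omega
        obtain ⟨σ, hσ, h⟩ := hK.left_boundary ⟨i.val - 1, by omega⟩
        apply hno (leftBoundaryEdge ⟨i.val - 1, by omega⟩).1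
        refine ⟨σ, hσ, Tile.mem_edges_iff.2 (Or.inl ?_)⟩
        convert h using 2
        rw [hvi, leftBoundaryEdge, leftBoundaryEdge]
        congr 1
        ext k
        simp only [Finset.mem_filter, Finset.mem_univ, true_and]
        rw [Fin.lt_def, Fin.le_def]
        dsimp only
        omega
      · obtain ⟨s, w, w', h1, h2, h3, h4, h5⟩ := (hK.valid τ' hτ').source_edges
        have hs := (hsource τ' hτ' (Or.inr (pair_infix_mem hu').1)).1
        obtain rfl := Option.some.inj (h1.symm.trans hs)
        obtain rfl := pair_infix_right_unique
          (nodup_of_weight_lt (hK.valid τ' hτ').rpath_weight_lt) hu' h4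
        exact ih _ h5 τ' hτ' w h3 rfl
  obtain ⟨τ, hτ, h⟩ := hv
  obtain ⟨s, u, u', h1, -, h3, -⟩ := (hK.valid τ hτ).source_edges
  have hs := (hsource τ hτ (Tile.mem_verts_iff.1 h)).1
  obtain rfl := Option.some.inj (h1.symm.trans hs)
  exact key _ τ hτ u h3 rfl

lemma EdgeTiling.exists_outgoing (hK : EdgeTiling ξ K) {v : Vert n}
    (hv : v ∈ vertices K) (h0 : v ≠ Finset.univ) : ∃ u, (v, u) ∈ edges K := by
  by_contra hno
  push Not at hno
  have hsink : ∀ τ ∈ K, (v ∈ τ.lpath ∨ v ∈ τ.rpath) →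
      τ.lpath.getLast? = some v ∧ τ.rpath.getLast? = some v := by
    intro τ hτ h
    obtain ⟨s, u, u', h1, h2, -⟩ := (hK.valid τ hτ).sink_edges
    have : s = v := by
      rcases h with h | h
      · rcases getLast?_or_exists_pair h with h | ⟨u, h⟩
        · exact Option.some.inj (h1.symm.trans h)
        · exact absurd ⟨τ, hτ, Tile.mem_edges_iff.2 (Or.inl h)⟩ (hno u)
      · rcases getLast?_or_exists_pair h with h | ⟨u, h⟩
        · exact Option.some.inj (h2.symm.trans h)
        · exact absurd ⟨τ, hτ, Tile.mem_edges_iff.2 (Or.inr h)⟩ (hno u)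
    exact this ▸ ⟨h1, h2⟩
  have key : ∀ N, ∀ τ ∈ K, ∀ u, [u, v] <:+: τ.rpath → inRank u v = N → False := by
    intro N
    induction N using Nat.strong_induction_on with
    | _ N ih =>
      rintro τ hτ u hu rfl
      rcases hK.right_exists τ hτ u v hu with ⟨i, hi⟩ | ⟨τ', hτ', hu'⟩
      · have hvi : v = (rightBoundaryEdge i).2 := congrArg Prod.snd hi
        have hpos : 0 < i.val := by
          by_contra h
          apply h0
          rw [hvi, rightBoundaryEdge]
          refine Finset.filter_eq_self.2 fun k _ => ?_
          show i.val ≤ k.val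
          omega
        obtain ⟨σ, hσ, h⟩ := hK.right_boundary ⟨i.val - 1, by omega⟩
        apply hno (rightBoundaryEdge ⟨i.val - 1, by omega⟩).2
        refine ⟨σ, hσ, Tile.mem_edges_iff.2 (Or.inr ?_)⟩
        convert h using 2
        rw [hvi, rightBoundaryEdge, rightBoundaryEdge]
        dsimp only
        ext k
        simp only [Finset.mem_filter, Finset.mem_univ, true_and]
        rw [Fin.lt_def, Fin.le_def]
        dsimp only
        omega
      · obtain ⟨s, w, w', h1, h2, h3, h4, h5⟩ := (hK.valid τ' hτ').sink_edges
        have hs := (hsink τ' hτ' (Or.inl (pair_infix_mem hu').2)).1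
        obtain rfl := Option.some.inj (h1.symm.trans hs)
        obtain rfl := pair_infix_left_unique
          (nodup_of_weight_lt (hK.valid τ' hτ').lpath_weight_lt) hu' h3
        exact ih _ h5 τ' hτ' w' h4 rfl
  obtain ⟨τ, hτ, h⟩ := hv
  obtain ⟨s, u, u', h1, -, -, h4, -⟩ := (hK.valid τ hτ).sink_edges
  have hs := (hsink τ hτ (Tile.mem_verts_iff.1 h)).1
  obtain rfl := Option.some.inj (h1.symm.trans hs)
  exact key _ τ hτ u' h4 rfl

end ends

/-! ### The components of the bottom and top vertices -/

section components

variable {n : ℕ} {ξ : Fin (n + 1) → Plane} {K : Set (Tile (n + 1))}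

lemma EdgeTiling.edge_type {m : ℕ} {ξ : Fin m → Plane} {K : Set (Tile m)} (hK : EdgeTiling ξ K)
    {A B : Finset (Fin m)} (h : (A, B) ∈ edges K) :
    (∃ i, IsVEdge i A B) ∨ ∃ i j, IsHEdge i j A B := by
  obtain ⟨τ, hτ, h⟩ := h
  exact (hK.valid τ hτ).isVEdge_or_isHEdge h

lemma mem_edges_vertices {m : ℕ} {K : Set (Tile m)} {A B : Finset (Fin m)} (h : (A, B) ∈ edges K) :
    A ∈ vertices K ∧ B ∈ vertices K := by
  obtain ⟨τ, hτ, h⟩ := h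
  exact (Tile.mem_verts_of_edge h).imp (fun h => ⟨τ, hτ, h⟩) fun h => ⟨τ, hτ, h⟩

/-- An edge lies in the strip if and only if exactly its second vertex contains the last index. -/
lemma mem_stripEdges_iff (hK : EdgeTiling ξ K) {A B : Vert (n + 1)}
    (h : (A, B) ∈ edges K) :
    ((A, B) ∈ stripEdges K ↔ Fin.last n ∉ A ∧ Fin.last n ∈ B) ∧
      (Fin.last n ∈ A → Fin.last n ∈ B) := by
  have hs : (A, B) ∈ stripEdges K ↔
      (IsVEdge (Fin.last n) A B ∨ ∃ i, IsHEdge i (Fin.last n) A B) := by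
    simp [stripEdges, h]
  rw [hs]
  rcases hK.edge_type h with ⟨i, hi⟩ | ⟨i, j, hij⟩
  · have hno : ¬ ∃ k, IsHEdge k (Fin.last n) A B := fun ⟨k, hk⟩ => hi.not_isHEdge hk
    simp only [hno, or_false]
    obtain ⟨h1, rfl⟩ := hi
    constructor
    · constructor
      · rintro h; exact ⟨h.1, by rw [h.2]; simp⟩
      · rintro ⟨h2, h3⟩
        rcases Finset.mem_insert.1 h3 with rfl | h3
        · exact ⟨h1, rfl⟩
        · exact absurd h3 h2
    · intro h; simp [h]
  · have hno : ¬ IsVEdge (Fin.last n) A B := fun hk => hk.not_isHEdge hij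
    simp only [hno, false_or]
    have hij' := hij
    obtain ⟨h0, X, h1, h2, rfl, rfl⟩ := hij
    have hi : Fin.last n ≠ i := by
      rintro rfl
      exact absurd h0 (Fin.le_last j).not_gt
    constructor
    · constructor
      · rintro ⟨k, hk⟩
        obtain ⟨rfl, rfl⟩ := hij'.unique hk
        simp [hi, h2]
      · grind
    · simp only [Finset.mem_insert, hi, false_or]
      tauto

theorem component_empty (hK : EdgeTiling ξ K) :
    component K ∅ = {v | v ∈ vertices K ∧ Fin.last n ∉ v} := by
  ext v
  simp only [component, Set.mem_ofPred_eq]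
  refine and_congr_right fun hv => ⟨fun h => ?_, fun h => ?_⟩
  · suffices H : ∀ u v, Relation.EqvGen (fun A B => (A, B) ∈ edges K \ stripEdges K) u v →
        (Fin.last n ∈ u ↔ Fin.last n ∈ v) from fun h' => by simpa using (H _ _ h).2 h'
    intro u v h
    induction h with
    | rel A B h =>
      obtain ⟨h1, h2⟩ := mem_stripEdges_iff hK h.1
      have := h.2
      rw [h1] at this
      tauto
    | refl => rfl
    | symm _ _ _ ih => exact ih.symm
    | trans _ _ _ _ _ ih1 ih2 => exact ih1.trans ih2
  · induction hN : weight v using Nat.strong_induction_on generalizing v with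
    | _ N ih =>
      subst hN
      by_cases h0 : v = ∅
      · subst h0; exact Relation.EqvGen.refl _
      obtain ⟨u, hu⟩ := hK.exists_incoming hv h0
      obtain ⟨h1, h2⟩ := mem_stripEdges_iff hK hu
      have hlt : weight u < weight v := by
        rcases hK.edge_type hu with ⟨i, h⟩ | ⟨i, j, h⟩
        exacts [h.weight_lt, h.weight_lt]
      refine Relation.EqvGen.trans _ _ _ (ih _ hlt u (mem_edges_vertices hu).1
        (fun h3 => h (h2 h3)) rfl) (Relation.EqvGen.rel _ _ ⟨hu, ?_⟩)
      rw [h1]; tauto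

theorem component_univ (hK : EdgeTiling ξ K) :
    component K Finset.univ = {v | v ∈ vertices K ∧ Fin.last n ∈ v} := by
  ext v
  simp only [component, Set.mem_ofPred_eq]
  refine and_congr_right fun hv => ⟨fun h => ?_, fun h => ?_⟩
  · suffices H : ∀ u v, Relation.EqvGen (fun A B => (A, B) ∈ edges K \ stripEdges K) u v →
        (Fin.last n ∈ u ↔ Fin.last n ∈ v) from (H _ _ h).1 (Finset.mem_univ _)
    intro u v h
    induction h with
    | rel A B h =>
      obtain ⟨h1, h2⟩ := mem_stripEdges_iff hK h.1
      have := h.2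
      rw [h1] at this
      tauto
    | refl => rfl
    | symm _ _ _ ih => exact ih.symm
    | trans _ _ _ _ _ ih1 ih2 => exact ih1.trans ih2
  · induction hN : weight (Finset.univ : Vert (n + 1)) - weight v
      using Nat.strong_induction_on generalizing v with
    | _ N ih =>
      subst hN
      by_cases h0 : v = Finset.univ
      · subst h0; exact Relation.EqvGen.refl _
      obtain ⟨u, hu⟩ := hK.exists_outgoing hv h0
      obtain ⟨h1, h2⟩ := mem_stripEdges_iff hK hu
      have hlt : weight v < weight u := by
        rcases hK.edge_type hu with ⟨i, h⟩ | ⟨i, j, h⟩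
        exacts [h.weight_lt, h.weight_lt]
      have := weight_le_univ u
      refine Relation.EqvGen.trans _ _ _ (ih _ (by omega) u (mem_edges_vertices hu).2 (h2 h) rfl)
        (Relation.EqvGen.symm _ _ (Relation.EqvGen.rel _ _ ⟨hu, ?_⟩))
      rw [h1]; tauto

end components

end Combi

namespace Combi

/-! ### The tiles of the strip -/

section strip

variable {n : ℕ}

lemma exists_map_castSucc {I : List (Fin (n + 1))} (h : ∀ i ∈ I, i ≠ Fin.last n) :
    ∃ I' : List (Fin n), I = I'.map Fin.castSucc := by
  induction I with
  | nil => exact ⟨[], rfl⟩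
  | cons i I ih =>
    obtain ⟨I', rfl⟩ := ih fun j hj => h j (by simp [hj])
    obtain ⟨i', rfl⟩ := Fin.exists_castSucc_eq.2 (h i (by simp))
    exact ⟨i' :: I', rfl⟩

lemma exists_delta_map {f : Vert n → Vert (n + 1)} (hf : IsLift f) {i j : Fin n}
    {X : Vert n} (hij : i < j) (hi : i ∉ X) (hj : j ∉ X) :
    ∃ σ : Tile n, σ.IsValid ∧ Tile.delta (insert j.castSucc (insert i.castSucc (f X)))
      (insert i.castSucc (f X)) (insert j.castSucc (f X)) = σ.map f := by
  refine ⟨Tile.delta (insert j (insert i X)) (insert i X) (insert j X),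
    ⟨i, j, ⟨hij, X, hi, hj, rfl, rfl⟩, ⟨by simp [hij.ne', hj], rfl⟩,
      by simp [hij.ne, hi], Finset.insert_comm _ _ _⟩, ?_⟩
  simp [Tile.map, hf.insert]

lemma exists_nabla_map {f : Vert n → Vert (n + 1)} (hf : IsLift f) {i j : Fin n}
    {X : Vert n} (hij : i < j) (hi : i ∉ X) (hj : j ∉ X) :
    ∃ σ : Tile n, σ.IsValid ∧ Tile.nabla (f X)
      (insert i.castSucc (f X)) (insert j.castSucc (f X)) = σ.map f := by
  refine ⟨Tile.nabla X (insert i X) (insert j X),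
    ⟨i, j, ⟨hij, X, hi, hj, rfl, rfl⟩, ⟨hi, rfl⟩, hj, rfl⟩, ?_⟩
  simp [Tile.map, hf.insert]

/-- The conditions under which `stripLens x y X Y` is a lens. -/
def IsStripLens (x y : Vert n) (X Y : List (Vert n)) : Prop :=
  ∃ w z, IsUpperFilling {τ | τ.IsValid} x y z X ∧ IsLowerFilling {τ | τ.IsValid} w x y Y ∧
    w ≠ y ∧ x ≠ z

lemma isUpperFilling_of_index {y : Vert n} {i k : Fin n} {I : List (Fin n)}
    (hI : (i :: (I ++ [k])).Pairwise (· < ·)) (hy : ∀ j ∈ i :: (I ++ [k]), j ∉ y) :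
    IsUpperFilling {τ | τ.IsValid} (insert i y) y (insert k y)
      ((i :: (I ++ [k])).map (fun j => insert j y)) := by
  refine ⟨rfl, ?_, ?_⟩
  · rw [List.getLast?_map, ← List.cons_append, List.getLast?_concat]; rfl
  · rw [List.isChain_map]
    exact (hI.imp_of_mem fun hu hv huv => ⟨_, _, ⟨huv, y, hy _ hu, hy _ hv, rfl, rfl⟩,
      ⟨hy _ hu, rfl⟩, hy _ hv, rfl⟩).isChain

lemma isVEdge_erase {y : Vert n} {i : Fin n} (h : i ∈ y) : IsVEdge i (y.erase i) y :=
  ⟨by simp, (Finset.insert_erase h).symm⟩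

lemma isLowerFilling_of_index {y : Vert n} {i k : Fin n} {I : List (Fin n)}
    (hI : (i :: (I ++ [k])).Pairwise (· > ·)) (hy : ∀ j ∈ i :: (I ++ [k]), j ∈ y) :
    IsLowerFilling {τ | τ.IsValid} (y.erase i) y (y.erase k)
      ((i :: (I ++ [k])).map (fun j => y.erase j)) := by
  refine ⟨rfl, ?_, ?_⟩
  · rw [List.getLast?_map, ← List.cons_append, List.getLast?_concat]; rfl
  · rw [List.isChain_map]
    exact (hI.imp_of_mem fun hu hv huv => ⟨_, _, isHEdge_erase huv (hy _ hu) (hy _ hv),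
      isVEdge_erase (hy _ hu), isVEdge_erase (hy _ hv)⟩).isChain

/-- The position of a tile with respect to the last index. -/
theorem Tile.IsValid.cases_last {τ : Tile (n + 1)} (h : τ.IsValid) :
    (∃ σ : Tile n, σ.IsValid ∧ τ = σ.map lo) ∨ (∃ σ : Tile n, σ.IsValid ∧ τ = σ.map hi) ∨
    (∃ a b i, IsVEdge i a b ∧ τ = upTile a b) ∨ (∃ a b i, IsVEdge i a b ∧ τ = downTile a b) ∨
    ∃ x y X Y, IsStripLens x y X Y ∧ τ = stripLens x y X Y := by
  cases τ with
  | delta A B C =>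
    obtain ⟨i, j, ⟨hij, X, hi, hj, rfl, rfl⟩, ⟨-, rfl⟩, -⟩ := h
    have hil : i ≠ Fin.last n := (hij.trans_le (Fin.le_last j)).ne
    obtain ⟨i', rfl⟩ := Fin.exists_castSucc_eq.2 hil
    by_cases hX : Fin.last n ∈ X
    · obtain ⟨X, rfl⟩ : ∃ X', X = Combi.hi X' := ⟨drop X, (hi_drop hX).symm⟩
      have hjl : j ≠ Fin.last n := by rintro rfl; exact hj hX
      obtain ⟨j', rfl⟩ := Fin.exists_castSucc_eq.2 hjl
      exact Or.inr (Or.inl (exists_delta_map isLift_hi (by simpa using hij) (by simpa using hi)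
        (by simpa using hj)))
    · obtain ⟨X, rfl⟩ : ∃ X', X = lo X' := ⟨drop X, (lo_drop hX).symm⟩
      by_cases hjl : j = Fin.last n
      · subst hjl
        refine Or.inr (Or.inr (Or.inr (Or.inl ⟨X, insert i' X, i', ⟨by simpa using hi, rfl⟩, ?_⟩)))
        simp [downTile, Combi.hi, lo_insert]
      · obtain ⟨j', rfl⟩ := Fin.exists_castSucc_eq.2 hjl
        exact Or.inl (exists_delta_map isLift_lo (by simpa using hij) (by simpa using hi)
          (by simpa using hj))
  | nabla A B C =>
    obtain ⟨i, j, ⟨hij, -⟩, ⟨hi, rfl⟩, hj, rfl⟩ := h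
    have hil : i ≠ Fin.last n := (hij.trans_le (Fin.le_last j)).ne
    obtain ⟨i', rfl⟩ := Fin.exists_castSucc_eq.2 hil
    by_cases hX : Fin.last n ∈ A
    · obtain ⟨X, rfl⟩ : ∃ X', A = Combi.hi X' := ⟨drop A, (hi_drop hX).symm⟩
      have hjl : j ≠ Fin.last n := by rintro rfl; exact hj hX
      obtain ⟨j', rfl⟩ := Fin.exists_castSucc_eq.2 hjl
      exact Or.inr (Or.inl (exists_nabla_map isLift_hi (by simpa using hij) (by simpa using hi)
        (by simpa using hj)))
    · obtain ⟨X, rfl⟩ : ∃ X', A = lo X' := ⟨drop A, (lo_drop hX).symm⟩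
      by_cases hjl : j = Fin.last n
      · subst hjl
        refine Or.inr (Or.inr (Or.inl ⟨X, insert i' X, i', ⟨by simpa using hi, rfl⟩, ?_⟩))
        simp [upTile, Combi.hi, lo_insert]
      · obtain ⟨j', rfl⟩ := Fin.exists_castSucc_eq.2 hjl
        exact Or.inl (exists_nabla_map isLift_lo (by simpa using hij) (by simpa using hi)
          (by simpa using hj))
  | lens U L =>
    obtain ⟨X, a, c, I, J, hI, hI0, hIX, rfl, hJ, hJ0, hJX, rfl⟩ := isValid_lens_iff.1 h
    have hac : a < c := (List.pairwise_cons.1 hI).1 c (by simp)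
    have hal : a ≠ Fin.last n := (hac.trans_le (Fin.le_last c)).ne
    have hIl : ∀ i ∈ I, i ≠ Fin.last n := by grind
    have hJl : ∀ j ∈ J, j ≠ Fin.last n := by
      intro j hj
      have : j < c := (List.pairwise_cons.1 hJ).1 j (by simp [hj])
      exact (this.trans_le (Fin.le_last c)).ne
    obtain ⟨a, rfl⟩ := Fin.exists_castSucc_eq.2 hal
    obtain ⟨I, rfl⟩ := exists_map_castSucc hIl
    obtain ⟨J, rfl⟩ := exists_map_castSucc hJl
    by_cases hc : c = Fin.last n
    · subst hc
      have hX : Fin.last n ∉ X := hIX _ (by simp)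
      obtain ⟨y, rfl⟩ : ∃ X', X = lo X' := ⟨drop X, (lo_drop hX).symm⟩
      have hay : a ∉ y := by simpa using hIX a.castSucc (by simp)
      have hxe : insert a.castSucc (insert (Fin.last n) (lo y)) = hi (insert a y) := by
        rw [hi_insert]; rfl
      rw [hxe] at hJX ⊢
      rcases List.eq_nil_or_concat I with rfl | ⟨I, k, rfl⟩
      · simp at hI0
      rcases J with _ | ⟨j, J⟩
      · simp at hJ0
      rw [List.concat_eq_append] at *
      refine Or.inr (Or.inr (Or.inr (Or.inr ⟨insert a y, y,
        (a :: (I ++ [k])).map (fun i => insert i y),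
        (j :: (J ++ [a])).map (fun i => (insert a y).erase i), ⟨(insert a y).erase j, insert k y,
          ?_, ?_, ?_, ?_⟩, ?_⟩)))
      · refine isUpperFilling_of_index ?_ ?_
        · have : ((a :: (I ++ [k])).map Fin.castSucc ++ [Fin.last n]).Pairwise (· < ·) := by
            simpa using hI
          have := (List.pairwise_append.1 this).1
          rw [List.pairwise_map] at this
          exact this.imp fun h => by simpa using h
        · intro i hi
          have := hIX i.castSucc (by simpa using hi)
          simpa using this
      · have := isLowerFilling_of_index (y := insert a y) (i := j) (k := a) (I := J) ?_ ?_
        · rwa [Finset.erase_insert hay] at this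
        · have : ((j :: (J ++ [a])).map Fin.castSucc).Pairwise (· > ·) := by
            simpa using (List.pairwise_cons.1 hJ).2
          rw [List.pairwise_map] at this
          exact this.imp fun h => by simpa using h
        · intro i hi
          have := hJX i.castSucc (by simpa using hi)
          simpa using this
      · grind
      · intro he
        have hak : a < k := by
          simpa using (List.pairwise_cons.1 hI).1 k.castSucc (by simp)
        have : a ∈ insert k y := by rw [← he]; simp
        rcases Finset.mem_insert.1 this with h | h
        exacts [hak.ne h, hay h]
      · have h1 : insert (Fin.last n) (lo y) = hi y := rfl
        simp [stripLens, List.map_map, Function.comp_def, lo_insert, hi_erase, hi_erase_last, h1]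
        rw [hi_insert, Finset.erase_insert_eq_erase]
    · obtain ⟨c, rfl⟩ := Fin.exists_castSucc_eq.2 hc
      have hf : ∀ f : Vert n → Vert (n + 1), IsLift f → (∃ X', X = f X') →
          ∃ σ : Tile n, σ.IsValid ∧ Tile.lens (List.map (fun i => insert i X)
            (a.castSucc :: (I.map Fin.castSucc ++ [c.castSucc])))
            (List.map (fun j => (insert a.castSucc (insert c.castSucc X)).erase j)
            (c.castSucc :: (J.map Fin.castSucc ++ [a.castSucc]))) = σ.map f := by
        rintro f hf ⟨X, rfl⟩
        refine ⟨Tile.lens ((a :: (I ++ [c])).map (fun i => insert i X))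
          ((c :: (J ++ [a])).map (fun j => (insert a (insert c X)).erase j)),
          isValid_lens_iff.2 ⟨X, a, c, I, J, ?_, by simpa using hI0, ?_, rfl, ?_,
            by simpa using hJ0, ?_, rfl⟩, ?_⟩
        · have : ((a :: (I ++ [c])).map Fin.castSucc).Pairwise (· < ·) := by simpa using hI
          rw [List.pairwise_map] at this
          exact this.imp fun h => by simpa using h
        · intro i hi hiX
          exact hIX i.castSucc (by simpa using hi) ((hf.mem _ _).2 hiX)
        · have : ((c :: (J ++ [a])).map Fin.castSucc).Pairwise (· > ·) := by simpa using hJ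
          rw [List.pairwise_map] at this
          exact this.imp fun h => by simpa using h
        · intro i hi
          have := hJX i.castSucc (by simpa using hi)
          rwa [← hf.insert, ← hf.insert, hf.mem] at this
        · simp [Tile.map, List.map_map, Function.comp_def, hf.insert, hf.erase]
      by_cases hX : Fin.last n ∈ X
      · exact Or.inr (Or.inl (hf hi isLift_hi ⟨drop X, (hi_drop hX).symm⟩))
      · exact Or.inl (hf lo isLift_lo ⟨drop X, (lo_drop hX).symm⟩)

lemma stripLens_inj {x y x' y' : Vert n} {X Y X' Y' : List (Vert n)}
    (h : stripLens x y X Y = stripLens x' y' X' Y') : x = x' ∧ y = y' ∧ X = X' ∧ Y = Y' := by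
  simp only [stripLens, Tile.lens.injEq, List.cons.injEq] at h
  obtain ⟨h1, h2, h3⟩ := h
  obtain ⟨h4, h5⟩ := List.append_inj' h1 rfl
  exact ⟨lo_injective h2, hi_injective (by simpa using h5), List.map_injective_iff.2 lo_injective h4,
    List.map_injective_iff.2 hi_injective h3⟩

lemma Tile.mem_verts_map {m k : ℕ} {f : Finset (Fin m) → Finset (Fin k)} {σ : Tile m}
    {v : Finset (Fin k)} : v ∈ (σ.map f).verts ↔ ∃ u ∈ σ.verts, v = f u := by
  cases σ with
  | delta A B C => simp [Tile.map, Tile.verts]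
  | nabla A B C => simp [Tile.map, Tile.verts]
  | lens U L =>
    simp only [Tile.map, Tile.verts, Set.mem_ofPred_eq, List.mem_map]
    grind

lemma Tile.map_map_eq {m k : ℕ} {f : Finset (Fin m) → Finset (Fin k)}
    {g : Finset (Fin k) → Finset (Fin m)} (h : ∀ A, g (f A) = A) (σ : Tile m) :
    (σ.map f).map g = σ := by
  cases σ <;> simp [Tile.map, h, Function.comp_def]

lemma Tile.map_lo_injective : Function.Injective (Tile.map (lo (n := n))) :=
  Function.LeftInverse.injective (Tile.map_map_eq drop_lo)

lemma Tile.map_hi_injective : Function.Injective (Tile.map (hi (n := n))) :=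
  Function.LeftInverse.injective (Tile.map_map_eq drop_hi)

/-- A tile with a vertex that contains the last index and a vertex that does not. -/
def Tile.Mixed (τ : Tile (n + 1)) : Prop :=
  (∃ v ∈ τ.verts, Fin.last n ∉ v) ∧ ∃ v ∈ τ.verts, Fin.last n ∈ v

lemma Tile.HasType.mixed {τ : Tile (n + 1)} {i : Fin (n + 1)} (h : τ.HasType i (Fin.last n)) :
    τ.Mixed := by
  have key : ∀ l r : Vert (n + 1), IsHEdge i (Fin.last n) l r →
      Fin.last n ∉ l ∧ Fin.last n ∈ r := by
    rintro l r ⟨h1, X, h2, h3, rfl, rfl⟩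
    simp [h1.ne', h3]
  cases τ with
  | delta A B C =>
    have := key _ _ h
    exact ⟨⟨B, by simp [Tile.verts], this.1⟩, ⟨C, by simp [Tile.verts], this.2⟩⟩
  | nabla A B C =>
    have := key _ _ h
    exact ⟨⟨B, by simp [Tile.verts], this.1⟩, ⟨C, by simp [Tile.verts], this.2⟩⟩
  | lens U L =>
    obtain ⟨l, r, hl, hr, h⟩ := h
    have := key _ _ h
    exact ⟨⟨l, Or.inl (List.mem_of_mem_head? hl), this.1⟩,
      ⟨r, Or.inl (List.mem_of_getLast? hr), this.2⟩⟩

lemma Tile.not_mixed_lo (σ : Tile n) : ¬ (σ.map lo).Mixed := by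
  rintro ⟨-, v, hv, h⟩
  obtain ⟨u, -, rfl⟩ := Tile.mem_verts_map.1 hv
  simp at h

lemma Tile.not_mixed_hi (σ : Tile n) : ¬ (σ.map hi).Mixed := by
  rintro ⟨⟨v, hv, h⟩, -⟩
  obtain ⟨u, -, rfl⟩ := Tile.mem_verts_map.1 hv
  simp at h

lemma Tile.IsValid.cases_mixed {τ : Tile (n + 1)} (h : τ.IsValid) (hm : τ.Mixed) :
    (∃ a b i, IsVEdge i a b ∧ τ = upTile a b) ∨ (∃ a b i, IsVEdge i a b ∧ τ = downTile a b) ∨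
    ∃ x y X Y, IsStripLens x y X Y ∧ τ = stripLens x y X Y := by
  rcases h.cases_last with ⟨σ, -, rfl⟩ | ⟨σ, -, rfl⟩ | h
  · exact absurd hm (Tile.not_mixed_lo σ)
  · exact absurd hm (Tile.not_mixed_hi σ)
  · exact h

lemma Tile.IsValid.exists_mem_verts {m : ℕ} {τ : Tile m} (h : τ.IsValid) : ∃ v, v ∈ τ.verts := by
  obtain ⟨s, u, u', -, -, h, -⟩ := h.source_edges
  exact ⟨s, Tile.mem_verts_iff.2 (Or.inl (pair_infix_mem h).1)⟩

lemma mixed_upTile (a b : Vert n) : (upTile a b).Mixed :=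
  ⟨⟨lo a, by simp [Tile.verts], by simp⟩, ⟨hi a, by simp [Tile.verts], by simp⟩⟩

lemma mixed_downTile (a b : Vert n) : (downTile a b).Mixed :=
  ⟨⟨lo b, by simp [Tile.verts], by simp⟩, ⟨hi a, by simp [Tile.verts], by simp⟩⟩

lemma mixed_stripLens (x y : Vert n) (X Y : List (Vert n)) :
    (stripLens x y X Y).Mixed :=
  ⟨⟨lo x, by simp [Tile.verts], by simp⟩,
    ⟨hi y, by simp [Tile.verts], by simp⟩⟩

lemma IsStripLens.hasType {x y : Vert n} {X Y : List (Vert n)}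
    (h : IsStripLens x y X Y) : ∃ i, (stripLens x y X Y).HasType i (Fin.last n) := by
  obtain ⟨w, z, hX, hY, -, hxz⟩ := h
  obtain ⟨t, rfl⟩ := head_eq_of_head? hX.1
  rcases t with _ | ⟨u, t⟩
  · exact absurd (by simpa using hX.2.1) hxz
  · obtain ⟨i, j, -, hi', -⟩ := (List.isChain_cons_cons.1 hX.2.2).1
    exact ⟨i.castSucc, lo x, hi y, by simp, by simp [List.getLast?_cons], hi'.isHEdge_last⟩

lemma isStripLens_of_isValid {x y : Vert n} {X Y : List (Vert n)}
    (h : (stripLens x y X Y).IsValid) : IsStripLens x y X Y := by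
  rcases h.cases_mixed (mixed_stripLens x y X Y) with ⟨a, b, i, hi, h'⟩ | ⟨a, b, i, hi, h'⟩ |
    ⟨x', y', X', Y', hs, h'⟩
  · cases h'
  · cases h'
  · obtain ⟨rfl, rfl, rfl, rfl⟩ := stripLens_inj h'
    exact hs

lemma Tile.IsValid.cases_not_mixed {τ : Tile (n + 1)} (h : τ.IsValid) (hm : ¬ τ.Mixed) :
    (∃ σ : Tile n, τ = σ.map lo) ∨ ∃ σ : Tile n, τ = σ.map hi := by
  rcases h.cases_last with ⟨σ, -, h⟩ | ⟨σ, -, h⟩ | ⟨a, b, -, -, rfl⟩ | ⟨a, b, -, -, rfl⟩ |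
    ⟨x, y, X, Y, -, rfl⟩
  exacts [Or.inl ⟨σ, h⟩, Or.inr ⟨σ, h⟩, absurd (mixed_upTile a b) hm,
    absurd (mixed_downTile a b) hm, absurd (mixed_stripLens x y X Y) hm]

/-- `σ` is one of the tiles that the contraction makes of `τ`. -/
def Contracts (τ : Tile (n + 1)) (σ : Tile n) : Prop :=
  τ = σ.map lo ∨ τ = σ.map hi ∨
  (∃ x y X Y u v, τ = stripLens x y X Y ∧ [u, v] <:+: Y ∧ σ = Tile.delta x u v) ∨
  ∃ x y X Y u v, τ = stripLens x y X Y ∧ [u, v] <:+: X ∧ σ = Tile.nabla y u v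

variable {ξ : Fin (n + 1) → Plane} {K : Set (Tile (n + 1))}

lemma mem_leftTiles_iff (hK : EdgeTiling ξ K) {τ : Tile (n + 1)} :
    τ ∈ leftTiles K ↔ τ ∈ K ∧ ∃ σ : Tile n, τ = σ.map lo := by
  simp only [leftTiles, component_empty hK]
  constructor
  · rintro ⟨⟨h1, -⟩, h2⟩
    refine ⟨h1, ?_⟩
    have hv := hK.valid τ h1
    refine (hv.cases_not_mixed fun ⟨_, v, hv, h⟩ => (h2 hv).2 h).resolve_right ?_
    rintro ⟨σ, rfl⟩
    obtain ⟨v, hv⟩ := hv.exists_mem_verts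
    obtain ⟨_, _, rfl⟩ := Tile.mem_verts_map.1 hv
    exact (h2 hv).2 last_mem_hi
  · rintro ⟨h1, σ, rfl⟩
    refine ⟨⟨h1, fun ⟨_, i, h⟩ => Tile.not_mixed_lo σ h.mixed⟩, fun v hv => ?_⟩
    refine ⟨⟨_, h1, hv⟩, ?_⟩
    obtain ⟨_, _, rfl⟩ := Tile.mem_verts_map.1 hv
    exact last_notMem_lo

lemma mem_rightTiles_iff (hK : EdgeTiling ξ K) {τ : Tile (n + 1)} :
    τ ∈ rightTiles K ↔ τ ∈ K ∧ ∃ σ : Tile n, τ = σ.map hi := by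
  simp only [rightTiles, component_univ hK]
  constructor
  · rintro ⟨⟨h1, -⟩, h2⟩
    refine ⟨h1, ?_⟩
    have hv := hK.valid τ h1
    refine (hv.cases_not_mixed fun ⟨⟨v, hv, h⟩, _⟩ => h (h2 hv).2).resolve_left ?_
    rintro ⟨σ, rfl⟩
    obtain ⟨v, hv⟩ := hv.exists_mem_verts
    obtain ⟨_, _, rfl⟩ := Tile.mem_verts_map.1 hv
    exact last_notMem_lo (h2 hv).2
  · rintro ⟨h1, σ, rfl⟩
    refine ⟨⟨h1, fun ⟨_, i, h⟩ => Tile.not_mixed_hi σ h.mixed⟩, fun v hv => ?_⟩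
    refine ⟨⟨_, h1, hv⟩, ?_⟩
    obtain ⟨_, _, rfl⟩ := Tile.mem_verts_map.1 hv
    exact last_mem_hi

lemma mem_stripTiles_lens (hK : EdgeTiling ξ K) {U L : List (Vert (n + 1))}
    (h : Tile.lens U L ∈ stripTiles K) : ∃ x y X Y, IsStripLens x y X Y ∧
      Tile.lens U L = stripLens x y X Y := by
  obtain ⟨h, i, hi⟩ := h
  rcases (hK.valid _ h).cases_mixed hi.mixed with ⟨a, b, i, hi, h'⟩ | ⟨a, b, i, hi, h'⟩ | h'
  · cases h'
  · cases h'
  · exact h'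

theorem contraction_eq (hK : EdgeTiling ξ K) :
    contraction K = {σ | ∃ τ ∈ K, Contracts τ σ} := by
  ext σ
  simp only [contraction, Set.mem_union, Set.mem_image, Set.mem_ofPred_eq, mem_leftTiles_iff hK,
    mem_rightTiles_iff hK]
  constructor
  · rintro (((⟨_, ⟨h1, σ, rfl⟩, rfl⟩ | ⟨_, ⟨h1, σ, rfl⟩, rfl⟩) |
      ⟨U, L, l, u, v, h1, h2, h3, rfl⟩) | ⟨U, L, r, u, v, h1, h2, h3, rfl⟩)
    · rw [Tile.map_map_eq drop_lo]; exact ⟨_, h1, Or.inl rfl⟩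
    · rw [Tile.map_map_eq drop_hi]; exact ⟨_, h1, Or.inr (Or.inl rfl)⟩
    · obtain ⟨x, y, X, Y, hs, he⟩ := mem_stripTiles_lens hK h1
      refine ⟨_, h1.1, Or.inr (Or.inr (Or.inl ⟨x, y, X, Y, drop u, drop v, he, ?_⟩))⟩
      cases he
      obtain ⟨w, z, hX, hY, -, -⟩ := hs
      obtain ⟨t, ht⟩ := head_eq_of_head? hX.1
      rw [List.tail_cons] at h3
      obtain ⟨u, v, huv, rfl, rfl⟩ := pair_infix_map.1 h3
      obtain rfl : lo x = l := by simpa [ht] using h2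
      simp [huv]
    · obtain ⟨x, y, X, Y, hs, he⟩ := mem_stripTiles_lens hK h1
      refine ⟨_, h1.1, Or.inr (Or.inr (Or.inr ⟨x, y, X, Y, drop u, drop v, he, ?_⟩))⟩
      cases he
      obtain ⟨w, z, hX, hY, -, -⟩ := hs
      rw [List.dropLast_concat] at h3
      obtain ⟨u, v, huv, rfl, rfl⟩ := pair_infix_map.1 h3
      obtain rfl : hi y = r := by
        rw [List.getLast?_cons, List.getLast?_map, hY.2.1] at h2
        simpa using h2
      simp [huv]
  · rintro ⟨τ, h1, rfl | rfl | ⟨x, y, X, Y, u, v, rfl, h2, rfl⟩ | ⟨x, y, X, Y, u, v, rfl, h2, rfl⟩⟩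
    · exact Or.inl (Or.inl (Or.inl ⟨_, ⟨h1, _, rfl⟩, Tile.map_map_eq drop_lo _⟩))
    · exact Or.inl (Or.inl (Or.inr ⟨_, ⟨h1, _, rfl⟩, Tile.map_map_eq drop_hi _⟩))
    · have hs := isStripLens_of_isValid (hK.valid _ h1)
      have ht := hs.hasType
      obtain ⟨w, z, hX, hY, -, -⟩ := hs
      obtain ⟨t, rfl⟩ := head_eq_of_head? hX.1
      exact Or.inl (Or.inr ⟨_, _, lo x, hi u, hi v, ⟨h1, ht⟩, by simp,
        pair_infix_map.2 ⟨u, v, h2, rfl, rfl⟩, by simp⟩)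
    · have hs := isStripLens_of_isValid (hK.valid _ h1)
      have ht := hs.hasType
      obtain ⟨w, z, hX, hY, -, -⟩ := hs
      refine Or.inr ⟨_, _, hi y, lo u, lo v, ⟨h1, ht⟩, ?_, ?_, by simp⟩
      · rw [List.getLast?_cons, List.getLast?_map, hY.2.1]; rfl
      · rw [List.dropLast_concat]
        exact pair_infix_map.2 ⟨u, v, h2, rfl, rfl⟩

lemma Tile.IsValid.map_lo_ne_map_hi {σ σ' : Tile n} (hσ : σ.IsValid) : σ.map lo ≠ σ'.map hi := by
  intro h
  obtain ⟨v, hv⟩ := hσ.exists_mem_verts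
  obtain ⟨_, _, hs⟩ := Tile.mem_verts_map.1 (h ▸ Tile.mem_verts_map.2 ⟨v, hv, rfl⟩)
  exact lo_ne_hi _ _ hs

lemma Tile.IsValid.map_hi_ne_map_lo {σ σ' : Tile n} (hσ : σ.IsValid) : σ.map hi ≠ σ'.map lo := by
  intro h
  obtain ⟨v, hv⟩ := hσ.exists_mem_verts
  obtain ⟨_, _, hs⟩ := Tile.mem_verts_map.1 (h ▸ Tile.mem_verts_map.2 ⟨v, hv, rfl⟩)
  exact lo_ne_hi _ _ hs.symm

lemma contracts_map_lo {σ σ' : Tile n} (hσ : σ.IsValid) : Contracts (σ.map lo) σ' ↔ σ' = σ := by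
  constructor
  · rintro (h | h | ⟨x, y, X, Y, u, v, h, -⟩ | ⟨x, y, X, Y, u, v, h, -⟩)
    · exact (Tile.map_lo_injective h).symm
    · exact absurd h hσ.map_lo_ne_map_hi
    · exact absurd (h ▸ mixed_stripLens x y X Y) (Tile.not_mixed_lo σ)
    · exact absurd (h ▸ mixed_stripLens x y X Y) (Tile.not_mixed_lo σ)
  · rintro rfl; exact Or.inl rfl

lemma contracts_map_hi {σ σ' : Tile n} (hσ : σ.IsValid) : Contracts (σ.map hi) σ' ↔ σ' = σ := by
  constructor
  · rintro (h | h | ⟨x, y, X, Y, u, v, h, -⟩ | ⟨x, y, X, Y, u, v, h, -⟩)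
    · exact absurd h hσ.map_hi_ne_map_lo
    · exact (Tile.map_hi_injective h).symm
    · exact absurd (h ▸ mixed_stripLens x y X Y) (Tile.not_mixed_hi σ)
    · exact absurd (h ▸ mixed_stripLens x y X Y) (Tile.not_mixed_hi σ)
  · rintro rfl; exact Or.inr (Or.inl rfl)

lemma not_contracts_upTile {a b : Vert n} {σ : Tile n} : ¬ Contracts (upTile a b) σ := by
  rintro (h | h | ⟨x, y, X, Y, u, v, h, -⟩ | ⟨x, y, X, Y, u, v, h, -⟩)
  · exact Tile.not_mixed_lo σ (h ▸ mixed_upTile a b)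
  · exact Tile.not_mixed_hi σ (h ▸ mixed_upTile a b)
  · cases h
  · cases h

lemma not_contracts_downTile {a b : Vert n} {σ : Tile n} :
    ¬ Contracts (downTile a b) σ := by
  rintro (h | h | ⟨x, y, X, Y, u, v, h, -⟩ | ⟨x, y, X, Y, u, v, h, -⟩)
  · exact Tile.not_mixed_lo σ (h ▸ mixed_downTile a b)
  · exact Tile.not_mixed_hi σ (h ▸ mixed_downTile a b)
  · cases h
  · cases h

lemma contracts_stripLens_iff {x y : Vert n} {X Y : List (Vert n)} {σ : Tile n} :
    Contracts (stripLens x y X Y) σ ↔ (∃ u v, [u, v] <:+: Y ∧ σ = Tile.delta x u v) ∨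
      ∃ u v, [u, v] <:+: X ∧ σ = Tile.nabla y u v := by
  constructor
  · rintro (h | h | ⟨x', y', X', Y', u, v, h, h', rfl⟩ | ⟨x', y', X', Y', u, v, h, h', rfl⟩)
    · exact absurd (h ▸ mixed_stripLens x y X Y) (Tile.not_mixed_lo σ)
    · exact absurd (h ▸ mixed_stripLens x y X Y) (Tile.not_mixed_hi σ)
    · obtain ⟨rfl, rfl, rfl, rfl⟩ := stripLens_inj h
      exact Or.inl ⟨u, v, h', rfl⟩
    · obtain ⟨rfl, rfl, rfl, rfl⟩ := stripLens_inj h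
      exact Or.inr ⟨u, v, h', rfl⟩
  · rintro (⟨u, v, h, rfl⟩ | ⟨u, v, h, rfl⟩)
    · exact Or.inr (Or.inr (Or.inl ⟨_, _, _, _, u, v, rfl, h, rfl⟩))
    · exact Or.inr (Or.inr (Or.inr ⟨_, _, _, _, u, v, rfl, h, rfl⟩))

open Classical in
lemma Tile.IsValid.exists_contracts {τ : Tile (n + 1)} (hτ : τ.IsValid) :
    ∃ M : Multiset (Tile n), (∀ σ, σ ∈ M ↔ Contracts τ σ) ∧ (∀ σ ∈ M, σ.IsValid) ∧
      ∀ φ : Vert n → Vert n → ℤ, (∀ A B, φ A B = -φ B A) →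
        (M.map (Tile.bdry φ)).sum = τ.bdry (fun A B => φ (drop A) (drop B)) := by
  rcases hτ.cases_last with ⟨σ, hσ, rfl⟩ | ⟨σ, hσ, rfl⟩ | ⟨a, b, i, hi, rfl⟩ | ⟨a, b, i, hi, rfl⟩ |
      ⟨x, y, X, Y, hs, rfl⟩
  · refine ⟨{σ}, fun σ' => ?_, by simpa using hσ, fun φ hφ => ?_⟩
    · rw [Multiset.mem_singleton, contracts_map_lo hσ]
    · simp [Tile.bdry_map]
  · refine ⟨{σ}, fun σ' => ?_, by simpa using hσ, fun φ hφ => ?_⟩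
    · rw [Multiset.mem_singleton, contracts_map_hi hσ]
    · simp [Tile.bdry_map]
  · refine ⟨0, fun σ' => by simp [not_contracts_upTile], by simp, fun φ hφ => ?_⟩
    have := hφ a a
    have := hφ a b
    simp only [Multiset.map_zero, Multiset.sum_zero, Tile.bdry, Tile.lpath, Tile.rpath,
      pathSum_cons_cons, pathSum_singleton, drop_lo, drop_hi]
    omega
  · refine ⟨0, fun σ' => by simp [not_contracts_downTile], by simp, fun φ hφ => ?_⟩
    have := hφ b b
    have := hφ a b
    simp only [Multiset.map_zero, Multiset.sum_zero, Tile.bdry, Tile.lpath, Tile.rpath,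
      pathSum_cons_cons, pathSum_singleton, drop_lo, drop_hi]
    omega
  · obtain ⟨w, z, hX, hY, -, -⟩ := hs
    obtain ⟨F, hF, hFs⟩ := exists_finset_delta (fun τ h => h) hY
    obtain ⟨G, hG, hGs⟩ := exists_finset_nabla (fun τ h => h) hX
    refine ⟨F.val + G.val, fun σ' => ?_, fun σ' h => ?_, fun φ hφ => ?_⟩
    · rw [Multiset.mem_add, Finset.mem_val, Finset.mem_val, hF, hG, contracts_stripLens_iff]
    · rw [Multiset.mem_add, Finset.mem_val, Finset.mem_val, hF, hG] at h
      rcases h with ⟨u, v, h, rfl⟩ | ⟨u, v, h, rfl⟩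
      · exact chain_of_pair_infix hY.2.2 h
      · exact chain_of_pair_infix hX.2.2 h
    · have e1 := hFs φ
      have e2 := hGs φ
      obtain ⟨tY, htY⟩ := head_eq_of_head? hY.1
      have hXl : pathSum (fun A B => φ (drop A) (drop B)) (X.map lo ++ [hi y]) =
          pathSum φ X + φ z y := by
        obtain ⟨m, hm⟩ := List.getLast?_eq_some_iff.1 hX.2.1
        rw [hm, List.map_append, List.append_assoc, List.map_singleton, List.singleton_append,
          pathSum_append, ← List.map_singleton (f := lo), ← List.map_append, pathSum_map]
        simp
      have hYl : pathSum (fun A B => φ (drop A) (drop B)) (lo x :: Y.map hi) =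
          φ x w + pathSum φ Y := by
        rw [htY, List.map_cons, pathSum_cons_cons, ← List.map_cons, pathSum_map]
        simp
      have h1 := hφ x w
      have h2 := hφ y x
      have h3 := hφ y z
      rw [Multiset.map_add, Multiset.sum_add]
      simp only [Finset.sum] at e1 e2
      rw [e1, e2]
      simp only [Tile.bdry, Tile.lpath, Tile.rpath, hXl, hYl]
      linarith

open Classical in
/-- The contraction of a combined tiling is a combined tiling. -/
theorem contraction_edgeTiling (hξ : IsGenerators ξ) (hn : 2 ≤ n) (hK : EdgeTiling ξ K) :
    EdgeTiling (fun i => ξ i.castSucc) (contraction K) := by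
  have hex : ∀ τ : Tile (n + 1), ∃ M : Multiset (Tile n), τ ∈ K →
      (∀ σ, σ ∈ M ↔ Contracts τ σ) ∧ (∀ σ ∈ M, σ.IsValid) ∧
      ∀ φ : Vert n → Vert n → ℤ, (∀ A B, φ A B = -φ B A) →
        (M.map (Tile.bdry φ)).sum = τ.bdry (fun A B => φ (drop A) (drop B)) := by
    intro τ
    by_cases hτ : τ ∈ K
    · obtain ⟨M, hM⟩ := (hK.valid τ hτ).exists_contracts
      exact ⟨M, fun _ => hM⟩
    · exact ⟨0, fun h => absurd h hτ⟩
  choose M hM using hex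
  have := edgeTiling_of_boundary hξ.castSucc hn (hK.finite.toFinset.val.bind M) ?_ ?_
  · rw [contraction_eq hK]
    convert this using 1
    ext σ
    simp only [Set.mem_ofPred_eq, Multiset.mem_bind, Finset.mem_val, Set.Finite.mem_toFinset]
    exact exists_congr fun τ => and_congr_right fun hτ => ((hM τ hτ).1 σ).symm
  · intro σ hσ
    obtain ⟨τ, hτ, hσ⟩ := Multiset.mem_bind.1 hσ
    exact (hM τ (by simpa using hτ)).2.1 σ hσ
  · intro φ hφ
    have h1 := hK.sum_bdry_eq hξ (fun A B => φ (drop A) (drop B))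
    rw [zonogonBdry_succ] at h1
    simp only [drop_lo, drop_hi] at h1
    have h2 := hφ Finset.univ Finset.univ
    have h3 := hφ ∅ ∅
    rw [Multiset.map_bind, Multiset.sum_bind]
    have h4 : ∑ τ ∈ hK.finite.toFinset, ((M τ).map (Tile.bdry φ)).sum =
        ∑ τ ∈ hK.finite.toFinset, τ.bdry (fun A B => φ (drop A) (drop B)) :=
      Finset.sum_congr rfl fun τ hτ => (hM τ (by simpa using hτ)).2.2 φ hφ
    rw [← h4] at h1
    rw [zonogonBdry]
    simp only [Finset.sum] at h1 ⊢
    omega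

end strip

end Combi

namespace Combi

/-! ### The contraction of an expansion -/

section contractionExpansion

variable {n : ℕ}

lemma Leg.contracts_stripPart {ξ : Fin n → Plane} {K : Set (Tile n)} {P : List (Vert n)}
    (hξ : IsGenerators ξ) (hK : EdgeTiling ξ K) {a b : Vert n} (h : Leg K a b P)
    (σ : Tile n) : (∃ τ ∈ stripPart K P, Contracts τ σ) ↔
      σ ∈ peakFillings K P ∨ σ ∈ pitFillings K P := by
  induction h with
  | @base a h =>
    simp [stripPart_stop, peakFillings_pair, pitFillings_pair, not_contracts_downTile]
  | @up a b c P h hP ih =>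
    obtain ⟨hbc, t, rfl⟩ := hP.shape
    have h1 := h.card_eq
    have h2 := hbc.card_eq
    rw [peakFillings_up (by omega) (by omega), pitFillings_up (by omega), ← ih]
    constructor
    · rintro ⟨τ, hτ, hc⟩
      rcases (stripPart_up (by omega) (by omega)).1 hτ with rfl | rfl | hτ
      · exact absurd hc not_contracts_downTile
      · exact absurd hc not_contracts_upTile
      · exact ⟨τ, hτ, hc⟩
    · rintro ⟨τ, hτ, hc⟩
      exact ⟨τ, (stripPart_up (by omega) (by omega)).2 (Or.inr (Or.inr hτ)), hc⟩
  | @turn a b y z P h h' hay hbz hP ih =>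
    obtain ⟨hyz, t, rfl⟩ := hP.shape
    have h1 := h.card_eq
    have h2 := h'.card_eq
    have h3 := hyz.card_eq
    obtain ⟨hs1, hs2⟩ := Leg.turn_stripLE hξ hK h h' hyz hay hbz
    obtain ⟨Y, hY⟩ := hs1.exists_lowerFilling hK.valid
    obtain ⟨X, hX⟩ := hs2.exists_upperFilling hK.valid
    rw [peakFillings_turn (by omega) (by omega), pitFillings_turn (by omega) (by omega) (by omega),
      or_or_or_comm, ← ih]
    constructor
    · rintro ⟨τ, hτ, hc⟩
      rcases (stripPart_turn (by omega) (by omega) (by omega)).1 hτ with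
        ⟨X', Y', hY', hX', rfl⟩ | hτ
      · left
        rcases contracts_stripLens_iff.1 hc with ⟨u, v, h4, h5⟩ | ⟨u, v, h4, h5⟩
        · exact Or.inl ⟨Y', u, v, hY', h4, h5⟩
        · exact Or.inr ⟨X', u, v, hX', h4, h5⟩
      · exact Or.inr ⟨τ, hτ, hc⟩
    · rintro ((⟨Y', u, v, hY', h4, h5⟩ | ⟨X', u, v, hX', h4, h5⟩) | ⟨τ, hτ, hc⟩)
      · exact ⟨stripLens b y X Y', (stripPart_turn (by omega) (by omega) (by omega)).2
          (Or.inl ⟨X, Y', hY', hX, rfl⟩), contracts_stripLens_iff.2 (Or.inl ⟨u, v, h4, h5⟩)⟩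
      · exact ⟨stripLens b y X' Y, (stripPart_turn (by omega) (by omega) (by omega)).2
          (Or.inl ⟨X', Y, hY, hX', rfl⟩), contracts_stripLens_iff.2 (Or.inr ⟨u, v, h4, h5⟩)⟩
      · exact ⟨τ, (stripPart_turn (by omega) (by omega) (by omega)).2 (Or.inr hτ), hc⟩

theorem contraction_expansion {ξ : Fin (n + 1) → Plane} {K : Set (Tile n)}
    {P : List (Vert n)} (hξ : IsGenerators ξ) (hn : 2 ≤ n)
    (hK : EdgeTiling (fun i => ξ i.castSucc) K) (hP : IsLegalPath K P) :
    contraction (expansion (fun i => ξ i.castSucc) K P) = K := by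
  rw [contraction_eq (expansion_edgeTiling hξ hn hK hP)]
  obtain ⟨b, hL⟩ := hP.leg (by omega)
  obtain ⟨w, hw⟩ := exists_winding hξ.castSucc hn hK hL.isPathOf
  rw [expansion_eq hξ hn hK hw hL]
  have h01 := winding_eq_zero_or_one hξ.castSucc hK hw hL
  have hc := hL.contracts_stripPart hξ.castSucc hK
  ext σ
  constructor
  · rintro ⟨τ, (⟨σ', ⟨⟨h1, -⟩, -⟩, rfl⟩ | ⟨σ', ⟨⟨h1, -⟩, -⟩, rfl⟩) | rfl | hτ, h⟩
    · rwa [(contracts_map_lo (hK.valid _ h1)).1 h]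
    · rwa [(contracts_map_hi (hK.valid _ h1)).1 h]
    · exact absurd h not_contracts_upTile
    · rcases (hc σ).1 ⟨τ, hτ, h⟩ with h | h
      · exact (peakFillings_subset hξ.castSucc hK hw hL h).1
      · exact (pitFillings_subset hξ.castSucc hK hw hL h).1
  · intro hσ
    by_cases h1 : σ ∈ peakFillings K P ∨ σ ∈ pitFillings K P
    · obtain ⟨τ, hτ, h⟩ := (hc σ).2 h1
      exact ⟨τ, Or.inr (Or.inr hτ), h⟩
    · push Not at h1
      rcases h01 σ hσ with h | h
      · exact ⟨_, Or.inl (Or.inr ⟨σ, ⟨⟨hσ, h⟩, h1.1⟩, rfl⟩), Or.inr (Or.inl rfl)⟩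
      · exact ⟨_, Or.inl (Or.inl ⟨σ, ⟨⟨hσ, h⟩, h1.2⟩, rfl⟩), Or.inl rfl⟩

end contractionExpansion

end Combi

namespace Combi

/-! ### The strip of a combined tiling -/

section stripPath

variable {n : ℕ} {ξ : Fin (n + 1) → Plane} {K : Set (Tile (n + 1))}

/-- The sequence of the tiles of the strip of `K` above the edge from `b` to `a ∪ {n}` gives the
path `P` that starts with `a` and `b`. -/
inductive Strip (K : Set (Tile (n + 1))) :
    Vert n → Vert n → List (Vert n) → Prop
  | base {a} (h : downTile a Finset.univ ∈ K) : Strip K a Finset.univ [a, Finset.univ]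
  | up {a b c P} (h : downTile a b ∈ K) (h' : upTile b c ∈ K) (hP : Strip K b c P) :
      Strip K a b (a :: P)
  | turn {a b y z X Y P} (h : stripLens b y X Y ∈ K) (hY : Y.head? = some a)
      (hX : X.getLast? = some z) (hP : Strip K y z P) : Strip K a b (a :: b :: P)

lemma Leg.strip {ξ' : Fin n → Plane} {K' : Set (Tile n)} {P : List (Vert n)}
    (hξ : IsGenerators ξ') (hK : EdgeTiling ξ' K') {a b : Vert n} (h : Leg K' a b P)
    (hs : ∀ τ ∈ stripPart K' P, τ ∈ K) : Strip K a b P := by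
  induction h with
  | @base a h => exact Strip.base (hs _ (by simp [stripPart_stop]))
  | @up a b c P h hP ih =>
    obtain ⟨hbc, t, rfl⟩ := hP.shape
    have h1 := h.card_eq
    have h2 := hbc.card_eq
    have hm := fun τ => stripPart_up (K := K') (t := t) (show a.card < b.card by omega)
      (show b.card < c.card by omega) (τ := τ)
    exact Strip.up (hs _ ((hm _).2 (Or.inl rfl))) (hs _ ((hm _).2 (Or.inr (Or.inl rfl))))
      (ih fun τ hτ => hs τ ((hm τ).2 (Or.inr (Or.inr hτ))))
  | @turn a b y z P h h' hay hbz hP ih =>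
    obtain ⟨hyz, t, rfl⟩ := hP.shape
    have h1 := h.card_eq
    have h2 := h'.card_eq
    have h3 := hyz.card_eq
    obtain ⟨hs1, hs2⟩ := Leg.turn_stripLE hξ hK h h' hyz hay hbz
    obtain ⟨Y, hY⟩ := hs1.exists_lowerFilling hK.valid
    obtain ⟨X, hX⟩ := hs2.exists_upperFilling hK.valid
    have hm := fun τ => stripPart_turn (K := K') (t := t) (show a.card < b.card by omega)
      (show y.card < b.card by omega) (show y.card < z.card by omega) (τ := τ)
    exact Strip.turn (hs _ ((hm _).2 (Or.inl ⟨X, Y, hY, hX, rfl⟩))) hY.1 hX.2.1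
      (ih fun τ hτ => hs τ ((hm τ).2 (Or.inr hτ)))

lemma IsUpperFilling.vEdges {x y z : Vert n} {X : List (Vert n)}
    (h : IsUpperFilling {τ | τ.IsValid} x y z X) (hne : x ≠ z) :
    (∃ i, IsVEdge i y x) ∧ (∃ i, IsVEdge i y z) ∧ weight x < weight z := by
  obtain ⟨⟨u, hu⟩, ⟨v, hv⟩, hlt⟩ := steps_of_isChain weight (fun _ _ => nabla_weight_lt fun _ h => h) h.2.2 h.1
    h.2.1 hne
  obtain ⟨_, _, -, hu, -⟩ := hu
  obtain ⟨_, _, -, -, hv⟩ := hv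
  exact ⟨⟨_, hu⟩, ⟨_, hv⟩, hlt⟩

lemma IsLowerFilling.vEdges {x y z : Vert n} {X : List (Vert n)}
    (h : IsLowerFilling {τ | τ.IsValid} x y z X) (hne : x ≠ z) :
    (∃ i, IsVEdge i x y) ∧ (∃ i, IsVEdge i z y) ∧ weight x < weight z := by
  obtain ⟨⟨u, hu⟩, ⟨v, hv⟩, hlt⟩ := steps_of_isChain weight (fun _ _ => delta_weight_lt fun _ h => h) h.2.2 h.1
    h.2.1 hne
  obtain ⟨_, _, -, hu, -⟩ := hu
  obtain ⟨_, _, -, -, hv⟩ := hv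
  exact ⟨⟨_, hu⟩, ⟨_, hv⟩, hlt⟩

lemma isVEdge_of_isValid_downTile {a b : Vert n} (h : (downTile a b).IsValid) :
    ∃ i, IsVEdge i a b := by
  rcases h.cases_mixed (mixed_downTile a b) with ⟨a', b', i, hi', h'⟩ | ⟨a', b', i, hi', h'⟩ |
    ⟨x', y', X', Y', hs, h'⟩
  · cases h'
  · simp only [downTile, Tile.delta.injEq] at h'
    rw [lo_injective h'.2.1, hi_injective h'.2.2]
    exact ⟨i, hi'⟩
  · cases h'

lemma isVEdge_of_isValid_upTile {a b : Vert n} (h : (upTile a b).IsValid) :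
    ∃ i, IsVEdge i a b := by
  rcases h.cases_mixed (mixed_upTile a b) with ⟨a', b', i, hi', h'⟩ | ⟨a', b', i, hi', h'⟩ |
    ⟨x', y', X', Y', hs, h'⟩
  · simp only [upTile, Tile.nabla.injEq] at h'
    rw [lo_injective h'.2.1, hi_injective h'.2.2]
    exact ⟨i, hi'⟩
  · cases h'
  · cases h'

lemma downTile_rpath (a b : Vert n) : [lo b, hi a] <:+: (downTile a b).rpath :=
  ⟨[], [hi b], rfl⟩

lemma upTile_rpath (a b : Vert n) : [lo a, hi a] <:+: (upTile a b).rpath :=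
  ⟨[], [], rfl⟩

lemma stripLens_rpath {x y a : Vert n} {X Y : List (Vert n)}
    (h : Y.head? = some a) : [lo x, hi a] <:+: (stripLens x y X Y).rpath := by
  obtain ⟨t, rfl⟩ := head_eq_of_head? h
  exact ⟨[], t.map hi, rfl⟩

lemma stripLens_lpath {x y z : Vert n} {X Y : List (Vert n)}
    (h : X.getLast? = some z) : [lo z, hi y] <:+: (stripLens x y X Y).lpath := by
  obtain ⟨t, rfl⟩ := List.getLast?_eq_some_iff.1 h
  exact ⟨t.map lo, [], by simp [Tile.lpath]⟩

lemma Strip.unique (hξ : IsGenerators ξ) (hK : EdgeTiling ξ K) {a b : Vert n}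
    {P P' : List (Vert n)} (h : Strip K a b P) (h' : Strip K a b P') : P = P' := by
  have huniv : ∀ c : Vert n, upTile Finset.univ c ∉ K := fun c hc => by
    obtain ⟨i, hi⟩ := isVEdge_of_isValid_upTile (hK.valid _ hc)
    exact hi.1 (Finset.mem_univ _)
  have hdl : ∀ {a b y : Vert n} {X Y : List (Vert n)}, downTile a b ∈ K →
      stripLens b y X Y ∈ K → Y.head? = some a → False := by
    intro a b y X Y h1 h2 h3
    have := hK.right_unique hξ h1 h2 (downTile_rpath a b) (stripLens_rpath h3)
    cases this
  induction h generalizing P' with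
  | @base a h =>
    cases h' with
    | base => rfl
    | up _ h2 => exact absurd h2 (huniv _)
    | turn h2 hY => exact (hdl h h2 hY).elim
  | @up a b c P h h1 hP ih =>
    cases h' with
    | base => exact absurd h1 (huniv _)
    | up h2 h3 h4 =>
      have := hK.right_unique hξ h1 h3 (upTile_rpath _ _) (upTile_rpath _ _)
      simp only [upTile, Tile.nabla.injEq, true_and, and_true] at this
      obtain rfl := lo_injective this
      rw [ih h4]
    | turn h2 hY => exact (hdl h h2 hY).elim
  | @turn a b y z X Y P h hY hX hP ih =>
    cases h' with
    | base h2 => exact (hdl h2 h hY).elim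
    | up h2 => exact (hdl h2 h hY).elim
    | turn h2 hY' hX' h4 =>
      have := hK.right_unique hξ h h2 (stripLens_rpath hY) (stripLens_rpath hY')
      obtain ⟨-, rfl, rfl, rfl⟩ := stripLens_inj this
      obtain rfl := Option.some.inj (hX.symm.trans hX')
      rw [ih h4]

lemma Tile.IsValid.mixed_rpath {τ : Tile (n + 1)} (hτ : τ.IsValid) {A B : Vert (n + 1)}
    (h : [A, B] <:+: τ.rpath) (hA : Fin.last n ∉ A) (hB : Fin.last n ∈ B) :
    (∃ a b i, IsVEdge i a b ∧ τ = upTile a b ∧ A = lo a ∧ B = hi a) ∨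
    (∃ a b i, IsVEdge i a b ∧ τ = downTile a b ∧ A = lo b ∧ B = hi a) ∨
    ∃ x y X Y a, IsStripLens x y X Y ∧ τ = stripLens x y X Y ∧ A = lo x ∧ B = hi a ∧
      Y.head? = some a := by
  have hm : τ.Mixed := ⟨⟨A, Tile.mem_verts_iff.2 (Or.inr (pair_infix_mem h).1), hA⟩,
    ⟨B, Tile.mem_verts_iff.2 (Or.inr (pair_infix_mem h).2), hB⟩⟩
  rcases hτ.cases_mixed hm with ⟨a, b, i, hi', rfl⟩ | ⟨a, b, i, hi', rfl⟩ | ⟨x, y, X, Y, hs, rfl⟩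
  · simp only [Tile.rpath, pair_infix_cons, not_pair_infix, or_false] at h
    exact Or.inl ⟨a, b, i, hi', rfl, h⟩
  · simp only [Tile.rpath, pair_infix_cons, not_pair_infix,
      or_false] at h
    rcases h with h | ⟨rfl, -⟩
    · exact Or.inr (Or.inl ⟨a, b, i, hi', rfl, h⟩)
    · exact absurd last_mem_hi hA
  · refine Or.inr (Or.inr ?_)
    simp only [Tile.rpath] at h
    rcases Y with _ | ⟨w, t⟩
    · exact absurd h not_pair_infix
    · rcases pair_infix_cons.1 h with ⟨h1, h2⟩ | h
      · exact ⟨x, y, X, _, w, hs, rfl, h1, h2, rfl⟩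
      · have h' : [A, B] <:+: (w :: t).map hi := h
        obtain ⟨_, _, _, rfl, _⟩ := pair_infix_map.1 h'
        exact absurd last_mem_hi hA

lemma Tile.IsValid.mixed_lpath {τ : Tile (n + 1)} (hτ : τ.IsValid) {A B : Vert (n + 1)}
    (h : [A, B] <:+: τ.lpath) (hA : Fin.last n ∉ A) (hB : Fin.last n ∈ B) :
    (∃ a b i, IsVEdge i a b ∧ τ = upTile a b ∧ A = lo b ∧ B = hi a) ∨
    (∃ a b i, IsVEdge i a b ∧ τ = downTile a b ∧ A = lo b ∧ B = hi b) ∨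
    ∃ x y X Y z, IsStripLens x y X Y ∧ τ = stripLens x y X Y ∧ A = lo z ∧ B = hi y ∧
      X.getLast? = some z := by
  have hm : τ.Mixed := ⟨⟨A, Tile.mem_verts_iff.2 (Or.inl (pair_infix_mem h).1), hA⟩,
    ⟨B, Tile.mem_verts_iff.2 (Or.inl (pair_infix_mem h).2), hB⟩⟩
  rcases hτ.cases_mixed hm with ⟨a, b, i, hi', rfl⟩ | ⟨a, b, i, hi', rfl⟩ | ⟨x, y, X, Y, hs, rfl⟩
  · simp only [Tile.lpath, pair_infix_cons, not_pair_infix, or_false] at h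
    rcases h with ⟨-, rfl⟩ | h
    · exact absurd hB last_notMem_lo
    · exact Or.inl ⟨a, b, i, hi', rfl, h⟩
  · simp only [Tile.lpath, pair_infix_cons, not_pair_infix,
      or_false] at h
    exact Or.inr (Or.inl ⟨a, b, i, hi', rfl, h⟩)
  · refine Or.inr (Or.inr ?_)
    simp only [Tile.lpath] at h
    have ⟨w, z, hX, _⟩ := hs
    obtain ⟨t, ht⟩ := List.getLast?_eq_some_iff.1 hX.2.1
    have h' : [A, B] <:+: t.map lo ++ lo z :: [hi y] := by
      rw [ht] at h; simpa using h
    rcases pair_infix_append_cons.1 h' with h | h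
    · have h' : [A, B] <:+: (t ++ [z]).map lo := by simpa using h
      obtain ⟨_, _, _, _, rfl⟩ := pair_infix_map.1 h'
      exact absurd hB last_notMem_lo
    · simp only [pair_infix_cons, not_pair_infix, or_false] at h
      exact ⟨x, y, X, Y, z, hs, rfl, h.1, h.2, hX.2.1⟩

/-- Every edge from `b` to `a ∪ {n}` below which there is a tile is followed by a strip. -/
theorem EdgeTiling.exists_strip (hK : EdgeTiling ξ K) :
    ∀ (N : ℕ) (a b : Vert n) (i : Fin n), IsVEdge i a b →
      weight (Finset.univ : Vert n) - weight b = N →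
      ∀ τ ∈ K, [lo b, hi a] <:+: τ.lpath → ∃ P, Strip K a b P := by
  intro N
  induction N using Nat.strong_induction_on with
  | _ N ih =>
    rintro a b i hi' rfl τ hτ h
    obtain ⟨τ', hτ', h'⟩ := (hK.left_exists τ hτ _ _ h).resolve_left fun ⟨j, hj⟩ =>
      isHEdge_ne_leftBoundaryEdge ⟨_, _, hi'.isHEdge_last⟩ j hj
    rcases (hK.valid τ' hτ').mixed_rpath h' last_notMem_lo last_mem_hi with
      ⟨a', b', j, hj, rfl, h1, h2⟩ | ⟨a', b', j, hj, rfl, h1, h2⟩ |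
      ⟨x, y, X, Y, a', hs, rfl, h1, h2, h3⟩
    · obtain rfl := lo_injective h1
      rw [hi_injective h2] at hi'
      have := hi'.weight_lt
      omega
    · obtain rfl := lo_injective h1
      obtain rfl := hi_injective h2
      by_cases hb : b = Finset.univ
      · subst hb; exact ⟨_, Strip.base hτ'⟩
      have hl : [lo b, hi b] <:+: (downTile a b).lpath := ⟨[], [], rfl⟩
      obtain ⟨σ, hσ, h3⟩ := (hK.left_exists _ hτ' _ _ hl).resolve_left fun ⟨k, hk⟩ => by
        revert hk
        refine Fin.lastCases ?_ (fun k => ?_) k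
        · rw [leftBoundaryEdge_last]
          exact fun hk => hb (lo_injective (congrArg Prod.fst hk))
        · rw [leftBoundaryEdge_castSucc]
          exact fun hk => lo_ne_hi _ _ (congrArg Prod.snd hk).symm
      rcases (hK.valid σ hσ).mixed_rpath h3 last_notMem_lo last_mem_hi with
        ⟨a', b', k, hk, rfl, h1, h2⟩ | ⟨a', b', k, hk, rfl, h1, h2⟩ |
        ⟨x, y, X, Y, a', hs, rfl, h1, h2, h3⟩
      · obtain rfl := lo_injective h1
        have h4 : [lo b', hi b] <:+: (upTile b b').lpath := ⟨[lo b], [], rfl⟩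
        have h5 := hk.weight_lt
        have h6 := weight_le_univ b'
        obtain ⟨P, hP⟩ := ih _ (by omega) b b' k hk rfl _ hσ h4
        exact ⟨_, Strip.up hτ' hσ hP⟩
      · obtain rfl := lo_injective h1
        rw [hi_injective h2] at hk
        exact absurd rfl (hk.weight_lt.ne)
      · obtain rfl := lo_injective h1
        obtain ⟨w, z, -, hY, hwy, -⟩ := hs
        obtain rfl := hi_injective h2
        obtain rfl := Option.some.inj (hY.1.symm.trans h3)
        obtain ⟨⟨k, hk⟩, -⟩ := hY.vEdges hwy
        exact absurd rfl (hk.weight_lt.ne)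
    · obtain rfl := lo_injective h1
      obtain rfl := hi_injective h2
      obtain ⟨w, z, hX, hY, hwy, hbz⟩ := hs
      obtain ⟨-, ⟨k, hk⟩, hlt⟩ := hX.vEdges hbz
      have h6 := weight_le_univ z
      obtain ⟨P, hP⟩ := ih _ (by omega) y z k hk rfl _ hτ' (stripLens_lpath hX.2.1)
      exact ⟨_, Strip.turn hτ' h3 hX.2.1 hP⟩

lemma mem_contraction_lo (hK : EdgeTiling ξ K) {σ : Tile n} (h : σ.map lo ∈ K) :
    σ ∈ contraction K := by
  rw [contraction_eq hK]; exact ⟨_, h, Or.inl rfl⟩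

lemma mem_contraction_hi (hK : EdgeTiling ξ K) {σ : Tile n} (h : σ.map hi ∈ K) :
    σ ∈ contraction K := by
  rw [contraction_eq hK]; exact ⟨_, h, Or.inr (Or.inl rfl)⟩

lemma isFilling_of_stripLens (hK : EdgeTiling ξ K) {x y : Vert n}
    {X Y : List (Vert n)} (h : stripLens x y X Y ∈ K) :
    ∃ w z, IsUpperFilling (contraction K) x y z X ∧ IsLowerFilling (contraction K) w x y Y ∧
      w ≠ y ∧ x ≠ z ∧ (∃ i, IsVEdge i w x) ∧ (∃ i, IsVEdge i y x) ∧ weight w < weight y ∧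
      weight x < weight z := by
  obtain ⟨w, z, hX, hY, h1, h2⟩ := isStripLens_of_isValid (hK.valid _ h)
  have hv := hX.vEdges h2
  have hv' := hY.vEdges h1
  refine ⟨w, z, ⟨hX.1, hX.2.1, isChain_of_pair_infix fun u v huv => ?_⟩,
    ⟨hY.1, hY.2.1, isChain_of_pair_infix fun u v huv => ?_⟩, h1, h2, hv'.1, hv.1, hv'.2.2,
    hv.2.2⟩
  · rw [contraction_eq hK]
    exact ⟨_, h, contracts_stripLens_iff.2 (Or.inr ⟨u, v, huv, rfl⟩)⟩
  · rw [contraction_eq hK]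
    exact ⟨_, h, contracts_stripLens_iff.2 (Or.inl ⟨u, v, huv, rfl⟩)⟩

lemma isVEdgeOf_of_isLowerFilling {K' : Set (Tile n)} {w x y : Vert n}
    {Y : List (Vert n)} (h : IsLowerFilling K' w x y Y) (hK : ∀ τ ∈ K', τ.IsValid)
    (hne : w ≠ y) : IsVEdgeOf K' w x ∧ IsVEdgeOf K' y x := by
  obtain ⟨⟨u, hu⟩, ⟨v, hv⟩, -⟩ := steps_of_isChain weight
    (fun _ _ => delta_weight_lt hK) h.2.2 h.1 h.2.1 hne
  exact ⟨((exists_stripTile_delta x w u).isVEdgeOf (hK _ hu) hu).1,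
    ((exists_stripTile_delta x v y).isVEdgeOf (hK _ hv) hv).2⟩

lemma isVEdgeOf_contraction (hξ : IsGenerators ξ) (hn : 2 ≤ n) (hK : EdgeTiling ξ K)
    {a b : Vert n} (h : downTile a b ∈ K) : IsVEdgeOf (contraction K) a b := by
  obtain ⟨i, hi'⟩ := isVEdge_of_isValid_downTile (hK.valid _ h)
  refine ⟨?_, i, hi'⟩
  have hr : [hi a, hi b] <:+: (downTile a b).rpath := ⟨[lo b], [], rfl⟩
  have hK' := contraction_edgeTiling hξ hn hK
  rcases hK.right_exists _ h _ _ hr with ⟨j, hj⟩ | ⟨τ, hτ, h'⟩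
  · revert hj
    refine Fin.lastCases ?_ (fun j => ?_) j
    · rw [rightBoundaryEdge_last]
      exact fun hj => absurd (congrArg Prod.fst hj).symm (lo_ne_hi _ _)
    · rw [rightBoundaryEdge_castSucc]
      intro hj
      obtain ⟨σ, hσ, h''⟩ := hK'.right_boundary j
      have h1 := hi_injective (congrArg Prod.fst hj)
      have h2 := hi_injective (congrArg Prod.snd hj)
      rw [← h1, ← h2] at h''
      exact ⟨σ, hσ, Tile.mem_edges_iff.2 (Or.inr h'')⟩
  · rcases (hK.valid τ hτ).cases_last with ⟨σ, -, rfl⟩ | ⟨σ, -, rfl⟩ | ⟨a', b', j, hj, rfl⟩ |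
      ⟨a', b', j, hj, rfl⟩ | ⟨x, y, X, Y, hs, rfl⟩
    · rw [Tile.lpath_map] at h'
      obtain ⟨_, _, _, h1, _⟩ := pair_infix_map.1 h'
      exact absurd h1 (lo_ne_hi _ _)
    · rw [Tile.lpath_map] at h'
      obtain ⟨u, v, huv, h1, h2⟩ := pair_infix_map.1 h'
      rw [← hi_injective h1, ← hi_injective h2]
      exact ⟨σ, mem_contraction_hi hK hτ, Tile.mem_edges_iff.2 (Or.inl huv)⟩
    · simp only [Tile.lpath, pair_infix_cons, not_pair_infix,
        or_false] at h'
      rcases h' with ⟨h1, -⟩ | ⟨h1, -⟩ <;> exact absurd h1.symm (lo_ne_hi _ _)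
    · simp only [Tile.lpath, pair_infix_cons, not_pair_infix,
        or_false] at h'
      exact absurd h'.1.symm (lo_ne_hi _ _)
    · obtain ⟨k, l, hkl⟩ := lens_edge_isHEdge (hK.valid _ hτ) (Tile.mem_edges_iff.2 (Or.inl h'))
      exact absurd hkl (isLift_hi.isVEdge hi').not_isHEdge

lemma Strip.leg (hξ : IsGenerators ξ) (hn : 2 ≤ n) (hK : EdgeTiling ξ K)
    {a b : Vert n} {P : List (Vert n)} (h : Strip K a b P) :
    Leg (contraction K) a b P := by
  have hK' := contraction_edgeTiling hξ hn hK
  induction h with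
  | base h => exact Leg.base (isVEdgeOf_contraction hξ hn hK h)
  | up h _ _ ih => exact Leg.up (isVEdgeOf_contraction hξ hn hK h) ih
  | turn h hY hX _ ih =>
    obtain ⟨w, z, h1, h2, h3, h4, h5, h6, h7, h8⟩ := isFilling_of_stripLens hK h
    obtain rfl := Option.some.inj (h2.1.symm.trans hY)
    obtain rfl := Option.some.inj (h1.2.1.symm.trans hX)
    have := isVEdgeOf_of_isLowerFilling h2 hK'.valid h3
    exact Leg.turn this.1 this.2 h7 h8 ih

lemma Strip.stripPart_subset (hξ : IsGenerators ξ) (hn : 2 ≤ n) (hK : EdgeTiling ξ K)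
    {a b : Vert n} {P : List (Vert n)} (h : Strip K a b P) :
    ∀ τ ∈ stripPart (contraction K) P, τ ∈ K := by
  have hK' := contraction_edgeTiling hξ hn hK
  induction h with
  | base h =>
    intro τ hτ
    rw [stripPart_stop] at hτ
    exact hτ ▸ h
  | @up a b c P h h' hP ih =>
    obtain ⟨hbc, t, rfl⟩ := (hP.leg hξ hn hK).shape
    have h1 := (isVEdgeOf_contraction hξ hn hK h).card_eq
    have h2 := hbc.card_eq
    intro τ hτ
    rcases (stripPart_up (by omega) (by omega)).1 hτ with rfl | rfl | hτ
    exacts [h, h', ih τ hτ]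
  | @turn a b y z X Y P h hY hX hP ih =>
    obtain ⟨hyz, t, rfl⟩ := (hP.leg hξ hn hK).shape
    obtain ⟨w, z', h1, h2, h3, h4, h5, h6, h7, h8⟩ := isFilling_of_stripLens hK h
    obtain rfl := Option.some.inj (h2.1.symm.trans hY)
    obtain rfl := Option.some.inj (h1.2.1.symm.trans hX)
    obtain ⟨i, hi1⟩ := h5
    obtain ⟨j, hj1⟩ := h6
    have e1 := hi1.card_eq
    have e2 := hj1.card_eq
    have e3 := hyz.card_eq
    intro τ hτ
    rcases (stripPart_turn (by omega) (by omega) (by omega)).1 hτ with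
      ⟨X', Y', hY', hX', rfl⟩ | hτ
    · rw [hY'.unique hξ.castSucc hK' h2, hX'.unique hξ.castSucc hK' h1]
      exact h
    · exact ih τ hτ

end stripPath

end Combi

namespace Combi

/-! ### Every combined tiling is an expansion -/

section surjectivity

variable {n : ℕ}

lemma EdgeTiling.mem_of_sum_eq {ξ : Fin n → Plane} {K : Set (Tile n)} (hξ : IsGenerators ξ)
    (hn : 2 ≤ n) (hK : EdgeTiling ξ K) {S S' : Finset (Tile n)} (hS : ∀ τ ∈ S, τ ∈ K)
    (hS' : ∀ τ ∈ S', τ ∈ K)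
    (h : ∀ φ : Vert n → Vert n → ℤ, (∀ A B, φ A B = -φ B A) →
      ∑ τ ∈ S, τ.bdry φ = ∑ τ ∈ S', τ.bdry φ) {τ : Tile n} (hτ : τ ∈ S) : τ ∈ S' := by
  by_contra hτ'
  obtain ⟨p, q, hq, -⟩ := hξ.exists_height hn
  obtain ⟨z, hz, hg⟩ := (dense_inGeneralPosition (p := p) (q := q) (Or.inr hq)
    (finite_nodes ξ)).inter_open_nonempty _ Tile.isOpen_inner
      ((hK.valid τ (hS τ hτ)).inner_nonempty hξ)
  have hs := h _ fun A B => crossing_swap p q z (point ξ A) (point ξ B)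
  rw [Finset.sum_eq_single τ, Finset.sum_eq_zero] at hs
  · rw [(Tile.bdry_crossing hξ (hK.valid τ (hS τ hτ)) hg).1
      ((hK.valid τ (hS τ hτ)).inner_subset hξ hz)] at hs
    exact absurd hs one_ne_zero
  · intro σ hσ
    exact (Tile.bdry_crossing hξ (hK.valid σ (hS' σ hσ)) hg).2
      (hK.inner_disjoint_polygon hξ (hS τ hτ) (hS' σ hσ) (by rintro rfl; exact hτ' hσ) hz)
  · intro σ hσ hne
    exact (Tile.bdry_crossing hξ (hK.valid σ (hS σ hσ)) hg).2
      (hK.inner_disjoint_polygon hξ (hS τ hτ) (hS σ hσ) hne.symm hz)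
  · exact fun h => absurd hτ h

lemma weight_lo (A : Vert n) : weight (lo A) = weight A := by
  simp [weight, lo]

lemma weight_hi (A : Vert n) : weight (hi A) = weight A + (n + 1) := by
  rw [hi, weight_insert last_notMem_lo, weight_lo, Fin.val_last]

variable {ξ : Fin (n + 1) → Plane} {K E : Set (Tile (n + 1))}

lemma Tile.Mixed.exists_lpath {τ : Tile (n + 1)} (hτ : τ.IsValid) (h : τ.Mixed) :
    ∃ A B, [A, B] <:+: τ.lpath ∧ Fin.last n ∉ A ∧ Fin.last n ∈ B := by
  rcases hτ.cases_mixed h with ⟨a, b, -, -, rfl⟩ | ⟨a, b, -, -, rfl⟩ | ⟨x, y, X, Y, hs, rfl⟩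
  · exact ⟨lo b, hi a, ⟨[lo a], [], rfl⟩, by simp, by simp⟩
  · exact ⟨lo b, hi b, ⟨[], [], rfl⟩, by simp, by simp⟩
  · obtain ⟨w, z, hX, -⟩ := hs
    exact ⟨lo z, hi y, stripLens_lpath hX.2.1, by simp, by simp⟩

lemma Tile.IsValid.exists_mixed_rpath {τ : Tile (n + 1)} (hτ : τ.IsValid)
    {A B : Vert (n + 1)} (h : [A, B] <:+: τ.lpath) (hA : Fin.last n ∉ A)
    (hB : Fin.last n ∈ B) : ∃ C D, [C, D] <:+: τ.rpath ∧ Fin.last n ∉ C ∧ Fin.last n ∈ D ∧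
      weight C + weight D < weight A + weight B := by
  rcases hτ.mixed_lpath h hA hB with ⟨a, b, i, hi', rfl, rfl, rfl⟩ |
    ⟨a, b, i, hi', rfl, rfl, rfl⟩ | ⟨x, y, X, Y, z, ⟨w, z', hX, hY, h1, h2⟩, rfl, rfl, rfl, hz⟩
  · refine ⟨lo a, hi a, upTile_rpath a b, by simp, by simp, ?_⟩
    have := hi'.weight_lt
    simp only [weight_lo, weight_hi]
    omega
  · refine ⟨lo b, hi a, downTile_rpath a b, by simp, by simp, ?_⟩
    have := hi'.weight_lt
    simp only [weight_lo, weight_hi]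
    omega
  · obtain rfl := Option.some.inj (hz.symm.trans hX.2.1)
    refine ⟨lo x, hi w, stripLens_rpath hY.1, by simp, by simp, ?_⟩
    have := (hX.vEdges h2).2.2
    have := (hY.vEdges h1).2.2
    simp only [weight_lo, weight_hi]
    omega

lemma mixed_of_rpath {m : ℕ} {τ : Tile (m + 1)} {A B : Finset (Fin (m + 1))}
    (h : [A, B] <:+: τ.rpath) (hA : Fin.last m ∉ A) (hB : Fin.last m ∈ B) : τ.Mixed :=
  ⟨⟨A, Tile.mem_verts_iff.2 (Or.inr (pair_infix_mem h).1), hA⟩,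
    ⟨B, Tile.mem_verts_iff.2 (Or.inr (pair_infix_mem h).2), hB⟩⟩

/-- The strips of two combined tilings coincide if one of them contains the other one. -/
theorem EdgeTiling.mixed_mem (hξ : IsGenerators ξ) (hK : EdgeTiling ξ K) (hE : EdgeTiling ξ E)
    (hEK : ∀ τ ∈ E, τ.Mixed → τ ∈ K) {τ : Tile (n + 1)} (hτ : τ ∈ K) (hm : τ.Mixed) : τ ∈ E := by
  have key : ∀ N, ∀ τ ∈ K, ∀ A B, [A, B] <:+: τ.lpath → Fin.last n ∉ A → Fin.last n ∈ B →
      weight A + weight B = N → τ ∈ E := by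
    intro N
    induction N using Nat.strong_induction_on with
    | _ N ih =>
      rintro τ hτ A B h hA hB rfl
      obtain ⟨C, D, h1, hC, hD, hlt⟩ := (hK.valid τ hτ).exists_mixed_rpath h hA hB
      have hdone : ∀ τ' ∈ E, [C, D] <:+: τ'.rpath → τ ∈ E := fun τ' hτ' h2 =>
        hK.right_unique hξ hτ (hEK τ' hτ' (mixed_of_rpath h2 hC hD)) h1 h2 ▸ hτ'
      rcases hK.right_exists τ hτ C D h1 with ⟨i, hi'⟩ | ⟨σ, hσ, h2⟩
      · obtain ⟨τ', hτ', h2⟩ := hE.right_boundary i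
        rw [← hi'] at h2
        exact hdone τ' hτ' h2
      · have hσE := ih _ hlt σ hσ C D h2 hC hD rfl
        rcases hE.left_exists σ hσE C D h2 with ⟨i, hi'⟩ | ⟨τ', hτ', h3⟩
        · have := (hK.valid τ hτ).leftBoundaryEdge_not_rpath hξ i
          rw [← hi'] at this
          exact absurd h1 this
        · exact hdone τ' hτ' h3
  obtain ⟨A, B, h, hA, hB⟩ := hm.exists_lpath (hK.valid τ hτ)
  exact key _ τ hτ A B h hA hB rfl

open Classical in
lemma EdgeTiling.sum_bdry_map (hξ : IsGenerators ξ) (hK : EdgeTiling ξ K) {K' : Set (Tile n)}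
    (hK' : K'.Finite) {f : Vert n → Vert (n + 1)} (hf : ∀ A, drop (f A) = A)
    {q : Vert (n + 1) → Prop} (hq : ∀ A, q (f A))
    (hmem : ∀ σ : Tile n, σ.map f ∈ K → σ ∈ K') (hm : ∀ σ : Tile n, ¬ (σ.map f).Mixed)
    (hpure : ∀ τ ∈ K, ¬ τ.Mixed → (∃ σ : Tile n, τ = σ.map f) ∨ ∀ v ∈ τ.verts, ¬ q v)
    (φ : Vert n → Vert n → ℤ) :
    ∑ σ ∈ hK'.toFinset.filter (fun σ => σ.map f ∈ K), σ.bdry φ =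
      zonogonBdry (fun A B => if q A ∧ q B then φ (drop A) (drop B) else 0) -
        ∑ τ ∈ hK.finite.toFinset.filter Tile.Mixed,
          τ.bdry (fun A B => if q A ∧ q B then φ (drop A) (drop B) else 0) := by
  rw [← hK.sum_bdry_eq hξ, ← Finset.sum_filter_add_sum_filter_not _ Tile.Mixed, add_sub_cancel_left]
  have himg : (hK'.toFinset.filter (fun σ => σ.map f ∈ K)).image (Tile.map f) ⊆
      hK.finite.toFinset.filter (fun τ => ¬ τ.Mixed) := by
    intro τ hτ
    obtain ⟨σ, hσ, rfl⟩ := Finset.mem_image.1 hτ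
    simp only [Finset.mem_filter, Set.Finite.mem_toFinset] at hσ ⊢
    exact ⟨hσ.2, hm σ⟩
  rw [← Finset.sum_subset himg, Finset.sum_image]
  · refine Finset.sum_congr rfl fun σ _ => ?_
    rw [Tile.bdry_map]
    simp only [hq, and_self, if_true, hf]
  · exact fun _ _ _ _ h => Function.LeftInverse.injective (Tile.map_map_eq hf) h
  · intro τ hτ hτ'
    simp only [Finset.mem_filter, Set.Finite.mem_toFinset] at hτ
    rcases hpure τ hτ.1 hτ.2 with ⟨σ, rfl⟩ | h
    · exact absurd (Finset.mem_image.2 ⟨σ, by simp [hτ.1, hmem σ hτ.1], rfl⟩) hτ'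
    · have hz : ∀ l : List (Vert (n + 1)), (∀ v ∈ l, ¬ q v) →
          pathSum (fun A B => if q A ∧ q B then φ (drop A) (drop B) else 0) l = 0 := by
        intro l hl
        rw [pathSum_congr (ψ := fun _ _ => 0)]
        · induction l with
          | nil => rfl
          | cons a l ih =>
            rcases l with _ | ⟨b, l⟩
            · rfl
            · simp_all
        · intro a b hab
          rw [if_neg fun h => hl a (pair_infix_mem hab).1 h.1]
      rw [Tile.bdry, hz _ fun v hv => h v (Tile.mem_verts_iff.2 (Or.inl hv)),
        hz _ fun v hv => h v (Tile.mem_verts_iff.2 (Or.inr hv)), sub_zero]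

open Classical in
lemma map_mem_of_mixed_eq (hξ : IsGenerators ξ) (hn : 2 ≤ n) (hK : EdgeTiling ξ K)
    (hE : EdgeTiling ξ E) (hmix : ∀ τ, τ.Mixed → (τ ∈ K ↔ τ ∈ E)) {K' : Set (Tile n)}
    (hK' : EdgeTiling (fun i => ξ i.castSucc) K')
    {f : Vert n → Vert (n + 1)} (hf : ∀ A, drop (f A) = A)
    {q : Vert (n + 1) → Prop} (hq : ∀ A, q (f A))
    (hmK : ∀ σ : Tile n, σ.map f ∈ K → σ ∈ K') (hmE : ∀ σ : Tile n, σ.map f ∈ E → σ ∈ K')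
    (hm : ∀ σ : Tile n, ¬ (σ.map f).Mixed)
    (hpure : ∀ τ : Tile (n + 1), τ.IsValid → ¬ τ.Mixed →
      (∃ σ : Tile n, τ = σ.map f) ∨ ∀ v ∈ τ.verts, ¬ q v) {σ : Tile n} :
    σ.map f ∈ K ↔ σ.map f ∈ E := by
  have hK1 := hK.sum_bdry_map hξ hK'.finite hf hq hmK hm fun τ hτ => hpure τ (hK.valid τ hτ)
  have hE1 := hE.sum_bdry_map hξ hK'.finite hf hq hmE hm fun τ hτ => hpure τ (hE.valid τ hτ)
  have hmm : hK.finite.toFinset.filter Tile.Mixed = hE.finite.toFinset.filter Tile.Mixed := by aesop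
  have heq : ∀ φ : Vert n → Vert n → ℤ,
      ∑ σ ∈ hK'.finite.toFinset.filter (fun σ => σ.map f ∈ K), σ.bdry φ =
      ∑ σ ∈ hK'.finite.toFinset.filter (fun σ => σ.map f ∈ E), σ.bdry φ := by
    intro φ; rw [hK1, hE1, hmm]
  have hmem := fun S S' hS hS' h => hK'.mem_of_sum_eq hξ.castSucc hn (S := S) (S' := S') hS hS' h
    (τ := σ)
  constructor
  · intro h
    have := hmem _ _ (by simp +contextual) (by simp +contextual) (fun φ _ => heq φ)
      (by simp [h, hmK σ h])
    simp at this
    exact this.2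
  · intro h
    have := hmem _ _ (by simp +contextual) (by simp +contextual) (fun φ _ => (heq φ).symm)
      (by simp [h, hmE σ h])
    simp at this
    exact this.2

/-- Every combined tiling is an expansion of its contraction. -/
theorem exists_expansion_eq (hξ : IsGenerators ξ) (hn : 2 ≤ n) (hK : EdgeTiling ξ K) :
    ∃ P, IsLegalPath (contraction K) P ∧
      expansion (fun i => ξ i.castSucc) (contraction K) P = K := by
  have hK' := contraction_edgeTiling hξ hn hK
  obtain ⟨τ, hτ, h⟩ := hK.right_boundary (Fin.last n)
  rw [rightBoundaryEdge_last] at h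
  obtain ⟨b, i, hi', hup⟩ : ∃ b i, IsVEdge i ∅ b ∧ upTile ∅ b ∈ K := by
    rcases (hK.valid τ hτ).mixed_rpath h last_notMem_lo last_mem_hi with
      ⟨a', b', k, hk, rfl, h1, h2⟩ | ⟨a', b', k, hk, rfl, h1, h2⟩ |
      ⟨x, y, X, Y, a', ⟨w, z, -, hY, hwy, -⟩, rfl, h1, h2, h3⟩
    · obtain rfl := lo_injective h1
      exact ⟨b', k, hk, hτ⟩
    · rw [← lo_injective h1, ← hi_injective h2] at hk
      exact absurd rfl hk.weight_lt.ne
    · obtain rfl := Option.some.inj (hY.1.symm.trans h3)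
      obtain ⟨⟨k, hk⟩, -⟩ := hY.vEdges hwy
      rw [← lo_injective h1, ← hi_injective h2] at hk
      exact absurd rfl hk.weight_lt.ne
  obtain ⟨P, hP⟩ := hK.exists_strip _ ∅ b i hi' rfl _ hup ⟨[lo ∅], [], rfl⟩
  have hL := hP.leg hξ hn hK
  have hleg := hL.isLegalPath
  refine ⟨P, hleg, ?_⟩
  have hE := expansion_edgeTiling hξ hn hK' hleg
  have hcE := contraction_expansion hξ hn hK' hleg
  have hEK : ∀ τ ∈ expansion (fun i => ξ i.castSucc) (contraction K) P, τ.Mixed → τ ∈ K := by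
    obtain ⟨w, hw⟩ := exists_winding hξ.castSucc hn hK' hL.isPathOf
    rw [expansion_eq hξ hn hK' hw hL]
    rintro τ ((⟨σ, -, rfl⟩ | ⟨σ, -, rfl⟩) | rfl | hτ) hm
    · exact absurd hm (Tile.not_mixed_lo σ)
    · exact absurd hm (Tile.not_mixed_hi σ)
    · exact hup
    · exact hP.stripPart_subset hξ hn hK τ hτ
  have hmix : ∀ τ : Tile (n + 1), τ.Mixed →
      (τ ∈ expansion (fun i => ξ i.castSucc) (contraction K) P ↔ τ ∈ K) := fun τ hm =>
    ⟨fun h => hEK τ h hm, fun h => hK.mixed_mem hξ hE hEK h hm⟩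
  have hlo : ∀ σ : Tile n, σ.map lo ∈ expansion (fun i => ξ i.castSucc) (contraction K) P ↔
      σ.map lo ∈ K := fun σ => by
    refine map_mem_of_mixed_eq hξ hn hE hK hmix hK' drop_lo (q := fun A => Fin.last n ∉ A)
      (fun _ => last_notMem_lo) (fun σ h => ?_) (fun σ => mem_contraction_lo hK)
      Tile.not_mixed_lo ?_
    · have := mem_contraction_lo hE h
      rwa [hcE] at this
    · intro τ hτ hm
      refine (hτ.cases_not_mixed hm).imp_right ?_
      rintro ⟨σ, rfl⟩ v hv
      obtain ⟨_, _, rfl⟩ := Tile.mem_verts_map.1 hv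
      simp
  have hhi : ∀ σ : Tile n, σ.map hi ∈ expansion (fun i => ξ i.castSucc) (contraction K) P ↔
      σ.map hi ∈ K := fun σ => by
    refine map_mem_of_mixed_eq hξ hn hE hK hmix hK' drop_hi (q := fun A => Fin.last n ∈ A)
      (fun _ => last_mem_hi) (fun σ h => ?_) (fun σ => mem_contraction_hi hK)
      Tile.not_mixed_hi ?_
    · have := mem_contraction_hi hE h
      rwa [hcE] at this
    · intro τ hτ hm
      refine (hτ.cases_not_mixed hm).symm.imp_right ?_
      rintro ⟨σ, rfl⟩ v hv
      obtain ⟨_, _, rfl⟩ := Tile.mem_verts_map.1 hv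
      simp
  have hall : ∀ τ : Tile (n + 1), τ.IsValid →
      (τ ∈ expansion (fun i => ξ i.castSucc) (contraction K) P ↔ τ ∈ K) := by
    intro τ hτ
    by_cases hm : τ.Mixed
    · exact hmix τ hm
    · rcases hτ.cases_not_mixed hm with ⟨σ, rfl⟩ | ⟨σ, rfl⟩
      exacts [hlo σ, hhi σ]
  ext τ
  exact ⟨fun h => (hall τ (hE.valid τ h)).1 h, fun h => (hall τ (hK.valid τ h)).2 h⟩

/-- The path is determined by the expansion. -/
theorem legalPath_unique {K' : Set (Tile n)} (hξ : IsGenerators ξ) (hn : 2 ≤ n)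
    (hK' : EdgeTiling (fun i => ξ i.castSucc) K') {P P' : List (Vert n)}
    (hP : IsLegalPath K' P) (hP' : IsLegalPath K' P')
    (h : expansion (fun i => ξ i.castSucc) K' P = expansion (fun i => ξ i.castSucc) K' P') :
    P = P' := by
  have hex : ∀ P, IsLegalPath K' P → ∃ b, upTile ∅ b ∈ expansion (fun i => ξ i.castSucc) K' P ∧
      Strip (expansion (fun i => ξ i.castSucc) K' P) ∅ b P := by
    intro P hP
    obtain ⟨b, hL⟩ := hP.leg (by omega)
    obtain ⟨w, hw⟩ := exists_winding hξ.castSucc hn hK' hL.isPathOf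
    rw [expansion_eq hξ hn hK' hw hL]
    exact ⟨b, Or.inr (Or.inl rfl), hL.strip hξ.castSucc hK' fun τ hτ => Or.inr (Or.inr hτ)⟩
  obtain ⟨b, hb, hs⟩ := hex P hP
  obtain ⟨b', hb', hs'⟩ := hex P' hP'
  rw [← h] at hb' hs'
  have hE := expansion_edgeTiling hξ hn hK' hP
  have := hE.right_unique hξ hb hb' (upTile_rpath _ _) (upTile_rpath _ _)
  simp only [upTile, Tile.nabla.injEq, true_and, and_true] at this
  obtain rfl := lo_injective this
  exact hs.unique hξ hE hs'

end surjectivity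

end Combi

theorem theorem6 (n : ℕ) (hn : 2 ≤ n) (ξ : Fin (n + 1) → Combi.Plane)
    (hξ : Combi.IsGenerators ξ) :
    Set.BijOn
      (fun p : Set (Combi.Tile n) × List (Finset (Fin n)) =>
        Combi.expansion (fun i => ξ i.castSucc) p.1 p.2)
      {p | Combi.IsCTiling (fun i => ξ i.castSucc) p.1 ∧ Combi.IsLegalPath p.1 p.2}
      {K | Combi.IsCTiling ξ K} ∧
    ∀ (K' : Set (Combi.Tile n)) (P : List (Finset (Fin n))),
      Combi.IsCTiling (fun i => ξ i.castSucc) K' → Combi.IsLegalPath K' P →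
        Combi.contraction (Combi.expansion (fun i => ξ i.castSucc) K' P) = K' := by
  have hc : ∀ (K' : Set (Combi.Tile n)) (P : List (Finset (Fin n))),
      Combi.IsCTiling (fun i => ξ i.castSucc) K' → Combi.IsLegalPath K' P →
        Combi.contraction (Combi.expansion (fun i => ξ i.castSucc) K' P) = K' :=
    fun K' P hK' hP =>
      Combi.contraction_expansion hξ hn (hK'.edgeTiling hξ.castSucc hn) hP
  refine ⟨⟨?_, ?_, ?_⟩, hc⟩
  · rintro ⟨K', P⟩ ⟨hK', hP⟩
    exact (Combi.expansion_edgeTiling hξ hn (hK'.edgeTiling hξ.castSucc hn) hP).isCTiling hξ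
      (by omega)
  · rintro ⟨K', P⟩ ⟨hK', hP⟩ ⟨K'', P'⟩ ⟨hK'', hP'⟩ h
    dsimp only at hK' hP hK'' hP' h
    obtain rfl : K' = K'' := by
      rw [← hc K' P hK' hP, h, hc K'' P' hK'' hP']
    rw [Combi.legalPath_unique hξ hn (hK'.edgeTiling hξ.castSucc hn) hP hP' h]
  · intro K hK
    have hE := Combi.IsCTiling.edgeTiling hξ (by omega) hK
    obtain ⟨P, hP, h⟩ := Combi.exists_expansion_eq hξ hn hE
    exact ⟨(Combi.contraction K, P),
      ⟨(Combi.contraction_edgeTiling hξ hn hE).isCTiling hξ.castSucc hn, hP⟩, h⟩
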